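/- Let $a>\frac14$. There is a constant $C$ depending only on $a$ such that the following holds for every $2<p<\infty$ and every interval $I\subset\mathbb R$. Let $u$ be an $H^1$-solution on $I\times\mathbb R^2$ of the defocusing nonlinear Schrödinger equation with inverse-square potential $$i\partial_t u+\Delta u-\frac{a}{|x|^2}u=|u|^{p}u ,$$ that is, $u\in C(I;H^1(\mathbb R^2))$ and, at every time $t\in I$, the equation holds in the sense of distributions on $\mathbb R^2\setminus\{0\}$ (for every real $\psi\in C_c^\infty(\mathbb R^2\setminus\{0\})$ the function $t\mapsto\int u(t)\psi\,dx$ is differentiable on $I$ and $i\frac{d}{dt}\int u\psi\,dx+\int u\,\Delta\psi\,dx-\int\frac{a}{|x|^2}u\psi\,dx=\int|u|^pu\,\psi\,dx$). Then for every $t_0\in I$ $$\big\||\nabla|^{\frac12}(|u|^2)\big\|_{L^2(I;L^2(\mathbb R^2))}\le C\,\|u(t_0)\|_{L^2}^{\frac32}\,\sup_{t\in I}\|u(t)\|_{\dot H^1}^{\frac12}$$ and $$\|u\|_{L^4_t(I;L^8_x(\mathbb R^2))}\le C\,\|u(t_0)\|_{L^2}^{\frac34}\,\sup_{t\in I}\|u(t)\|_{\dot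 H^1}^{\frac14}.$$ Here $\|f\|_{\dot H^1}=\|\nabla f\|_{L^2}$, and $|\nabla|^{1/2}$ is the Fourier multiplier with symbol $|\xi|^{1/2}$ (where $\nabla$ has symbol $i\xi$). -/

import Mathlib

open MeasureTheory Filter Topology
open scoped ENNReal NNReal ContDiff FourierTransform

/-- The Euclidean plane. -/
abbrev Plane : Type := EuclideanSpace ℝ (Fin 2)

/-- `G = (G₁, G₂)` is the weak (distributional) gradient of `f` on the plane. -/
structure IsWeakGradient (f : Plane → ℂ) (G : Plane → EuclideanSpace ℂ (Fin 2)) : Prop where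
  locallyIntegrable_fun : LocallyIntegrable f volume
  locallyIntegrable_grad : LocallyIntegrable G volume
  integral_eq : ∀ φ : Plane → ℝ, ContDiff ℝ ∞ φ → HasCompactSupport φ → ∀ j : Fin 2,
    ∫ x, (fderiv ℝ φ x (EuclideanSpace.single j 1)) • f x = - ∫ x, φ x • G x j

/-- Membership in the Sobolev space `H¹` of the plane. -/
def MemH1 (f : Plane → ℂ) : Prop :=
  MemLp f 2 volume ∧ ∃ G, IsWeakGradient f G ∧ MemLp G 2 volume

/-- The homogeneous norm `‖f‖_{Ḣ¹} = ‖∇f‖_{L²}`; it is `∞` if `f` has no weak gradient.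
The weak gradient is unique almost everywhere, so the infimum is over a single value. -/
noncomputable def hDotOneNorm (f : Plane → ℂ) : ℝ≥0∞ :=
  ⨅ (G : Plane → EuclideanSpace ℂ (Fin 2)) (_ : IsWeakGradient f G), eLpNorm G 2 volume

/-- The norm of `H¹` (equivalent to the Hilbertian one). -/
noncomputable def hOneNorm (f : Plane → ℂ) : ℝ≥0∞ :=
  eLpNorm f 2 volume + hDotOneNorm f

/-- `‖|∇|^s f‖_{L²}` for an integrable function `f`, where `|∇|^s` is the Fourier multiplier
with symbol `|2πξ|^s` for the Fourier transform `𝓕 f ξ = ∫ exp(-2πi x·ξ) f x dx`;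
it is `∞` if `|∇|^s f` is not in `L²`. -/
noncomputable def absGradPowL2Norm (s : ℝ) (f : Plane → ℂ) : ℝ≥0∞ :=
  eLpNorm (fun ξ : Plane => ((2 * Real.pi * ‖ξ‖) ^ s : ℝ) • 𝓕 f ξ) 2 volume

/-- `u` belongs to `C(I; H¹)`. -/
def ContinuousInH1On (u : ℝ → Plane → ℂ) (I : Set ℝ) : Prop :=
  (∀ t ∈ I, MemH1 (u t)) ∧
    ∀ t ∈ I, Tendsto (fun s => hOneNorm (fun x => u s x - u t x)) (𝓝[I] t) (𝓝 0)

/-- `u` is an `H¹`-solution on `I × ℝ²` of the defocusing equation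
`i ∂ₜu + Δu - (a/|x|²) u = |u|^p u`: it is in `C(I; H¹)`, and at every time of `I` the equation
holds in the sense of distributions on `ℝ² ∖ {0}`, that is, against every test function `ψ`
in `C_c^∞(ℝ² ∖ {0})`. -/
structure IsH1Solution (a p : ℝ) (I : Set ℝ) (u : ℝ → Plane → ℂ) : Prop where
  continuousInH1On : ContinuousInH1On u I
  equation : ∀ ψ : Plane → ℝ, ContDiff ℝ ∞ ψ → HasCompactSupport ψ → (0 : Plane) ∉ tsupport ψ →
    ∀ t ∈ I, ∃ D : ℂ,
      HasDerivWithinAt (fun s => ∫ x, ψ x • u s x) D I t ∧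
      Complex.I * D + (∫ x, Laplacian.laplacian ψ x • u t x)
          - ∫ x, (a / ‖x‖ ^ 2 * ψ x) • u t x
        = ∫ x, (‖u t x‖ ^ p * ψ x) • u t x

/-! The theorem is an interaction Morawetz estimate. For a vector field X put M_X = Im ∫ X·ū∇u.
Formally dM_X/dt is the virial 2 Re ∫ ∂ₖXⱼ ∂ⱼū ∂ₖu + Re ∫ ∇(div X)·ū∇u + 2a ∫ (X·x)|x|⁻⁴|u|² +
p/(p+2) ∫ (div X)|u|^(p+2), while ∂ₜ|u|² = -2 div Im(ū∇u). With X the convolution of ∇√(|x|²+σ²) and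
ρ = |u|², M_X is bounded by a multiple of ‖u‖₂³‖∇u‖₂. The convexity of the weight makes the Hessian
terms of its derivative nonnegative together with the flux of mass (`interForm_ge`), and what
remains is ∫∫ Δ√(|x-y|²+σ²) ∇ρ(x)·∇ρ(y), up to a constant. As σ → 0 the kernel tends to 1/|x-y|,
whose Fourier transform in the plane is a multiple of 1/|ξ|. Hence ‖|∇|^(1/2)ρ‖₂² is controlled
(`ofReal_sum_dbl_ge`, `halfEnergy_le_liminf`), and the second estimate is the embedding of Ḣ^(1/2)
into L⁴ applied to ρ (`lintegral_pow_four_le`).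

The potential is not translation invariant: for the interaction field the term 2a ∫ (X·x)|x|⁻⁴|u|²
has no sign and is only O(|u|²/|x|³). It is absorbed by a Morawetz estimate centred at the origin,
with X = ∇w and w = √(|x|²+δ²). In the plane Δ²|x| = |x|⁻³, which costs ½|u|²/|x|³, whereas the
potential contributes 2a|u|²/|x|³; the sum is coercive because a > 1/4. The regularized version
`Flow.morawetz` bounds the space-time integrals of δ²w⁻³|∇u|², |u|²/(w|x|²) and |u|^(p+2)/w by ‖u‖₂
sup ‖∇u‖₂, uniformly in δ.

The equation is available only away from the origin, so every field is multiplied by a cutoff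
`plateau k` to a dyadic annulus. The cutoff errors live on a shell and contain |u|²/|x|², which H¹
does not control in the plane. `Flow.exists_wMass_le` bounds its space-time integral by feeding the
Morawetz inequality at level k with the one at level k+3; the shell errors then tend to zero
(`Flow.tendsto_shellError`). The interaction field does not vanish at the origin, so its cutoff
errors are worse by a factor 1/|x|. They are controlled by the Morawetz estimate taken at the cutoff
scale δ = 2⁻ᵏ (`exists_interForm_le`), with a constant that depends neither on σ nor on p.

Since u is only in H¹, the conservation laws need justification. Steklov means in time turn ∂ₜu into
an L² function, so that the averaged solution has a square integrable Laplacian away from the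
origin. Rellich's identity (`rellich`), proved by mollification in space, then gives the momentum
law for the means, and the mean is removed in integrated form (`WeakSchr.hasDerivAt_mom`,
`hasDerivAt_of_parametric`). -/

namespace InteractionMorawetz

/-! ### Partial derivatives and test functions. -/

section PartialDerivatives

variable {E : Type*} [NormedAddCommGroup E] [NormedSpace ℝ E]

/-- The partial derivative in the `j`-th coordinate direction. -/
noncomputable def pd (j : Fin 2) (f : Plane → E) (x : Plane) : E :=
  fderiv ℝ f x (EuclideanSpace.single j 1)

/-- Smooth functions with compact support. -/
structure IsTest (φ : Plane → E) : Prop where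
  contDiff : ContDiff ℝ ∞ φ
  compact : HasCompactSupport φ

theorem contDiff_pd {f : Plane → E} (hf : ContDiff ℝ ∞ f) (j : Fin 2) : ContDiff ℝ ∞ (pd j f) :=
  (hf.fderiv_right (m := ∞) le_rfl).clm_apply contDiff_const

theorem differentiable_of_contDiff {f : Plane → E} (hf : ContDiff ℝ ∞ f) : Differentiable ℝ f :=
  hf.differentiable (by simp)

theorem tsupport_pd_subset (j : Fin 2) (f : Plane → E) : tsupport (pd j f) ⊆ tsupport f := by
  refine closure_minimal (fun x hx => ?_) (isClosed_tsupport f)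
  refine support_fderiv_subset ℝ (fun h => hx ?_)
  simp [pd, h]

theorem IsTest.pd {φ : Plane → E} (hφ : IsTest φ) (j : Fin 2) : IsTest (pd j φ) :=
  ⟨contDiff_pd hφ.contDiff j, hφ.compact.mono' ((subset_tsupport _).trans (tsupport_pd_subset j φ))⟩

theorem IsTest.continuous {φ : Plane → E} (hφ : IsTest φ) : Continuous φ := hφ.contDiff.continuous

theorem IsTest.integrable {φ : Plane → E} (hφ : IsTest φ) : Integrable φ :=
  hφ.continuous.integrable_of_hasCompactSupport hφ.compact

theorem IsTest.memLp {φ : Plane → E} (hφ : IsTest φ) (q : ℝ≥0∞) : MemLp φ q :=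
  hφ.continuous.memLp_of_hasCompactSupport hφ.compact

theorem IsTest.exists_bound {φ : Plane → E} (hφ : IsTest φ) : ∃ C, ∀ x, ‖φ x‖ ≤ C :=
  hφ.continuous.bounded_above_of_compact_support hφ.compact

theorem IsTest.add {φ ψ : Plane → E} (hφ : IsTest φ) (hψ : IsTest ψ) :
    IsTest (fun x => φ x + ψ x) :=
  ⟨hφ.contDiff.add hψ.contDiff, hφ.compact.add hψ.compact⟩

theorem IsTest.sum {φ : Fin 2 → Plane → E} (hφ : ∀ j, IsTest (φ j)) :
    IsTest (fun x => ∑ j, φ j x) := by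
  simpa only [Fin.sum_univ_two] using (hφ 0).add (hφ 1)

theorem IsTest.smul {φ : Plane → ℝ} {f : Plane → E} (hφ : IsTest φ) (hf : ContDiff ℝ ∞ f) :
    IsTest (fun x => φ x • f x) :=
  ⟨hφ.contDiff.smul hf, hφ.compact.smul_right⟩

theorem IsTest.smul' {φ : Plane → ℝ} {f : Plane → E} (hφ : ContDiff ℝ ∞ φ) (hf : IsTest f) :
    IsTest (fun x => φ x • f x) :=
  ⟨hφ.smul hf.contDiff, hf.compact.smul_left⟩

theorem IsTest.mul {φ f : Plane → ℝ} (hφ : IsTest φ) (hf : ContDiff ℝ ∞ f) :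
    IsTest (fun x => φ x * f x) := hφ.smul hf

theorem IsTest.mul' {φ f : Plane → ℝ} (hφ : ContDiff ℝ ∞ φ) (hf : IsTest f) :
    IsTest (fun x => φ x * f x) := IsTest.smul' hφ hf

theorem pd_add {f g : Plane → E} {x : Plane} (j : Fin 2) (hf : DifferentiableAt ℝ f x)
    (hg : DifferentiableAt ℝ g x) : pd j (fun x => f x + g x) x = pd j f x + pd j g x := by
  simp only [pd, fderiv_fun_add hf hg, add_apply]

theorem pd_sum {f : Fin 2 → Plane → E} {x : Plane} (j : Fin 2)
    (hf : ∀ i, DifferentiableAt ℝ (f i) x) :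
    pd j (fun x => ∑ i, f i x) x = ∑ i, pd j (f i) x := by
  simp only [Fin.sum_univ_two]
  exact pd_add j (hf 0) (hf 1)

theorem pd_smul {φ : Plane → ℝ} {f : Plane → E} {x : Plane} (j : Fin 2)
    (hφ : DifferentiableAt ℝ φ x) (hf : DifferentiableAt ℝ f x) :
    pd j (fun x => φ x • f x) x = φ x • pd j f x + pd j φ x • f x := by
  simp [pd, fderiv_fun_smul hφ hf]

theorem pd_mul {f g : Plane → ℝ} {x : Plane} (j : Fin 2) (hf : DifferentiableAt ℝ f x)
    (hg : DifferentiableAt ℝ g x) :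
    pd j (fun x => f x * g x) x = f x * pd j g x + pd j f x * g x :=
  pd_smul j hf hg

theorem pd_const_mul {f : Plane → ℝ} {x : Plane} (j : Fin 2) (c : ℝ)
    (hf : DifferentiableAt ℝ f x) : pd j (fun x => c * f x) x = c * pd j f x := by
  simp [pd, fderiv_const_mul hf]

theorem pd_comp_clm {F : Type*} [NormedAddCommGroup F] [NormedSpace ℝ F] {f : Plane → E}
    {x : Plane} (j : Fin 2) (l : E →L[ℝ] F) (hf : DifferentiableAt ℝ f x) :
    pd j (fun x => l (f x)) x = l (pd j f x) := by
  have : HasFDerivAt (fun x => l (f x)) (l.comp (fderiv ℝ f x)) x :=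
    l.hasFDerivAt.comp x hf.hasFDerivAt
  simp [pd, this.fderiv]

theorem pd_comm {f : Plane → E} (hf : ContDiff ℝ ∞ f) (i j : Fin 2) (x : Plane) :
    pd i (pd j f) x = pd j (pd i f) x := by
  have h2 : ContDiffAt ℝ 2 f x := (contDiff_infty.1 hf 2).contDiffAt
  have hd : DifferentiableAt ℝ (fderiv ℝ f) x :=
    ((hf.fderiv_right (m := ∞) le_rfl).differentiable (by simp)).differentiableAt
  have key : ∀ i j : Fin 2, pd i (pd j f) x =
      fderiv ℝ (fderiv ℝ f) x (EuclideanSpace.single i 1) (EuclideanSpace.single j 1) := by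
    intro i j
    have : HasFDerivAt (pd j f) ((ContinuousLinearMap.apply ℝ E
        (EuclideanSpace.single j (1 : ℝ))).comp (fderiv ℝ (fderiv ℝ f) x)) x :=
      (ContinuousLinearMap.apply ℝ E (EuclideanSpace.single j (1 : ℝ))).hasFDerivAt.comp x
        hd.hasFDerivAt
    change fderiv ℝ (pd j f) x _ = _
    rw [this.fderiv]
    rfl
  rw [key, key]
  exact (h2.isSymmSndFDerivAt (by simp)).eq _ _

theorem laplacian_eq_sum_pd {f : Plane → E} (hf : ContDiff ℝ ∞ f) (x : Plane) :
    Laplacian.laplacian f x = ∑ j, pd j (pd j f) x := by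
  have hd : DifferentiableAt ℝ (fderiv ℝ f) x :=
    ((hf.fderiv_right (m := ∞) le_rfl).differentiable (by simp)).differentiableAt
  rw [InnerProductSpace.laplacian_eq_iteratedFDeriv_orthonormalBasis f
    (EuclideanSpace.basisFun (Fin 2) ℝ)]
  refine Finset.sum_congr rfl fun j _ => ?_
  have : HasFDerivAt (pd j f) ((ContinuousLinearMap.apply ℝ E
      (EuclideanSpace.single j (1 : ℝ))).comp (fderiv ℝ (fderiv ℝ f) x)) x :=
    (ContinuousLinearMap.apply ℝ E (EuclideanSpace.single j (1 : ℝ))).hasFDerivAt.comp x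
      hd.hasFDerivAt
  change _ = fderiv ℝ (pd j f) x _
  rw [this.fderiv, iteratedFDeriv_two_apply]
  simp

/-- Integration by parts against the constant one. Only C¹ is assumed because the lemma is also
applied to φ|ψ|^(p+2), which need not be smooth at the zeros of ψ. -/
theorem integral_pd_eq_zero {f : Plane → ℝ} (hf : ContDiff ℝ 1 f) (hc : HasCompactSupport f)
    (j : Fin 2) : ∫ x, pd j f x = 0 := by
  have hd : Continuous (fun x => fderiv ℝ f x (EuclideanSpace.single j (1 : ℝ))) :=
    (hf.continuous_fderiv (by simp)).clm_apply continuous_const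
  have h := integral_mul_fderiv_eq_neg_fderiv_mul_of_integrable (μ := (volume : Measure Plane))
    (f := fun _ : Plane => (1 : ℝ)) (g := f) (v := EuclideanSpace.single j 1) (by simp)
    (by
      simp only [one_mul]
      refine hd.integrable_of_hasCompactSupport ?_
      exact hc.mono' ((subset_tsupport _).trans (tsupport_pd_subset j f)))
    (by simpa using hf.continuous.integrable_of_hasCompactSupport hc)
    (fun _ _ => by fun_prop) (fun x _ => (hf.differentiable (by simp)).differentiableAt)
  simpa [pd] using h

end PartialDerivatives

/-! ### Mollifiers and their convergence in L². -/

section Mollification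

/-- A sequence of smooth bumps at the origin with shrinking supports. -/
noncomputable def bump (n : ℕ) : ContDiffBump (0 : Plane) where
  rIn := 1 / (2 * (n + 1))
  rOut := 1 / (n + 1)
  rIn_pos := by positivity
  rIn_lt_rOut := by
    apply one_div_lt_one_div_of_lt <;> nlinarith [(Nat.cast_nonneg n : (0 : ℝ) ≤ n)]

/-- The mollifier of mass one. -/
noncomputable def mollifier (n : ℕ) : Plane → ℝ := (bump n).normed volume

theorem isTest_mollifier (n : ℕ) : IsTest (mollifier n) :=
  ⟨(bump n).contDiff_normed, (bump n).hasCompactSupport_normed⟩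

theorem mollifier_nonneg (n : ℕ) (x : Plane) : 0 ≤ mollifier n x := (bump n).nonneg_normed x

theorem integral_mollifier (n : ℕ) : ∫ x, mollifier n x = 1 := (bump n).integral_normed

theorem tsupport_mollifier (n : ℕ) :
    tsupport (mollifier n) = Metric.closedBall (0 : Plane) (1 / (n + 1)) :=
  (bump n).tsupport_normed_eq

/-- The mollification of a function. -/
noncomputable def moll (n : ℕ) (f : Plane → ℂ) (x : Plane) : ℂ :=
  ∫ y, mollifier n y • f (x - y)

theorem moll_eq_convolution (n : ℕ) (f : Plane → ℂ) :
    moll n f = MeasureTheory.convolution (mollifier n) f (ContinuousLinearMap.lsmul ℝ ℝ) volume :=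
  rfl

theorem moll_apply (n : ℕ) (f : Plane → ℂ) (x : Plane) :
    moll n f x = ∫ y, mollifier n (x - y) • f y := by
  rw [moll, ← integral_sub_left_eq_self _ volume x]
  simp

theorem contDiff_moll (n : ℕ) {f : Plane → ℂ} (hf : LocallyIntegrable f) :
    ContDiff ℝ ∞ (moll n f) := by
  rw [moll_eq_convolution]
  exact (isTest_mollifier n).compact.contDiff_convolution_left _
    (isTest_mollifier n).contDiff hf

theorem isTest_mollifier_sub (n : ℕ) (x : Plane) : IsTest (fun y => mollifier n (x - y)) := by
  refine ⟨(isTest_mollifier n).contDiff.comp (contDiff_const.sub contDiff_id), ?_⟩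
  exact (isTest_mollifier n).compact.comp_homeomorph (Homeomorph.subLeft x)

theorem tsupport_mollifier_sub (n : ℕ) (x : Plane) :
    tsupport (fun y => mollifier n (x - y)) ⊆ Metric.closedBall x (1 / (n + 1)) := by
  refine closure_minimal (fun y hy => ?_) Metric.isClosed_closedBall
  have : x - y ∈ tsupport (mollifier n) := subset_tsupport _ hy
  rw [tsupport_mollifier] at this
  simpa [dist_eq_norm, norm_sub_rev] using this

theorem pd_moll (n : ℕ) {f : Plane → ℂ} (hf : LocallyIntegrable f) (j : Fin 2) (x : Plane) :
    pd j (moll n f) x = - ∫ y, pd j (fun y => mollifier n (x - y)) y • f y := by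
  have h := (isTest_mollifier n).compact.hasFDerivAt_convolution_left
    (ContinuousLinearMap.lsmul ℝ ℝ : ℝ →L[ℝ] ℂ →L[ℝ] ℂ)
    ((isTest_mollifier n).contDiff.of_le (by simp)) hf x (μ := volume)
  rw [← moll_eq_convolution] at h
  have hex := ((isTest_mollifier n).compact.fderiv ℝ).convolutionExists_left
    (ContinuousLinearMap.precompL Plane (ContinuousLinearMap.lsmul ℝ ℝ : ℝ →L[ℝ] ℂ →L[ℝ] ℂ))
    ((isTest_mollifier n).contDiff.continuous_fderiv (by simp)) hf x (μ := volume)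
  rw [pd, h.fderiv, MeasureTheory.convolution_def, ContinuousLinearMap.integral_apply hex,
    ← integral_sub_left_eq_self _ volume x]
  have hneg : ∀ y, pd j (fun y => mollifier n (x - y)) y =
      - fderiv ℝ (mollifier n) (x - y) (EuclideanSpace.single j 1) := by
    intro y
    have h1 : HasFDerivAt (fun y => mollifier n (x - y))
        ((fderiv ℝ (mollifier n) (x - y)).comp (-ContinuousLinearMap.id ℝ Plane)) y :=
      ((differentiable_of_contDiff (isTest_mollifier n).contDiff _).hasFDerivAt).comp y
        ((hasFDerivAt_id y).const_sub x)
    simp [pd, h1.fderiv]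
  simp only [hneg, neg_smul, integral_neg, neg_neg]
  simp [ContinuousLinearMap.precompL_apply]

/-- The weak identity is tested with the reflected and translated mollifier, which turns a weak
derivative into a classical one. -/
theorem pd_moll_of_weak (n : ℕ) {f g : Plane → ℂ} (hf : LocallyIntegrable f) {j : Fin 2}
    (h : ∀ φ : Plane → ℝ, IsTest φ → ∫ x, pd j φ x • f x = - ∫ x, φ x • g x) (x : Plane) :
    pd j (moll n f) x = moll n g x := by
  rw [pd_moll n hf, h _ (isTest_mollifier_sub n x), neg_neg, moll_apply]

/-- This is the continuity of the translation action on `Lp`, valid because the exponent is finite.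
-/
theorem tendsto_eLpNorm_translate {f : Plane → ℂ} (hf : MemLp f 2) :
    Tendsto (fun y => eLpNorm (fun x => f (x - y) - f x) 2 volume) (𝓝 0) (𝓝 0) := by
  have : Fact ((2 : ℝ≥0∞) ≠ ⊤) := ⟨by simp⟩
  let F := hf.toLp f
  have hc : Continuous (fun y : Plane => DomAddAct.mk (-y) +ᵥ F) := by
    have h1 : Continuous (fun y : Plane => DomAddAct.mk (-y)) :=
      DomAddAct.continuous_mk.comp continuous_neg
    exact h1.vadd continuous_const
  have h0 : DomAddAct.mk (-(0 : Plane)) +ᵥ F = F := by simp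
  have h2 : Tendsto (fun y : Plane => edist (DomAddAct.mk (-y) +ᵥ F) F) (𝓝 0) (𝓝 0) := by
    have := (hc.edist (continuous_const (y := F))).tendsto 0
    simpa only [h0, edist_self] using this
  refine h2.congr fun y => ?_
  rw [Lp.edist_def]
  refine eLpNorm_congr_ae ?_
  have h3 : (DomAddAct.mk (-y) +ᵥ F : Lp ℂ 2 volume) =ᵐ[volume] fun x => F (-y + x) :=
    DomAddAct.vadd_Lp_ae_eq _ _
  have h4 : F =ᵐ[volume] f := hf.coeFn_toLp
  have h5 : (fun x => F (-y + x)) =ᵐ[volume] fun x => f (-y + x) :=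
    (measurePreserving_add_left volume (-y)).quasiMeasurePreserving.ae_eq_comp h4
  filter_upwards [h3, h4, h5] with x e3 e4 e5
  simp only [Pi.sub_apply, e3, e4]
  rw [show F (-y + x) = f (-y + x) from e5]
  congr 2
  abel

/-- Jensen's inequality for the probability density `mollifier n`, obtained from Cauchy–Schwarz
after splitting the density into two square roots. -/
theorem sq_lintegral_mollifier_le (n : ℕ) {h : Plane → ℝ≥0∞} (hh : AEMeasurable h) :
    (∫⁻ y, ENNReal.ofReal (mollifier n y) * h y) ^ 2
      ≤ ∫⁻ y, ENNReal.ofReal (mollifier n y) * h y ^ 2 := by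
  have hm : Measurable (fun y => ENNReal.ofReal (mollifier n y)) :=
    (isTest_mollifier n).continuous.measurable.ennreal_ofReal
  have hone : ∫⁻ y, ENNReal.ofReal (mollifier n y) = 1 := by
    rw [← ofReal_integral_eq_lintegral_ofReal (isTest_mollifier n).integrable
      (ae_of_all _ (mollifier_nonneg n)), integral_mollifier, ENNReal.ofReal_one]
  have key := ENNReal.lintegral_mul_le_Lp_mul_Lq (volume : Measure Plane)
    (Real.HolderConjugate.two_two) (f := fun y => ENNReal.ofReal (mollifier n y) ^ (1 / 2 : ℝ))
    (g := fun y => ENNReal.ofReal (mollifier n y) ^ (1 / 2 : ℝ) * h y)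
    (hm.pow_const _).aemeasurable ((hm.pow_const _).aemeasurable.mul hh)
  have hsq : ∀ z : ℝ≥0∞, z ^ (1 / 2 : ℝ) * z ^ (1 / 2 : ℝ) = z := fun z => by
    rw [← ENNReal.rpow_add_of_nonneg _ _ (by norm_num) (by norm_num)]; norm_num
  simp only [Pi.mul_apply, ← mul_assoc, hsq] at key
  have h1 : ∀ z : ℝ≥0∞, (z ^ (1 / 2 : ℝ)) ^ (2 : ℝ) = z := fun z => by
    rw [← ENNReal.rpow_mul]; norm_num
  simp only [ENNReal.mul_rpow_of_nonneg _ _ (zero_le_two (α := ℝ)), h1, hone,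
    ENNReal.one_rpow, one_mul] at key
  calc _ ≤ ((∫⁻ y, ENNReal.ofReal (mollifier n y) * h y ^ (2 : ℝ)) ^ (1 / 2 : ℝ)) ^ 2 := by
        gcongr
    _ = _ := by
        rw [← ENNReal.rpow_two, h1]
        simp

/-- The difference is an average of the differences f(·-y) - f over the support of the mollifier;
Jensen and Tonelli bound its L² norm by the largest of theirs. -/
theorem eLpNorm_moll_sub_le (n : ℕ) {f : Plane → ℂ} (hf : MemLp f 2) {ε : ℝ≥0∞}
    (hε : ∀ y ∈ Metric.closedBall (0 : Plane) (1 / (n + 1)),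
      eLpNorm (fun x => f (x - y) - f x) 2 volume ≤ ε) :
    eLpNorm (fun x => moll n f x - f x) 2 volume ≤ ε := by
  have hloc : LocallyIntegrable f := hf.locallyIntegrable (by norm_num)
  have hm : Measurable (fun y => ENNReal.ofReal (mollifier n y)) :=
    (isTest_mollifier n).continuous.measurable.ennreal_ofReal
  have hone : ∫⁻ y, ENNReal.ofReal (mollifier n y) = 1 := by
    rw [← ofReal_integral_eq_lintegral_ofReal (isTest_mollifier n).integrable
      (ae_of_all _ (mollifier_nonneg n)), integral_mollifier, ENNReal.ofReal_one]
  have hsubm : ∀ x, AEStronglyMeasurable (fun y => f (x - y)) volume := fun x =>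
    hf.aestronglyMeasurable.comp_measurePreserving (Measure.measurePreserving_sub_left volume x)
  have hptw : ∀ x, ‖moll n f x - f x‖ₑ ^ 2
      ≤ ∫⁻ y, ENNReal.ofReal (mollifier n y) * ‖f (x - y) - f x‖ₑ ^ 2 := by
    intro x
    have e1 : moll n f x - f x = ∫ y, mollifier n y • (f (x - y) - f x) := by
      have i1 : Integrable (fun y => mollifier n y • f (x - y)) :=
        (isTest_mollifier n).compact.convolutionExists_left
          (ContinuousLinearMap.lsmul ℝ ℝ : ℝ →L[ℝ] ℂ →L[ℝ] ℂ)
          (isTest_mollifier n).continuous hloc x (μ := volume)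
      simp only [smul_sub]
      rw [integral_sub i1 ((isTest_mollifier n).integrable.smul_const _), integral_smul_const,
        integral_mollifier, one_smul, moll]
    refine le_trans ?_ (sq_lintegral_mollifier_le n ((hsubm x).sub aestronglyMeasurable_const).enorm)
    gcongr
    rw [e1]
    refine (enorm_integral_le_lintegral_enorm _).trans (lintegral_mono fun y => ?_)
    rw [enorm_smul, Real.enorm_of_nonneg (mollifier_nonneg n y)]
  have hprod : AEMeasurable (fun z : Plane × Plane =>
      ENNReal.ofReal (mollifier n z.2) * ‖f (z.1 - z.2) - f z.1‖ₑ ^ 2) (volume.prod volume) := by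
    refine (hm.comp measurable_snd).aemeasurable.mul (AEMeasurable.pow_const ?_ _)
    refine (AEStronglyMeasurable.sub ?_ ?_).enorm
    · exact hf.aestronglyMeasurable.comp_quasiMeasurePreserving
        (quasiMeasurePreserving_sub volume volume)
    · exact hf.aestronglyMeasurable.comp_fst
  have hnorm : ∀ g : Plane → ℂ, eLpNorm g 2 volume ^ 2 = ∫⁻ x, ‖g x‖ₑ ^ 2 := by
    intro g
    rw [eLpNorm_eq_lintegral_rpow_enorm_toReal (by norm_num) (by norm_num), ← ENNReal.rpow_two,
      ← ENNReal.rpow_mul]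
    norm_num
  rw [← ENNReal.pow_le_pow_left_iff two_ne_zero, hnorm]
  calc ∫⁻ x, ‖moll n f x - f x‖ₑ ^ 2
      ≤ ∫⁻ x, ∫⁻ y, ENNReal.ofReal (mollifier n y) * ‖f (x - y) - f x‖ₑ ^ 2 := lintegral_mono hptw
    _ = ∫⁻ y, ∫⁻ x, ENNReal.ofReal (mollifier n y) * ‖f (x - y) - f x‖ₑ ^ 2 :=
        lintegral_lintegral_swap hprod
    _ ≤ ∫⁻ y, ENNReal.ofReal (mollifier n y) * ε ^ 2 := by
        refine lintegral_mono fun y => ?_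
        rw [lintegral_const_mul' _ _ ENNReal.ofReal_ne_top]
        by_cases hy : y ∈ Metric.closedBall (0 : Plane) (1 / (n + 1))
        · gcongr
          rw [← hnorm]
          gcongr
          exact hε y hy
        · rw [← tsupport_mollifier] at hy
          simp [image_eq_zero_of_notMem_tsupport hy]
    _ = ε ^ 2 := by rw [lintegral_mul_const _ hm, hone, one_mul]

theorem tendsto_eLpNorm_moll_sub {f : Plane → ℂ} (hf : MemLp f 2) :
    Tendsto (fun n => eLpNorm (fun x => moll n f x - f x) 2 volume) atTop (𝓝 0) := by
  rw [ENNReal.tendsto_nhds_zero]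
  intro ε hε
  have h := ENNReal.tendsto_nhds_zero.1 (tendsto_eLpNorm_translate hf) ε hε
  obtain ⟨r, hr, hball⟩ := Metric.eventually_nhds_iff.1 h
  obtain ⟨N, hN⟩ := exists_nat_one_div_lt hr
  filter_upwards [eventually_ge_atTop N] with n hn
  refine eLpNorm_moll_sub_le n hf fun y hy => hball ?_
  refine lt_of_le_of_lt (Metric.mem_closedBall.1 hy) (lt_of_le_of_lt ?_ hN)
  apply one_div_le_one_div_of_le <;> first | positivity | (gcongr)

/-- Every translate differs from `f` by at most twice the norm of `f`, so the previous averaging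
bound already gives square integrability. -/
theorem memLp_moll (n : ℕ) {f : Plane → ℂ} (hf : MemLp f 2) : MemLp (moll n f) 2 := by
  have hsm : AEStronglyMeasurable (moll n f) volume :=
    (contDiff_moll n (hf.locallyIntegrable (by norm_num))).continuous.aestronglyMeasurable
  have h : eLpNorm (fun x => moll n f x - f x) 2 volume ≤ 2 * eLpNorm f 2 volume := by
    refine eLpNorm_moll_sub_le n hf fun y _ => ?_
    have h1 : AEStronglyMeasurable (fun x => f (x - y)) volume :=
      hf.aestronglyMeasurable.comp_measurePreserving (measurePreserving_sub_right volume y)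
    refine (eLpNorm_sub_le h1 hf.aestronglyMeasurable (by norm_num)).trans ?_
    rw [two_mul]
    gcongr
    exact (eLpNorm_comp_measurePreserving hf.aestronglyMeasurable
      (measurePreserving_sub_right volume y)).le
  have h2 : MemLp (fun x => moll n f x - f x) 2 volume :=
    ⟨hsm.sub hf.aestronglyMeasurable, h.trans_lt (ENNReal.mul_lt_top (by simp) hf.2)⟩
  refine (h2.add hf).ae_eq (ae_of_all _ fun x => ?_)
  simp

end Mollification

/-! ### Smooth cutoffs and their scaling. -/

section Cutoff

/-- A smooth function which vanishes on the unit ball and is one outside the ball of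
radius `√2`. -/
noncomputable def cutOne (x : Plane) : ℝ := Real.smoothTransition (‖x‖ ^ 2 - 1)

/-- The rescaled cutoff `x ↦ cutOne (s x)`. -/
noncomputable def cut (s : ℝ) (x : Plane) : ℝ := cutOne (s • x)

theorem contDiff_cutOne : ContDiff ℝ ∞ cutOne :=
  Real.smoothTransition.contDiff.comp ((contDiff_norm_sq ℝ).sub contDiff_const)

theorem contDiff_cut (s : ℝ) : ContDiff ℝ ∞ (cut s) :=
  contDiff_cutOne.comp (contDiff_const_smul s)

theorem cut_nonneg (s : ℝ) (x : Plane) : 0 ≤ cut s x := Real.smoothTransition.nonneg _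

theorem cut_le_one (s : ℝ) (x : Plane) : cut s x ≤ 1 := Real.smoothTransition.le_one _

theorem cut_eq_zero {s : ℝ} {x : Plane} (h : |s| * ‖x‖ ≤ 1) : cut s x = 0 := by
  refine Real.smoothTransition.zero_of_nonpos ?_
  rw [norm_smul, Real.norm_eq_abs]
  nlinarith [mul_nonneg (abs_nonneg s) (norm_nonneg x)]

theorem cut_eq_one {s : ℝ} {x : Plane} (h : 2 ≤ |s| * ‖x‖) : cut s x = 1 := by
  refine Real.smoothTransition.one_of_one_le ?_
  rw [norm_smul, Real.norm_eq_abs]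
  nlinarith

/-- The complementary cutoff is compactly supported. -/
theorem isTest_one_sub_cut {s : ℝ} (hs : s ≠ 0) : IsTest (fun x => 1 - cut s x) := by
  refine ⟨contDiff_const.sub (contDiff_cut s), ?_⟩
  refine HasCompactSupport.of_support_subset_isCompact (isCompact_closedBall 0 (2 / |s|)) ?_
  intro x hx
  rw [mem_closedBall_zero_iff, le_div_iff₀ (abs_pos.2 hs)]
  by_contra! h
  exact hx (by simp [cut_eq_one (s := s) (x := x) (by linarith)])

theorem pd_comp_smul {E : Type*} [NormedAddCommGroup E] [NormedSpace ℝ E] {f : Plane → E}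
    (hf : Differentiable ℝ f) (s : ℝ) (j : Fin 2) (x : Plane) :
    pd j (fun x => f (s • x)) x = s • pd j f (s • x) := by
  have h : HasFDerivAt (fun x : Plane => f (s • x))
      ((fderiv ℝ f (s • x)).comp (s • ContinuousLinearMap.id ℝ Plane)) x :=
    (hf (s • x)).hasFDerivAt.comp x ((hasFDerivAt_id x).const_smul s)
  simp [pd, h.fderiv]

theorem pd_cut (s : ℝ) (j : Fin 2) (x : Plane) : pd j (cut s) x = s * pd j cutOne (s • x) :=
  pd_comp_smul (differentiable_of_contDiff contDiff_cutOne) s j x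

theorem pd_pd_cut (s : ℝ) (i j : Fin 2) (x : Plane) :
    pd i (pd j (cut s)) x = s ^ 2 * pd i (pd j cutOne) (s • x) := by
  have h : pd j (cut s) = fun x => s * pd j cutOne (s • x) := funext (pd_cut s j)
  have hd := differentiable_of_contDiff (contDiff_pd contDiff_cutOne j)
  rw [h, pd_const_mul i s (by fun_prop), pd_comp_smul hd, smul_eq_mul]
  ring

/-- The cutoff itself is not compactly supported, but its complement is, and the two have opposite
derivatives. -/
theorem pd_cutOne_eq_neg (j : Fin 2) : pd j cutOne = fun x => - pd j (fun x => 1 - cut 1 x) x := by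
  funext x
  have : (fun x => 1 - cut 1 x) = fun x => 1 - cutOne x := by simp [cut]
  rw [this]
  simp [pd, fderiv_const_sub]

theorem isTest_pd_cutOne (j : Fin 2) : IsTest (pd j cutOne) := by
  rw [pd_cutOne_eq_neg]
  have h := (isTest_one_sub_cut (s := 1) one_ne_zero).pd j
  exact ⟨h.contDiff.neg, h.compact.neg⟩

/-- Uniform bound for the derivatives of the cutoff of orders one and two. -/
theorem exists_cut_bound : ∃ C, 0 < C ∧ ∀ (s : ℝ) (x : Plane) (i j : Fin 2),
    |pd j (cut s) x| ≤ C * |s| ∧ |pd i (pd j (cut s)) x| ≤ C * s ^ 2 := by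
  choose C hC using fun j => (isTest_pd_cutOne j).exists_bound
  choose C' hC' using fun i j => ((isTest_pd_cutOne j).pd i).exists_bound
  refine ⟨1 + ∑ j, |C j| + ∑ i, ∑ j, |C' i j|, by positivity, fun s x i j => ⟨?_, ?_⟩⟩
  · rw [pd_cut, abs_mul, mul_comm]
    gcongr
    have h1 : |pd j cutOne (s • x)| ≤ |C j| := (hC j _).trans (le_abs_self _)
    have h2 : |C j| ≤ ∑ j, |C j| :=
      Finset.single_le_sum (f := fun j => |C j|) (fun _ _ => abs_nonneg _) (Finset.mem_univ j)
    have h3 : 0 ≤ ∑ i, ∑ j, |C' i j| := by positivity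
    linarith
  · rw [pd_pd_cut, abs_mul, abs_of_nonneg (sq_nonneg s), mul_comm]
    gcongr
    have h1 : |pd i (pd j cutOne) (s • x)| ≤ |C' i j| := (hC' i j _).trans (le_abs_self _)
    have h2 : |C' i j| ≤ ∑ j, |C' i j| :=
      Finset.single_le_sum (f := fun j => |C' i j|) (fun _ _ => abs_nonneg _) (Finset.mem_univ j)
    have h4 : ∑ j, |C' i j| ≤ ∑ i, ∑ j, |C' i j| :=
      Finset.single_le_sum (f := fun i => ∑ j, |C' i j|) (fun _ _ => by positivity)
        (Finset.mem_univ i)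
    have h3 : 0 ≤ ∑ j, |C j| := by positivity
    linarith

theorem pd_cut_eq_zero {s : ℝ} {x : Plane} (h : |s| * ‖x‖ < 1 ∨ 2 < |s| * ‖x‖) (j : Fin 2) :
    pd j (cut s) x = 0 := by
  have hc : Continuous fun x : Plane => |s| * ‖x‖ := by fun_prop
  rcases h with h | h
  · have : cut s =ᶠ[𝓝 x] fun _ => 0 := by
      filter_upwards [hc.continuousAt.eventually_lt continuousAt_const h] with y hy
      exact cut_eq_zero hy.le
    rw [pd, this.fderiv_eq]; simp
  · have : cut s =ᶠ[𝓝 x] fun _ => 1 := by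
      filter_upwards [continuousAt_const.eventually_lt hc.continuousAt h] with y hy
      exact cut_eq_one hy.le
    rw [pd, this.fderiv_eq]; simp

theorem pd_pd_cut_eq_zero {s : ℝ} {x : Plane} (h : |s| * ‖x‖ < 1 ∨ 2 < |s| * ‖x‖) (i j : Fin 2) :
    pd i (pd j (cut s)) x = 0 := by
  have hc : Continuous fun x : Plane => |s| * ‖x‖ := by fun_prop
  have : pd j (cut s) =ᶠ[𝓝 x] fun _ => 0 := by
    rcases h with h | h
    · filter_upwards [hc.continuousAt.eventually_lt continuousAt_const h] with y hy
      exact pd_cut_eq_zero (Or.inl hy) j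
    · filter_upwards [continuousAt_const.eventually_lt hc.continuousAt h] with y hy
      exact pd_cut_eq_zero (Or.inr hy) j
  rw [pd, this.fderiv_eq]; simp

end Cutoff

/-! ### Weighted L² pairings. -/

section WeightedInner

/-- Bounded measurable weights. -/
structure IsBdd (b : Plane → ℝ) : Prop where
  measurable : Measurable b
  bounded : ∃ C, ∀ x, |b x| ≤ C

theorem IsTest.isBdd {φ : Plane → ℝ} (hφ : IsTest φ) : IsBdd φ :=
  ⟨hφ.continuous.measurable, hφ.exists_bound⟩

theorem IsBdd.memLp_smul {b : Plane → ℝ} (hb : IsBdd b) {f : Plane → ℂ} {q : ℝ≥0∞}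
    (hf : MemLp f q) : MemLp (fun x => b x • f x) q := by
  obtain ⟨C, hC⟩ := hb.bounded
  refine MemLp.of_le_mul (c := C) hf
    (hb.measurable.aestronglyMeasurable.smul hf.aestronglyMeasurable) (ae_of_all _ fun x => ?_)
  rw [norm_smul]
  gcongr
  exact hC x

/-- The weighted inner product `∫ b f̄ g`. -/
noncomputable def ip (b : Plane → ℝ) (f g : Plane → ℂ) : ℂ :=
  ∫ x, b x • (starRingEnd ℂ (f x) * g x)

theorem memLp_conj {f : Plane → ℂ} {q : ℝ≥0∞} (hf : MemLp f q) :
    MemLp (fun x => starRingEnd ℂ (f x)) q := hf.star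

theorem integrable_conj_mul {f g : Plane → ℂ} (hf : MemLp f 2) (hg : MemLp g 2) :
    Integrable (fun x => starRingEnd ℂ (f x) * g x) :=
  (memLp_conj hf).integrable_mul hg

theorem integrable_ip {b : Plane → ℝ} (hb : IsBdd b) {f g : Plane → ℂ} (hf : MemLp f 2)
    (hg : MemLp g 2) : Integrable (fun x => b x • (starRingEnd ℂ (f x) * g x)) := by
  obtain ⟨C, hC⟩ := hb.bounded
  exact (integrable_conj_mul hf hg).bdd_smul C hb.measurable.aestronglyMeasurable
    (ae_of_all _ hC)

theorem ip_congr {b : Plane → ℝ} {f f' g g' : Plane → ℂ} (hf : f =ᵐ[volume] f')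
    (hg : g =ᵐ[volume] g') : ip b f g = ip b f' g' := by
  refine integral_congr_ae ?_
  filter_upwards [hf, hg] with x h1 h2
  rw [h1, h2]

theorem norm_integral_conj_mul_le {f g : Plane → ℂ} (hf : MemLp f 2) (hg : MemLp g 2) :
    ∫ x, ‖f x‖ * ‖g x‖ ≤ (eLpNorm f 2 volume).toReal * (eLpNorm g 2 volume).toReal := by
  have h := integral_mul_norm_le_Lp_mul_Lq (μ := (volume : Measure Plane)) (f := f) (g := g)
    Real.HolderConjugate.two_two (by simpa using hf) (by simpa using hg)
  refine h.trans_eq ?_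
  congr 1
  · rw [hf.eLpNorm_eq_integral_rpow_norm (by norm_num) (by norm_num),
      ENNReal.toReal_ofReal (by positivity)]
    norm_num
  · rw [hg.eLpNorm_eq_integral_rpow_norm (by norm_num) (by norm_num),
      ENNReal.toReal_ofReal (by positivity)]
    norm_num

theorem norm_ip_le {b : Plane → ℝ} {C : ℝ} (hC : ∀ x, |b x| ≤ C) {f g : Plane → ℂ}
    (hf : MemLp f 2) (hg : MemLp g 2) :
    ‖ip b f g‖ ≤ C * ((eLpNorm f 2 volume).toReal * (eLpNorm g 2 volume).toReal) := by
  have hC0 : 0 ≤ C := (abs_nonneg _).trans (hC 0)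
  have hintg : Integrable (fun x => ‖f x‖ * ‖g x‖) := hf.norm.integrable_mul hg.norm
  calc ‖ip b f g‖ ≤ ∫ x, ‖b x • (starRingEnd ℂ (f x) * g x)‖ := norm_integral_le_integral_norm _
    _ ≤ ∫ x, C * (‖f x‖ * ‖g x‖) := by
        refine integral_mono_of_nonneg (ae_of_all _ fun _ => norm_nonneg _) (hintg.const_mul C)
          (ae_of_all _ fun x => ?_)
        simp only [norm_smul, norm_mul, RCLike.norm_conj, Real.norm_eq_abs]
        gcongr
        exact hC x
    _ ≤ _ := by
        rw [integral_const_mul]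
        gcongr
        exact norm_integral_conj_mul_le hf hg

/-- Bilinearity over ℝ is enough, and it avoids the conjugation in the first slot. Continuity and
the product rule for pairings of L² curves follow from it. -/
theorem isBoundedBilinearMap_ip {b : Plane → ℝ} (hb : IsBdd b) :
    IsBoundedBilinearMap ℝ
      (fun z : Lp ℂ 2 (volume : Measure Plane) × Lp ℂ 2 (volume : Measure Plane) =>
        ip b z.1 z.2) where
  add_left f f' g := by
    rw [ip, ip, ip, ← integral_add (integrable_ip hb (Lp.memLp f) (Lp.memLp g))
      (integrable_ip hb (Lp.memLp f') (Lp.memLp g))]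
    refine integral_congr_ae ?_
    filter_upwards [Lp.coeFn_add f f'] with x hx
    simp only [hx, Pi.add_apply, map_add, add_mul, smul_add]
  smul_left c f g := by
    rw [ip, ip, ← integral_smul]
    refine integral_congr_ae ?_
    filter_upwards [Lp.coeFn_smul c f] with x hx
    simp only [hx, Pi.smul_apply, Complex.real_smul, map_mul, Complex.conj_ofReal]
    ring
  add_right f g g' := by
    rw [ip, ip, ip, ← integral_add (integrable_ip hb (Lp.memLp f) (Lp.memLp g))
      (integrable_ip hb (Lp.memLp f) (Lp.memLp g'))]
    refine integral_congr_ae ?_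
    filter_upwards [Lp.coeFn_add g g'] with x hx
    simp only [hx, Pi.add_apply, mul_add, smul_add]
  smul_right c f g := by
    rw [ip, ip, ← integral_smul]
    refine integral_congr_ae ?_
    filter_upwards [Lp.coeFn_smul c g] with x hx
    simp only [hx, Pi.smul_apply, Complex.real_smul]
    ring
  bound := by
    obtain ⟨C, hC⟩ := hb.bounded
    refine ⟨|C| + 1, by positivity, fun f g => ?_⟩
    refine (norm_ip_le hC (Lp.memLp f) (Lp.memLp g)).trans ?_
    rw [← Lp.norm_def, ← Lp.norm_def, ← mul_assoc]
    gcongr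
    linarith [le_abs_self C]

theorem tendsto_ip {ι : Type*} {l : Filter ι} {b : Plane → ℝ} (hb : IsBdd b)
    {f g : Plane → ℂ} {fn gn : ι → Plane → ℂ} (hf : MemLp f 2) (hg : MemLp g 2)
    (hfn : ∀ i, MemLp (fn i) 2) (hgn : ∀ i, MemLp (gn i) 2)
    (h1 : Tendsto (fun i => eLpNorm (fun x => fn i x - f x) 2 volume) l (𝓝 0))
    (h2 : Tendsto (fun i => eLpNorm (fun x => gn i x - g x) 2 volume) l (𝓝 0)) :
    Tendsto (fun i => ip b (fn i) (gn i)) l (𝓝 (ip b f g)) := by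
  have t1 : Tendsto (fun i => (hfn i).toLp (fn i)) l (𝓝 (hf.toLp f)) :=
    (Lp.tendsto_Lp_iff_tendsto_eLpNorm'' _ hfn f hf).2 h1
  have t2 : Tendsto (fun i => (hgn i).toLp (gn i)) l (𝓝 (hg.toLp g)) :=
    (Lp.tendsto_Lp_iff_tendsto_eLpNorm'' _ hgn g hg).2 h2
  have h := ((isBoundedBilinearMap_ip hb).continuous.tendsto (hf.toLp f, hg.toLp g)).comp
    (t1.prodMk_nhds t2)
  have e0 : ip b (hf.toLp f) (hg.toLp g) = ip b f g := ip_congr hf.coeFn_toLp hg.coeFn_toLp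
  rw [← e0]
  refine h.congr fun i => ?_
  exact ip_congr (hfn i).coeFn_toLp (hgn i).coeFn_toLp

end WeightedInner

/-! ### H¹ functions with their weak gradients, and density of test functions. -/

section SobolevPairs

/-- `f` is in `H¹` with weak gradient `g`. -/
structure H1Pair (f : Plane → ℂ) (g : Fin 2 → Plane → ℂ) : Prop where
  memLp : MemLp f 2
  memLp_grad : ∀ j, MemLp (g j) 2
  weak : ∀ φ : Plane → ℝ, IsTest φ → ∀ j, ∫ x, pd j φ x • f x = - ∫ x, φ x • g j x

theorem H1Pair.locallyIntegrable {f : Plane → ℂ} {g : Fin 2 → Plane → ℂ} (h : H1Pair f g) :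
    LocallyIntegrable f := h.memLp.locallyIntegrable (by norm_num)

theorem H1Pair.pd_moll {f : Plane → ℂ} {g : Fin 2 → Plane → ℂ} (h : H1Pair f g) (n : ℕ)
    (j : Fin 2) : pd j (moll n f) = moll n (g j) :=
  funext (pd_moll_of_weak n h.locallyIntegrable fun φ hφ => h.weak φ hφ j)

/-- Dominated convergence: the cutoff vanishes for |x| ≤ n+1, so at each point the integrand is
eventually zero. -/
theorem tendsto_eLpNorm_cut_smul {f : Plane → ℂ} (hf : MemLp f 2) :
    Tendsto (fun n : ℕ => eLpNorm (fun x => cut (1 / (n + 1)) x • f x) 2 volume) atTop (𝓝 0) := by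
  have h2 : Tendsto (fun n : ℕ => ∫⁻ x, ‖cut (1 / (n + 1)) x • f x‖ₑ ^ (2 : ℝ)) atTop
      (𝓝 (∫⁻ _ : Plane, 0)) := by
    refine tendsto_lintegral_of_dominated_convergence' (fun x => ‖f x‖ₑ ^ (2 : ℝ)) ?_ ?_ ?_ ?_
    · intro n
      exact (((contDiff_cut _).continuous.aestronglyMeasurable.smul
        hf.aestronglyMeasurable).enorm.pow_const _)
    · refine fun n => ae_of_all _ fun x => ?_
      refine ENNReal.rpow_le_rpow ?_ (by norm_num)
      rw [enorm_smul, Real.enorm_of_nonneg (cut_nonneg _ _)]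
      calc ENNReal.ofReal (cut (1 / (n + 1)) x) * ‖f x‖ₑ ≤ 1 * ‖f x‖ₑ := by
            gcongr
            rw [ENNReal.ofReal_le_one]
            exact cut_le_one _ _
        _ = _ := one_mul _
    · have := lintegral_rpow_enorm_lt_top_of_eLpNorm_lt_top (by norm_num) (by norm_num) hf.2
      simpa using this.ne
    · refine ae_of_all _ fun x => tendsto_const_nhds.congr' ?_
      obtain ⟨N, hN⟩ := exists_nat_ge ‖x‖
      filter_upwards [eventually_ge_atTop N] with n hn
      rw [cut_eq_zero, zero_smul, enorm_zero, ENNReal.zero_rpow_of_pos (by norm_num)]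
      rw [abs_of_nonneg (by positivity), one_div_mul_eq_div, div_le_one (by positivity)]
      have : (N : ℝ) ≤ n := by exact_mod_cast hn
      linarith
  have h3 : ∀ n : ℕ, eLpNorm (fun x => cut (1 / (n + 1)) x • f x) 2 volume
      = (∫⁻ x, ‖cut (1 / (n + 1)) x • f x‖ₑ ^ (2 : ℝ)) ^ (1 / 2 : ℝ) := by
    intro n
    rw [eLpNorm_eq_lintegral_rpow_enorm_toReal (by norm_num) (by norm_num)]
    norm_num
  simp only [h3]
  have := (ENNReal.continuous_rpow_const (y := (1 / 2 : ℝ))).tendsto 0 |>.comp (by simpa using h2)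
  simpa using! this

/-- Smooth compactly supported functions are dense in `H¹`. -/
theorem H1Pair.exists_approx {f : Plane → ℂ} {g : Fin 2 → Plane → ℂ} (h : H1Pair f g) :
    ∃ φ : ℕ → Plane → ℂ, (∀ n, IsTest (φ n)) ∧
      Tendsto (fun n => eLpNorm (fun x => φ n x - f x) 2 volume) atTop (𝓝 0) ∧
      ∀ j, Tendsto (fun n => eLpNorm (fun x => pd j (φ n) x - g j x) 2 volume) atTop (𝓝 0) := by
  obtain ⟨C, hC0, hC⟩ := exists_cut_bound
  have hs : ∀ n : ℕ, (1 / ((n : ℝ) + 1)) ≠ 0 := fun n => by positivity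
  set ζ : ℕ → Plane → ℝ := fun n x => 1 - cut (1 / (n + 1)) x with hζ
  have hζt : ∀ n, IsTest (ζ n) := fun n => isTest_one_sub_cut (hs n)
  have hζ1 : ∀ n x, ‖ζ n x‖ ≤ 1 := fun n x => by
    rw [Real.norm_eq_abs, abs_le]
    constructor <;> simp only [hζ] <;> linarith [cut_nonneg (1 / (n + 1 : ℝ)) x, cut_le_one (1 / (n + 1 : ℝ)) x]
  have hm : ∀ {F : Plane → ℂ}, MemLp F 2 → ∀ n, ContDiff ℝ ∞ (moll n F) := fun hF n =>
    contDiff_moll n (hF.locallyIntegrable (by norm_num))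
  have hconv : ∀ {F : Plane → ℂ}, MemLp F 2 →
      Tendsto (fun n => eLpNorm (fun x => ζ n x • moll n F x - F x) 2 volume) atTop (𝓝 0) := by
    intro F hF
    have hup := (tendsto_eLpNorm_moll_sub hF).add (tendsto_eLpNorm_cut_smul hF)
    rw [add_zero] at hup
    refine tendsto_of_tendsto_of_tendsto_of_le_of_le tendsto_const_nhds hup
      (fun _ => zero_le) (fun n => ?_)
    have e : (fun x => ζ n x • moll n F x - F x) =
        (fun x => ζ n x • (moll n F x - F x)) - fun x => cut (1 / (n + 1)) x • F x := by
      funext x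
      simp only [hζ, Pi.sub_apply, smul_sub, sub_smul, one_smul]
      abel
    have m1 : AEStronglyMeasurable (fun x => moll n F x - F x) volume :=
      (hm hF n).continuous.aestronglyMeasurable.sub hF.aestronglyMeasurable
    have m2 : AEStronglyMeasurable (fun x => ζ n x • (moll n F x - F x)) volume :=
      (hζt n).continuous.aestronglyMeasurable.smul m1
    have m3 : AEStronglyMeasurable (fun x => cut (1 / (n + 1)) x • F x) volume :=
      (contDiff_cut _).continuous.aestronglyMeasurable.smul hF.aestronglyMeasurable
    rw [e]
    refine (eLpNorm_sub_le m2 m3 (by norm_num)).trans ?_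
    gcongr
    refine eLpNorm_mono fun x => ?_
    rw [norm_smul]
    exact mul_le_of_le_one_left (norm_nonneg _) (hζ1 n x)
  -- The approximants are mollified at scale 1/n and then cut off at radius of order n.
  refine ⟨fun n x => ζ n x • moll n f x, fun n => (hζt n).smul (hm h.memLp n), hconv h.memLp,
    fun j => ?_⟩
  -- The derivative of the cutoff is O(1/n) and multiplies a sequence bounded in L².
  have hz : Tendsto (fun n : ℕ => ENNReal.ofReal (C * (1 / (n + 1)))
      * (eLpNorm (fun x => moll n f x - f x) 2 volume + eLpNorm f 2 volume)) atTop (𝓝 0) := by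
    have a1 : Tendsto (fun n : ℕ => ENNReal.ofReal (C * (1 / (n + 1)))) atTop (𝓝 0) := by
      have := (tendsto_one_div_add_atTop_nhds_zero_nat (𝕜 := ℝ)).const_mul C
      rw [mul_zero] at this
      simpa using ENNReal.tendsto_ofReal this
    have a2 := (tendsto_eLpNorm_moll_sub h.memLp).add (tendsto_const_nhds (x := eLpNorm f 2 volume))
    have := ENNReal.Tendsto.mul a1 (Or.inr (by simpa using h.memLp.2.ne)) a2 (Or.inr (by simp))
    simpa using! this
  have hup := (hconv (h.memLp_grad j)).add hz
  rw [add_zero] at hup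
  refine tendsto_of_tendsto_of_tendsto_of_le_of_le tendsto_const_nhds hup (fun _ => zero_le) (fun n => ?_)
  have e : (fun x => pd j (fun x => ζ n x • moll n f x) x - g j x) =
      (fun x => ζ n x • moll n (g j) x - g j x) + fun x => pd j (ζ n) x • moll n f x := by
    funext x
    rw [pd_smul j (differentiable_of_contDiff (hζt n).contDiff x)
      (differentiable_of_contDiff (hm h.memLp n) x), h.pd_moll]
    simp only [Pi.add_apply]
    abel
  have hb : ∀ x, ‖pd j (ζ n) x‖ ≤ C * (1 / (n + 1)) := by
    intro x
    have : pd j (ζ n) x = - pd j (cut (1 / (n + 1))) x := by simp [hζ, pd, fderiv_const_sub]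
    rw [this, norm_neg, Real.norm_eq_abs]
    simpa [abs_of_nonneg (by positivity : (0 : ℝ) ≤ n + 1)] using (hC (1 / (n + 1)) x j j).1
  have m1 : AEStronglyMeasurable (fun x => ζ n x • moll n (g j) x - g j x) volume :=
    ((hζt n).continuous.smul (hm (h.memLp_grad j) n).continuous).aestronglyMeasurable.sub
      (h.memLp_grad j).aestronglyMeasurable
  have m2 : AEStronglyMeasurable (fun x => pd j (ζ n) x • moll n f x) volume :=
    (((hζt n).pd j).continuous.smul (hm h.memLp n).continuous).aestronglyMeasurable
  rw [e]
  refine (eLpNorm_add_le m1 m2 (by norm_num)).trans ?_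
  refine add_le_add le_rfl ?_
  calc eLpNorm (fun x => pd j (ζ n) x • moll n f x) 2 volume
      ≤ ENNReal.ofReal (C * (1 / (n + 1))) * eLpNorm (moll n f) 2 volume := by
        refine eLpNorm_le_mul_eLpNorm_of_ae_le_mul (ae_of_all _ fun x => ?_) 2
        rw [norm_smul]
        gcongr
        exact hb x
    _ ≤ _ := by
        gcongr
        have : moll n f = (fun x => moll n f x - f x) + f := by funext x; simp
        refine (congrArg (eLpNorm · 2 volume) this).trans_le ?_
        exact eLpNorm_add_le ((hm h.memLp n).continuous.aestronglyMeasurable.sub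
          h.memLp.aestronglyMeasurable) h.memLp.aestronglyMeasurable (by norm_num)

end SobolevPairs

/-! ### Integration by parts for H¹ functions. -/

section WeakIdentities

theorem integral_re_im_mul {φ f : Plane → ℂ} (hφ : IsTest φ) (hf : LocallyIntegrable f) :
    ∫ x, φ x * f x = (∫ x, (φ x).re • f x) + Complex.I * ∫ x, (φ x).im • f x := by
  have hr : Integrable (fun x => (φ x).re • f x) :=
    hf.integrable_smul_left_of_hasCompactSupport (Complex.continuous_re.comp hφ.continuous)
      (hφ.compact.comp_left Complex.zero_re)
  have hi : Integrable (fun x => (φ x).im • f x) :=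
    hf.integrable_smul_left_of_hasCompactSupport (Complex.continuous_im.comp hφ.continuous)
      (hφ.compact.comp_left Complex.zero_im)
  rw [← integral_const_mul, ← integral_add hr (hi.const_mul _)]
  refine integral_congr_ae (ae_of_all _ fun x => ?_)
  simp only [Complex.real_smul]
  conv_lhs => rw [← Complex.re_add_im (φ x)]
  ring

theorem IsTest.re {φ : Plane → ℂ} (hφ : IsTest φ) : IsTest (fun x => (φ x).re) :=
  ⟨Complex.reCLM.contDiff.comp hφ.contDiff, hφ.compact.comp_left Complex.zero_re⟩

theorem IsTest.im {φ : Plane → ℂ} (hφ : IsTest φ) : IsTest (fun x => (φ x).im) :=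
  ⟨Complex.imCLM.contDiff.comp hφ.contDiff, hφ.compact.comp_left Complex.zero_im⟩

theorem pd_re {φ : Plane → ℂ} {x : Plane} (hφ : DifferentiableAt ℝ φ x) (j : Fin 2) :
    pd j (fun x => (φ x).re) x = (pd j φ x).re := pd_comp_clm j Complex.reCLM hφ

theorem pd_im {φ : Plane → ℂ} {x : Plane} (hφ : DifferentiableAt ℝ φ x) (j : Fin 2) :
    pd j (fun x => (φ x).im) x = (pd j φ x).im := pd_comp_clm j Complex.imCLM hφ

theorem H1Pair.weak_complex {f : Plane → ℂ} {g : Fin 2 → Plane → ℂ} (h : H1Pair f g)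
    {φ : Plane → ℂ} (hφ : IsTest φ) (j : Fin 2) :
    ∫ x, pd j φ x * f x = - ∫ x, φ x * g j x := by
  rw [integral_re_im_mul (hφ.pd j) h.locallyIntegrable,
    integral_re_im_mul hφ ((h.memLp_grad j).locallyIntegrable (by norm_num))]
  have hd := differentiable_of_contDiff hφ.contDiff
  have h1 := h.weak _ hφ.re j
  have h2 := h.weak _ hφ.im j
  simp only [pd_re (hd _), pd_im (hd _)] at h1 h2
  rw [h1, h2]
  ring

theorem IsTest.conj {φ : Plane → ℂ} (hφ : IsTest φ) : IsTest (fun x => starRingEnd ℂ (φ x)) :=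
  ⟨(Complex.conjCLE : ℂ →L[ℝ] ℂ).contDiff.comp hφ.contDiff, hφ.compact.comp_left (map_zero _)⟩

theorem pd_conj {φ : Plane → ℂ} {x : Plane} (hφ : DifferentiableAt ℝ φ x) (j : Fin 2) :
    pd j (fun x => starRingEnd ℂ (φ x)) x = starRingEnd ℂ (pd j φ x) :=
  pd_comp_clm j (Complex.conjCLE : ℂ →L[ℝ] ℂ) hφ

/-- Integration by parts for the product of two functions in `H¹`. -/
theorem ip_pd_eq {f f' : Plane → ℂ} {g g' : Fin 2 → Plane → ℂ} (h : H1Pair f g)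
    (h' : H1Pair f' g') {φ : Plane → ℝ} (hφ : ContDiff ℝ ∞ φ) (hb : IsBdd φ) (j : Fin 2)
    (hb' : IsBdd (pd j φ)) :
    ip (pd j φ) f f' = -(ip φ (g j) f' + ip φ f (g' j)) := by
  -- Only the first factor is approximated. The product of φ with the conjugate of ψ n is then
  -- compactly supported, hence admissible in the weak identity for `f'`, even though φ is merely
  -- bounded with a bounded derivative; φ may thus be a plane wave or a convolution.
  obtain ⟨ψ, hψ, hψ0, hψ1⟩ := h.exists_approx
  have key : ∀ n, ip (pd j φ) (ψ n) f' = -(ip φ (pd j (ψ n)) f' + ip φ (ψ n) (g' j)) := by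
    intro n
    have ht : IsTest (fun x => φ x • starRingEnd ℂ (ψ n x)) := IsTest.smul' hφ (hψ n).conj
    have hd := differentiable_of_contDiff (hψ n).contDiff
    have e := h'.weak_complex ht j
    have e1 : (fun x => pd j (fun x => φ x • starRingEnd ℂ (ψ n x)) x * f' x) = fun x =>
        φ x • (starRingEnd ℂ (pd j (ψ n) x) * f' x)
          + pd j φ x • (starRingEnd ℂ (ψ n x) * f' x) := by
      funext x
      rw [pd_smul j (differentiable_of_contDiff hφ x)
        (differentiable_of_contDiff (hψ n).conj.contDiff x), pd_conj (hd x)]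
      simp only [Complex.real_smul]
      ring
    rw [e1, integral_add (integrable_ip hb (((hψ n).pd j).memLp 2) h'.memLp)
      (integrable_ip hb' ((hψ n).memLp 2) h'.memLp)] at e
    have e2 : ∫ x, φ x • starRingEnd ℂ (ψ n x) * g' j x = ip φ (ψ n) (g' j) :=
      integral_congr_ae (ae_of_all _ fun x => by simp only [Complex.real_smul]; ring)
    rw [e2] at e
    change ip φ (pd j (ψ n)) f' + ip (pd j φ) (ψ n) f' = _ at e
    linear_combination e
  have hz : ∀ F : Plane → ℂ, Tendsto (fun _ : ℕ => eLpNorm (fun x => F x - F x) 2 volume) atTop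
      (𝓝 0) := fun F => by simp
  have t1 := tendsto_ip hb' h.memLp h'.memLp (fun n => (hψ n).memLp 2) (fun _ => h'.memLp) hψ0
    (hz _)
  have t2 := tendsto_ip hb (h.memLp_grad j) h'.memLp (fun n => ((hψ n).pd j).memLp 2)
    (fun _ => h'.memLp) (hψ1 j) (hz _)
  have t3 := tendsto_ip hb h.memLp (h'.memLp_grad j) (fun n => (hψ n).memLp 2)
    (fun _ => h'.memLp_grad j) hψ0 (hz _)
  refine tendsto_nhds_unique t1 (((t2.add t3).neg).congr fun n => (key n).symm)

/-- The divergence of `g` is `ℓ` on `Ω`, in the sense of distributions. -/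
def WeakDiv (Ω : Set Plane) (g : Fin 2 → Plane → ℂ) (ℓ : Plane → ℂ) : Prop :=
  ∀ ψ : Plane → ℝ, IsTest ψ → tsupport ψ ⊆ Ω → ∫ x, ψ x • ℓ x = - ∑ j, ∫ x, pd j ψ x • g j x

theorem WeakDiv.complex {Ω : Set Plane} {g : Fin 2 → Plane → ℂ} {ℓ : Plane → ℂ}
    (h : WeakDiv Ω g ℓ) (hℓ : MemLp ℓ 2) (hg : ∀ j, MemLp (g j) 2) {ψ : Plane → ℂ}
    (hψ : IsTest ψ) (hs : tsupport ψ ⊆ Ω) :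
    ∫ x, ψ x * ℓ x = - ∑ j, ∫ x, pd j ψ x * g j x := by
  have hre : tsupport (fun x => (ψ x).re) ⊆ tsupport ψ := by
    refine closure_mono fun x hx => ?_
    simp only [Function.mem_support] at hx ⊢
    exact fun h0 => hx (by simp [h0])
  have him : tsupport (fun x => (ψ x).im) ⊆ tsupport ψ := by
    refine closure_mono fun x hx => ?_
    simp only [Function.mem_support] at hx ⊢
    exact fun h0 => hx (by simp [h0])
  have hd := differentiable_of_contDiff hψ.contDiff
  have h1 := h _ hψ.re (hre.trans hs)
  have h2 := h _ hψ.im (him.trans hs)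
  simp only [pd_re (hd _), pd_im (hd _)] at h1 h2
  rw [integral_re_im_mul hψ (hℓ.locallyIntegrable (by norm_num)), h1, h2]
  simp only [fun j => integral_re_im_mul (hψ.pd j) ((hg j).locallyIntegrable (by norm_num)),
    Fin.sum_univ_two]
  ring

/-- Testing the weak Laplacian of `f` against `ψ f`. -/
theorem WeakDiv.ip_eq {Ω : Set Plane} {f : Plane → ℂ} {g : Fin 2 → Plane → ℂ} {ℓ : Plane → ℂ}
    (h : H1Pair f g) (hdiv : WeakDiv Ω g ℓ) (hℓ : MemLp ℓ 2) {ψ : Plane → ℝ} (hψ : IsTest ψ)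
    (hs : tsupport ψ ⊆ Ω) :
    ip ψ f ℓ = - ∑ j, (ip (pd j ψ) f (g j) + ip ψ (g j) (g j)) := by
  -- The product of ψ with the conjugate of `f` is not smooth, so the divergence identity is tested
  -- with test functions approaching `f` in H¹.
  obtain ⟨η, hη, hη0, hη1⟩ := h.exists_approx
  have hb := hψ.isBdd
  have hb' : ∀ j, IsBdd (pd j ψ) := fun j => (hψ.pd j).isBdd
  have key : ∀ n, ip ψ (η n) ℓ = - ∑ j, (ip (pd j ψ) (η n) (g j) + ip ψ (pd j (η n)) (g j)) := by
    intro n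
    have ht : IsTest (fun x => ψ x • starRingEnd ℂ (η n x)) := IsTest.smul' hψ.contDiff (hη n).conj
    have hd := differentiable_of_contDiff (hη n).contDiff
    have e := hdiv.complex hℓ h.memLp_grad ht ((tsupport_smul_subset_left _ _).trans hs)
    have e1 : ∀ j, ∫ x, pd j (fun x => ψ x • starRingEnd ℂ (η n x)) x * g j x =
        ip (pd j ψ) (η n) (g j) + ip ψ (pd j (η n)) (g j) := by
      intro j
      rw [ip, ip, ← integral_add (integrable_ip (hb' j) ((hη n).memLp 2) (h.memLp_grad j))
        (integrable_ip hb (((hη n).pd j).memLp 2) (h.memLp_grad j))]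
      refine integral_congr_ae (ae_of_all _ fun x => ?_)
      simp only
      rw [pd_smul j (differentiable_of_contDiff hψ.contDiff x)
        (differentiable_of_contDiff (hη n).conj.contDiff x), pd_conj (hd x)]
      simp only [Complex.real_smul]
      ring
    simp only [e1] at e
    rw [← e, ip]
    refine integral_congr_ae (ae_of_all _ fun x => ?_)
    simp only [Complex.real_smul]
    ring
  have hz : ∀ F : Plane → ℂ, Tendsto (fun _ : ℕ => eLpNorm (fun x => F x - F x) 2 volume) atTop
      (𝓝 0) := fun F => by simp
  have t1 := tendsto_ip hb h.memLp hℓ (fun n => (hη n).memLp 2) (fun _ => hℓ) hη0 (hz _)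
  have t2 : ∀ j, _ := fun j => tendsto_ip (hb' j) h.memLp (h.memLp_grad j)
    (fun n => (hη n).memLp 2) (fun _ => h.memLp_grad j) hη0 (hz _)
  have t3 : ∀ j, _ := fun j => tendsto_ip hb (h.memLp_grad j) (h.memLp_grad j)
    (fun n => ((hη n).pd j).memLp 2) (fun _ => h.memLp_grad j) (hη1 j) (hz _)
  refine tendsto_nhds_unique t1 (Tendsto.congr (fun n => (key n).symm) ?_)
  exact (tendsto_finsetSum _ fun j _ => (t2 j).add (t3 j)).neg

end WeakIdentities

/-! ### Rellich's identity. -/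

section Rellich

/-- `f` is integrable with integral `v`. -/
def HasInt (f : Plane → ℝ) (v : ℝ) : Prop := Integrable f ∧ ∫ x, f x = v

theorem HasInt.add {f g : Plane → ℝ} {v w : ℝ} (hf : HasInt f v) (hg : HasInt g w) :
    HasInt (fun x => f x + g x) (v + w) :=
  ⟨hf.1.add hg.1, by rw [integral_add hf.1 hg.1, hf.2, hg.2]⟩

theorem HasInt.const_mul {f : Plane → ℝ} {v : ℝ} (hf : HasInt f v) (c : ℝ) :
    HasInt (fun x => c * f x) (c * v) :=
  ⟨hf.1.const_mul c, by rw [integral_const_mul, hf.2]⟩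

theorem HasInt.sum {f : Fin 2 → Plane → ℝ} {v : Fin 2 → ℝ} (hf : ∀ j, HasInt (f j) (v j)) :
    HasInt (fun x => ∑ j, f j x) (∑ j, v j) := by
  simpa only [Fin.sum_univ_two] using (hf 0).add (hf 1)

theorem HasInt.unique {f : Plane → ℝ} {v w : ℝ} (hf : HasInt f v) (hg : HasInt f w) : v = w :=
  hf.2.symm.trans hg.2

theorem HasInt.congr {f g : Plane → ℝ} {v : ℝ} (hf : HasInt f v) (h : ∀ x, f x = g x) :
    HasInt g v := by
  rwa [← show f = g from funext h]

/-- The divergence of a vector field. -/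
noncomputable def dv (X : Fin 2 → Plane → ℝ) (x : Plane) : ℝ := ∑ j, pd j (X j) x

theorem isTest_dv {X : Fin 2 → Plane → ℝ} (hX : ∀ j, IsTest (X j)) : IsTest (dv X) :=
  IsTest.sum fun j => (hX j).pd j

/-- The integrand is pointwise the divergence of the compactly supported flux 2(X·∇w)∂ₖw + (div
X)w∂ₖw - Xₖ|∇w|². -/
theorem rellich_smooth_real {X : Fin 2 → Plane → ℝ} (hX : ∀ j, IsTest (X j)) {w : Plane → ℝ}
    (hw : ContDiff ℝ ∞ w) :
    HasInt (fun x => (∑ j, 2 * X j x * pd j w x + dv X x * w x) * (∑ k, pd k (pd k w) x)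
      + (∑ j, ∑ k, 2 * pd k (X j) x * (pd j w x * pd k w x)
        + ∑ k, pd k (dv X) x * (w x * pd k w x))) 0 := by
  have hD := isTest_dv hX
  have hw1 : ∀ j, ContDiff ℝ ∞ (pd j w) := contDiff_pd hw
  let Z : Fin 2 → Plane → ℝ := fun k x => 2 * (X 0 x * (pd 0 w x * pd k w x))
    + 2 * (X 1 x * (pd 1 w x * pd k w x)) + dv X x * (w x * pd k w x)
    + (-1) * (X k x * (pd 0 w x * pd 0 w x + pd 1 w x * pd 1 w x))
  have hZ : ∀ k, IsTest (Z k) := by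
    intro k
    have m : ∀ {a b : Plane → ℝ}, ContDiff ℝ ∞ a → ContDiff ℝ ∞ b →
        ContDiff ℝ ∞ (fun x => a x * b x) := fun ha hb => ha.mul hb
    have c : ∀ (r : ℝ) {a : Plane → ℝ}, IsTest a → IsTest (fun x => r * a x) := fun r a ha =>
      IsTest.mul' contDiff_const ha
    exact (((c 2 ((hX 0).mul (m (hw1 0) (hw1 k)))).add (c 2 ((hX 1).mul (m (hw1 1) (hw1 k))))).add
      (hD.mul (m hw (hw1 k)))).add
      (c (-1) ((hX k).mul ((m (hw1 0) (hw1 0)).add (m (hw1 1) (hw1 1)))))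
  have hzero : ∫ x, (pd 0 (Z 0) x + pd 1 (Z 1) x) = 0 := by
    rw [integral_add ((hZ 0).pd 0).integrable ((hZ 1).pd 1).integrable,
      integral_pd_eq_zero ((hZ 0).contDiff.of_le (by simp)) (hZ 0).compact,
      integral_pd_eq_zero ((hZ 1).contDiff.of_le (by simp)) (hZ 1).compact, add_zero]
  suffices h : (fun x => (∑ j, 2 * X j x * pd j w x + dv X x * w x) * (∑ k, pd k (pd k w) x)
      + (∑ j, ∑ k, 2 * pd k (X j) x * (pd j w x * pd k w x)
        + ∑ k, pd k (dv X) x * (w x * pd k w x))) = fun x => pd 0 (Z 0) x + pd 1 (Z 1) x by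
    rw [h]
    exact ⟨((hZ 0).pd 0).integrable.add ((hZ 1).pd 1).integrable, hzero⟩
  funext x
  have dX : ∀ j, DifferentiableAt ℝ (X j) x := fun j => differentiable_of_contDiff (hX j).contDiff x
  have dD : DifferentiableAt ℝ (dv X) x := differentiable_of_contDiff hD.contDiff x
  have dw : DifferentiableAt ℝ w x := differentiable_of_contDiff hw x
  have dw1 : ∀ j, DifferentiableAt ℝ (pd j w) x := fun j => differentiable_of_contDiff (hw1 j) x
  have hc : pd 1 (pd 0 w) x = pd 0 (pd 1 w) x := pd_comm hw 1 0 x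
  have hpd : ∀ k, pd k (Z k) x =
      2 * (X 0 x * (pd 0 w x * pd k (pd k w) x + pd k (pd 0 w) x * pd k w x)
        + pd k (X 0) x * (pd 0 w x * pd k w x))
      + 2 * (X 1 x * (pd 1 w x * pd k (pd k w) x + pd k (pd 1 w) x * pd k w x)
        + pd k (X 1) x * (pd 1 w x * pd k w x))
      + (dv X x * (w x * pd k (pd k w) x + pd k w x * pd k w x)
        + pd k (dv X) x * (w x * pd k w x))
      + (-1) * (X k x * ((pd 0 w x * pd k (pd 0 w) x + pd k (pd 0 w) x * pd 0 w x)
          + (pd 1 w x * pd k (pd 1 w) x + pd k (pd 1 w) x * pd 1 w x))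
        + pd k (X k) x * (pd 0 w x * pd 0 w x + pd 1 w x * pd 1 w x)) := by
    intro k
    have d1 : ∀ i j, DifferentiableAt ℝ (fun x => pd i w x * pd j w x) x :=
      fun i j => (dw1 i).mul (dw1 j)
    have d2 : ∀ i j, DifferentiableAt ℝ (fun x => X i x * (pd i w x * pd j w x)) x :=
      fun i j => (dX i).mul (d1 i j)
    have d3 : DifferentiableAt ℝ (fun x => w x * pd k w x) x := dw.mul (dw1 k)
    have d4 : DifferentiableAt ℝ (fun x => pd 0 w x * pd 0 w x + pd 1 w x * pd 1 w x) x :=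
      (d1 0 0).add (d1 1 1)
    have d5 : DifferentiableAt ℝ (fun x => X k x * (pd 0 w x * pd 0 w x + pd 1 w x * pd 1 w x)) x :=
      (dX k).mul d4
    have d6 : DifferentiableAt ℝ (fun x => dv X x * (w x * pd k w x)) x := dD.mul d3
    have d7 : ∀ i, DifferentiableAt ℝ (fun x => 2 * (X i x * (pd i w x * pd k w x))) x :=
      fun i => (d2 i k).const_mul 2
    simp only [Z]
    rw [pd_add k (((d7 0).fun_add (d7 1)).fun_add d6) (d5.const_mul (-1)),
      pd_add k ((d7 0).fun_add (d7 1)) d6, pd_add k (d7 0) (d7 1), pd_const_mul k _ (d2 0 k),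
      pd_const_mul k _ (d2 1 k), pd_const_mul k _ d5, pd_mul k (dX 0) (d1 0 k),
      pd_mul k (dX 1) (d1 1 k), pd_mul k dD d3, pd_mul k (dX k) d4, pd_mul k dw (dw1 k),
      pd_add k (d1 0 0) (d1 1 1), pd_mul k (dw1 0) (dw1 k), pd_mul k (dw1 1) (dw1 k),
      pd_mul k (dw1 0) (dw1 0), pd_mul k (dw1 1) (dw1 1)]
  have hdv : dv X x = pd 0 (X 0) x + pd 1 (X 1) x := by simp [dv, Fin.sum_univ_two]
  simp only [hpd, Fin.sum_univ_two, hc]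
  -- The terms (div X)|∇w|² coming from the second and third parts of the flux cancel; symmetry of
  -- second derivatives disposes of the rest.
  linear_combination (- pd 0 w x * pd 0 w x - pd 1 w x * pd 1 w x) * hdv

/-- The real part of conj G · H splits into products of real parts and of imaginary parts, so the
real identity is applied to Re F and Im F and summed. -/
theorem rellich_smooth {X : Fin 2 → Plane → ℝ} (hX : ∀ j, IsTest (X j)) {F : Plane → ℂ}
    (hF : ContDiff ℝ ∞ F) :
    (∑ j, 2 * ip (X j) (pd j F) (fun x => ∑ k, pd k (pd k F) x)
      + ip (dv X) F (fun x => ∑ k, pd k (pd k F) x)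
      + (∑ j, ∑ k, 2 * ip (pd k (X j)) (pd j F) (pd k F) + ∑ k, ip (pd k (dv X)) F (pd k F))).re
      = 0 := by
  have hD := isTest_dv hX
  have hF1 : ∀ j, ContDiff ℝ ∞ (pd j F) := contDiff_pd hF
  have hF2 : ContDiff ℝ ∞ (fun x => ∑ k, pd k (pd k F) x) := by
    simp only [Fin.sum_univ_two]
    exact (contDiff_pd (hF1 0) 0).add (contDiff_pd (hF1 1) 1)
  have hi : ∀ {b : Plane → ℝ} {G H : Plane → ℂ}, IsTest b → ContDiff ℝ ∞ G → ContDiff ℝ ∞ H →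
      Integrable (fun x => b x • (starRingEnd ℂ (G x) * H x)) := by
    intro b G H hb hG hH
    have : ContDiff ℝ ∞ (fun x => starRingEnd ℂ (G x) * H x) :=
      ((Complex.conjCLE : ℂ →L[ℝ] ℂ).contDiff.comp hG).mul hH
    exact (hb.smul this).integrable
  have hre : ∀ {b : Plane → ℝ} {G H : Plane → ℂ}, IsTest b → ContDiff ℝ ∞ G → ContDiff ℝ ∞ H →
      HasInt (fun x => b x * ((G x).re * (H x).re + (G x).im * (H x).im)) (ip b G H).re := by
    intro b G H hb hG hH
    have e : (fun x => (b x • (starRingEnd ℂ (G x) * H x)).re) =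
        fun x => b x * ((G x).re * (H x).re + (G x).im * (H x).im) := by
      funext x
      simp [Complex.mul_re, Complex.mul_im]
    have h1 := hi hb hG hH
    refine ⟨e ▸ h1.re, ?_⟩
    rw [ip, ← e]
    exact integral_re h1
  have hFr : ContDiff ℝ ∞ (fun x => (F x).re) := Complex.reCLM.contDiff.comp hF
  have hFi : ContDiff ℝ ∞ (fun x => (F x).im) := Complex.imCLM.contDiff.comp hF
  have dF := differentiable_of_contDiff hF
  have dF1 := fun j => differentiable_of_contDiff (hF1 j)
  have p1 : ∀ j, pd j (fun x => (F x).re) = fun x => (pd j F x).re := fun j =>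
    funext fun x => pd_re (dF x) j
  have p2 : ∀ j, pd j (fun x => (F x).im) = fun x => (pd j F x).im := fun j =>
    funext fun x => pd_im (dF x) j
  have p3 : ∀ k j, pd k (fun x => (pd j F x).re) = fun x => (pd k (pd j F) x).re := fun k j =>
    funext fun x => pd_re (dF1 j x) k
  have p4 : ∀ k j, pd k (fun x => (pd j F x).im) = fun x => (pd k (pd j F) x).im := fun k j =>
    funext fun x => pd_im (dF1 j x) k
  have r1 := rellich_smooth_real hX hFr
  have r2 := rellich_smooth_real hX hFi
  simp only [p1, p2, p3, p4] at r1 r2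
  have q1 := fun j => hre (hX j) (hF1 j) hF2
  have q2 := hre hD hF hF2
  have q3 := fun j k => hre ((hX j).pd k) (hF1 j) (hF1 k)
  have q4 := fun k => hre (hD.pd k) hF (hF1 k)
  have t1 := ((HasInt.sum fun j => (q1 j).const_mul 2).add q2).add
    ((HasInt.sum fun j => HasInt.sum fun k => (q3 j k).const_mul 2).add (HasInt.sum q4))
  have t2 := r1.add r2
  refine Eq.trans ?_ (t1.unique ((t2.congr fun x => ?_ : HasInt _ (0 + 0)))) |>.trans (add_zero 0)
  · simp [Fin.sum_univ_two]
  · simp only [Fin.sum_univ_two, Complex.add_re, Complex.add_im]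
    ring

/-- Rellich's identity for a function in `H¹` whose Laplacian is square integrable. -/
theorem rellich {Ω : Set Plane} (hΩ : IsOpen Ω) {f : Plane → ℂ} {g : Fin 2 → Plane → ℂ}
    {ℓ : Plane → ℂ} (h : H1Pair f g) (hdiv : WeakDiv Ω g ℓ) (hℓ : MemLp ℓ 2)
    {X : Fin 2 → Plane → ℝ} (hX : ∀ j, IsTest (X j)) (hs : ∀ j, tsupport (X j) ⊆ Ω) :
    (∑ j, 2 * ip (X j) (g j) ℓ + ip (dv X) f ℓ
      + (∑ j, ∑ k, 2 * ip (pd k (X j)) (g j) (g k) + ∑ k, ip (pd k (dv X)) f (g k))).re = 0 := by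
  have hD := isTest_dv hX
  let K : Set Plane := ⋃ j, tsupport (X j)
  have hK : IsCompact K := isCompact_iUnion fun j => (hX j).compact
  obtain ⟨δ, hδ, hKδ⟩ := hK.exists_cthickening_subset_open hΩ (Set.iUnion_subset hs)
  have hmem : ∀ {F : Plane → ℂ}, MemLp F 2 → LocallyIntegrable F := fun hF =>
    hF.locallyIntegrable (by norm_num)
  -- Once the mollification radius is smaller than the distance from K to the complement of Ω, the
  -- mollifier centred at a point of K is admissible in the weak divergence identity.
  have hlap : ∀ᶠ n : ℕ in atTop, ∀ x ∈ K, ∑ k, pd k (pd k (moll n f)) x = moll n ℓ x := by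
    obtain ⟨N, hN⟩ := exists_nat_one_div_lt hδ
    filter_upwards [eventually_ge_atTop N] with n hn x hx
    have hball : Metric.closedBall x (1 / ((n : ℝ) + 1)) ⊆ Ω := by
      refine Set.Subset.trans ?_ hKδ
      refine (Metric.closedBall_subset_closedBall ?_).trans
        (Metric.closedBall_subset_cthickening hx δ)
      refine le_trans ?_ hN.le
      apply one_div_le_one_div_of_le <;> first | positivity | (gcongr)
    have e := hdiv _ (isTest_mollifier_sub n x) ((tsupport_mollifier_sub n x).trans hball)
    rw [moll_apply, e, ← Finset.sum_neg_distrib]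
    refine Finset.sum_congr rfl fun k _ => ?_
    rw [h.pd_moll, pd_moll n (hmem (h.memLp_grad k))]
  have hzero : ∀ {b : Plane → ℝ}, tsupport b ⊆ K → ∀ {n : ℕ},
      (∀ x ∈ K, ∑ k, pd k (pd k (moll n f)) x = moll n ℓ x) → ∀ G : Plane → ℂ,
      ip b G (fun x => ∑ k, pd k (pd k (moll n f)) x) = ip b G (moll n ℓ) := by
    intro b hb n hn G
    refine integral_congr_ae (ae_of_all _ fun x => ?_)
    by_cases hx : x ∈ K
    · simp only [hn x hx]
    · simp [image_eq_zero_of_notMem_tsupport (fun hx' => hx (hb hx'))]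
  have hXK : ∀ j, tsupport (X j) ⊆ K := Set.subset_iUnion fun j => tsupport (X j)
  have hDK : tsupport (dv X) ⊆ K := by
    refine closure_minimal (fun x hx => ?_) hK.isClosed
    by_contra hxK
    refine hx (Finset.sum_eq_zero fun j _ => ?_)
    exact image_eq_zero_of_notMem_tsupport fun h' => hxK (hXK j (tsupport_pd_subset j _ h'))
  have conv : ∀ {b : Plane → ℝ} {F G : Plane → ℂ}, IsTest b → MemLp F 2 → MemLp G 2 →
      Tendsto (fun n => ip b (moll n F) (moll n G)) atTop (𝓝 (ip b F G)) := fun hb hF hG =>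
    tendsto_ip hb.isBdd hF hG (fun n => memLp_moll n hF) (fun n => memLp_moll n hG)
      (tendsto_eLpNorm_moll_sub hF) (tendsto_eLpNorm_moll_sub hG)
  have lim : Tendsto (fun n => (∑ j, 2 * ip (X j) (moll n (g j)) (moll n ℓ)
      + ip (dv X) (moll n f) (moll n ℓ)
      + (∑ j, ∑ k, 2 * ip (pd k (X j)) (moll n (g j)) (moll n (g k))
        + ∑ k, ip (pd k (dv X)) (moll n f) (moll n (g k)))).re) atTop
      (𝓝 (∑ j, 2 * ip (X j) (g j) ℓ + ip (dv X) f ℓ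
      + (∑ j, ∑ k, 2 * ip (pd k (X j)) (g j) (g k) + ∑ k, ip (pd k (dv X)) f (g k))).re) := by
    refine (Complex.continuous_re.tendsto _).comp ?_
    refine ((tendsto_finsetSum _ fun j _ => (conv (hX j) (h.memLp_grad j) hℓ).const_mul 2).add
      (conv hD h.memLp hℓ)).add ((tendsto_finsetSum _ fun j _ => tendsto_finsetSum _ fun k _ =>
        (conv ((hX j).pd k) (h.memLp_grad j) (h.memLp_grad k)).const_mul 2).add
        (tendsto_finsetSum _ fun k _ => conv (hD.pd k) h.memLp (h.memLp_grad k)))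
  refine tendsto_nhds_unique lim (tendsto_const_nhds.congr' ?_)
  filter_upwards [hlap] with n hn
  have r := rellich_smooth hX (contDiff_moll n h.locallyIntegrable)
  simp only [fun j => hzero (hXK j) hn, hzero hDK hn] at r
  simp only [h.pd_moll] at r
  exact r.symm

end Rellich

/-! ### Bounds for the powers of an H¹ function. -/

section GagliardoNirenberg

/-- The sum of the `L²` norms of the components of a vector field. -/
noncomputable def gradNorm (g : Fin 2 → Plane → ℂ) : ℝ≥0∞ := ∑ j, eLpNorm (g j) 2 volume

theorem norm_fderiv_le {φ : Plane → ℂ} (x : Plane) :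
    ‖fderiv ℝ φ x‖ ≤ ‖pd 0 φ x‖ + ‖pd 1 φ x‖ := by
  refine ContinuousLinearMap.opNorm_le_bound _ (by positivity) fun v => ?_
  have hv : v = v 0 • EuclideanSpace.single 0 (1 : ℝ) + v 1 • EuclideanSpace.single 1 (1 : ℝ) := by
    ext i
    fin_cases i <;> simp
  have h : fderiv ℝ φ x v = v 0 • pd 0 φ x + v 1 • pd 1 φ x := by
    conv_lhs => rw [hv]
    simp [pd]
  rw [h]
  refine (norm_add_le _ _).trans ?_
  rw [norm_smul, norm_smul]
  have h0 := EuclideanSpace.norm_eq v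
  have h1 : ∀ i, ‖v i‖ ≤ ‖v‖ := fun i => PiLp.norm_apply_le v i
  nlinarith [h1 0, h1 1, norm_nonneg (pd 0 φ x), norm_nonneg (pd 1 φ x)]

/-- The constant of the Sobolev inequality `‖v‖_{L²} ≤ C ‖∇v‖_{L¹}` in the plane. -/
noncomputable def sobolevConst : ℝ≥0∞ :=
  (eLpNormLESNormFDerivOneConst (volume : Measure Plane) 2 : ℝ≥0∞)

theorem sobolevConst_ne_top : sobolevConst ≠ ⊤ := ENNReal.coe_ne_top

theorem IsTest.pow {φ : Plane → ℂ} (hφ : IsTest φ) (m : ℕ) : IsTest (fun x => φ x ^ (m + 1)) :=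
  ⟨hφ.contDiff.pow _, hφ.compact.comp_left (g := fun z : ℂ => z ^ (m + 1)) (by simp)⟩

theorem lintegral_mul_le_eLpNorm {f g : Plane → ℂ} (hf : AEStronglyMeasurable f volume)
    (hg : AEStronglyMeasurable g volume) :
    ∫⁻ x, ‖f x‖ₑ * ‖g x‖ₑ ≤ eLpNorm f 2 volume * eLpNorm g 2 volume := by
  have h := ENNReal.lintegral_mul_le_Lp_mul_Lq (volume : Measure Plane)
    Real.HolderConjugate.two_two hf.enorm hg.enorm
  rw [eLpNorm_eq_lintegral_rpow_enorm_toReal (by norm_num) (by norm_num),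
    eLpNorm_eq_lintegral_rpow_enorm_toReal (by norm_num) (by norm_num)]
  simpa using! h

/-- Induction on m: the inequality ‖v‖_{L²} ≤ C‖∇v‖_{L¹} is applied to v = φ^(m+2), whose gradient
is (m+2)φ^(m+1)∇φ, and Cauchy–Schwarz returns to the previous power. The factors m+2 accumulate to
the factorial. -/
theorem eLpNorm_pow_le_of_isTest {φ : Plane → ℂ} (hφ : IsTest φ) (m : ℕ) :
    eLpNorm (fun x => φ x ^ (m + 1)) 2 volume
      ≤ (sobolevConst ^ m * ((m + 1).factorial : ℝ≥0∞)) * eLpNorm φ 2 volume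
        * gradNorm (fun j => pd j φ) ^ m := by
  induction m with
  | zero => simp
  | succ m ih =>
    have hd := differentiable_of_contDiff hφ.contDiff
    have hn : NNReal.HolderConjugate (Module.finrank ℝ Plane) 2 := by
      rw [finrank_euclideanSpace, Fintype.card_fin]
      exact_mod_cast NNReal.HolderConjugate.two_two
    have h1 := eLpNorm_le_eLpNorm_fderiv_one (volume : Measure Plane)
      ((hφ.pow (m + 1)).contDiff.of_le (by simp)) (hφ.pow (m + 1)).compact hn
    have hmeas : ∀ k, AEStronglyMeasurable (fun x => φ x ^ k) volume := fun k =>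
      (hφ.continuous.pow k).aestronglyMeasurable
    have h2 : eLpNorm (fderiv ℝ fun x => φ x ^ (m + 1 + 1)) 1 volume
        ≤ (m + 2 : ℕ) * (eLpNorm (fun x => φ x ^ (m + 1)) 2 volume
          * gradNorm (fun j => pd j φ)) := by
      rw [eLpNorm_one_eq_lintegral_enorm]
      have hp : ∀ x, ‖fderiv ℝ (fun x => φ x ^ (m + 1 + 1)) x‖ₑ ≤ (m + 2 : ℕ) *
          (‖φ x ^ (m + 1)‖ₑ * ‖pd 0 φ x‖ₑ + ‖φ x ^ (m + 1)‖ₑ * ‖pd 1 φ x‖ₑ) := by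
        intro x
        have e : fderiv ℝ (fun x => φ x ^ (m + 1 + 1)) x
            = (((m + 1 + 1 : ℕ) : ℂ) * φ x ^ (m + 1)) • fderiv ℝ φ x := by
          have := ((hd x).hasFDerivAt.pow (m + 1 + 1)).fderiv
          simpa [mul_comm] using! this
        rw [e, enorm_smul, enorm_mul, ← mul_add, ← mul_assoc]
        gcongr
        · rw [← ofReal_norm, Complex.norm_natCast, ENNReal.ofReal_natCast]
        · have := norm_fderiv_le (φ := φ) x
          rw [← ofReal_norm, ← ofReal_norm, ← ofReal_norm,
            ← ENNReal.ofReal_add (norm_nonneg _) (norm_nonneg _)]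
          exact ENNReal.ofReal_le_ofReal this
      refine (lintegral_mono hp).trans ?_
      rw [lintegral_const_mul' _ _ (by simp)]
      gcongr
      have mm : ∀ j, AEStronglyMeasurable (pd j φ) volume := fun j =>
        (hφ.pd j).continuous.aestronglyMeasurable
      have me : AEMeasurable (fun x => ‖φ x ^ (m + 1)‖ₑ * ‖pd 0 φ x‖ₑ) volume :=
        (hmeas _).enorm.mul (mm 0).enorm
      rw [lintegral_add_left' me, gradNorm, Fin.sum_univ_two, mul_add]
      exact add_le_add (lintegral_mul_le_eLpNorm (hmeas _) (mm 0))
        (lintegral_mul_le_eLpNorm (hmeas _) (mm 1))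
    calc eLpNorm (fun x => φ x ^ (m + 1 + 1)) 2 volume
        ≤ sobolevConst * ((m + 2 : ℕ) * (eLpNorm (fun x => φ x ^ (m + 1)) 2 volume
          * gradNorm (fun j => pd j φ))) := by
          refine le_trans (by simpa using! h1) ?_
          exact mul_le_mul' le_rfl h2
      _ ≤ sobolevConst * ((m + 2 : ℕ) * (((sobolevConst ^ m * ((m + 1).factorial : ℝ≥0∞))
          * eLpNorm φ 2 volume * gradNorm (fun j => pd j φ) ^ m) * gradNorm (fun j => pd j φ))) := by
          gcongr
      _ = _ := by
          rw [Nat.factorial_succ (m + 1)]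
          push_cast
          ring

/-- Density of test functions, with Fatou's lemma along a subsequence that converges almost
everywhere. -/
theorem H1Pair.eLpNorm_pow_le {f : Plane → ℂ} {g : Fin 2 → Plane → ℂ} (h : H1Pair f g) (m : ℕ) :
    eLpNorm (fun x => f x ^ (m + 1)) 2 volume
      ≤ (sobolevConst ^ m * ((m + 1).factorial : ℝ≥0∞)) * eLpNorm f 2 volume * gradNorm g ^ m := by
  obtain ⟨φ, hφ, hφ0, hφ1⟩ := h.exists_approx
  have hmeas : TendstoInMeasure volume φ atTop f :=
    tendstoInMeasure_of_tendsto_eLpNorm (p := 2) (by norm_num)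
      (fun n => ((hφ n).memLp 2).aestronglyMeasurable) h.memLp.aestronglyMeasurable hφ0
  obtain ⟨ns, hns, hae⟩ := hmeas.exists_seq_tendsto_ae
  have hnorm : ∀ {F : ℕ → Plane → ℂ} {G : Plane → ℂ}, (∀ n, MemLp (F n) 2) → MemLp G 2 →
      Tendsto (fun n => eLpNorm (fun x => F n x - G x) 2 volume) atTop (𝓝 0) →
      Tendsto (fun n => eLpNorm (F n) 2 volume) atTop (𝓝 (eLpNorm G 2 volume)) := by
    intro F G hF hG ht
    have t1 : Tendsto (fun n => (hF n).toLp (F n)) atTop (𝓝 (hG.toLp G)) :=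
      (Lp.tendsto_Lp_iff_tendsto_eLpNorm'' _ hF G hG).2 ht
    have t2 := t1.enorm
    simpa only [Lp.enorm_toLp] using t2
  have hlim : Tendsto (fun n => (sobolevConst ^ m * ((m + 1).factorial : ℝ≥0∞))
      * eLpNorm (φ n) 2 volume * gradNorm (fun j => pd j (φ n)) ^ m) atTop
      (𝓝 ((sobolevConst ^ m * ((m + 1).factorial : ℝ≥0∞)) * eLpNorm f 2 volume
        * gradNorm g ^ m)) := by
    have hgr : gradNorm g ≠ ⊤ := by
      simp only [gradNorm, ne_eq, ENNReal.sum_eq_top, not_exists, not_and]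
      exact fun j _ => (h.memLp_grad j).2.ne
    have a1 := hnorm (fun n => (hφ n).memLp 2) h.memLp hφ0
    have a2 : Tendsto (fun n => gradNorm (fun j => pd j (φ n))) atTop (𝓝 (gradNorm g)) :=
      tendsto_finsetSum _ fun j _ =>
        hnorm (fun n => ((hφ n).pd j).memLp 2) (h.memLp_grad j) (hφ1 j)
    have hK : sobolevConst ^ m * ((m + 1).factorial : ℝ≥0∞) ≠ ⊤ :=
      ENNReal.mul_ne_top (ENNReal.pow_ne_top sobolevConst_ne_top) (ENNReal.natCast_ne_top _)
    have a3 := ENNReal.Tendsto.const_mul a1 (Or.inr hK)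
    exact ENNReal.Tendsto.mul a3 (Or.inr (ENNReal.pow_ne_top hgr))
      (((ENNReal.continuous_pow m).tendsto _).comp a2)
      (Or.inr (ENNReal.mul_ne_top hK h.memLp.2.ne))
  have hF := Lp.eLpNorm_lim_le_liminf_eLpNorm (p := 2) (μ := (volume : Measure Plane))
    (f := fun n x => φ (ns n) x ^ (m + 1))
    (fun n => ((hφ (ns n)).continuous.pow _).aestronglyMeasurable) (fun x => f x ^ (m + 1))
    (hae.mono fun x hx => hx.pow _)
  refine hF.trans ?_
  rw [← (hlim.comp hns.tendsto_atTop).liminf_eq]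
  exact liminf_le_liminf (Eventually.of_forall fun n => eLpNorm_pow_le_of_isTest (hφ (ns n)) m)

theorem gradNorm_ne_top {f : Plane → ℂ} {g : Fin 2 → Plane → ℂ} (h : H1Pair f g) :
    gradNorm g ≠ ⊤ := by
  simp only [gradNorm, ne_eq, ENNReal.sum_eq_top, not_exists, not_and]
  exact fun j _ => (h.memLp_grad j).2.ne

theorem H1Pair.eLpNorm_pow_ne_top {f : Plane → ℂ} {g : Fin 2 → Plane → ℂ} (h : H1Pair f g)
    (m : ℕ) : eLpNorm (fun x => f x ^ (m + 1)) 2 volume ≠ ⊤ :=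
  ne_top_of_le_ne_top (ENNReal.mul_ne_top (ENNReal.mul_ne_top
    (ENNReal.mul_ne_top (ENNReal.pow_ne_top sobolevConst_ne_top) (ENNReal.natCast_ne_top _))
    h.memLp.2.ne) (ENNReal.pow_ne_top (gradNorm_ne_top h))) (h.eLpNorm_pow_le m)

end GagliardoNirenberg

/-! ### Continuity of the power nonlinearity from H¹ to L². -/

section PowerNonlinearity

/-- The power nonlinearity. -/
noncomputable def nl (p : ℝ) (f : Plane → ℂ) (x : Plane) : ℂ := (‖f x‖ ^ p : ℝ) • f x

/-- After ordering |w| ≤ |z|, the difference is |z|^p(z-w) plus (|z|^p-|w|^p)w, and the second term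
is bounded through Bernoulli's inequality. -/
theorem norm_rpow_smul_sub_le {p : ℝ} (hp : 1 ≤ p) (z w : ℂ) :
    ‖(‖z‖ ^ p : ℝ) • z - (‖w‖ ^ p : ℝ) • w‖ ≤ (p + 1) * ((‖z‖ ^ p + ‖w‖ ^ p) * ‖z - w‖) := by
  wlog h : ‖w‖ ≤ ‖z‖ generalizing z w
  · have := this w z (le_of_not_ge h)
    rwa [norm_sub_rev, add_comm (‖w‖ ^ p), norm_sub_rev w z] at this
  have e : (‖z‖ ^ p : ℝ) • z - (‖w‖ ^ p : ℝ) • w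
      = (‖z‖ ^ p : ℝ) • (z - w) + (‖z‖ ^ p - ‖w‖ ^ p : ℝ) • w := by
    simp only [smul_sub, sub_smul]; abel
  have hz : 0 ≤ ‖z‖ ^ p := by positivity
  have hw : 0 ≤ ‖w‖ ^ p := by positivity
  have hmono : ‖w‖ ^ p ≤ ‖z‖ ^ p := Real.rpow_le_rpow (norm_nonneg _) h (by linarith)
  have hdiff : (‖z‖ ^ p - ‖w‖ ^ p) * ‖w‖ ≤ p * (‖z‖ ^ p * ‖z - w‖) := by
    rcases eq_or_lt_of_le (norm_nonneg z) with h0 | h0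
    · have hw0 : ‖w‖ = 0 := le_antisymm (h0 ▸ h) (norm_nonneg _)
      rw [hw0, mul_zero]
      positivity
    -- Bernoulli's inequality at |w|/|z| - 1, which lies above -1 and is nonpositive.
    · have hb : 1 + p * (‖w‖ / ‖z‖ - 1) ≤ (1 + (‖w‖ / ‖z‖ - 1)) ^ p :=
        one_add_mul_self_le_rpow_one_add (by
          have : 0 ≤ ‖w‖ / ‖z‖ := by positivity
          linarith) hp
      rw [add_sub_cancel, Real.div_rpow (norm_nonneg _) (norm_nonneg _),
        le_div_iff₀ (Real.rpow_pos_of_pos h0 p)] at hb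
      have h1 : ‖z‖ ^ p - ‖w‖ ^ p ≤ p * (1 - ‖w‖ / ‖z‖) * ‖z‖ ^ p := by linarith
      have h2 : (1 - ‖w‖ / ‖z‖) * ‖w‖ ≤ ‖z - w‖ := by
        have h3 : ‖z‖ - ‖w‖ ≤ ‖z - w‖ := norm_sub_norm_le z w
        have h4 : (1 - ‖w‖ / ‖z‖) * ‖w‖ = (‖z‖ - ‖w‖) * (‖w‖ / ‖z‖) := by field_simp
        have h5 : ‖w‖ / ‖z‖ ≤ 1 := (div_le_one h0).2 h
        rw [h4]
        nlinarith [sub_nonneg.2 h]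
      calc (‖z‖ ^ p - ‖w‖ ^ p) * ‖w‖ ≤ p * (1 - ‖w‖ / ‖z‖) * ‖z‖ ^ p * ‖w‖ := by gcongr
        _ = p * (‖z‖ ^ p * ((1 - ‖w‖ / ‖z‖) * ‖w‖)) := by ring
        _ ≤ _ := by gcongr
  rw [e]
  refine (norm_add_le _ _).trans ?_
  rw [norm_smul, norm_smul, Real.norm_of_nonneg hz, Real.norm_of_nonneg (by linarith)]
  nlinarith [mul_nonneg hw (norm_nonneg (z - w)), norm_nonneg (z - w),
    mul_nonneg (by linarith : 0 ≤ p + 1) (mul_nonneg hw (norm_nonneg (z - w)))]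

/-- This replaces the real exponent by an integer, for which the bounds on powers of H¹ functions
are available. -/
theorem rpow_le_one_add_pow {p r : ℝ} (hr : 0 ≤ r) {m : ℕ} (hm : p ≤ m) (hp : 0 ≤ p) :
    r ^ p ≤ 1 + r ^ m := by
  rcases le_total r 1 with h | h
  · have := Real.rpow_le_one hr h hp
    have : 0 ≤ r ^ m := by positivity
    linarith
  · have := Real.rpow_le_rpow_of_exponent_le h hm
    rw [Real.rpow_natCast] at this
    linarith

theorem eLpNorm_pow_mul_le {f d : Plane → ℂ} (hf : AEStronglyMeasurable f volume)
    (hd : AEStronglyMeasurable d volume) (m : ℕ) :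
    eLpNorm (fun x => f x ^ m * d x) 2 volume
      ≤ (eLpNorm (fun x => f x ^ (2 * m)) 2 volume * eLpNorm (fun x => d x ^ 2) 2 volume)
        ^ (1 / 2 : ℝ) := by
  rw [eLpNorm_eq_lintegral_rpow_enorm_toReal (by norm_num) (by norm_num)]
  simp only [ENNReal.toReal_ofNat]
  gcongr
  refine le_trans (lintegral_mono fun x => ?_)
    (lintegral_mul_le_eLpNorm (hf.pow (2 * m)) (hd.pow 2))
  simp only [enorm_mul, enorm_pow, ENNReal.rpow_ofNat, pow_mul']
  rw [mul_pow]

theorem aestronglyMeasurable_nl (p : ℝ) {f : Plane → ℂ} (hf : AEStronglyMeasurable f volume) :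
    AEStronglyMeasurable (nl p f) volume :=
  (hf.norm.aemeasurable.pow_const p).aestronglyMeasurable.smul hf

/-- Local Lipschitz continuity of the nonlinearity from `H¹` to `L²`. -/
theorem eLpNorm_nl_sub_le {p : ℝ} (hp : 1 ≤ p) {m : ℕ} (hm : p ≤ m) {f f' : Plane → ℂ}
    (hf : AEStronglyMeasurable f volume) (hf' : AEStronglyMeasurable f' volume) :
    eLpNorm (fun x => nl p f x - nl p f' x) 2 volume
      ≤ ENNReal.ofReal (p + 1) * (2 * eLpNorm (fun x => f x - f' x) 2 volume
        + (eLpNorm (fun x => f x ^ (2 * m)) 2 volume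
            * eLpNorm (fun x => (f x - f' x) ^ 2) 2 volume) ^ (1 / 2 : ℝ)
        + (eLpNorm (fun x => f' x ^ (2 * m)) 2 volume
            * eLpNorm (fun x => (f x - f' x) ^ 2) 2 volume) ^ (1 / 2 : ℝ)) := by
  set d : Plane → ℂ := fun x => f x - f' x with hd
  have hdm : AEStronglyMeasurable d volume := hf.sub hf'
  have a1 : AEStronglyMeasurable (fun x => ‖d x‖) volume := hdm.norm
  have a2 : AEStronglyMeasurable (fun x => ‖f x ^ m * d x‖) volume := ((hf.pow m).mul hdm).norm
  have a3 : AEStronglyMeasurable (fun x => ‖f' x ^ m * d x‖) volume := ((hf'.pow m).mul hdm).norm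
  have a0 : AEStronglyMeasurable (fun x => 2 * ‖d x‖) volume := a1.const_mul 2
  calc eLpNorm (fun x => nl p f x - nl p f' x) 2 volume
      ≤ ENNReal.ofReal (p + 1) * eLpNorm ((fun x => 2 * ‖d x‖) + (fun x => ‖f x ^ m * d x‖)
          + fun x => ‖f' x ^ m * d x‖) 2 volume := by
        refine eLpNorm_le_mul_eLpNorm_of_ae_le_mul (ae_of_all _ fun x => ?_) 2
        refine (norm_rpow_smul_sub_le hp (f x) (f' x)).trans ?_
        refine mul_le_mul_of_nonneg_left ?_ (by linarith)
        have h1 := rpow_le_one_add_pow (norm_nonneg (f x)) hm (by linarith)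
        have h2 := rpow_le_one_add_pow (norm_nonneg (f' x)) hm (by linarith)
        simp only [Pi.add_apply, norm_mul, norm_pow]
        rw [Real.norm_of_nonneg (by positivity)]
        calc (‖f x‖ ^ p + ‖f' x‖ ^ p) * ‖d x‖
            ≤ ((1 + ‖f x‖ ^ m) + (1 + ‖f' x‖ ^ m)) * ‖d x‖ := by gcongr
          _ = _ := by ring
    _ ≤ _ := by
        gcongr
        refine (eLpNorm_add_le (a0.add a2) a3 (by norm_num)).trans ?_
        gcongr
        · refine (eLpNorm_add_le a0 a2 (by norm_num)).trans ?_
          gcongr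
          · have : (fun x => 2 * ‖d x‖) = (2 : ℝ) • fun x => ‖d x‖ := rfl
            rw [this, eLpNorm_const_smul, eLpNorm_norm, Real.enorm_of_nonneg (by norm_num),
              ENNReal.ofReal_ofNat]
          · rw [eLpNorm_norm]
            exact eLpNorm_pow_mul_le hf hdm m
        · rw [eLpNorm_norm]
          exact eLpNorm_pow_mul_le hf' hdm m

theorem H1Pair.sub {f f' : Plane → ℂ} {g g' : Fin 2 → Plane → ℂ} (h : H1Pair f g)
    (h' : H1Pair f' g') : H1Pair (fun x => f x - f' x) (fun j x => g j x - g' j x) where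
  memLp := h.memLp.sub h'.memLp
  memLp_grad j := (h.memLp_grad j).sub (h'.memLp_grad j)
  weak φ hφ j := by
    have i : ∀ {ψ : Plane → ℝ} {F : Plane → ℂ}, IsTest ψ → MemLp F 2 →
        Integrable (fun x => ψ x • F x) := fun hψ hF =>
      (hF.locallyIntegrable (by norm_num)).integrable_smul_left_of_hasCompactSupport hψ.continuous
        hψ.compact
    simp only [smul_sub]
    rw [integral_sub (i (hφ.pd j) h.memLp) (i (hφ.pd j) h'.memLp),
      integral_sub (i hφ (h.memLp_grad j)) (i hφ (h'.memLp_grad j)), h.weak φ hφ, h'.weak φ hφ]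
    ring

theorem h1Pair_zero : H1Pair (fun _ => 0) (fun _ _ => 0) where
  memLp := MemLp.zero
  memLp_grad _ := MemLp.zero
  weak _ _ _ := by simp

theorem IsTest.h1Pair {φ : Plane → ℂ} (hφ : IsTest φ) :
    H1Pair φ (fun j => InteractionMorawetz.pd j φ) where
  memLp := hφ.memLp 2
  memLp_grad j := (hφ.pd j).memLp 2
  weak ψ hψ j := by
    have h := integral_smul_fderiv_eq_neg_fderiv_smul_of_integrable
      (μ := (volume : Measure Plane)) (f := ψ) (g := φ) (v := EuclideanSpace.single j 1)
      ((hψ.pd j).smul hφ.contDiff).integrable (hψ.smul (hφ.pd j).contDiff).integrable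
      (hψ.smul hφ.contDiff).integrable
      (fun x _ => differentiable_of_contDiff hψ.contDiff x)
      (fun x _ => differentiable_of_contDiff hφ.contDiff x)
    exact (neg_eq_iff_eq_neg.2 h).symm ▸ rfl

theorem H1Pair.memLp_nl {f : Plane → ℂ} {g : Fin 2 → Plane → ℂ} (h : H1Pair f g) {p : ℝ}
    (hp : 1 ≤ p) : MemLp (nl p f) 2 := by
  obtain ⟨m, hm⟩ := exists_nat_ge p
  have hm1 : 1 ≤ m := by exact_mod_cast hp.trans hm
  -- The Lipschitz bound is used against the zero function.
  have := eLpNorm_nl_sub_le hp hm h.memLp.aestronglyMeasurable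
    (h1Pair_zero.memLp.aestronglyMeasurable)
  have e : (fun x => nl p f x - nl p (fun _ => 0) x) = nl p f := by
    funext x
    simp [nl]
  rw [e] at this
  refine ⟨aestronglyMeasurable_nl p h.memLp.aestronglyMeasurable, this.trans_lt ?_⟩
  -- The bound on powers is stated for exponents of the form k+1.
  obtain ⟨k, hk⟩ : ∃ k, 2 * m = k + 1 := ⟨2 * m - 1, by omega⟩
  have h2 := h.eLpNorm_pow_ne_top 1
  have h3 := h.eLpNorm_pow_ne_top k
  simp only [sub_zero, hk, ne_eq, Nat.add_eq_zero_iff, one_ne_zero, and_false, not_false_eq_true,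
    zero_pow, eLpNorm_zero', zero_mul]
  refine ENNReal.mul_lt_top ENNReal.ofReal_lt_top (ENNReal.add_lt_top.2 ⟨ENNReal.add_lt_top.2
    ⟨ENNReal.mul_lt_top (by simp) h.memLp.2, ?_⟩, by simp⟩)
  exact ENNReal.rpow_lt_top_of_nonneg (by norm_num) (ENNReal.mul_ne_top h3 h2)

/-- Sequential continuity of the nonlinearity from `H¹` to `L²`. -/
theorem tendsto_nl {ι : Type*} {l : Filter ι} {p : ℝ} (hp : 1 ≤ p) {f : Plane → ℂ}
    {g : Fin 2 → Plane → ℂ} {fn : ι → Plane → ℂ} {gn : ι → Fin 2 → Plane → ℂ}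
    (h : H1Pair f g) (hn : ∀ i, H1Pair (fn i) (gn i))
    (h1 : Tendsto (fun i => eLpNorm (fun x => fn i x - f x) 2 volume) l (𝓝 0))
    (h2 : ∀ j, Tendsto (fun i => eLpNorm (fun x => gn i j x - g j x) 2 volume) l (𝓝 0)) :
    Tendsto (fun i => eLpNorm (fun x => nl p (fn i) x - nl p f x) 2 volume) l (𝓝 0) := by
  obtain ⟨m, hm⟩ := exists_nat_ge p
  have hm1 : 1 ≤ m := by exact_mod_cast hp.trans hm
  obtain ⟨k, hk⟩ : ∃ k, 2 * m = k + 1 := ⟨2 * m - 1, by omega⟩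
  have hnorm : ∀ {F : ι → Plane → ℂ} {G : Plane → ℂ}, (∀ n, MemLp (F n) 2) → MemLp G 2 →
      Tendsto (fun n => eLpNorm (fun x => F n x - G x) 2 volume) l (𝓝 0) →
      Tendsto (fun n => eLpNorm (F n) 2 volume) l (𝓝 (eLpNorm G 2 volume)) := by
    intro F G hF hG ht
    have t1 : Tendsto (fun n => (hF n).toLp (F n)) l (𝓝 (hG.toLp G)) :=
      (Lp.tendsto_Lp_iff_tendsto_eLpNorm'' _ hF G hG).2 ht
    have t2 := t1.enorm
    simpa only [Lp.enorm_toLp] using t2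
  have c1 : ∀ m : ℕ, (sobolevConst ^ m * ((m + 1).factorial : ℝ≥0∞)) ≠ ⊤ := fun m =>
    ENNReal.mul_ne_top (ENNReal.pow_ne_top sobolevConst_ne_top) (ENNReal.natCast_ne_top _)
  have hgr := gradNorm_ne_top h
  have tg : Tendsto (fun i => gradNorm (gn i)) l (𝓝 (gradNorm g)) :=
    tendsto_finsetSum _ fun j _ => hnorm (fun i => (hn i).memLp_grad j) (h.memLp_grad j) (h2 j)
  have tgd : Tendsto (fun i => gradNorm (fun j x => gn i j x - g j x)) l (𝓝 0) := by
    simpa [gradNorm] using (h2 0).add (h2 1)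
  let B : ℝ≥0∞ := (sobolevConst ^ k * ((k + 1).factorial : ℝ≥0∞)) * eLpNorm f 2 volume
    * gradNorm g ^ k
  have hB : B ≠ ⊤ := ENNReal.mul_ne_top (ENNReal.mul_ne_top (c1 k) h.memLp.2.ne)
    (ENNReal.pow_ne_top hgr)
  have tB : Tendsto (fun i => (sobolevConst ^ k * ((k + 1).factorial : ℝ≥0∞))
      * eLpNorm (fn i) 2 volume * gradNorm (gn i) ^ k) l (𝓝 B) :=
    ENNReal.Tendsto.mul (ENNReal.Tendsto.const_mul (hnorm (fun i => (hn i).memLp) h.memLp h1)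
      (Or.inr (c1 k))) (Or.inr (ENNReal.pow_ne_top hgr))
      (((ENNReal.continuous_pow k).tendsto _).comp tg)
      (Or.inr (ENNReal.mul_ne_top (c1 k) h.memLp.2.ne))
  have tD : Tendsto (fun i => (sobolevConst ^ 1 * ((1 + 1).factorial : ℝ≥0∞))
      * eLpNorm (fun x => fn i x - f x) 2 volume * gradNorm (fun j x => gn i j x - g j x) ^ 1) l
      (𝓝 0) := by
    have := ENNReal.Tendsto.mul (ENNReal.Tendsto.const_mul h1 (Or.inr (c1 1)))
      (Or.inr (by simp)) (((ENNReal.continuous_pow 1).tendsto _).comp tgd) (Or.inr (by simp))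
    simpa using! this
  have tmul : ∀ {A : ι → ℝ≥0∞} {a : ℝ≥0∞}, a ≠ ⊤ → Tendsto A l (𝓝 a) →
      Tendsto (fun i => (A i * ((sobolevConst ^ 1 * ((1 + 1).factorial : ℝ≥0∞))
      * eLpNorm (fun x => fn i x - f x) 2 volume
      * gradNorm (fun j x => gn i j x - g j x) ^ 1)) ^ (1 / 2 : ℝ)) l (𝓝 0) := by
    intro A a ha tA
    have := ENNReal.Tendsto.mul tA (Or.inr (by simp)) tD (Or.inr ha)
    rw [mul_zero] at this
    have := ((ENNReal.continuous_rpow_const (y := (1 / 2 : ℝ))).tendsto 0).comp this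
    simpa using! this
  have tot : Tendsto (fun i => ENNReal.ofReal (p + 1) *
      (2 * eLpNorm (fun x => fn i x - f x) 2 volume
        + (((sobolevConst ^ k * ((k + 1).factorial : ℝ≥0∞))
      * eLpNorm (fn i) 2 volume * gradNorm (gn i) ^ k)
            * ((sobolevConst ^ 1 * ((1 + 1).factorial : ℝ≥0∞))
      * eLpNorm (fun x => fn i x - f x) 2 volume
      * gradNorm (fun j x => gn i j x - g j x) ^ 1)) ^ (1 / 2 : ℝ)
        + (B * ((sobolevConst ^ 1 * ((1 + 1).factorial : ℝ≥0∞))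
      * eLpNorm (fun x => fn i x - f x) 2 volume
      * gradNorm (fun j x => gn i j x - g j x) ^ 1)) ^ (1 / 2 : ℝ))) l (𝓝 0) := by
    have := ENNReal.Tendsto.const_mul (((ENNReal.Tendsto.const_mul h1
      (Or.inr (ENNReal.ofNat_ne_top (n := 2)))).add (tmul hB tB)).add
      (tmul hB tendsto_const_nhds)) (Or.inr (ENNReal.ofReal_ne_top (r := p + 1)))
    simpa only [mul_zero, add_zero] using this
  refine tendsto_of_tendsto_of_tendsto_of_le_of_le tendsto_const_nhds tot (fun _ => zero_le)
    (fun i => ?_)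
  refine (eLpNorm_nl_sub_le hp hm (hn i).memLp.aestronglyMeasurable
    h.memLp.aestronglyMeasurable).trans ?_
  have b1 := (hn i).eLpNorm_pow_le k
  have b2 := h.eLpNorm_pow_le k
  have b3 := ((hn i).sub h).eLpNorm_pow_le 1
  rw [hk]
  gcongr

end PowerNonlinearity

/-! ### The chain rule for |f|^(p+2). -/

section ChainRule

/-- The integral of ∂ⱼ(φ|ψ|^(p+2)) vanishes. Since p+2 > 1, the power is C¹ with derivative
(p+2)|ψ|^p Re(ψ̄∂ⱼψ), also at the zeros of ψ. -/
theorem ip_pd_nl_of_isTest {p : ℝ} (hp : 1 ≤ p) {ψ : Plane → ℂ} (hψ : IsTest ψ)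
    {φ : Plane → ℝ} (hφ : IsTest φ) (j : Fin 2) :
    (ip (pd j φ) ψ (nl p ψ)).re = -(p + 2) * (ip φ (nl p ψ) (pd j ψ)).re := by
  have hP := hψ.h1Pair
  let N : Plane → ℝ := fun x => ‖ψ x‖ ^ (p + 2)
  have hN1 : ContDiff ℝ 1 N :=
    (contDiff_norm_rpow (E := ℂ) (p := p + 2) (by linarith)).comp (hψ.contDiff.of_le (by simp))
  have hNd : ∀ x, pd j N x = (p + 2) * (‖ψ x‖ ^ p * (starRingEnd ℂ (ψ x) * pd j ψ x).re) := by
    intro x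
    have h := (hasFDerivAt_norm_rpow (ψ x) (p := p + 2) (by linarith)).comp x
      (differentiable_of_contDiff hψ.contDiff x).hasFDerivAt
    rw [pd, show N = (fun x : ℂ => ‖x‖ ^ (p + 2)) ∘ ψ from rfl, h.fderiv]
    simp only [add_sub_cancel_right, ContinuousLinearMap.comp_apply,
      smul_apply, innerSL_apply_apply, smul_eq_mul]
    rw [Complex.inner]
    simp [pd, mul_assoc, mul_comm]
    ring
  have hz := integral_pd_eq_zero (f := fun x => φ x * N x)
    ((hφ.contDiff.of_le (by simp)).mul hN1) hφ.compact.mul_right j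
  have i1 := integrable_ip (hφ.pd j).isBdd hP.memLp (hP.memLp_nl hp)
  have i2 := integrable_ip hφ.isBdd (hP.memLp_nl hp) (hP.memLp_grad j)
  have t1 : HasInt _ (ip (pd j φ) ψ (nl p ψ)).re := ⟨i1.re, integral_re i1⟩
  have t2 : HasInt _ (ip φ (nl p ψ) (pd j ψ)).re := ⟨i2.re, integral_re i2⟩
  have t3 := (t1.add (t2.const_mul (p + 2))).2
  have e : ∀ x, pd j (fun x => φ x * N x) x
      = RCLike.re (pd j φ x • (starRingEnd ℂ (ψ x) * nl p ψ x))
        + (p + 2) * RCLike.re (φ x • (starRingEnd ℂ (nl p ψ x) * pd j ψ x)) := by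
    intro x
    rw [pd_mul j (differentiable_of_contDiff hφ.contDiff x)
      ((hN1.differentiable (by simp)) x), hNd]
    have hpow : N x = ‖ψ x‖ ^ p * ‖ψ x‖ ^ 2 := by
      simp only [N]
      rw [Real.rpow_add_of_nonneg (norm_nonneg _) (by linarith) (by norm_num), Real.rpow_two]
    rw [hpow, Complex.sq_norm, Complex.normSq_apply]
    simp [nl, Complex.mul_re]
    ring
  rw [← integral_congr_ae (ae_of_all _ e), hz] at t3
  linarith

/-- The chain rule for `|f|^{p+2}`, in weak form. -/
theorem H1Pair.ip_pd_nl {p : ℝ} (hp : 1 ≤ p) {f : Plane → ℂ} {g : Fin 2 → Plane → ℂ}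
    (h : H1Pair f g) {φ : Plane → ℝ} (hφ : IsTest φ) (j : Fin 2) :
    (ip (pd j φ) f (nl p f)).re = -(p + 2) * (ip φ (nl p f) (g j)).re := by
  obtain ⟨ψ, hψ, hψ0, hψ1⟩ := h.exists_approx
  have hn := fun n => (hψ n).h1Pair
  have tn := tendsto_nl hp h hn hψ0 hψ1
  have t1 := tendsto_ip (hφ.pd j).isBdd h.memLp (h.memLp_nl hp) (fun n => (hn n).memLp)
    (fun n => (hn n).memLp_nl hp) hψ0 tn
  have t2 := tendsto_ip hφ.isBdd (h.memLp_nl hp) (h.memLp_grad j) (fun n => (hn n).memLp_nl hp)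
    (fun n => (hn n).memLp_grad j) tn (hψ1 j)
  refine tendsto_nhds_unique ((Complex.continuous_re.tendsto _).comp t1) ?_
  refine (((Complex.continuous_re.tendsto _).comp t2).const_mul (-(p + 2))).congr fun n => ?_
  exact (ip_pd_nl_of_isTest hp (hψ n) hφ j).symm

end ChainRule

/-! ### Conservation laws for a forced Schrödinger equation, by averaging in time. -/

section WeakSchrodinger

/-- The space of square integrable functions on the plane. -/
abbrev L2 : Type := Lp ℂ 2 (volume : Measure Plane)

/-- Square integrable data `(U, G, N)` depending continuously on time, with `G = ∇U` and
`∂ₜU = i (ΔU - N)` on `Ω` at the times of the interval `(c, d)`. -/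
structure WeakSchr (Ω : Set Plane) (c d : ℝ) (U : ℝ → L2) (G : Fin 2 → ℝ → L2) (N : ℝ → L2) :
    Prop where
  cU : Continuous U
  cG : ∀ j, Continuous (G j)
  cN : Continuous N
  pair : ∀ t, H1Pair (U t) (fun j => G j t)
  eq : ∀ ψ : Plane → ℝ, IsTest ψ → tsupport ψ ⊆ Ω → ∀ t ∈ Set.Ioo c d,
    HasDerivAt (fun s => ∫ x, ψ x • U s x)
      (Complex.I * (-(∑ j, ∫ x, pd j ψ x • G j t x) - ∫ x, ψ x • N t x)) t

/-- Integration against a test function, as a functional on `L²`. -/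
theorem exists_functional {ψ : Plane → ℝ} (hψ : IsTest ψ) :
    ∃ l : L2 →L[ℝ] ℂ, ∀ F : L2, l F = ∫ x, ψ x • F x := by
  have hi : ∀ F : L2, Integrable (fun x => ψ x • F x) := fun F =>
    ((Lp.memLp F).locallyIntegrable (by norm_num)).integrable_smul_left_of_hasCompactSupport
      hψ.continuous hψ.compact
  have hb : ∀ F : L2, ‖∫ x, ψ x • F x‖ ≤ (eLpNorm ψ 2 volume).toReal * ‖F‖ := by
    intro F
    have hm : MemLp (fun x => (ψ x : ℂ)) 2 := (hψ.memLp 2).ofReal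
    have h1 := norm_integral_conj_mul_le hm (Lp.memLp F)
    have h2 : eLpNorm (fun x => (ψ x : ℂ)) 2 volume = eLpNorm ψ 2 volume :=
      eLpNorm_congr_norm_ae (ae_of_all _ fun x => by simp)
    rw [h2, ← Lp.norm_def] at h1
    refine (norm_integral_le_integral_norm _).trans (le_trans (le_of_eq ?_) h1)
    refine integral_congr_ae (ae_of_all _ fun x => ?_)
    simp
  refine ⟨LinearMap.mkContinuous
    { toFun := fun F => ∫ x, ψ x • F x
      map_add' := fun F F' => ?_
      map_smul' := fun r F => ?_ } _ hb, fun F => rfl⟩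
  · rw [← integral_add (hi F) (hi F')]
    refine integral_congr_ae ?_
    filter_upwards [Lp.coeFn_add F F'] with x hx
    rw [hx, Pi.add_apply, smul_add]
  · rw [← integral_smul]
    refine integral_congr_ae ?_
    filter_upwards [Lp.coeFn_smul r F] with x hx
    rw [hx, Pi.smul_apply, smul_comm]
    rfl

/-- The Steklov mean. -/
noncomputable def steklov (F : ℝ → L2) (h t : ℝ) : L2 := ∫ s in (0 : ℝ)..1, F (t + h * s)

theorem steklov_zero (F : ℝ → L2) (t : ℝ) : steklov F 0 t = F t := by simp [steklov]

/-- Averaging over the fixed interval [0,1] gives joint continuity up to h = 0, where the mean is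
`F` itself. This is what allows the limit h → 0 later. -/
theorem continuous_steklov {F : ℝ → L2} (hF : Continuous F) :
    Continuous (fun z : ℝ × ℝ => steklov F z.1 z.2) := by
  unfold steklov
  apply intervalIntegral.continuous_parametric_intervalIntegral_of_continuous'
  fun_prop

theorem steklov_eq {F : ℝ → L2} {h : ℝ} (hh : h ≠ 0) (t : ℝ) :
    steklov F h t = h⁻¹ • ∫ s in t..t + h, F s := by
  have := intervalIntegral.integral_comp_add_mul (a := (0 : ℝ)) (b := 1) F hh t
  simpa [steklov] using this

theorem hasDerivAt_steklov {F : ℝ → L2} (hF : Continuous F) {h : ℝ} (hh : h ≠ 0) (t : ℝ) :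
    HasDerivAt (steklov F h) (h⁻¹ • (F (t + h) - F t)) t := by
  have e : steklov F h = fun t => h⁻¹ • ((∫ s in (0 : ℝ)..t + h, F s) - ∫ s in (0 : ℝ)..t, F s) := by
    funext t
    rw [steklov_eq hh, intervalIntegral.integral_interval_sub_left (hF.intervalIntegrable _ _)
      (hF.intervalIntegrable _ _)]
  have hp : ∀ t, HasDerivAt (fun t => ∫ s in (0 : ℝ)..t, F s) (F t) t := fun t =>
    intervalIntegral.integral_hasDerivAt_right (hF.intervalIntegrable _ _)
      (hF.stronglyMeasurableAtFilter _ _) hF.continuousAt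
  rw [e]
  exact (((hp (t + h)).comp_add_const t h).fun_sub (hp t)).fun_const_smul _

variable {Ω : Set Plane} {c d : ℝ} {U : ℝ → L2} {G : Fin 2 → ℝ → L2} {N : ℝ → L2}

theorem functional_steklov (l : L2 →L[ℝ] ℂ) {F : ℝ → L2} (hF : Continuous F) (h t : ℝ) :
    l (steklov F h t) = ∫ s in (0 : ℝ)..1, l (F (t + h * s)) :=
  (l.intervalIntegral_comp_comm ((hF.comp (by fun_prop)).intervalIntegrable _ _)).symm

theorem WeakSchr.pair_steklov (H : WeakSchr Ω c d U G N) (h t : ℝ) :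
    H1Pair (steklov U h t) (fun j => steklov (G j) h t) where
  memLp := Lp.memLp _
  memLp_grad _ := Lp.memLp _
  weak φ hφ j := by
    obtain ⟨l1, hl1⟩ := exists_functional (hφ.pd j)
    obtain ⟨l2, hl2⟩ := exists_functional hφ
    rw [← hl1, ← hl2, functional_steklov l1 H.cU, functional_steklov l2 (H.cG j),
      ← intervalIntegral.integral_neg]
    refine intervalIntegral.integral_congr fun s _ => ?_
    simp only [hl1, hl2]
    exact (H.pair _).weak φ hφ j

/-- The time derivative of a Steklov mean is a difference quotient of `U`, hence again in H¹. It can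
therefore be integrated by parts in space. -/
theorem WeakSchr.pair_diff (H : WeakSchr Ω c d U G N) (h t : ℝ) :
    H1Pair (h⁻¹ • (U (t + h) - U t) : L2) (fun j => (h⁻¹ • (G j (t + h) - G j t) : L2)) where
  memLp := Lp.memLp _
  memLp_grad _ := Lp.memLp _
  weak φ hφ j := by
    obtain ⟨l1, hl1⟩ := exists_functional (hφ.pd j)
    obtain ⟨l2, hl2⟩ := exists_functional hφ
    rw [← hl1, ← hl2]
    simp only [map_smul, map_sub]
    have e : ∀ t, l1 (U t) = - l2 (G j t) := fun t => by
      rw [hl1, hl2]; exact (H.pair t).weak φ hφ j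
    rw [e, e, ← smul_neg]
    congr 1
    ring

/-- Averaging ΔU = N - i∂ₜU over [t, t+h] leaves on the right a difference quotient, which is in L².
The mean thus has the square integrable Laplacian that Rellich's identity requires. -/
theorem WeakSchr.weakDiv (H : WeakSchr Ω c d U G N) {h t : ℝ} (hh : 0 < h) (hc : c < t)
    (hd : t + h < d) :
    WeakDiv Ω (fun j => steklov (G j) h t)
      (steklov N h t - Complex.I • (h⁻¹ • (U (t + h) - U t)) : L2) := by
  intro ψ hψ hs
  obtain ⟨l, hl⟩ := exists_functional hψ
  choose m hm using fun j => exists_functional (hψ.pd j)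
  have hI : ∀ F : L2, l (Complex.I • F) = Complex.I * l F := by
    intro F
    rw [hl, hl, ← integral_const_mul]
    refine integral_congr_ae ?_
    filter_upwards [Lp.coeFn_smul Complex.I F] with x hx
    rw [hx, Pi.smul_apply]
    simp only [smul_eq_mul, Complex.real_smul]
    ring
  let D : ℝ → ℂ := fun t => Complex.I * (-(∑ j, m j (G j t)) - l (N t))
  have hD : Continuous D := by
    have h1 : ∀ j, Continuous (fun t => m j (G j t)) := fun j => (m j).continuous.comp (H.cG j)
    have h2 : Continuous (fun t => l (N t)) := l.continuous.comp H.cN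
    exact continuous_const.mul ((continuous_finsetSum _ fun j _ => h1 j).neg.sub h2)
  have hder : ∀ s ∈ Set.uIcc t (t + h), HasDerivAt (fun s => l (U s)) (D s) s := by
    intro s hs'
    rw [Set.uIcc_of_le (by linarith)] at hs'
    have := H.eq ψ hψ hs s ⟨by linarith [hs'.1], by linarith [hs'.2]⟩
    simpa only [D, hl, hm] using this
  have hftc := intervalIntegral.integral_eq_sub_of_hasDerivAt hder (hD.intervalIntegrable _ _)
  have hmean : (∫ s in (0 : ℝ)..1, D (t + h * s)) = h⁻¹ • (l (U (t + h)) - l (U t)) := by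
    rw [← hftc]
    have := intervalIntegral.integral_comp_add_mul (a := (0 : ℝ)) (b := 1) D hh.ne' t
    simpa using this
  have hlin : (∫ s in (0 : ℝ)..1, D (t + h * s))
      = Complex.I * (-(∑ j, m j (steklov (G j) h t)) - l (steklov N h t)) := by
    have c1 : ∀ j, Continuous (fun s : ℝ => m j (G j (t + h * s))) := fun j =>
      (m j).continuous.comp ((H.cG j).comp (by fun_prop))
    have c2 : Continuous (fun s : ℝ => l (N (t + h * s))) :=
      l.continuous.comp (H.cN.comp (by fun_prop))
    simp only [D, functional_steklov _ (H.cG _), functional_steklov l H.cN]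
    have c3 : Continuous (fun s : ℝ => -∑ j, m j (G j (t + h * s))) :=
      (continuous_finsetSum _ fun j _ => c1 j).neg
    rw [intervalIntegral.integral_const_mul, intervalIntegral.integral_sub
      (c3.intervalIntegrable _ _) (c2.intervalIntegrable _ _), intervalIntegral.integral_neg,
      intervalIntegral.integral_finsetSum fun j _ => (c1 j).intervalIntegrable _ _]
  rw [← hl]
  simp only [← hm]
  rw [map_sub, hI, map_smul, map_sub, ← hmean, hlin]
  linear_combination (- ∑ j, m j (steklov (G j) h t) - l (steklov N h t)) * Complex.I_sq.symm

/-- Derivatives do not pass to limits, but their integrated form does: the fundamental theorem for h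
> 0 survives h → 0 by joint continuity, and the integral of the continuous function `L 0` is then
differentiated. -/
theorem hasDerivAt_of_parametric {F L : ℝ → ℝ → ℝ} (hF : Continuous fun z : ℝ × ℝ => F z.1 z.2)
    (hL : Continuous fun z : ℝ × ℝ => L z.1 z.2)
    (hder : ∀ h t, 0 < h → c < t → t + h < d → HasDerivAt (F h) (L h t) t) {t : ℝ}
    (ht : t ∈ Set.Ioo c d) : HasDerivAt (F 0) (L 0 t) t := by
  have hL0 : ∀ h, Continuous (L h) := fun h => hL.comp (by fun_prop : Continuous fun t => (h, t))
  have key : ∀ t₁ t₂, c < t₁ → t₁ ≤ t₂ → t₂ < d → F 0 t₂ - F 0 t₁ = ∫ s in t₁..t₂, L 0 s := by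
    intro t₁ t₂ h1 h12 h2
    have c1 : Continuous fun h => F h t₂ - F h t₁ :=
      (hF.comp (by fun_prop : Continuous fun h => (h, t₂))).sub
        (hF.comp (by fun_prop : Continuous fun h => (h, t₁)))
    have c2 : Continuous fun h => ∫ s in t₁..t₂, L h s :=
      intervalIntegral.continuous_parametric_intervalIntegral_of_continuous' hL _ _
    refine tendsto_nhds_unique (c1.continuousWithinAt (s := Set.Ioi 0) (x := 0))
      ((c2.continuousWithinAt (s := Set.Ioi 0) (x := 0)).tendsto.congr' ?_)
    have : ∀ᶠ h in 𝓝[>] (0 : ℝ), h < d - t₂ :=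
      (eventually_lt_nhds (by linarith)).filter_mono nhdsWithin_le_nhds
    filter_upwards [this, self_mem_nhdsWithin] with h hh h0
    refine intervalIntegral.integral_eq_sub_of_hasDerivAt (fun s hs => ?_)
      ((hL0 h).intervalIntegrable _ _)
    rw [Set.uIcc_of_le h12] at hs
    exact hder h s h0 (by linarith [hs.1]) (by linarith [hs.2])
  obtain ⟨t₁, h1, h1t⟩ := exists_between ht.1
  have hd : HasDerivAt (fun s => F 0 t₁ + ∫ s in t₁..s, L 0 s) (L 0 t) t :=
    (intervalIntegral.integral_hasDerivAt_right ((hL0 0).intervalIntegrable _ _)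
      ((hL0 0).stronglyMeasurableAtFilter _ _) (hL0 0).continuousAt).const_add _
  refine hd.congr_of_eventuallyEq ?_
  filter_upwards [Ioo_mem_nhds h1t ht.2] with s hs
  rw [← key t₁ s h1 hs.1.le hs.2]
  ring

theorem hasDerivAt_ip {b : Plane → ℝ} (hb : IsBdd b) {f g : ℝ → L2} {f' g' : L2} {t : ℝ}
    (hf : HasDerivAt f f' t) (hg : HasDerivAt g g' t) :
    HasDerivAt (fun t => ip b (f t) (g t)) (ip b (f t) g' + ip b f' (g t)) t := by
  have h := ((isBoundedBilinearMap_ip hb).hasFDerivAt (f t, g t)).comp_hasDerivAt t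
    (hf.prodMk hg)
  simpa using! h

theorem continuous_ip {ι : Type*} [TopologicalSpace ι] {b : Plane → ℝ} (hb : IsBdd b)
    {f g : ι → L2} (hf : Continuous f) (hg : Continuous g) :
    Continuous (fun t => ip b (f t) (g t)) :=
  (isBoundedBilinearMap_ip hb).continuous.comp (hf.prodMk hg)

theorem ip_conj {b : Plane → ℝ} (f g : Plane → ℂ) : ip b g f = starRingEnd ℂ (ip b f g) := by
  rw [ip, ip, ← integral_conj]
  refine integral_congr_ae (ae_of_all _ fun x => ?_)
  simp only [Complex.real_smul, map_mul, Complex.conj_ofReal, Complex.conj_conj]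
  ring

theorem ip_sub_smul_I {b : Plane → ℝ} (hb : IsBdd b) {f : Plane → ℂ} (hf : MemLp f 2) (n w : L2) :
    ip b f (n - Complex.I • w : L2) = ip b f n - Complex.I * ip b f w := by
  rw [ip, ip, ip, ← integral_const_mul, ← integral_sub (integrable_ip hb hf (Lp.memLp n))
    ((integrable_ip hb hf (Lp.memLp w)).const_mul _)]
  refine integral_congr_ae ?_
  filter_upwards [Lp.coeFn_sub n (Complex.I • w), Lp.coeFn_smul Complex.I w] with x h1 h2
  rw [h1, Pi.sub_apply, h2, Pi.smul_apply]
  simp only [smul_eq_mul, Complex.real_smul]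
  ring

theorem ip_dv {X : Fin 2 → Plane → ℝ} (hX : ∀ j, IsTest (X j)) {f g : Plane → ℂ}
    (hf : MemLp f 2) (hg : MemLp g 2) : ip (dv X) f g = ∑ j, ip (pd j (X j)) f g := by
  simp only [ip, Fin.sum_univ_two]
  rw [← integral_add (integrable_ip ((hX 0).pd 0).isBdd hf hg)
    (integrable_ip ((hX 1).pd 1).isBdd hf hg)]
  refine integral_congr_ae (ae_of_all _ fun x => ?_)
  simp only [dv, Fin.sum_univ_two, add_smul]

/-- The momentum of `f` in the direction of the vector field `X`. -/
noncomputable def mom (X : Fin 2 → Plane → ℝ) (f : Plane → ℂ) (g : Fin 2 → Plane → ℂ) : ℝ :=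
  ∑ j, (ip (X j) f (g j)).im

/-- The time derivative of the momentum, with the forcing term `n`. -/
noncomputable def momDeriv (X : Fin 2 → Plane → ℝ) (f : Plane → ℂ) (g : Fin 2 → Plane → ℂ)
    (n : Plane → ℂ) : ℝ :=
  (∑ j, ∑ k, 2 * ip (pd k (X j)) (g j) (g k) + ∑ k, ip (pd k (dv X)) f (g k)).re
    + (∑ j, 2 * ip (X j) (g j) n + ip (dv X) f n).re

/-- For the Steklov means all curves are differentiable in L². Inserting the Laplacian n - i w' in
Rellich's identity, the terms with w' form the time derivative of the momentum and those with n the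
forcing. Finally h → 0. -/
theorem WeakSchr.hasDerivAt_mom (H : WeakSchr Ω c d U G N) (hΩ : IsOpen Ω)
    {X : Fin 2 → Plane → ℝ} (hX : ∀ j, IsTest (X j)) (hs : ∀ j, tsupport (X j) ⊆ Ω) {t : ℝ}
    (ht : t ∈ Set.Ioo c d) :
    HasDerivAt (fun t => mom X (U t) (fun j => G j t))
      (momDeriv X (U t) (fun j => G j t) (N t)) t := by
  have hD := isTest_dv hX
  have cU := continuous_steklov H.cU
  have cG := fun j => continuous_steklov (H.cG j)
  have cN := continuous_steklov H.cN
  have hF : Continuous fun z : ℝ × ℝ =>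
      mom X (steklov U z.1 z.2) (fun j => steklov (G j) z.1 z.2) :=
    continuous_finsetSum _ fun j _ => Complex.continuous_im.comp
      (continuous_ip (hX j).isBdd cU (cG j))
  have hL : Continuous fun z : ℝ × ℝ => momDeriv X (steklov U z.1 z.2)
      (fun j => steklov (G j) z.1 z.2) (steklov N z.1 z.2) := by
    refine (Complex.continuous_re.comp ((continuous_finsetSum _ fun j _ =>
      continuous_finsetSum _ fun k _ => continuous_const.mul
        (continuous_ip ((hX j).pd k).isBdd (cG j) (cG k))).add
        (continuous_finsetSum _ fun k _ => continuous_ip (hD.pd k).isBdd cU (cG k)))).add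
      (Complex.continuous_re.comp ((continuous_finsetSum _ fun j _ => continuous_const.mul
        (continuous_ip (hX j).isBdd (cG j) cN)).add (continuous_ip hD.isBdd cU cN)))
  have := hasDerivAt_of_parametric (c := c) (d := d)
    (F := fun h t => mom X (steklov U h t) (fun j => steklov (G j) h t))
    (L := fun h t => momDeriv X (steklov U h t) (fun j => steklov (G j) h t) (steklov N h t))
    hF hL ?_ ht
  · simpa only [steklov_zero] using this
  intro h t h0 hct htd
  have dU := hasDerivAt_steklov H.cU h0.ne' t
  have dG := fun j => hasDerivAt_steklov (H.cG j) h0.ne' t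
  set w := steklov U h t with hw
  set g := fun j => steklov (G j) h t with hg
  set w' : L2 := h⁻¹ • (U (t + h) - U t) with hw'
  set g' : Fin 2 → L2 := fun j => h⁻¹ • (G j (t + h) - G j t) with hg'
  set n := steklov N h t with hn
  have P : H1Pair w (fun j => g j) := H.pair_steklov h t
  have P' : H1Pair w' (fun j => g' j) := H.pair_diff h t
  have hdiv : WeakDiv Ω (fun j => g j) (n - Complex.I • w' : L2) := H.weakDiv h0 hct htd
  have hr := rellich hΩ P hdiv (Lp.memLp _) hX hs
  have hder : HasDerivAt (fun t => mom X (steklov U h t) (fun j => steklov (G j) h t))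
      (∑ j, (ip (X j) w (g' j) + ip (X j) w' (g j)).im) t := by
    refine HasDerivAt.fun_sum fun j _ => ?_
    exact Complex.imCLM.hasFDerivAt.comp_hasDerivAt t (hasDerivAt_ip (hX j).isBdd dU (dG j))
  convert hder using 1
  -- Integration by parts removes the gradient from the difference quotient, leaving only pairings
  -- that occur in Rellich's identity.
  have hi : ∀ j, ip (pd j (X j)) w w' = -(ip (X j) (g j) w' + ip (X j) w (g' j)) := fun j =>
    ip_pd_eq P P' (hX j).contDiff (hX j).isBdd j ((hX j).pd j).isBdd
  have hc : ∀ j, ip (X j) w' (g j) = starRingEnd ℂ (ip (X j) (g j) w') := fun j => ip_conj _ _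
  have e1 : ∀ j, ip (X j) w (g' j) = -ip (pd j (X j)) w w' - ip (X j) (g j) w' := fun j => by
    rw [hi]; ring
  simp only [hc, e1]
  change momDeriv X w (fun j => g j) n = _
  rw [ip_sub_smul_I hD.isBdd (Lp.memLp w)] at hr
  simp only [fun j => ip_sub_smul_I (hX j).isBdd (Lp.memLp (g j)) n w',
    ip_dv hX (Lp.memLp w) (Lp.memLp w')] at hr
  simp only [momDeriv, ip_dv hX (Lp.memLp w) (Lp.memLp n)] at hr ⊢
  simp only [Fin.sum_univ_two, Complex.add_re, Complex.mul_re, Complex.re_ofNat, Complex.im_ofNat,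
    Complex.sub_re, Complex.I_re, Complex.I_im, Complex.add_im, Complex.neg_im, Complex.sub_im,
    Complex.conj_im, Complex.mul_im] at hr ⊢
  linarith

/-- The averaged equation is tested against ψ times the conjugate of the mean. In imaginary parts
the terms ψ|∇w|² drop out. -/
theorem WeakSchr.hasDerivAt_mass (H : WeakSchr Ω c d U G N) {ψ : Plane → ℝ} (hψ : IsTest ψ)
    (hs : tsupport ψ ⊆ Ω) {t : ℝ} (ht : t ∈ Set.Ioo c d) :
    HasDerivAt (fun t => (ip ψ (U t) (U t)).re)
      (2 * ((∑ j, (ip (pd j ψ) (U t) (G j t)).im) + (ip ψ (U t) (N t)).im)) t := by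
  have cU := continuous_steklov H.cU
  have cG := fun j => continuous_steklov (H.cG j)
  have cN := continuous_steklov H.cN
  have hF : Continuous fun z : ℝ × ℝ => (ip ψ (steklov U z.1 z.2) (steklov U z.1 z.2)).re :=
    Complex.continuous_re.comp (continuous_ip hψ.isBdd cU cU)
  have hL : Continuous fun z : ℝ × ℝ =>
      2 * ((∑ j, (ip (pd j ψ) (steklov U z.1 z.2) (steklov (G j) z.1 z.2)).im)
        + (ip ψ (steklov U z.1 z.2) (steklov N z.1 z.2)).im) :=
    continuous_const.mul ((continuous_finsetSum _ fun j _ => Complex.continuous_im.comp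
      (continuous_ip (hψ.pd j).isBdd cU (cG j))).add
      (Complex.continuous_im.comp (continuous_ip hψ.isBdd cU cN)))
  have := hasDerivAt_of_parametric (c := c) (d := d)
    (F := fun h t => (ip ψ (steklov U h t) (steklov U h t)).re)
    (L := fun h t => 2 * ((∑ j, (ip (pd j ψ) (steklov U h t) (steklov (G j) h t)).im)
      + (ip ψ (steklov U h t) (steklov N h t)).im)) hF hL ?_ ht
  · simpa only [steklov_zero] using this
  intro h t h0 hct htd
  have dU := hasDerivAt_steklov H.cU h0.ne' t
  set w := steklov U h t with hw
  set g := fun j => steklov (G j) h t with hg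
  set w' : L2 := h⁻¹ • (U (t + h) - U t) with hw'
  set n := steklov N h t with hn
  have P : H1Pair w (fun j => g j) := H.pair_steklov h t
  have hdiv : WeakDiv Ω (fun j => g j) (n - Complex.I • w' : L2) := H.weakDiv h0 hct htd
  have hr := WeakDiv.ip_eq P hdiv (Lp.memLp _) hψ hs
  have hder : HasDerivAt (fun t => (ip ψ (steklov U h t) (steklov U h t)).re)
      (ip ψ w w' + ip ψ w' w).re t :=
    Complex.reCLM.hasFDerivAt.comp_hasDerivAt t (hasDerivAt_ip hψ.isBdd dU dU)
  convert hder using 1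
  rw [ip_sub_smul_I hψ.isBdd (Lp.memLp w)] at hr
  have hc : ip ψ w' w = starRingEnd ℂ (ip ψ w w') := ip_conj _ _
  have hc' : ∀ j, (ip ψ (g j) (g j)).im = 0 := fun j => by
    have := congrArg Complex.im (ip_conj (b := ψ) (g j) (g j))
    rw [Complex.conj_im] at this
    linarith
  have hr' := congrArg Complex.im hr
  rw [hc]
  simp only [Fin.sum_univ_two, Complex.sub_im, Complex.mul_im, Complex.I_re, Complex.I_im,
    Complex.neg_im, Complex.add_im, hc', Complex.add_re, Complex.conj_re] at hr' ⊢
  linarith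

end WeakSchrodinger

/-! ### Uniqueness of weak gradients and the homogeneous norm. -/

section WeakGradient

theorem isWeakGradient_h1Pair {f : Plane → ℂ} {G : Plane → EuclideanSpace ℂ (Fin 2)}
    (h : IsWeakGradient f G) (hf : MemLp f 2) (hG : MemLp G 2) :
    H1Pair f (fun j x => G x j) where
  memLp := hf
  memLp_grad j := by
    refine hG.of_le ?_ (ae_of_all _ fun x => PiLp.norm_apply_le (G x) j)
    exact ((EuclideanSpace.proj j : EuclideanSpace ℂ (Fin 2) →L[ℂ] ℂ).continuous).comp_aestronglyMeasurable
      hG.aestronglyMeasurable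
  weak φ hφ j := h.integral_eq φ hφ.contDiff hφ.compact j

theorem locallyIntegrable_coord {G : Plane → EuclideanSpace ℂ (Fin 2)}
    (h : LocallyIntegrable G volume) (j : Fin 2) : LocallyIntegrable (fun x => G x j) volume := by
  intro x
  obtain ⟨s, hs, hi⟩ := h x
  exact ⟨s, hs, (EuclideanSpace.proj j : EuclideanSpace ℂ (Fin 2) →L[ℂ] ℂ).integrable_comp hi⟩

theorem isWeakGradient_unique {f : Plane → ℂ} {G G' : Plane → EuclideanSpace ℂ (Fin 2)}
    (h : IsWeakGradient f G) (h' : IsWeakGradient f G') : G =ᵐ[volume] G' := by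
  have hj : ∀ j, (fun x => G x j) =ᵐ[volume] fun x => G' x j := by
    intro j
    refine ae_eq_of_integral_contDiff_smul_eq (locallyIntegrable_coord h.locallyIntegrable_grad j)
      (locallyIntegrable_coord h'.locallyIntegrable_grad j) fun φ hφ hc => ?_
    have h1 := h.integral_eq φ hφ hc j
    have h2 := h'.integral_eq φ hφ hc j
    rw [h1] at h2
    exact neg_injective h2
  filter_upwards [hj 0, hj 1] with x h0 h1
  ext i
  fin_cases i
  · exact h0
  · exact h1

theorem hDotOneNorm_eq {f : Plane → ℂ} {G : Plane → EuclideanSpace ℂ (Fin 2)}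
    (h : IsWeakGradient f G) : hDotOneNorm f = eLpNorm G 2 volume := by
  refine le_antisymm (iInf₂_le G h) (le_iInf₂ fun G' h' => ?_)
  exact (eLpNorm_congr_ae (isWeakGradient_unique h h')).le

theorem isWeakGradient_sub {f f' : Plane → ℂ} {G G' : Plane → EuclideanSpace ℂ (Fin 2)}
    (h : IsWeakGradient f G) (h' : IsWeakGradient f' G') :
    IsWeakGradient (fun x => f x - f' x) (fun x => G x - G' x) where
  locallyIntegrable_fun := h.locallyIntegrable_fun.sub h'.locallyIntegrable_fun
  locallyIntegrable_grad := h.locallyIntegrable_grad.sub h'.locallyIntegrable_grad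
  integral_eq φ hφ hc j := by
    have ht : IsTest φ := ⟨hφ, hc⟩
    have i : ∀ {ψ : Plane → ℝ} {F : Plane → ℂ}, IsTest ψ → LocallyIntegrable F volume →
        Integrable (fun x => ψ x • F x) := fun hψ hF =>
      hF.integrable_smul_left_of_hasCompactSupport hψ.continuous hψ.compact
    simp only [smul_sub, PiLp.sub_apply]
    have e1 := integral_sub (i (ht.pd j) h.locallyIntegrable_fun) (i (ht.pd j) h'.locallyIntegrable_fun)
    have e2 := integral_sub (i ht (locallyIntegrable_coord h.locallyIntegrable_grad j))
      (i ht (locallyIntegrable_coord h'.locallyIntegrable_grad j))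
    simp only [pd] at e1
    rw [e1, e2, h.integral_eq φ hφ hc, h'.integral_eq φ hφ hc]
    ring

end WeakGradient

/-! ### Derivatives of radial functions. -/

section Radial

theorem pd_coord (i j : Fin 2) (x : Plane) : pd j (fun x : Plane => x i) x = if i = j then 1 else 0 := by
  have : HasFDerivAt (fun x : Plane => x i) (EuclideanSpace.proj i : Plane →L[ℝ] ℝ) x :=
    (EuclideanSpace.proj i : Plane →L[ℝ] ℝ).hasFDerivAt
  rw [pd, this.fderiv]
  simp

theorem contDiff_coord (i : Fin 2) : ContDiff ℝ ∞ (fun x : Plane => x i) :=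
  (EuclideanSpace.proj i : Plane →L[ℝ] ℝ).contDiff

theorem pd_radial {h : ℝ → ℝ} {h' : ℝ} {x : Plane} (hh : HasDerivAt h h' (‖x‖ ^ 2)) (j : Fin 2) :
    pd j (fun x : Plane => h (‖x‖ ^ 2)) x = h' * (2 * x j) := by
  have h1 : HasFDerivAt (fun x : Plane => ‖x‖ ^ 2) (2 • innerSL ℝ x) x :=
    (hasStrictFDerivAt_norm_sq x).hasFDerivAt
  have h2 := hh.comp_hasFDerivAt x h1
  rw [pd, show (fun x : Plane => h (‖x‖ ^ 2)) = h ∘ fun x => ‖x‖ ^ 2 from rfl, h2.fderiv]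
  simp [EuclideanSpace.inner_single_right]

theorem norm_sq_eq (x : Plane) : ‖x‖ ^ 2 = x 0 ^ 2 + x 1 ^ 2 := by
  simp [EuclideanSpace.norm_sq_eq, Fin.sum_univ_two]

end Radial

/-! ### The virial functional: contributions of the potential and of the nonlinearity. -/

section Flow

/-- The virial functional of the vector field `X`, which is the time derivative of the momentum. -/
noncomputable def virial (a p : ℝ) (X : Fin 2 → Plane → ℝ) (f : Plane → ℂ)
    (g : Fin 2 → Plane → ℂ) : ℝ :=
  (∑ j, ∑ k, 2 * ip (pd k (X j)) (g j) (g k) + ∑ k, ip (pd k (dv X)) f (g k)).re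
    + 2 * a * (ip (fun x => (∑ j, X j x * x j) / ‖x‖ ^ 4) f f).re
    + p / (p + 2) * (ip (dv X) f (nl p f)).re

/-- Continuous curves in `H¹` which satisfy the local conservation laws of mass and momentum of the
nonlinear Schrödinger equation with inverse square potential, away from the origin. -/
structure Flow (a p c d : ℝ) (U : ℝ → L2) (G : Fin 2 → ℝ → L2) : Prop where
  cU : Continuous U
  cG : ∀ j, Continuous (G j)
  pair : ∀ t, H1Pair (U t) (fun j => G j t)
  mass : ∀ ψ : Plane → ℝ, IsTest ψ → (0 : Plane) ∉ tsupport ψ → ∀ t ∈ Set.Ioo c d,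
    HasDerivAt (fun t => (ip ψ (U t) (U t)).re) (2 * ∑ j, (ip (pd j ψ) (U t) (G j t)).im) t
  momentum : ∀ X : Fin 2 → Plane → ℝ, (∀ j, IsTest (X j)) → (∀ j, (0 : Plane) ∉ tsupport (X j)) →
    ∀ t ∈ Set.Ioo c d, HasDerivAt (fun t => mom X (U t) (fun j => G j t))
      (virial a p X (U t) (fun j => G j t)) t

/-- The inverse square potential, truncated near the origin. -/
noncomputable def truncPot (a ε : ℝ) (x : Plane) : ℝ := if ε ≤ ‖x‖ then a / ‖x‖ ^ 2 else 0

theorem isBdd_truncPot (a : ℝ) {ε : ℝ} (hε : 0 < ε) : IsBdd (truncPot a ε) := by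
  refine ⟨?_, |a| / ε ^ 2, fun x => ?_⟩
  · exact Measurable.ite (measurableSet_le measurable_const measurable_norm)
      (measurable_const.div (measurable_norm.pow_const 2)) measurable_const
  · unfold truncPot
    split_ifs with h
    · rw [abs_div, abs_of_nonneg (sq_nonneg ‖x‖)]
      gcongr
    · rw [abs_zero]; positivity

theorem exists_mulL {b : Plane → ℝ} (hb : IsBdd b) :
    ∃ l : L2 → L2, Continuous l ∧ ∀ F : L2, l F =ᵐ[volume] fun x => b x • F x := by
  obtain ⟨C, hC⟩ := hb.bounded
  let l : L2 → L2 := fun F => (hb.memLp_smul (Lp.memLp F)).toLp _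
  have hl : ∀ F : L2, l F =ᵐ[volume] fun x => b x • F x := fun F => MemLp.coeFn_toLp _
  refine ⟨l, ?_, hl⟩
  refine LipschitzWith.continuous (K := ⟨|C|, abs_nonneg C⟩) (LipschitzWith.of_dist_le_mul ?_)
  intro F F'
  rw [dist_eq_norm, dist_eq_norm]
  refine Lp.norm_le_mul_norm_of_ae_le_mul ?_
  filter_upwards [hl F, hl F', Lp.coeFn_sub (l F) (l F'), Lp.coeFn_sub F F'] with x h1 h2 h3 h4
  rw [h3, h4, Pi.sub_apply, Pi.sub_apply, h1, h2, ← smul_sub, norm_smul]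
  gcongr
  exact (hC x).trans (le_abs_self C)

theorem tendsto_eLpNorm_coe_sub {F : ℝ → L2} {t : ℝ} (hF : ContinuousAt F t) :
    Tendsto (fun s => eLpNorm (fun x => F s x - F t x) 2 volume) (𝓝 t) (𝓝 0) := by
  have h : Tendsto (fun s => ‖F s - F t‖ₑ) (𝓝 t) (𝓝 0) := by
    have := (hF.sub continuousAt_const : ContinuousAt (fun s => F s - F t) t).enorm
    simpa [ContinuousAt] using this
  refine h.congr fun s => ?_
  rw [Lp.enorm_def]
  exact eLpNorm_congr_ae (Lp.coeFn_sub _ _)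

theorem exists_nlL {p : ℝ} (hp : 1 ≤ p) {U : ℝ → L2} {G : Fin 2 → ℝ → L2} (cU : Continuous U)
    (cG : ∀ j, Continuous (G j)) (hP : ∀ t, H1Pair (U t) (fun j => G j t)) :
    ∃ N : ℝ → L2, Continuous N ∧ ∀ t, N t =ᵐ[volume] nl p (U t) := by
  refine ⟨fun t => ((hP t).memLp_nl hp).toLp _, ?_, fun t => MemLp.coeFn_toLp _⟩
  refine continuous_iff_continuousAt.2 fun t => ?_
  refine (Lp.tendsto_Lp_iff_tendsto_eLpNorm'' _ (fun s => (hP s).memLp_nl hp) _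
    ((hP t).memLp_nl hp)).2 ?_
  exact tendsto_nl hp (hP t) hP (tendsto_eLpNorm_coe_sub cU.continuousAt)
    fun j => tendsto_eLpNorm_coe_sub (cG j).continuousAt

theorem contDiff_mul_of_support {V : Plane → ℝ} {X : Plane → ℝ} (hX : IsTest X)
    (hV : ∀ x ∈ tsupport X, ContDiffAt ℝ ∞ V x) : IsTest (fun x => V x * X x) := by
  refine ⟨contDiff_iff_contDiffAt.2 fun x => ?_, hX.compact.mul_left⟩
  by_cases hx : x ∈ tsupport X
  · exact (hV x hx).mul hX.contDiff.contDiffAt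
  · have : (fun x => V x * X x) =ᶠ[𝓝 x] fun _ => 0 := by
      filter_upwards [(isClosed_tsupport X).isOpen_compl.mem_nhds hx] with y hy
      rw [image_eq_zero_of_notMem_tsupport hy, mul_zero]
    exact contDiffAt_const.congr_of_eventuallyEq this

theorem hasDerivAt_div (a : ℝ) {q : ℝ} (hq : q ≠ 0) : HasDerivAt (fun q => a / q) (-a / q ^ 2) q := by
  have := (hasDerivAt_inv hq).const_mul a
  simpa [div_eq_mul_inv] using! this

/-- With V = a/|x|² the left side is ∫ div(VX)|f|² + VX·∇|f|² minus ∫ X·∇V|f|². The first two cancel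
after integration by parts, and ∇V = -2a x/|x|⁴. On the support of X the truncated potential equals
V. -/
theorem virial_potential {X : Fin 2 → Plane → ℝ} (hX : ∀ j, IsTest (X j)) {ε a : ℝ} (hε : 0 < ε)
    (hs : ∀ j, tsupport (X j) ⊆ {x | ε < ‖x‖}) {f : Plane → ℂ} {g : Fin 2 → Plane → ℂ}
    (h : H1Pair f g) :
    (∑ j, 2 * ip (X j) (g j) (fun x => truncPot a ε x • f x)
      + ip (dv X) f (fun x => truncPot a ε x • f x)).re
      = 2 * a * (ip (fun x => (∑ j, X j x * x j) / ‖x‖ ^ 4) f f).re := by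
  let V : Plane → ℝ := fun x => a / ‖x‖ ^ 2
  have hV : ∀ j, ∀ x ∈ tsupport (X j), ContDiffAt ℝ ∞ V x := by
    intro j x hx
    have h0 : 0 < ‖x‖ := hε.trans (hs j hx)
    have : ‖x‖ ^ 2 ≠ 0 := by positivity
    exact contDiffAt_const.div (contDiff_norm_sq ℝ).contDiffAt this
  let φ : Fin 2 → Plane → ℝ := fun j x => V x * X j x
  have hφ : ∀ j, IsTest (φ j) := fun j => contDiff_mul_of_support (hX j) (hV j)
  have hpd : ∀ j x, pd j (φ j) x = truncPot a ε x * pd j (X j) x + (-2 * a) * (X j x * x j / ‖x‖ ^ 4) := by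
    intro j x
    by_cases hx : x ∈ tsupport (X j)
    · have hx' : ε < ‖x‖ := hs j hx
      have hn : 0 < ‖x‖ := hε.trans hx'
      have hn2 : ‖x‖ ^ 2 ≠ 0 := by positivity
      have hd : pd j V x = -a / (‖x‖ ^ 2) ^ 2 * (2 * x j) :=
        pd_radial (h := fun q => a / q) (hasDerivAt_div a hn2) j
      rw [pd_mul j ((hV j x hx).differentiableAt (by simp))
        (differentiable_of_contDiff (hX j).contDiff x), hd, truncPot, if_pos hx'.le]
      simp only [V]
      field_simp
    · have h1 : pd j (φ j) x = 0 := image_eq_zero_of_notMem_tsupport fun h' =>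
        hx ((tsupport_mul_subset_right) (tsupport_pd_subset j _ h'))
      have h2 : pd j (X j) x = 0 := image_eq_zero_of_notMem_tsupport fun h' =>
        hx (tsupport_pd_subset j _ h')
      rw [h1, h2, image_eq_zero_of_notMem_tsupport hx]
      simp
  have hb : ∀ j, IsBdd (fun x => X j x * x j / ‖x‖ ^ 4) := by
    intro j
    have : (fun x : Plane => X j x * x j / ‖x‖ ^ 4) = fun x : Plane => (‖x‖ ^ 4)⁻¹ * (X j x * x j) := by
      funext x; rw [div_eq_mul_inv, mul_comm]
    rw [this]
    refine (contDiff_mul_of_support ((hX j).mul (contDiff_coord j)) fun x hx => ?_).isBdd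
    have hx' : ε < ‖x‖ := hs j (tsupport_mul_subset_left hx)
    have hn : 0 < ‖x‖ := hε.trans hx'
    have h4 : (‖x‖ ^ 2) ^ 2 ≠ 0 := by positivity
    have e : (fun x : Plane => (‖x‖ ^ 4)⁻¹) = fun x : Plane => ((‖x‖ ^ 2) ^ 2)⁻¹ := by
      funext x; ring
    rw [e]
    exact ContDiffAt.inv (((contDiff_norm_sq ℝ).pow 2).contDiffAt) h4
  have htb := isBdd_truncPot a hε
  have hvf : MemLp (fun x => truncPot a ε x • f x) 2 := htb.memLp_smul h.memLp
  have hφV : ∀ j, ip (X j) (g j) (fun x => truncPot a ε x • f x) = ip (φ j) (g j) f := by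
    intro j
    refine integral_congr_ae (ae_of_all _ fun x => ?_)
    by_cases hx : x ∈ tsupport (X j)
    · have hx' : ε < ‖x‖ := hs j hx
      simp only [truncPot, if_pos hx'.le, φ, V, Complex.real_smul]
      push_cast
      ring
    · simp [φ, image_eq_zero_of_notMem_tsupport hx]
  have hibp : ∀ j, (ip (pd j (φ j)) f f).re = -2 * (ip (φ j) (g j) f).re := by
    intro j
    have e := ip_pd_eq h h (hφ j).contDiff (hφ j).isBdd j ((hφ j).pd j).isBdd
    have e2 : ip (φ j) f (g j) = starRingEnd ℂ (ip (φ j) (g j) f) := ip_conj _ _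
    rw [e, e2]
    simp
    ring
  have hre : ∀ {b : Plane → ℝ} {F F' : Plane → ℂ}, IsBdd b → MemLp F 2 → MemLp F' 2 →
      HasInt (fun x => (b x • (starRingEnd ℂ (F x) * F' x)).re) (ip b F F').re := fun hb hF hF' =>
    ⟨(integrable_ip hb hF hF').re, integral_re (integrable_ip hb hF hF')⟩
  have t1 : ∀ j, HasInt _ _ := fun j => hre ((hφ j).pd j).isBdd h.memLp h.memLp
  have t2 : ∀ j, HasInt _ _ := fun j => hre ((hX j).pd j).isBdd h.memLp hvf
  have t3 : ∀ j, HasInt _ _ := fun j => hre (hb j) h.memLp h.memLp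
  have hsum : ∀ j, (ip (pd j (φ j)) f f).re
      = (ip (pd j (X j)) f (fun x => truncPot a ε x • f x)).re
        + (-2 * a) * (ip (fun x => X j x * x j / ‖x‖ ^ 4) f f).re := by
    intro j
    refine (t1 j).unique (((t2 j).add ((t3 j).const_mul (-2 * a))).congr fun x => ?_)
    rw [hpd]
    simp only [Complex.real_smul, Complex.mul_re, Complex.mul_im, Complex.ofReal_re,
      Complex.ofReal_im, Complex.conj_re, Complex.conj_im]
    ring
  have hb' : IsBdd (fun x => (∑ j, X j x * x j) / ‖x‖ ^ 4) := by
    obtain ⟨C0, h0⟩ := (hb 0).bounded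
    obtain ⟨C1, h1⟩ := (hb 1).bounded
    have e : (fun x => (∑ j, X j x * x j) / ‖x‖ ^ 4)
        = fun x => X 0 x * x 0 / ‖x‖ ^ 4 + X 1 x * x 1 / ‖x‖ ^ 4 := by
      funext x; rw [Fin.sum_univ_two, add_div]
    rw [e]
    exact ⟨(hb 0).measurable.add (hb 1).measurable, C0 + C1,
      fun x => (abs_add_le _ _).trans (add_le_add (h0 x) (h1 x))⟩
  have hpot : (ip (fun x => (∑ j, X j x * x j) / ‖x‖ ^ 4) f f).re
      = ∑ j, (ip (fun x => X j x * x j / ‖x‖ ^ 4) f f).re := by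
    refine (hre hb' h.memLp h.memLp).unique ((HasInt.sum t3).congr fun x => ?_)
    simp only [Fin.sum_univ_two, add_div, add_smul, Complex.add_re]
  rw [hpot]
  have := hsum 0
  have := hsum 1
  have := hibp 0
  have := hibp 1
  rw [ip_dv hX h.memLp hvf]
  simp only [Fin.sum_univ_two, hφV, Complex.add_re, Complex.mul_re, Complex.re_ofNat,
    Complex.im_ofNat, zero_mul, sub_zero] at *
  linarith

/-- By the chain rule, 2X·∇f̄ paired with |f|^p f contributes -2/(p+2) times the divergence term,
and 1 - 2/(p+2) = p/(p+2). -/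
theorem virial_nonlinear {X : Fin 2 → Plane → ℝ} (hX : ∀ j, IsTest (X j)) {p : ℝ} (hp : 1 ≤ p)
    {f : Plane → ℂ} {g : Fin 2 → Plane → ℂ} (h : H1Pair f g) :
    (∑ j, 2 * ip (X j) (g j) (nl p f) + ip (dv X) f (nl p f)).re
      = p / (p + 2) * (ip (dv X) f (nl p f)).re := by
  have hc : ∀ j, (ip (X j) (g j) (nl p f)).re = (ip (X j) (nl p f) (g j)).re := fun j => by
    rw [ip_conj (nl p f) (g j), Complex.conj_re]
  have h0 := h.ip_pd_nl hp (hX 0) 0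
  have h1 := h.ip_pd_nl hp (hX 1) 1
  rw [ip_dv hX h.memLp (h.memLp_nl hp)]
  simp only [Fin.sum_univ_two, Complex.add_re, Complex.mul_re, Complex.re_ofNat,
    Complex.im_ofNat, zero_mul, sub_zero, hc]
  have hp2 : p + 2 ≠ 0 := by linarith
  rw [h0, h1]
  field_simp
  ring

end Flow

/-! ### From an H¹ solution to curves in L² obeying the conservation laws. -/

section Construction

theorem eLpNorm_two_sq (f : Plane → ℂ) : eLpNorm f 2 volume ^ 2 = ∫⁻ x, ‖f x‖ₑ ^ 2 := by
  have := eLpNorm_nnreal_pow_eq_lintegral (f := f) (μ := (volume : Measure Plane)) (p := 2)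
    (by norm_num)
  simpa using! this

theorem eLpNorm_euclidean_sq {G : Plane → EuclideanSpace ℂ (Fin 2)} (hG : AEStronglyMeasurable G) :
    eLpNorm G 2 volume ^ 2 = ∑ j, eLpNorm (fun x => G x j) 2 volume ^ 2 := by
  have h1 : eLpNorm G 2 volume ^ 2 = ∫⁻ x, ‖G x‖ₑ ^ 2 := by
    have := eLpNorm_nnreal_pow_eq_lintegral (f := G) (μ := (volume : Measure Plane)) (p := 2)
      (by norm_num)
    simpa using! this
  have hm : ∀ j : Fin 2, AEMeasurable (fun x => ‖G x j‖ₑ ^ 2) := fun j =>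
    ((EuclideanSpace.proj j : EuclideanSpace ℂ (Fin 2) →L[ℂ] ℂ).continuous.comp_aestronglyMeasurable
      hG).enorm.pow_const 2
  simp only [h1, eLpNorm_two_sq]
  rw [Fin.sum_univ_two, ← lintegral_add_left' (hm 0)]
  refine lintegral_congr fun x => ?_
  rw [← ofReal_norm, ← ofReal_norm, ← ofReal_norm, ← ENNReal.ofReal_pow (norm_nonneg _),
    ← ENNReal.ofReal_pow (norm_nonneg _), ← ENNReal.ofReal_pow (norm_nonneg _),
    ← ENNReal.ofReal_add (by positivity) (by positivity), EuclideanSpace.norm_sq_eq,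
    Fin.sum_univ_two]

theorem ofReal_norm_sq_eq (F : L2) : ENNReal.ofReal (‖F‖ ^ 2) = eLpNorm F 2 volume ^ 2 := by
  rw [ENNReal.ofReal_pow (norm_nonneg _), ofReal_norm, Lp.enorm_def]

theorem exists_isWeakGradient {f : Plane → ℂ} (h : MemH1 f) :
    ∃ G, IsWeakGradient f G ∧ MemLp G 2 volume := h.2

/-- On test functions supported in |x| > ε the potential may be truncated, which makes the whole
forcing an L² function. At interior times the derivative within I is a genuine derivative. -/
theorem weakSchr_of_solution {a p : ℝ} {I : Set ℝ} {u : ℝ → Plane → ℂ}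
    (hu : IsH1Solution a p I u) {c d : ℝ} (hI : Set.Icc c d ⊆ I) {U : ℝ → L2}
    {G : Fin 2 → ℝ → L2} {Vl : L2 → L2} {N : ℝ → L2} {ε : ℝ}
    (cU : Continuous U) (cG : ∀ j, Continuous (G j)) (cV : Continuous Vl) (cN : Continuous N)
    (pair : ∀ t, H1Pair (U t) (fun j => G j t))
    (hV : ∀ F : L2, Vl F =ᵐ[volume] fun x => truncPot a ε x • F x)
    (hN : ∀ t, N t =ᵐ[volume] nl p (U t))
    (hUu : ∀ t ∈ Set.Icc c d, U t =ᵐ[volume] u t) (hε : 0 < ε) :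
    WeakSchr {x | ε < ‖x‖} c d U G (fun t => Vl (U t) + N t) where
  cU := cU
  cG := cG
  cN := (cV.comp cU).add cN
  pair := pair
  eq ψ hψ hs t ht := by
    have h0 : (0 : Plane) ∉ tsupport ψ := fun h => by
      have : ε < ‖(0 : Plane)‖ := hs h
      rw [norm_zero] at this
      exact this.not_gt hε
    have htI : t ∈ Set.Icc c d := Set.Ioo_subset_Icc_self ht
    obtain ⟨D, hD, e⟩ := hu.equation ψ hψ.contDiff hψ.compact h0 t (hI htI)
    have hn : Set.Icc c d ∈ 𝓝 t := Icc_mem_nhds ht.1 ht.2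
    have hD' := hD.hasDerivAt (mem_of_superset hn hI)
    have hD2 : HasDerivAt (fun s => ∫ x, ψ x • U s x) D t := by
      refine hD'.congr_of_eventuallyEq ?_
      filter_upwards [hn] with s hs
      refine integral_congr_ae ?_
      filter_upwards [hUu s hs] with x hx
      rw [hx]
    convert hD2 using 1
    have hut := hUu t htI
    have i1 : ∀ {F : Plane → ℂ} {φ : Plane → ℝ}, IsTest φ → MemLp F 2 volume →
        Integrable (fun x => φ x • F x) := fun hφ hF =>
      (hF.locallyIntegrable (by norm_num)).integrable_smul_left_of_hasCompactSupport hφ.continuous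
        hφ.compact
    have eL : ∫ x, Laplacian.laplacian ψ x • u t x = -(∑ j, ∫ x, pd j ψ x • G j t x) := by
      have h1 : ∫ x, Laplacian.laplacian ψ x • u t x = ∫ x, ∑ j, pd j (pd j ψ) x • U t x := by
        refine integral_congr_ae ?_
        filter_upwards [hut] with x hx
        rw [hx, laplacian_eq_sum_pd hψ.contDiff, Finset.sum_smul]
      rw [h1, integral_finsetSum _ fun j _ => i1 ((hψ.pd j).pd j) (pair t).memLp,
        ← Finset.sum_neg_distrib]
      exact Finset.sum_congr rfl fun j _ => (pair t).weak _ (hψ.pd j) j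
    have eN : ∫ x, ψ x • (Vl (U t) + N t : L2) x
        = (∫ x, (a / ‖x‖ ^ 2 * ψ x) • u t x) + ∫ x, (‖u t x‖ ^ p * ψ x) • u t x := by
      have j1 := i1 hψ (Lp.memLp (Vl (U t)))
      have j2 := i1 hψ (Lp.memLp (N t))
      have e1 : ∫ x, ψ x • (Vl (U t) + N t : L2) x = ∫ x, (ψ x • Vl (U t) x + ψ x • N t x) := by
        refine integral_congr_ae ?_
        filter_upwards [Lp.coeFn_add (Vl (U t)) (N t)] with x hx
        rw [hx, Pi.add_apply, smul_add]
      rw [e1, integral_add j1 j2]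
      congr 1
      · refine integral_congr_ae ?_
        filter_upwards [hV (U t), hut] with x h1 h2
        by_cases hx : x ∈ tsupport ψ
        · have : ε < ‖x‖ := hs hx
          rw [h1, h2, truncPot, if_pos this.le, smul_smul, mul_comm]
        · rw [image_eq_zero_of_notMem_tsupport hx]
          simp
      · refine integral_congr_ae ?_
        filter_upwards [hN t, hut] with x h1 h2
        rw [h1, nl, h2, smul_smul, mul_comm]
    rw [← eL, eN]
    linear_combination Complex.I * e - D * Complex.I_mul_I

/-- The curve is frozen outside [c, d], so that it is continuous and bounded on the whole line and
each of its values is a value of `u` on [c, d]; the bounds by the supremum of the Ḣ¹ norm thus hold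
at all real times. -/
theorem exists_flow {a p : ℝ} (hp : 1 ≤ p) {I : Set ℝ} {u : ℝ → Plane → ℂ}
    (hu : IsH1Solution a p I u) {c d : ℝ} (hcd : c ≤ d) (hI : Set.Icc c d ⊆ I) :
    ∃ (U : ℝ → L2) (G : Fin 2 → ℝ → L2), Flow a p c d U G ∧
      (∃ B, (∀ t, ‖U t‖ ≤ B) ∧ ∀ j t, ‖G j t‖ ≤ B) ∧
      (∀ t, ∃ s ∈ Set.Icc c d, U t =ᵐ[volume] u s ∧
        ENNReal.ofReal (∑ j, ‖G j t‖ ^ 2) = hDotOneNorm (u s) ^ 2) ∧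
      ∀ t ∈ Set.Icc c d, U t =ᵐ[volume] u t := by
  have hmem : ∀ t : Set.Icc c d, MemH1 (u t) := fun t => hu.continuousInH1On.1 t (hI t.2)
  choose g hg hg2 using fun t => exists_isWeakGradient (hmem t)
  have P : ∀ t : Set.Icc c d, H1Pair (u t) (fun j x => g t x j) := fun t =>
    isWeakGradient_h1Pair (hg t) (hmem t).1 (hg2 t)
  let U0 : Set.Icc c d → L2 := fun t => (hmem t).1.toLp _
  let G0 : Fin 2 → Set.Icc c d → L2 := fun j t => ((P t).memLp_grad j).toLp _
  have hU0 : ∀ t, U0 t =ᵐ[volume] u t := fun t => MemLp.coeFn_toLp _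
  have hG0 : ∀ j t, G0 j t =ᵐ[volume] fun x => g t x j := fun j t => MemLp.coeFn_toLp _
  have hlim : ∀ t : Set.Icc c d,
      Tendsto (fun s : Set.Icc c d => hOneNorm (fun x => u s x - u t x)) (𝓝 t) (𝓝 0) := fun t =>
    (hu.continuousInH1On.2 t (hI t.2)).comp (tendsto_nhdsWithin_iff.2
      ⟨continuous_subtype_val.continuousAt, Eventually.of_forall fun s => hI s.2⟩)
  have cU0 : Continuous U0 := by
    refine continuous_iff_continuousAt.2 fun t => ?_
    refine (Lp.tendsto_Lp_iff_tendsto_eLpNorm'' _ (fun s => (hmem s).1) _ (hmem t).1).2 ?_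
    exact tendsto_of_tendsto_of_tendsto_of_le_of_le tendsto_const_nhds (hlim t)
      (fun _ => zero_le) fun s => le_self_add
  have cG0 : ∀ j, Continuous (G0 j) := by
    intro j
    refine continuous_iff_continuousAt.2 fun t => ?_
    refine (Lp.tendsto_Lp_iff_tendsto_eLpNorm'' _ (fun s => (P s).memLp_grad j) _
      ((P t).memLp_grad j)).2 ?_
    refine tendsto_of_tendsto_of_tendsto_of_le_of_le tendsto_const_nhds (hlim t)
      (fun _ => zero_le) fun s => ?_
    refine le_trans ?_ le_add_self
    rw [hDotOneNorm_eq (isWeakGradient_sub (hg s) (hg t))]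
    exact eLpNorm_mono fun x => PiLp.norm_apply_le (g s x - g t x) j
  let U : ℝ → L2 := fun t => U0 (Set.projIcc c d hcd t)
  let G : Fin 2 → ℝ → L2 := fun j t => G0 j (Set.projIcc c d hcd t)
  have cU : Continuous U := cU0.comp continuous_projIcc
  have cG : ∀ j, Continuous (G j) := fun j => (cG0 j).comp continuous_projIcc
  have pair0 : ∀ t, H1Pair (U0 t) (fun j => G0 j t) := by
    intro t
    refine ⟨Lp.memLp _, fun j => Lp.memLp _, fun φ hφ j => ?_⟩
    have e1 : ∫ x, pd j φ x • U0 t x = ∫ x, pd j φ x • u t x := integral_congr_ae (by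
      filter_upwards [hU0 t] with x hx; rw [hx])
    have e2 : ∫ x, φ x • G0 j t x = ∫ x, φ x • g t x j := integral_congr_ae (by
      filter_upwards [hG0 j t] with x hx; rw [hx])
    rw [e1, e2]
    exact (P t).weak φ hφ j
  have pair : ∀ t, H1Pair (U t) (fun j => G j t) := fun t => pair0 _
  have hUu : ∀ t ∈ Set.Icc c d, U t =ᵐ[volume] u t := by
    intro t ht
    have e : U t = U0 ⟨t, ht⟩ := congrArg U0 (Set.projIcc_of_mem hcd ht)
    rw [e]
    exact hU0 ⟨t, ht⟩
  have hB : ∃ B, (∀ t, ‖U t‖ ≤ B) ∧ ∀ j t, ‖G j t‖ ≤ B := by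
    obtain ⟨B, hB⟩ := isCompact_univ.exists_bound_of_continuousOn cU0.continuousOn
    obtain ⟨B0, h0⟩ := isCompact_univ.exists_bound_of_continuousOn (cG0 0).continuousOn
    obtain ⟨B1, h1⟩ := isCompact_univ.exists_bound_of_continuousOn (cG0 1).continuousOn
    refine ⟨max B (max B0 B1), fun t => (hB _ trivial).trans (le_max_left _ _), fun j t => ?_⟩
    fin_cases j
    · exact (h0 _ trivial).trans ((le_max_left _ _).trans (le_max_right _ _))
    · exact (h1 _ trivial).trans ((le_max_right _ _).trans (le_max_right _ _))
  refine ⟨U, G, ?_, hB, fun t => ⟨Set.projIcc c d hcd t, (Set.projIcc c d hcd t).2, hU0 _, ?_⟩, hUu⟩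
  swap
  · rw [hDotOneNorm_eq (hg _), eLpNorm_euclidean_sq (hg2 _).aestronglyMeasurable,
      ENNReal.ofReal_sum_of_nonneg fun _ _ => by positivity]
    refine Finset.sum_congr rfl fun j _ => ?_
    rw [ofReal_norm_sq_eq, eLpNorm_congr_ae (hG0 j _)]
  obtain ⟨N, cN, hN⟩ := exists_nlL hp cU cG pair
  -- The curves do not depend on ε; only the forcing does. Each test function then chooses an ε
  -- below the distance of its support from the origin.
  have key : ∀ ε > 0, ∃ N' : ℝ → L2, WeakSchr {x | ε < ‖x‖} c d U G N' ∧
      ∀ t, N' t =ᵐ[volume] fun x => truncPot a ε x • U t x + nl p (U t) x := by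
    intro ε hε
    obtain ⟨Vl, cV, hV⟩ := exists_mulL (isBdd_truncPot a hε)
    refine ⟨_, weakSchr_of_solution hu hI cU cG cV cN pair hV hN hUu hε, fun t => ?_⟩
    filter_upwards [Lp.coeFn_add (Vl (U t)) (N t), hV (U t), hN t] with x h1 h2 h3
    rw [h1, Pi.add_apply, h2, h3]
  have hsupp : ∀ {φ : Plane → ℝ}, (0 : Plane) ∉ tsupport φ → ∃ ε > 0, ∀ x ∈ tsupport φ, ε < ‖x‖ := by
    intro φ h0
    obtain ⟨ε, hε, hb⟩ := Metric.isOpen_iff.1 (isClosed_tsupport φ).isOpen_compl 0 h0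
    refine ⟨ε / 2, by positivity, fun x hx => ?_⟩
    by_contra hlt
    have : x ∈ Metric.ball (0 : Plane) ε := by rw [mem_ball_zero_iff]; linarith
    exact hb this hx
  refine ⟨cU, cG, pair, fun ψ hψ h0 t ht => ?_, fun X hX h0 t ht => ?_⟩
  · obtain ⟨ε, hε, hs⟩ := hsupp h0
    obtain ⟨N', hW, hN'⟩ := key ε hε
    have h := hW.hasDerivAt_mass hψ hs ht
    -- Potential and nonlinearity multiply U by real functions, so they are not sources of mass.
    have hz : (ip ψ (U t) (N' t)).im = 0 := by
      rw [ip_congr (ae_eq_refl _) (hN' t)]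
      have hi : Integrable (fun x => ψ x • (starRingEnd ℂ (U t x) * (truncPot a ε x • U t x + nl p (U t) x))) :=
        (integrable_ip hψ.isBdd (pair t).memLp ((memLp_congr_ae (hN' t)).1 (Lp.memLp _)))
      have : (ip ψ (U t) fun x => truncPot a ε x • U t x + nl p (U t) x).im
          = ∫ x, (ψ x • (starRingEnd ℂ (U t x) * (truncPot a ε x • U t x + nl p (U t) x))).im :=
        (integral_im hi).symm
      rw [this]
      refine integral_eq_zero_of_ae (ae_of_all _ fun x => ?_)
      simp only [nl, Complex.real_smul, Complex.mul_im, Complex.mul_re, Complex.add_re,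
        Complex.add_im, Complex.ofReal_re, Complex.ofReal_im, Complex.conj_re, Complex.conj_im,
        Pi.zero_apply]
      ring
    rw [hz, add_zero] at h
    exact h
  · obtain ⟨ε0, hε0, hs0⟩ := hsupp (h0 0)
    obtain ⟨ε1, hε1, hs1⟩ := hsupp (h0 1)
    let ε := min ε0 ε1
    have hε : 0 < ε := lt_min hε0 hε1
    have hs : ∀ j, tsupport (X j) ⊆ {x | ε < ‖x‖} := by
      intro j
      fin_cases j
      · exact fun x hx => (min_le_left _ _).trans_lt (hs0 x hx)
      · exact fun x hx => (min_le_right _ _).trans_lt (hs1 x hx)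
    obtain ⟨N', hW, hN'⟩ := key ε hε
    have h := hW.hasDerivAt_mom (isOpen_lt continuous_const continuous_norm) hX hs ht
    convert h using 1
    have hvf : MemLp (fun x => truncPot a ε x • U t x) 2 :=
      (isBdd_truncPot a hε).memLp_smul (pair t).memLp
    have hnf := (pair t).memLp_nl hp
    have hadd : ∀ {b : Plane → ℝ} {F : Plane → ℂ}, IsBdd b → MemLp F 2 →
        ip b F (N' t) = ip b F (fun x => truncPot a ε x • U t x) + ip b F (nl p (U t)) := by
      intro b F hb hF
      rw [ip_congr (ae_eq_refl _) (hN' t)]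
      unfold ip
      rw [← integral_add (integrable_ip hb hF hvf) (integrable_ip hb hF hnf)]
      refine integral_congr_ae (ae_of_all _ fun x => ?_)
      simp only [mul_add, smul_add]
    have e1 := virial_potential (a := a) hX hε hs (pair t)
    have e2 := virial_nonlinear hX hp (pair t)
    rw [virial, momDeriv, ← e1, ← e2, hadd (isTest_dv hX).isBdd (pair t).memLp]
    simp only [fun j => hadd (hX j).isBdd ((pair t).memLp_grad j)]
    simp only [Fin.sum_univ_two, mul_add, Complex.add_re]
    ring

end Construction

/-! ### Dyadic annuli and scale-invariant cutoffs. -/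

section Plateau

/-- The indicator function of the annulus `2⁻ᵏ < ‖x‖ < 2ᵏ`. -/
noncomputable def core (k : ℕ) (x : Plane) : ℝ :=
  if ((2 : ℝ) ^ k)⁻¹ < ‖x‖ ∧ ‖x‖ < 2 ^ k then 1 else 0

/-- A smooth function between the indicator functions of two dyadic annuli. -/
noncomputable def plateau (k : ℕ) (x : Plane) : ℝ :=
  cut (2 ^ (k + 1)) x * (1 - cut ((2 ^ (k + 1))⁻¹) x)

/-- The indicator function of a dyadic neighbourhood of the region where `plateau k` varies. -/
noncomputable def shell (k : ℕ) (x : Plane) : ℝ := core (k + 3) x - core k x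

theorem measurable_core (k : ℕ) : Measurable (core k) :=
  Measurable.ite ((measurableSet_lt measurable_const measurable_norm).inter
    (measurableSet_lt measurable_norm measurable_const)) measurable_const measurable_const

theorem core_nonneg (k : ℕ) (x : Plane) : 0 ≤ core k x := by unfold core; split_ifs <;> norm_num

theorem core_le_one (k : ℕ) (x : Plane) : core k x ≤ 1 := by unfold core; split_ifs <;> norm_num

theorem core_mono {k l : ℕ} (h : k ≤ l) (x : Plane) : core k x ≤ core l x := by
  have h1 : (2 : ℝ) ^ k ≤ 2 ^ l := pow_le_pow_right₀ (by norm_num) h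
  have h2 : ((2 : ℝ) ^ l)⁻¹ ≤ (2 ^ k)⁻¹ := inv_anti₀ (by positivity) h1
  by_cases hx : ((2 : ℝ) ^ k)⁻¹ < ‖x‖ ∧ ‖x‖ < 2 ^ k
  · rw [core, core, if_pos hx, if_pos ⟨h2.trans_lt hx.1, hx.2.trans_le h1⟩]
  · rw [core, if_neg hx]
    exact core_nonneg l x

theorem isBdd_core (k : ℕ) : IsBdd (core k) :=
  ⟨measurable_core k, 1, fun x => by rw [abs_of_nonneg (core_nonneg k x)]; exact core_le_one k x⟩

theorem shell_nonneg (k : ℕ) (x : Plane) : 0 ≤ shell k x :=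
  sub_nonneg.2 (core_mono (by omega) x)

theorem shell_le_core (k : ℕ) (x : Plane) : shell k x ≤ core (k + 3) x :=
  sub_le_self _ (core_nonneg k x)

theorem shell_le_one (k : ℕ) (x : Plane) : shell k x ≤ 1 :=
  (shell_le_core k x).trans (core_le_one _ x)

theorem isBdd_shell (k : ℕ) : IsBdd (shell k) :=
  ⟨(measurable_core _).sub (measurable_core _), 1, fun x => by
    rw [abs_of_nonneg (shell_nonneg k x)]; exact shell_le_one k x⟩

/-- The inner cutoff varies for 2^(-k-1) ≤ |x| ≤ 2^(-k). The strict inequalities in `core` exclude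
the endpoint 2^(-k) from `core k`, and 2^(-k-3) stays strictly below the range. -/
theorem shell_eq_one_of_inner {k : ℕ} {x : Plane} (h1 : 1 ≤ 2 ^ (k + 1) * ‖x‖)
    (h2 : 2 ^ (k + 1) * ‖x‖ ≤ 2) : shell k x = 1 := by
  have hk : (0 : ℝ) < 2 ^ k := by positivity
  have hk1 : (1 : ℝ) ≤ 2 ^ k := one_le_pow₀ (by norm_num)
  have e1 : (2 : ℝ) ^ (k + 1) = 2 * 2 ^ k := by ring
  have e3 : (2 : ℝ) ^ (k + 3) = 8 * 2 ^ k := by ring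
  rw [e1] at h1 h2
  have h2' : ‖x‖ ≤ (2 ^ k)⁻¹ := by
    rw [← one_div, le_div_iff₀ hk]; linarith
  have h3 : ((2 : ℝ) ^ (k + 3))⁻¹ < ‖x‖ := by
    rw [e3, ← one_div, div_lt_iff₀ (by positivity)]; linarith
  have h4 : ‖x‖ < 2 ^ (k + 3) := by
    rw [e3]
    have : ((2 : ℝ) ^ k)⁻¹ ≤ 1 := inv_le_one_of_one_le₀ hk1
    linarith
  rw [shell, core, core, if_pos ⟨h3, h4⟩, if_neg fun h => h2'.not_gt h.1, sub_zero]

theorem shell_eq_one_of_outer {k : ℕ} {x : Plane} (h1 : 1 ≤ ((2 : ℝ) ^ (k + 1))⁻¹ * ‖x‖)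
    (h2 : ((2 : ℝ) ^ (k + 1))⁻¹ * ‖x‖ ≤ 2) : shell k x = 1 := by
  have hk : (0 : ℝ) < 2 ^ k := by positivity
  have hk1 : (1 : ℝ) ≤ 2 ^ k := one_le_pow₀ (by norm_num)
  have e1 : (2 : ℝ) ^ (k + 1) = 2 * 2 ^ k := by ring
  have e3 : (2 : ℝ) ^ (k + 3) = 8 * 2 ^ k := by ring
  rw [e1, inv_mul_eq_div, le_div_iff₀ (by positivity)] at h1
  rw [e1, inv_mul_eq_div, div_le_iff₀ (by positivity)] at h2
  have h3 : ((2 : ℝ) ^ (k + 3))⁻¹ < ‖x‖ := by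
    have : ((2 : ℝ) ^ (k + 3))⁻¹ ≤ 1 := inv_le_one_of_one_le₀ (one_le_pow₀ (by norm_num))
    linarith
  have h4 : ‖x‖ < 2 ^ (k + 3) := by rw [e3]; linarith
  rw [shell, core, core, if_pos ⟨h3, h4⟩, if_neg fun h => (by linarith [h.2]), sub_zero]

theorem contDiff_plateau (k : ℕ) : ContDiff ℝ ∞ (plateau k) :=
  (contDiff_cut _).mul (contDiff_const.sub (contDiff_cut _))

theorem isTest_plateau (k : ℕ) : IsTest (plateau k) :=
  IsTest.mul' (contDiff_cut _) (isTest_one_sub_cut (by positivity))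

theorem plateau_nonneg (k : ℕ) (x : Plane) : 0 ≤ plateau k x :=
  mul_nonneg (cut_nonneg _ x) (sub_nonneg.2 (cut_le_one _ x))

theorem plateau_le_one (k : ℕ) (x : Plane) : plateau k x ≤ 1 := by
  have h1 := cut_le_one (2 ^ (k + 1)) x
  have h2 := cut_nonneg ((2 ^ (k + 1))⁻¹) x
  have h3 := cut_nonneg (2 ^ (k + 1)) x
  have h4 := cut_le_one ((2 ^ (k + 1))⁻¹) x
  unfold plateau
  nlinarith

theorem core_le_plateau (k : ℕ) (x : Plane) : core k x ≤ plateau k x := by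
  unfold core
  split_ifs with h
  · have hk : (0 : ℝ) < 2 ^ k := by positivity
    have e1 : (2 : ℝ) ^ (k + 1) = 2 * 2 ^ k := by ring
    have h1 : cut (2 ^ (k + 1)) x = 1 := cut_eq_one (by
      rw [abs_of_pos (by positivity), e1]
      have := h.1
      rw [← one_div, div_lt_iff₀ hk] at this
      linarith)
    have h2 : cut ((2 ^ (k + 1))⁻¹) x = 0 := cut_eq_zero (by
      rw [abs_of_pos (by positivity), e1, inv_mul_eq_div, div_le_one (by positivity)]
      linarith [h.2])
    rw [plateau, h1, h2]; norm_num
  · exact plateau_nonneg k x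

theorem plateau_le_core (k : ℕ) (x : Plane) : plateau k x ≤ core (k + 3) x := by
  have hk : (0 : ℝ) < 2 ^ k := by positivity
  have e1 : (2 : ℝ) ^ (k + 1) = 2 * 2 ^ k := by ring
  have e3 : (2 : ℝ) ^ (k + 3) = 8 * 2 ^ k := by ring
  unfold core
  split_ifs with h
  · exact plateau_le_one k x
  · rw [not_and_or, not_lt, not_lt] at h
    rcases h with h | h
    · rw [plateau, cut_eq_zero, zero_mul]
      rw [abs_of_pos (by positivity), e1]
      rw [e3, ← one_div, le_div_iff₀ (by positivity)] at h
      nlinarith [norm_nonneg x]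
    · rw [plateau, cut_eq_one (s := (2 ^ (k + 1))⁻¹), sub_self, mul_zero]
      rw [abs_of_pos (by positivity), e1, inv_mul_eq_div, le_div_iff₀ (by positivity)]
      rw [e3] at h
      linarith

theorem zero_notMem_tsupport_plateau (k : ℕ) : (0 : Plane) ∉ tsupport (plateau k) := by
  rw [notMem_tsupport_iff_eventuallyEq]
  have hc : Continuous fun x : Plane => |(2 : ℝ) ^ (k + 1)| * ‖x‖ := by fun_prop
  filter_upwards [hc.continuousAt.eventually_lt (continuousAt_const (y := (1 : ℝ))) (by simp)]
    with x hx
  rw [plateau, cut_eq_zero hx.le, zero_mul, Pi.zero_apply]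

/-- Each derivative of `cut s` costs a factor s, and derivatives live where 1 ≤ s|x| ≤ 2, so s is at
most 2/|x| there. For both values of s that region lies where the shell indicator is one. -/
theorem exists_plateau_bound : ∃ C, 0 < C ∧ ∀ (k : ℕ) (x : Plane) (i j : Fin 2),
    |pd j (plateau k) x| * ‖x‖ ≤ C * shell k x ∧
      |pd i (pd j (plateau k)) x| * ‖x‖ ^ 2 ≤ C * shell k x := by
  obtain ⟨C, hC, hb⟩ := exists_cut_bound
  have key : ∀ (k : ℕ) (s : ℝ), (s = 2 ^ (k + 1) ∨ s = (2 ^ (k + 1))⁻¹) → ∀ (x : Plane) (i j : Fin 2),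
      |pd j (cut s) x| * ‖x‖ ≤ 2 * C * shell k x ∧
        |pd i (pd j (cut s)) x| * ‖x‖ ^ 2 ≤ 4 * C * shell k x := by
    intro k s hs x i j
    have hs0 : 0 < s := by rcases hs with rfl | rfl <;> positivity
    by_cases h : |s| * ‖x‖ < 1 ∨ 2 < |s| * ‖x‖
    · rw [pd_cut_eq_zero h, pd_pd_cut_eq_zero h, abs_zero, zero_mul, zero_mul]
      have := shell_nonneg k x
      exact ⟨by positivity, by positivity⟩
    · rw [not_or, not_lt, not_lt] at h
      rw [abs_of_pos hs0] at h
      have hsh : shell k x = 1 := by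
        rcases hs with rfl | rfl
        · exact shell_eq_one_of_inner h.1 h.2
        · exact shell_eq_one_of_outer h.1 h.2
      obtain ⟨b1, b2⟩ := hb s x i j
      rw [abs_of_pos hs0] at b1
      rw [hsh]
      have hx := norm_nonneg x
      constructor
      · calc |pd j (cut s) x| * ‖x‖ ≤ C * s * ‖x‖ := by gcongr
          _ = C * (s * ‖x‖) := by ring
          _ ≤ C * 2 := by gcongr; exact h.2
          _ = 2 * C * 1 := by ring
      · calc |pd i (pd j (cut s)) x| * ‖x‖ ^ 2 ≤ C * s ^ 2 * ‖x‖ ^ 2 := by gcongr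
          _ = C * (s * ‖x‖) ^ 2 := by ring
          _ ≤ C * 2 ^ 2 := by gcongr; exact h.2
          _ = 4 * C * 1 := by ring
  refine ⟨8 * C + 8 * C ^ 2, by positivity, fun k x i j => ?_⟩
  set s := (2 : ℝ) ^ (k + 1) with hs
  obtain ⟨a1, a2⟩ := key k s (Or.inl rfl) x i j
  obtain ⟨b1, b2⟩ := key k s⁻¹ (Or.inr rfl) x i j
  obtain ⟨a1', -⟩ := key k s (Or.inl rfl) x j i
  obtain ⟨b1', -⟩ := key k s⁻¹ (Or.inr rfl) x j i
  have d1 := differentiable_of_contDiff (contDiff_cut s)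
  have d2 := differentiable_of_contDiff (contDiff_cut s⁻¹)
  have d3 := fun j => differentiable_of_contDiff (contDiff_pd (contDiff_cut s) j)
  have d4 := fun j => differentiable_of_contDiff (contDiff_pd (contDiff_cut s⁻¹) j)
  have e1 : ∀ j, pd j (plateau k) = fun x => cut s x * ((-1) * pd j (cut s⁻¹) x)
      + pd j (cut s) x * (1 - cut s⁻¹ x) := by
    intro j
    funext x
    have : pd j (fun x => 1 - cut s⁻¹ x) x = (-1) * pd j (cut s⁻¹) x := by
      simp [pd, fderiv_const_sub]
    rw [← this]
    exact pd_mul j (d1 x) ((differentiable_const _).sub d2 x)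
  have e2 : pd i (pd j (plateau k)) x = cut s x * ((-1) * pd i (pd j (cut s⁻¹)) x)
      + pd i (cut s) x * ((-1) * pd j (cut s⁻¹) x)
      + (pd j (cut s) x * ((-1) * pd i (cut s⁻¹) x) + pd i (pd j (cut s)) x * (1 - cut s⁻¹ x)) := by
    have D1 : DifferentiableAt ℝ (fun x => -1 * pd j (cut s⁻¹) x) x := (d4 j x).const_mul _
    have D2 : DifferentiableAt ℝ (fun x => 1 - cut s⁻¹ x) x := (d2 x).const_sub 1
    rw [e1, pd_add i ((d1 x).fun_mul D1) ((d3 j x).fun_mul D2), pd_mul i (d1 x) D1,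
      pd_mul i (d3 j x) D2, pd_const_mul i _ (d4 j x)]
    have : pd i (fun x => 1 - cut s⁻¹ x) x = (-1) * pd i (cut s⁻¹) x := by
      simp [pd, fderiv_const_sub]
    rw [this]
  have c1 := cut_nonneg s x
  have c2 := cut_le_one s x
  have c3 := cut_nonneg s⁻¹ x
  have c4 := cut_le_one s⁻¹ x
  have sh0 := shell_nonneg k x
  have sh1 := shell_le_one k x
  have hx := norm_nonneg x
  have m : ∀ {u v : ℝ}, 0 ≤ u → u ≤ 1 → |u * v| ≤ |v| := by
    intro u v h0 h1
    rw [abs_mul, abs_of_nonneg h0]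
    exact mul_le_of_le_one_left (abs_nonneg v) h1
  constructor
  · have t1 : |pd j (plateau k) x| ≤ |pd j (cut s⁻¹) x| + |pd j (cut s) x| := by
      rw [e1]
      refine (abs_add_le _ _).trans (add_le_add ?_ ?_)
      · refine (m c1 c2).trans (by rw [neg_one_mul, abs_neg])
      · rw [mul_comm]; exact m (by linarith) (by linarith)
    calc |pd j (plateau k) x| * ‖x‖ ≤ (|pd j (cut s⁻¹) x| + |pd j (cut s) x|) * ‖x‖ := by gcongr
      _ ≤ 2 * C * shell k x + 2 * C * shell k x := by rw [add_mul]; exact add_le_add b1 a1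
      _ ≤ (8 * C + 8 * C ^ 2) * shell k x := by nlinarith [mul_nonneg hC.le sh0, mul_nonneg (sq_nonneg C) sh0]
  · have t1 : |pd i (pd j (plateau k)) x| ≤ |pd i (pd j (cut s⁻¹)) x|
        + |pd i (cut s) x| * |pd j (cut s⁻¹) x|
        + (|pd j (cut s) x| * |pd i (cut s⁻¹) x| + |pd i (pd j (cut s)) x|) := by
      rw [e2]
      refine (abs_add_le _ _).trans (add_le_add ((abs_add_le _ _).trans (add_le_add ?_ ?_))
        ((abs_add_le _ _).trans (add_le_add ?_ ?_)))
      · refine (m c1 c2).trans (by rw [neg_one_mul, abs_neg])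
      · rw [neg_one_mul, abs_mul, abs_neg]
      · rw [neg_one_mul, abs_mul, abs_neg]
      · rw [mul_comm]; exact m (by linarith) (by linarith)
    have x1 : |pd i (cut s) x| * ‖x‖ * (|pd j (cut s⁻¹) x| * ‖x‖) ≤ 2 * C * shell k x * (2 * C * 1) :=
      mul_le_mul a1' (b1.trans (by gcongr)) (by positivity) (by positivity)
    have x2 : |pd j (cut s) x| * ‖x‖ * (|pd i (cut s⁻¹) x| * ‖x‖) ≤ 2 * C * shell k x * (2 * C * 1) :=
      mul_le_mul a1 (b1'.trans (by gcongr)) (by positivity) (by positivity)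
    calc |pd i (pd j (plateau k)) x| * ‖x‖ ^ 2 ≤ _ * ‖x‖ ^ 2 :=
          mul_le_mul_of_nonneg_right t1 (by positivity)
      _ = |pd i (pd j (cut s⁻¹)) x| * ‖x‖ ^ 2 + |pd i (cut s) x| * ‖x‖ * (|pd j (cut s⁻¹) x| * ‖x‖)
        + (|pd j (cut s) x| * ‖x‖ * (|pd i (cut s⁻¹) x| * ‖x‖)
          + |pd i (pd j (cut s)) x| * ‖x‖ ^ 2) := by ring
      _ ≤ 4 * C * shell k x + 2 * C * shell k x * (2 * C * 1)
        + (2 * C * shell k x * (2 * C * 1) + 4 * C * shell k x) := by gcongr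
      _ = (8 * C + 8 * C ^ 2) * shell k x := by ring

end Plateau

/-! ### Densities of mass, momentum and energy. -/

section Densities

/-- The mass density. -/
noncomputable def rho (f : Plane → ℂ) (x : Plane) : ℝ := ‖f x‖ ^ 2

/-- The density of kinetic energy. -/
noncomputable def kin (g : Fin 2 → Plane → ℂ) (x : Plane) : ℝ := ‖g 0 x‖ ^ 2 + ‖g 1 x‖ ^ 2

/-- The density of potential energy. -/
noncomputable def pot (p : ℝ) (f : Plane → ℂ) (x : Plane) : ℝ := ‖f x‖ ^ p * ‖f x‖ ^ 2

/-- The real part of the product `conj f * h`. -/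
noncomputable def qd (f h : Plane → ℂ) (x : Plane) : ℝ := (starRingEnd ℂ (f x) * h x).re

/-- The imaginary part of the product `conj f * h`. -/
noncomputable def md (f h : Plane → ℂ) (x : Plane) : ℝ := (starRingEnd ℂ (f x) * h x).im

theorem rho_nonneg (f : Plane → ℂ) (x : Plane) : 0 ≤ rho f x := sq_nonneg _

theorem kin_nonneg (g : Fin 2 → Plane → ℂ) (x : Plane) : 0 ≤ kin g x := by unfold kin; positivity

theorem pot_nonneg (p : ℝ) (f : Plane → ℂ) (x : Plane) : 0 ≤ pot p f x := by unfold pot; positivity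

theorem qd_eq (f h : Plane → ℂ) (x : Plane) :
    qd f h x = (f x).re * (h x).re + (f x).im * (h x).im := by
  simp only [qd, Complex.mul_re, Complex.conj_re, Complex.conj_im]
  ring

theorem md_eq (f h : Plane → ℂ) (x : Plane) :
    md f h x = (f x).re * (h x).im - (f x).im * (h x).re := by
  simp only [md, Complex.mul_im, Complex.conj_re, Complex.conj_im]
  ring

theorem abs_qd_le (f h : Plane → ℂ) (x : Plane) : |qd f h x| ≤ ‖f x‖ * ‖h x‖ := by
  refine (Complex.abs_re_le_norm _).trans ?_
  rw [norm_mul, RCLike.norm_conj]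

theorem abs_md_le (f h : Plane → ℂ) (x : Plane) : |md f h x| ≤ ‖f x‖ * ‖h x‖ := by
  refine (Complex.abs_im_le_norm _).trans ?_
  rw [norm_mul, RCLike.norm_conj]

theorem norm_sq_complex (z : ℂ) : ‖z‖ ^ 2 = z.re * z.re + z.im * z.im := by
  rw [← Complex.normSq_eq_norm_sq, Complex.normSq_apply]

theorem qd_self (f : Plane → ℂ) (x : Plane) : qd f f x = rho f x := by
  rw [qd_eq, rho, norm_sq_complex]

theorem qd_nl (p : ℝ) (f : Plane → ℂ) (x : Plane) : qd f (nl p f) x = pot p f x := by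
  rw [qd_eq, pot, norm_sq_complex, nl]
  simp
  ring

theorem abs_qd_le_kin (g : Fin 2 → Plane → ℂ) (i j : Fin 2) (x : Plane) :
    |qd (g i) (g j) x| ≤ kin g x := by
  refine (abs_qd_le _ _ x).trans ?_
  unfold kin
  fin_cases i <;> fin_cases j <;> simp <;>
    nlinarith [sq_nonneg (‖g 0 x‖ - ‖g 1 x‖), sq_nonneg ‖g 0 x‖, sq_nonneg ‖g 1 x‖]

theorem hasInt_ip_re {b : Plane → ℝ} (hb : IsBdd b) {f h : Plane → ℂ} (hf : MemLp f 2)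
    (hh : MemLp h 2) : HasInt (fun x => b x * qd f h x) (ip b f h).re := by
  refine HasInt.congr ⟨(integrable_ip hb hf hh).re, integral_re (integrable_ip hb hf hh)⟩ fun x => ?_
  simp [qd]

theorem hasInt_ip_im {b : Plane → ℝ} (hb : IsBdd b) {f h : Plane → ℂ} (hf : MemLp f 2)
    (hh : MemLp h 2) : HasInt (fun x => b x * md f h x) (ip b f h).im := by
  refine HasInt.congr ⟨(integrable_ip hb hf hh).im, integral_im (integrable_ip hb hf hh)⟩ fun x => ?_
  simp [md]

theorem hasInt_rho {b : Plane → ℝ} (hb : IsBdd b) {f : Plane → ℂ} (hf : MemLp f 2) :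
    HasInt (fun x => b x * rho f x) (ip b f f).re :=
  (hasInt_ip_re hb hf hf).congr fun x => by rw [qd_self]

theorem hasInt_kin {b : Plane → ℝ} (hb : IsBdd b) {g : Fin 2 → Plane → ℂ}
    (hg : ∀ j, MemLp (g j) 2) :
    HasInt (fun x => b x * kin g x) (∑ j, (ip b (g j) (g j)).re) :=
  (HasInt.sum fun j => hasInt_rho hb (hg j)).congr fun x => by
    simp only [Fin.sum_univ_two, rho, kin]; ring

theorem hasInt_pot {b : Plane → ℝ} (hb : IsBdd b) {p : ℝ} (hp : 1 ≤ p) {f : Plane → ℂ}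
    {g : Fin 2 → Plane → ℂ} (h : H1Pair f g) :
    HasInt (fun x => b x * pot p f x) (ip b f (nl p f)).re :=
  (hasInt_ip_re hb h.memLp (h.memLp_nl hp)).congr fun x => by rw [qd_nl]

theorem IsBdd.of_le {b b' : Plane → ℝ} (hb : IsBdd b) (hm : Measurable b') {C : ℝ}
    (h : ∀ x, |b' x| ≤ C * |b x|) : IsBdd b' := by
  obtain ⟨C', hC'⟩ := hb.bounded
  exact ⟨hm, |C| * C', fun x => (h x).trans ((mul_le_mul_of_nonneg_right (le_abs_self C)
    (abs_nonneg _)).trans (mul_le_mul_of_nonneg_left (hC' x) (abs_nonneg C)))⟩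

theorem IsBdd.mul {b b' : Plane → ℝ} (hb : IsBdd b) (hb' : IsBdd b') :
    IsBdd (fun x => b x * b' x) := by
  obtain ⟨C, hC⟩ := hb'.bounded
  refine hb.of_le (hb.measurable.mul hb'.measurable) (C := C) fun x => ?_
  rw [abs_mul, mul_comm]
  exact mul_le_mul_of_nonneg_right (hC x) (abs_nonneg _)

theorem IsBdd.add {b b' : Plane → ℝ} (hb : IsBdd b) (hb' : IsBdd b') :
    IsBdd (fun x => b x + b' x) := by
  obtain ⟨C, hC⟩ := hb.bounded
  obtain ⟨C', hC'⟩ := hb'.bounded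
  exact ⟨hb.measurable.add hb'.measurable, C + C', fun x =>
    (abs_add_le _ _).trans (add_le_add (hC x) (hC' x))⟩

theorem isBdd_const (c : ℝ) : IsBdd (fun _ => c) := ⟨measurable_const, |c|, fun _ => le_rfl⟩

theorem IsBdd.const_mul {b : Plane → ℝ} (hb : IsBdd b) (c : ℝ) : IsBdd (fun x => c * b x) :=
  (isBdd_const c).mul hb

theorem core_div_le (k n : ℕ) (x : Plane) : core k x / ‖x‖ ^ n ≤ (2 ^ k) ^ n := by
  unfold core
  split_ifs with h
  · have h0 : 0 < ‖x‖ := lt_trans (by positivity) h.1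
    rw [one_div, ← inv_pow]
    gcongr
    rw [inv_le_comm₀ h0 (by positivity)]
    exact h.1.le
  · rw [zero_div]; positivity

theorem isBdd_core_div (k n : ℕ) : IsBdd (fun x => core k x / ‖x‖ ^ n) :=
  ⟨(measurable_core k).div (measurable_norm.pow_const n), (2 ^ k) ^ n, fun x => by
    rw [abs_of_nonneg (div_nonneg (core_nonneg k x) (by positivity))]
    exact core_div_le k n x⟩

theorem isBdd_shell_div (k n : ℕ) : IsBdd (fun x => shell k x / ‖x‖ ^ n) :=
  (isBdd_core_div (k + 3) n).of_le ((isBdd_shell k).measurable.div (measurable_norm.pow_const n))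
    (C := 1) fun x => by
      rw [abs_of_nonneg (div_nonneg (shell_nonneg k x) (by positivity)),
        abs_of_nonneg (div_nonneg (core_nonneg _ x) (by positivity)), one_mul]
      gcongr
      exact shell_le_core k x

theorem isBdd_plateau_div (k n : ℕ) : IsBdd (fun x => plateau k x / ‖x‖ ^ n) :=
  (isBdd_core_div (k + 3) n).of_le
    ((isTest_plateau k).isBdd.measurable.div (measurable_norm.pow_const n))
    (C := 1) fun x => by
      rw [abs_of_nonneg (div_nonneg (plateau_nonneg k x) (by positivity)),
        abs_of_nonneg (div_nonneg (core_nonneg _ x) (by positivity)), one_mul]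
      gcongr
      exact plateau_le_core k x

end Densities

/-! ### The virial density of a truncated field. -/

section VirialDensity

/-- The integrand of the virial functional. -/
noncomputable def vdens (a p : ℝ) (X : Fin 2 → Plane → ℝ) (f : Plane → ℂ)
    (g : Fin 2 → Plane → ℂ) (x : Plane) : ℝ :=
  (∑ j, ∑ l, 2 * (pd l (X j) x * qd (g j) (g l) x)) + (∑ l, pd l (dv X) x * qd f (g l) x)
    + 2 * a * ((∑ j, X j x * x j) / ‖x‖ ^ 4 * rho f x) + p / (p + 2) * (dv X x * pot p f x)

/-- The vector field `Y`, cut off near the origin and near infinity. -/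
noncomputable def cutField (k : ℕ) (Y : Fin 2 → Plane → ℝ) (j : Fin 2) (x : Plane) : ℝ :=
  plateau k x * Y j x

variable {Y : Fin 2 → Plane → ℝ}

theorem isTest_cutField (k : ℕ) (hY : ∀ j, ContDiff ℝ ∞ (Y j)) (j : Fin 2) :
    IsTest (cutField k Y j) := (isTest_plateau k).mul (hY j)

theorem zero_notMem_tsupport_cutField (k : ℕ) (j : Fin 2) :
    (0 : Plane) ∉ tsupport (cutField k Y j) := fun h =>
  zero_notMem_tsupport_plateau k (tsupport_mul_subset_left h)

/-- Wherever the plateau is nonzero, `core (k + 3)` equals one and |x| is bounded below. -/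
theorem isBdd_cutField_potential (k : ℕ) (hY : ∀ j, ContDiff ℝ ∞ (Y j)) :
    IsBdd (fun x => (∑ j, cutField k Y j x * x j) / ‖x‖ ^ 4) := by
  have ht : IsTest (fun x => ∑ j, cutField k Y j x * x j) :=
    IsTest.sum fun j => (isTest_cutField k hY j).mul (contDiff_coord j)
  refine (ht.isBdd.mul (isBdd_core_div (k + 3) 4)).of_le (C := 1)
    (ht.continuous.measurable.div (measurable_norm.pow_const 4)) fun x => ?_
  rw [one_mul]
  by_cases hx : plateau k x = 0
  · simp [cutField, hx]
  · have : core (k + 3) x = 1 := by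
      have h1 := plateau_le_core k x
      have h2 := (plateau_nonneg k x).lt_of_ne' hx
      unfold core at h1 ⊢
      split_ifs at h1 ⊢
      · rfl
      · exact absurd h1 (not_le.2 h2)
    rw [this, div_eq_mul_one_div]

theorem hasInt_virial {a p : ℝ} (hp : 1 ≤ p) (k : ℕ) (hY : ∀ j, ContDiff ℝ ∞ (Y j))
    {f : Plane → ℂ} {g : Fin 2 → Plane → ℂ} (h : H1Pair f g) :
    HasInt (vdens a p (cutField k Y) f g) (virial a p (cutField k Y) f g) := by
  have hX := isTest_cutField k hY
  have t1 := HasInt.sum fun j => HasInt.sum fun l =>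
    (hasInt_ip_re ((hX j).pd l).isBdd (h.memLp_grad j) (h.memLp_grad l)).const_mul 2
  have t2 := HasInt.sum fun l =>
    hasInt_ip_re ((isTest_dv hX).pd l).isBdd h.memLp (h.memLp_grad l)
  have t3 := (hasInt_rho (isBdd_cutField_potential k hY) h.memLp).const_mul (2 * a)
  have t4 := (hasInt_pot (isTest_dv hX).isBdd hp h).const_mul (p / (p + 2))
  refine (show virial a p (cutField k Y) f g = _ from ?_) ▸ ((t1.add t2).add t3).add t4
  simp only [virial, Fin.sum_univ_two, Complex.add_re, Complex.mul_re, Complex.re_ofNat,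
    Complex.im_ofNat, zero_mul, sub_zero]

theorem pd_cutField (k : ℕ) (hY : ∀ j, ContDiff ℝ ∞ (Y j)) (j l : Fin 2) (x : Plane) :
    pd l (cutField k Y j) x = plateau k x * pd l (Y j) x + pd l (plateau k) x * Y j x :=
  pd_mul l (differentiable_of_contDiff (contDiff_plateau k) x)
    (differentiable_of_contDiff (hY j) x)

theorem dv_cutField (k : ℕ) (hY : ∀ j, ContDiff ℝ ∞ (Y j)) :
    dv (cutField k Y) = fun x => plateau k x * dv Y x + ∑ j, pd j (plateau k) x * Y j x := by
  funext x
  simp only [dv, pd_cutField k hY, Fin.sum_univ_two]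
  ring

theorem contDiff_dv (hY : ∀ j, ContDiff ℝ ∞ (Y j)) : ContDiff ℝ ∞ (dv Y) := by
  have : dv Y = fun x => pd 0 (Y 0) x + pd 1 (Y 1) x := by
    funext x; rw [dv, Fin.sum_univ_two]
  rw [this]
  exact (contDiff_pd (hY 0) 0).add (contDiff_pd (hY 1) 1)

theorem pd_dv_cutField (k : ℕ) (hY : ∀ j, ContDiff ℝ ∞ (Y j)) (l : Fin 2) (x : Plane) :
    pd l (dv (cutField k Y)) x = plateau k x * pd l (dv Y) x + pd l (plateau k) x * dv Y x
      + ∑ j, (pd j (plateau k) x * pd l (Y j) x + pd l (pd j (plateau k)) x * Y j x) := by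
  have d1 := differentiable_of_contDiff (contDiff_plateau k)
  have d2 := fun j => differentiable_of_contDiff (contDiff_pd (contDiff_plateau k) j)
  have d3 := fun j => differentiable_of_contDiff (hY j)
  have d4 := differentiable_of_contDiff (contDiff_dv hY)
  have d5 : ∀ j, DifferentiableAt ℝ (fun x => pd j (plateau k) x * Y j x) x := fun j =>
    (d2 j x).fun_mul (d3 j x)
  have d6 : DifferentiableAt ℝ (fun x => ∑ j, pd j (plateau k) x * Y j x) x := by
    simp only [Fin.sum_univ_two]
    exact (d5 0).fun_add (d5 1)
  rw [dv_cutField k hY, pd_add l ((d1 x).fun_mul (d4 x)) d6, pd_mul l (d1 x) (d4 x), pd_sum l d5]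
  simp only [fun j => pd_mul l (d2 j x) (d3 j x)]

theorem abs_mul_three_le {u v w A B C : ℝ} (hu : |u| ≤ A) (hv : |v| ≤ B) (hw : |w| ≤ C) :
    |u * v * w| ≤ A * B * C := by
  rw [abs_mul, abs_mul]
  have := (abs_nonneg u).trans hu
  have := (abs_nonneg v).trans hv
  gcongr

/-- The triangle inequality for the terms in which the cutoff is differentiated: κ and κ' are its
first and second derivatives, y and y' the field and its derivatives, Q and q the densities
quadratic and linear in the gradient. The constant 8 counts the 2·4 Hessian terms and exceeds the
other counts. -/
theorem vdens_error_bound {κ : Fin 2 → ℝ} {κ' : Fin 2 → Fin 2 → ℝ} {y : Fin 2 → ℝ}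
    {y' : Fin 2 → Fin 2 → ℝ} {Q : Fin 2 → Fin 2 → ℝ} {q t : Fin 2 → ℝ} {A B b b' e P c : ℝ}
    (hκ : ∀ j, |κ j| ≤ A) (hκ' : ∀ l j, |κ' l j| ≤ B) (hy : ∀ j, |y j| ≤ b)
    (hy' : ∀ l j, |y' l j| ≤ b') (hQ : ∀ j l, |Q j l| ≤ e) (hq : ∀ l, |q l| ≤ t l)
    (hP : 0 ≤ P) (hc0 : 0 ≤ c) (hc : c ≤ 1) :
    -(8 * (A * b * (e + P) + (B * b + A * b') * (t 0 + t 1)))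
      ≤ (∑ j, ∑ l, 2 * (κ l * y j * Q j l))
        + (∑ l, (κ l * (∑ j, y' j j) + ∑ j, (κ j * y' l j + κ' l j * y j)) * q l)
        + c * ((∑ j, κ j * y j) * P) := by
  have hA : 0 ≤ A := (abs_nonneg _).trans (hκ 0)
  have hB : 0 ≤ B := (abs_nonneg _).trans (hκ' 0 0)
  have hb : 0 ≤ b := (abs_nonneg _).trans (hy 0)
  have hb' : 0 ≤ b' := (abs_nonneg _).trans (hy' 0 0)
  have he : 0 ≤ e := (abs_nonneg _).trans (hQ 0 0)
  have ht : ∀ l, 0 ≤ t l := fun l => (abs_nonneg _).trans (hq l)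
  have h1 := fun j l => (abs_le.1 (abs_mul_three_le (hκ l) (hy j) (hQ j l))).1
  have h2 := fun l j i => (abs_le.1 (abs_mul_three_le (hκ l) (hy' j i) (hq i))).1
  have h2' := fun l j i n => (abs_le.1 (abs_mul_three_le (hκ l) (hy' j i) (hq n))).1
  have h3 := fun l j i => (abs_le.1 (abs_mul_three_le (hκ' l j) (hy j) (hq i))).1
  have h4 : ∀ j, -(A * b * P) ≤ c * (κ j * y j * P) := by
    intro j
    have := (abs_le.1 (abs_mul_three_le (hκ j) (hy j) (abs_of_nonneg hP).le)).1
    nlinarith [mul_nonneg (mul_nonneg hA hb) hP]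
  have n1 := mul_nonneg (mul_nonneg hA hb) he
  have n2 := mul_nonneg (mul_nonneg hA hb) hP
  have n3 := fun l => mul_nonneg (mul_nonneg hB hb) (ht l)
  have n4 := fun l => mul_nonneg (mul_nonneg hA hb') (ht l)
  simp only [Fin.sum_univ_two]
  have := h1 0 0; have := h1 0 1; have := h1 1 0; have := h1 1 1
  have := h2' 0 0 0 0; have := h2' 0 1 1 0; have := h2' 1 0 0 1; have := h2' 1 1 1 1
  have := h2' 0 0 0 0; have := h2' 1 0 1 0; have := h2' 0 1 0 1; have := h2' 1 1 1 1
  have := h3 0 0 0; have := h3 0 1 0; have := h3 1 0 1; have := h3 1 1 1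
  have := h4 0; have := h4 1
  have := n3 0; have := n3 1; have := n4 0; have := n4 1
  nlinarith

/-- The error made by cutting off the vector field is supported in the shell. -/
theorem exists_vdens_cutField_ge : ∃ C, 0 < C ∧ ∀ (k : ℕ) (Y : Fin 2 → Plane → ℝ)
    (_ : ∀ j, ContDiff ℝ ∞ (Y j)) (a p : ℝ) (_ : 0 ≤ p) (f : Plane → ℂ) (g : Fin 2 → Plane → ℂ)
    (x : Plane) (_ : x ≠ 0) (b b' : ℝ) (_ : ∀ j, |Y j x| ≤ b) (_ : ∀ l j, |pd l (Y j) x| ≤ b'),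
    plateau k x * vdens a p Y f g x - C * shell k x * (b / ‖x‖ * (kin g x + pot p f x)
      + (b / ‖x‖ ^ 2 + b' / ‖x‖) * (‖f x‖ * (‖g 0 x‖ + ‖g 1 x‖)))
      ≤ vdens a p (cutField k Y) f g x := by
  obtain ⟨C, hC, hb⟩ := exists_plateau_bound
  refine ⟨8 * C, by positivity, fun k Y hY a p hp f g x hx b b' hy hy' => ?_⟩
  have hx0 : 0 < ‖x‖ := norm_pos_iff.2 hx
  have hκ : ∀ j, |pd j (plateau k) x| ≤ C * shell k x / ‖x‖ := fun j => by
    rw [le_div_iff₀ hx0]; exact (hb k x 0 j).1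
  have hκ' : ∀ l j, |pd l (pd j (plateau k)) x| ≤ C * shell k x / ‖x‖ ^ 2 := fun l j => by
    rw [le_div_iff₀ (by positivity)]; exact (hb k x l j).2
  have hc0 : 0 ≤ p / (p + 2) := by positivity
  have hc1 : p / (p + 2) ≤ 1 := by rw [div_le_one (by linarith)]; linarith
  have key := vdens_error_bound (y' := fun l j => pd l (Y j) x)
    (κ' := fun l j => pd l (pd j (plateau k)) x) (Q := fun j l => qd (g j) (g l) x)
    (q := fun l => qd f (g l) x) (t := fun l => ‖f x‖ * ‖g l x‖) (P := pot p f x)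
    hκ hκ' hy hy' (fun j l => abs_qd_le_kin g j l x) (fun l => abs_qd_le f (g l) x)
    (pot_nonneg p f x) hc0 hc1
  have e : vdens a p (cutField k Y) f g x = plateau k x * vdens a p Y f g x
      + ((∑ j, ∑ l, 2 * (pd l (plateau k) x * Y j x * qd (g j) (g l) x))
        + (∑ l, (pd l (plateau k) x * (∑ j, pd j (Y j) x) + ∑ j, (pd j (plateau k) x * pd l (Y j) x
          + pd l (pd j (plateau k)) x * Y j x)) * qd f (g l) x)
        + p / (p + 2) * ((∑ j, pd j (plateau k) x * Y j x) * pot p f x)) := by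
    have e0 : dv Y x = ∑ j, pd j (Y j) x := rfl
    have e1 := congrFun (dv_cutField k hY) x
    simp only [vdens, pd_dv_cutField k hY]
    simp only [e1, pd_cutField k hY, cutField, e0]
    simp only [Fin.sum_univ_two]
    ring
  rw [e]
  have e2 : 8 * C * shell k x * (b / ‖x‖ * (kin g x + pot p f x)
      + (b / ‖x‖ ^ 2 + b' / ‖x‖) * (‖f x‖ * (‖g 0 x‖ + ‖g 1 x‖)))
      = 8 * (C * shell k x / ‖x‖ * b * (kin g x + pot p f x)
        + (C * shell k x / ‖x‖ ^ 2 * b + C * shell k x / ‖x‖ * b')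
          * (‖f x‖ * ‖g 0 x‖ + ‖f x‖ * ‖g 1 x‖)) := by
    ring
  rw [e2]
  linarith

end VirialDensity

/-! ### The regularized distance and its gradient field. -/

section Weight

/-- The regularized distance to the origin. -/
noncomputable def wt (δ : ℝ) (x : Plane) : ℝ := Real.sqrt (‖x‖ ^ 2 + δ ^ 2)

variable {δ : ℝ}

theorem wt_sq (δ : ℝ) (x : Plane) : wt δ x ^ 2 = ‖x‖ ^ 2 + δ ^ 2 := Real.sq_sqrt (by positivity)

theorem wt_pos (hδ : 0 < δ) (x : Plane) : 0 < wt δ x := Real.sqrt_pos.2 (by positivity)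

theorem le_wt (δ : ℝ) (x : Plane) : δ ≤ wt δ x :=
  Real.le_sqrt_of_sq_le (by nlinarith [sq_nonneg ‖x‖])

theorem norm_le_wt (δ : ℝ) (x : Plane) : ‖x‖ ≤ wt δ x :=
  Real.le_sqrt_of_sq_le (by nlinarith [sq_nonneg δ])

theorem wt_le (hδ : 0 < δ) (x : Plane) : wt δ x ≤ ‖x‖ + δ :=
  Real.sqrt_le_iff.2 ⟨by positivity, by nlinarith [norm_nonneg x]⟩

theorem contDiff_wt (hδ : 0 < δ) : ContDiff ℝ ∞ (wt δ) :=
  contDiff_iff_contDiffAt.2 fun x => ContDiffAt.sqrt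
    (((contDiff_norm_sq ℝ).add contDiff_const).contDiffAt) (by positivity)

theorem contDiff_wt_inv (hδ : 0 < δ) (n : ℕ) : ContDiff ℝ ∞ (fun x => (wt δ x ^ n)⁻¹) :=
  ((contDiff_wt hδ).pow n).inv fun x => (pow_pos (wt_pos hδ x) n).ne'

theorem pd_wt_inv (hδ : 0 < δ) (n : ℕ) (j : Fin 2) (x : Plane) :
    pd j (fun x => (wt δ x ^ n)⁻¹) x = -n * x j * (wt δ x ^ (n + 2))⁻¹ := by
  have hq : ‖x‖ ^ 2 + δ ^ 2 ≠ 0 := by positivity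
  have hw := wt_pos hδ x
  have h1 : HasDerivAt (fun q => Real.sqrt (q + δ ^ 2)) (1 / (2 * wt δ x)) (‖x‖ ^ 2) := by
    have := ((hasDerivAt_id (‖x‖ ^ 2)).add_const (δ ^ 2)).sqrt hq
    simpa [wt] using! this
  have h2 := (h1.fun_pow n).fun_inv (pow_pos hw n).ne'
  have h3 := pd_radial h2 j
  have e : (fun x : Plane => (Real.sqrt (‖x‖ ^ 2 + δ ^ 2) ^ n)⁻¹) = fun x => (wt δ x ^ n)⁻¹ := rfl
  rw [e] at h3
  rw [h3]
  change -((n : ℝ) * wt δ x ^ (n - 1) * (1 / (2 * wt δ x))) / (wt δ x ^ n) ^ 2 * (2 * x j) = _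
  rcases n with _ | n
  · simp
  · rw [Nat.add_sub_cancel]
    field_simp
    ring

/-- The regularized radial unit field. -/
noncomputable def radial (δ : ℝ) (j : Fin 2) (x : Plane) : ℝ := x j * (wt δ x ^ 1)⁻¹

theorem contDiff_radial (hδ : 0 < δ) (j : Fin 2) : ContDiff ℝ ∞ (radial δ j) :=
  (contDiff_coord j).mul (contDiff_wt_inv hδ 1)

theorem pd_radial_field (hδ : 0 < δ) (j l : Fin 2) (x : Plane) :
    pd l (radial δ j) x = (if j = l then 1 else 0) * (wt δ x)⁻¹ - x j * x l * (wt δ x ^ 3)⁻¹ := by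
  have := pd_mul l (differentiable_of_contDiff (contDiff_coord j) x)
    (differentiable_of_contDiff (contDiff_wt_inv hδ 1) x)
  rw [pd_coord, pd_wt_inv hδ] at this
  refine this.trans ?_
  push_cast
  rw [pow_one]
  ring

/-- The field is the gradient of `wt δ`, so this is the Laplacian of the weight in two dimensions.
-/
theorem dv_radial (hδ : 0 < δ) :
    dv (radial δ) = fun x => (wt δ x ^ 1)⁻¹ + δ ^ 2 * (wt δ x ^ 3)⁻¹ := by
  funext x
  have hw := wt_pos hδ x
  have hw2 := wt_sq δ x
  rw [norm_sq_eq] at hw2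
  simp only [dv, pd_radial_field hδ, Fin.sum_univ_two, if_true]
  field_simp
  linear_combination hw2

theorem pd_dv_radial (hδ : 0 < δ) (l : Fin 2) (x : Plane) :
    pd l (dv (radial δ)) x
      = -(x l) * (wt δ x ^ 3)⁻¹ - 3 * δ ^ 2 * x l * (wt δ x ^ 5)⁻¹ := by
  have d1 := differentiable_of_contDiff (contDiff_wt_inv hδ 1) x
  have d3 := differentiable_of_contDiff (contDiff_wt_inv hδ 3) x
  rw [dv_radial hδ, pd_add l d1 (d3.const_mul _), pd_const_mul l _ d3, pd_wt_inv hδ, pd_wt_inv hδ]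
  push_cast
  ring

theorem abs_coord_le (x : Plane) (j : Fin 2) : |x j| ≤ ‖x‖ := PiLp.norm_apply_le x j

theorem abs_radial_le (hδ : 0 < δ) (j : Fin 2) (x : Plane) : |radial δ j x| ≤ ‖x‖ * (wt δ x)⁻¹ := by
  rw [radial, pow_one, abs_mul, abs_of_pos (inv_pos.2 (wt_pos hδ x))]
  have := inv_nonneg.2 (wt_pos hδ x).le
  gcongr
  exact abs_coord_le x j

theorem abs_radial_le_one (hδ : 0 < δ) (j : Fin 2) (x : Plane) : |radial δ j x| ≤ 1 := by
  refine (abs_radial_le hδ j x).trans ?_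
  rw [← div_eq_mul_inv, div_le_one (wt_pos hδ x)]
  exact norm_le_wt δ x

theorem abs_pd_radial_le (hδ : 0 < δ) (l j : Fin 2) (x : Plane) :
    |pd l (radial δ j) x| ≤ 2 * (wt δ x)⁻¹ := by
  have hw := wt_pos hδ x
  rw [pd_radial_field hδ]
  refine (abs_sub _ _).trans ?_
  have h1 : |(if j = l then (1 : ℝ) else 0) * (wt δ x)⁻¹| ≤ (wt δ x)⁻¹ := by
    rw [abs_mul, abs_of_pos (inv_pos.2 hw)]
    refine mul_le_of_le_one_left (inv_pos.2 hw).le ?_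
    split_ifs <;> simp
  have h2 : |x j * x l * (wt δ x ^ 3)⁻¹| ≤ (wt δ x)⁻¹ := by
    have : |x j * x l * (wt δ x ^ 3)⁻¹| ≤ wt δ x * wt δ x * (wt δ x ^ 3)⁻¹ :=
      abs_mul_three_le ((abs_coord_le x j).trans (norm_le_wt δ x))
        ((abs_coord_le x l).trans (norm_le_wt δ x)) (abs_of_pos (by positivity)).le
    refine this.trans_eq ?_
    field_simp
  linarith

end Weight

/-! ### The pointwise Morawetz inequality. -/

section MorawetzDensity

/-- The integrand is div(φ|f|²). Such null terms can be added to the virial density in order to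
complete squares. -/
theorem hasInt_rho_div {φ : Fin 2 → Plane → ℝ} (hφ : ∀ j, IsTest (φ j)) {f : Plane → ℂ}
    {g : Fin 2 → Plane → ℂ} (h : H1Pair f g) :
    HasInt (fun x => dv φ x * rho f x + ∑ j, φ j x * (2 * qd f (g j) x)) 0 := by
  have t1 := hasInt_rho (isTest_dv hφ).isBdd h.memLp
  have t2 := HasInt.sum fun j => (hasInt_ip_re (hφ j).isBdd h.memLp (h.memLp_grad j)).const_mul 2
  have e : (ip (dv φ) f f).re + ∑ j, 2 * (ip (φ j) f (g j)).re = 0 := by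
    have h1 : ∀ j, ip (pd j (φ j)) f f = _ := fun j =>
      ip_pd_eq h h (hφ j).contDiff (hφ j).isBdd j ((hφ j).pd j).isBdd
    have h2 : ∀ j, (ip (φ j) (g j) f).re = (ip (φ j) f (g j)).re := fun j => by
      rw [ip_conj f (g j), Complex.conj_re]
    rw [ip_dv hφ h.memLp h.memLp]
    simp only [h1, Fin.sum_univ_two, Complex.add_re, Complex.neg_re, h2]
    ring
  rw [← e]
  refine (t1.add t2).congr fun x => ?_
  simp only [Fin.sum_univ_two]
  ring

/-- The algebra behind the Morawetz estimate: `y` is the inverse of the weight, `A` the density of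
kinetic energy, `B` the square of the radial derivative, `P` the radial part of `conj f * ∇f`. -/
theorem morawetz_algebra {a c r δ y A B P R N : ℝ} (hr : 0 < r) (hy : 0 < y)
    (hw : (r ^ 2 + δ ^ 2) * y ^ 2 = 1) (hB : B ≤ r ^ 2 * A)
    (hsq : 0 ≤ A - 2 * P * y ^ 2 + r ^ 2 * R * y ^ 4) (hR : 0 ≤ R) (hc : 0 ≤ c) (hN : 0 ≤ N) :
    δ ^ 2 / 2 * y ^ 3 * A + (2 * a - 1 / 2) * (y / r ^ 2 * R) + c * (y * N)
      ≤ 2 * (A * y - B * y ^ 3) + (-y ^ 3 - 3 * δ ^ 2 * y ^ 5) * P + 2 * a * (y / r ^ 2 * R)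
        + c * ((y + δ ^ 2 * y ^ 3) * N) + (y ^ 3 * P + R * (2 * y ^ 3 - 3 * r ^ 2 * y ^ 5) / 2) := by
  have hd : 0 ≤ δ ^ 2 := sq_nonneg δ
  -- Cauchy–Schwarz bounds the radial part by the full gradient, and regularization leaves the
  -- surplus δ²y² = 1 - r²y² in the Hessian term.
  have h1 : 2 * (δ ^ 2 * y ^ 3 * A) ≤ 2 * (A * y - B * y ^ 3) := by
    have e : δ ^ 2 * y ^ 3 * A = A * y - r ^ 2 * A * y ^ 3 := by linear_combination (A * y) * hw
    have : B * y ^ 3 ≤ r ^ 2 * A * y ^ 3 := by gcongr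
    linarith
  -- The square of ∇f - xf/w², taken with the factor 3/2, absorbs the term -3δ²y⁵P. Of 2δ²y³A it
  -- leaves exactly δ²y³A/2.
  have h2 := mul_nonneg (mul_nonneg hd (pow_pos hy 3).le) hsq
  have h3 : 0 ≤ c * (δ ^ 2 * y ^ 3 * N) := by positivity
  -- The bi-Laplacian of the weight costs at most one half of yR/r²: with s = r²y² in [0,1], the
  -- unused part of that half factors through 1 - s. This half is the source of the condition a >
  -- 1/4.
  have h4 : 0 ≤ y / r ^ 2 * R * (1 / 2) + R * y ^ 3 - R * (3 / 2 * r ^ 2 * y ^ 5)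
      - 3 / 2 * δ ^ 2 * r ^ 2 * y ^ 7 * R := by
    set s := r ^ 2 * y ^ 2 with hs
    have hs0 : 0 ≤ s := by positivity
    have hs1 : s ≤ 1 := by nlinarith [mul_nonneg hd (sq_nonneg y)]
    have e : y / r ^ 2 * R * (1 / 2) + R * y ^ 3 - R * (3 / 2 * r ^ 2 * y ^ 5)
      - 3 / 2 * δ ^ 2 * r ^ 2 * y ^ 7 * R
        = y / r ^ 2 * R * ((1 - s) * (1 / 2 + 3 / 2 * s * (1 - s))) := by
      have e1 : δ ^ 2 * y ^ 2 = 1 - s := by rw [hs]; linear_combination hw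
      have e2 : y / r ^ 2 * R * ((1 - s) * (1 / 2 + 3 / 2 * s * (1 - s)))
          = y / r ^ 2 * R * (1 / 2 + s - 3 / 2 * s ^ 2 - 3 / 2 * (δ ^ 2 * y ^ 2) * s ^ 2) := by
        rw [e1]; ring
      rw [e2, hs]
      field_simp
    rw [e]
    have : 0 ≤ 1 - s := by linarith
    positivity
  nlinarith

/-- The bracket added to the virial density is half the divergence of x w⁻³|f|², hence a null term.
It cancels the part of the linear gradient term that δ does not make small, and the rest is the
algebraic inequality. -/
theorem vdens_radial_ge {δ : ℝ} (hδ : 0 < δ) {a p : ℝ} (hp : 0 ≤ p) (f : Plane → ℂ)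
    (g : Fin 2 → Plane → ℂ) {x : Plane} (hx : x ≠ 0) :
    δ ^ 2 / 2 * (wt δ x)⁻¹ ^ 3 * kin g x + (2 * a - 1 / 2) * ((wt δ x)⁻¹ / ‖x‖ ^ 2 * rho f x)
        + p / (p + 2) * ((wt δ x)⁻¹ * pot p f x)
      ≤ vdens a p (radial δ) f g x + ((wt δ x)⁻¹ ^ 3 * (∑ j, x j * qd f (g j) x)
        + rho f x * (2 * (wt δ x)⁻¹ ^ 3 - 3 * ‖x‖ ^ 2 * (wt δ x)⁻¹ ^ 5) / 2) := by
  have hx0 : 0 < ‖x‖ := norm_pos_iff.2 hx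
  have hw := wt_pos hδ x
  have hn := norm_sq_eq x
  have hk : kin g x = (g 0 x).re * (g 0 x).re + (g 0 x).im * (g 0 x).im
      + ((g 1 x).re * (g 1 x).re + (g 1 x).im * (g 1 x).im) := by
    rw [kin, norm_sq_complex, norm_sq_complex]
  have hR : rho f x = (f x).re * (f x).re + (f x).im * (f x).im := by rw [rho, norm_sq_complex]
  have key := morawetz_algebra (a := a) (c := p / (p + 2)) (δ := δ) (r := ‖x‖) (y := (wt δ x)⁻¹)
    (A := kin g x) (B := ∑ j, ∑ l, x j * x l * qd (g j) (g l) x)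
    (P := ∑ j, x j * qd f (g j) x) (R := rho f x) (N := pot p f x) hx0 (inv_pos.2 hw)
    (by rw [← wt_sq]; field_simp) ?_ ?_ (rho_nonneg f x) (by positivity) (pot_nonneg p f x)
  · refine key.trans_eq ?_
    have e1 := congrFun (dv_radial hδ) x
    simp only [vdens, pd_dv_radial hδ, e1, pd_radial_field hδ, radial, Fin.sum_univ_two, qd_self,
      if_true, if_neg (show ¬((0 : Fin 2) = 1) by decide),
      if_neg (show ¬((1 : Fin 2) = 0) by decide)]
    have e2 : (x 0 * (wt δ x ^ 1)⁻¹ * x 0 + x 1 * (wt δ x ^ 1)⁻¹ * x 1) / ‖x‖ ^ 4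
        = (wt δ x)⁻¹ / ‖x‖ ^ 2 := by
      rw [show x 0 * (wt δ x ^ 1)⁻¹ * x 0 + x 1 * (wt δ x ^ 1)⁻¹ * x 1
        = ‖x‖ ^ 2 * (wt δ x)⁻¹ by rw [hn]; ring]
      field_simp
    rw [e2]
    simp only [kin, rho]
    ring
  · rw [hk, hn]
    simp only [Fin.sum_univ_two, qd_eq]
    nlinarith [sq_nonneg (x 0 * (g 1 x).re - x 1 * (g 0 x).re),
      sq_nonneg (x 0 * (g 1 x).im - x 1 * (g 0 x).im)]
  · rw [hk, hn, hR]
    simp only [Fin.sum_univ_two, qd_eq]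
    set y := (wt δ x)⁻¹
    nlinarith [sq_nonneg ((g 0 x).re - x 0 * y ^ 2 * (f x).re),
      sq_nonneg ((g 0 x).im - x 0 * y ^ 2 * (f x).im),
      sq_nonneg ((g 1 x).re - x 1 * y ^ 2 * (f x).re),
      sq_nonneg ((g 1 x).im - x 1 * y ^ 2 * (f x).im)]

/-- The small parameter falls on the singular mass term |f|²/|x|², which will have to be absorbed;
the kinetic term may carry a large constant. -/
theorem young_grad {η r F G₀ G₁ : ℝ} (hη : 0 < η) :
    F * (G₀ + G₁) / r ≤ η * (F ^ 2 / r ^ 2) + η⁻¹ * (G₀ ^ 2 + G₁ ^ 2) := by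
  have h1 : F * (G₀ + G₁) / r = (F / r) * (G₀ + G₁) := by ring
  have h2 : F ^ 2 / r ^ 2 = (F / r) ^ 2 := by ring
  rw [h1, h2]
  set z := F / r
  have : 0 ≤ η⁻¹ * ((η * z - (G₀ + G₁)/2) ^ 2 + (G₀ - G₁) ^ 2 / 4 + (G₀ ^ 2 + G₁ ^ 2)/2) := by positivity
  have e : η⁻¹ * ((η * z - (G₀ + G₁)/2) ^ 2 + (G₀ - G₁) ^ 2 / 4 + (G₀ ^ 2 + G₁ ^ 2)/2)
      = η * z ^ 2 + η⁻¹ * (G₀ ^ 2 + G₁ ^ 2) - z * (G₀ + G₁) := by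
    field_simp
    ring
  linarith

end MorawetzDensity

/-! ### The Morawetz inequality at a fixed time, with cutoff errors. -/

section MorawetzFixedTime

theorem ae_ne_zero : ∀ᵐ x : Plane, x ≠ 0 := by
  simp [ae_iff]

theorem HasInt.mono_ae {f g : Plane → ℝ} {v w : ℝ} (hf : HasInt f v) (hg : HasInt g w)
    (h : ∀ᵐ x, f x ≤ g x) : v ≤ w := by
  rw [← hf.2, ← hg.2]
  exact integral_mono_ae hf.1 hg.1 h

theorem HasInt.self {f : Plane → ℝ} {v : ℝ} (hf : HasInt f v) : HasInt f (∫ x, f x) := ⟨hf.1, rfl⟩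

variable {δ : ℝ}

theorem isBdd_wt_inv_pow (hδ : 0 < δ) (n : ℕ) : IsBdd (fun x => (wt δ x)⁻¹ ^ n) := by
  refine ⟨((contDiff_wt hδ).continuous.measurable.inv).pow_const n, δ⁻¹ ^ n, fun x => ?_⟩
  rw [abs_of_pos (pow_pos (inv_pos.2 (wt_pos hδ x)) n)]
  have := inv_nonneg.2 (wt_pos hδ x).le
  gcongr
  exact le_wt δ x

theorem isBdd_wt_inv (hδ : 0 < δ) : IsBdd (fun x => (wt δ x)⁻¹) := by
  simpa using isBdd_wt_inv_pow hδ 1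

theorem isBdd_plateau_wt (hδ : 0 < δ) (k : ℕ) :
    IsBdd (fun x => plateau k x * ((wt δ x)⁻¹ / ‖x‖ ^ 2)) := by
  refine ((isBdd_plateau_div k 2).mul (isBdd_wt_inv hδ)).of_le (C := 1) ?_ fun x => ?_
  · exact (isTest_plateau k).isBdd.measurable.mul ((isBdd_wt_inv hδ).measurable.div
      (measurable_norm.pow_const 2))
  · rw [one_mul, div_mul_eq_mul_div, mul_div_assoc]

theorem isBdd_core_wt (hδ : 0 < δ) (k : ℕ) :
    IsBdd (fun x => core k x * ((wt δ x)⁻¹ / ‖x‖ ^ 2)) := by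
  refine ((isBdd_core_div k 2).mul (isBdd_wt_inv hδ)).of_le (C := 1) ?_ fun x => ?_
  · exact (measurable_core k).mul ((isBdd_wt_inv hδ).measurable.div
      (measurable_norm.pow_const 2))
  · rw [one_mul, div_mul_eq_mul_div, mul_div_assoc]

/-- The Morawetz estimate at a fixed time, with a truncated vector field. -/
theorem exists_virial_ge (hδ : 0 < δ) : ∃ C, 0 < C ∧ ∀ (k : ℕ) (a p : ℝ) (_ : 1 ≤ p)
    (f : Plane → ℂ) (g : Fin 2 → Plane → ℂ) (_ : H1Pair f g) (η : ℝ) (_ : 0 < η) (_ : η ≤ 1),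
    (δ ^ 2 / 2 * ∫ x, plateau k x * (wt δ x)⁻¹ ^ 3 * kin g x)
      + (2 * a - 1 / 2) * (∫ x, plateau k x * ((wt δ x)⁻¹ / ‖x‖ ^ 2) * rho f x)
      + p / (p + 2) * (∫ x, plateau k x * (wt δ x)⁻¹ * pot p f x)
      ≤ virial a p (cutField k (radial δ)) f g
        + C * ((η⁻¹ * ∫ x, shell k x * kin g x) + (∫ x, shell k x * rho f x)
          + (∫ x, shell k x * pot p f x) + η * ∫ x, shell k x / ‖x‖ ^ 2 * rho f x) := by
  obtain ⟨C₁, hC₁, hv⟩ := exists_vdens_cutField_ge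
  obtain ⟨C₀, hC₀, hb⟩ := exists_plateau_bound
  -- The first part comes from cutting off the field, the second from cutting off the null
  -- divergence.
  refine ⟨4 * C₁ * δ⁻¹ + C₀ * δ⁻¹ ^ 3, by positivity, fun k a p hp f g h η hη hη1 => ?_⟩
  have hp0 : 0 ≤ p := by linarith
  set C := 4 * C₁ * δ⁻¹ + C₀ * δ⁻¹ ^ 3 with hC
  have hκ := (isTest_plateau k).isBdd
  have hg := h.memLp_grad
  have L1 := ((hasInt_kin (hκ.mul (isBdd_wt_inv_pow hδ 3)) hg).self).const_mul (δ ^ 2 / 2)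
  have L2 := ((hasInt_rho (isBdd_plateau_wt hδ k) h.memLp).self).const_mul (2 * a - 1 / 2)
  have L3 := ((hasInt_pot (hκ.mul (isBdd_wt_inv hδ)) hp h).self).const_mul (p / (p + 2))
  have R0 := hasInt_virial (a := a) hp k (contDiff_radial hδ) h
  have R1 := ((hasInt_kin (isBdd_shell k) hg).self).const_mul η⁻¹
  have R2 := (hasInt_rho (isBdd_shell k) h.memLp).self
  have R3 := (hasInt_pot (isBdd_shell k) hp h).self
  have R4 := ((hasInt_rho (isBdd_shell_div k 2) h.memLp).self).const_mul η
  -- The null term of `vdens_radial_ge`, truncated so that it has compact support.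
  let φ : Fin 2 → Plane → ℝ := fun j x => plateau k x * (x j * (wt δ x ^ 3)⁻¹)
  have hs : ∀ j, ContDiff ℝ ∞ (fun x : Plane => x j * (wt δ x ^ 3)⁻¹) := fun j =>
    (contDiff_coord j).mul (contDiff_wt_inv hδ 3)
  have hφ : ∀ j, IsTest (φ j) := fun j => (isTest_plateau k).mul (hs j)
  have R5 := (hasInt_rho_div hφ h).const_mul (1 / 2)
  refine (((L1.add L2).add L3).mono_ae ((R0.add R5).add ((((R1.add R2).add R3).add R4).const_mul C))
    ?_).trans_eq (by ring)
  filter_upwards [ae_ne_zero] with x hx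
  have hx0 : 0 < ‖x‖ := norm_pos_iff.2 hx
  have hw := wt_pos hδ x
  have hsh := shell_nonneg k x
  have hdφ : dv φ x = plateau k x * (2 * (wt δ x)⁻¹ ^ 3 - 3 * ‖x‖ ^ 2 * (wt δ x)⁻¹ ^ 5)
      + (wt δ x)⁻¹ ^ 3 * (∑ j, pd j (plateau k) x * x j) := by
    have e : ∀ j, pd j (φ j) x = plateau k x * ((wt δ x ^ 3)⁻¹ - 3 * x j ^ 2 * (wt δ x ^ 5)⁻¹)
        + pd j (plateau k) x * (x j * (wt δ x ^ 3)⁻¹) := by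
      intro j
      rw [pd_mul j (differentiable_of_contDiff (contDiff_plateau k) x)
        (differentiable_of_contDiff (hs j) x), pd_mul j
        (differentiable_of_contDiff (contDiff_coord j) x)
        (differentiable_of_contDiff (contDiff_wt_inv hδ 3) x), pd_coord, pd_wt_inv hδ, if_pos rfl]
      push_cast
      ring
    simp only [dv, e, Fin.sum_univ_two]
    rw [norm_sq_eq]
    ring
  have m1 := mul_le_mul_of_nonneg_left (vdens_radial_ge (a := a) hδ hp0 f g hx) (plateau_nonneg k x)
  have m2 := hv k (radial δ) (contDiff_radial hδ) a p hp0 f g x hx (‖x‖ * (wt δ x)⁻¹)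
    (2 * (wt δ x)⁻¹) (fun j => abs_radial_le hδ j x) (fun l j => abs_pd_radial_le hδ l j x)
  have m3 : -(C₀ * δ⁻¹ ^ 3 * (shell k x * rho f x))
      ≤ rho f x * ((wt δ x)⁻¹ ^ 3 * (∑ j, pd j (plateau k) x * x j)) / 2 := by
    have hj : ∀ j, |pd j (plateau k) x * x j| ≤ C₀ * shell k x := fun j => by
      rw [abs_mul]
      exact (mul_le_mul_of_nonneg_left (abs_coord_le x j) (abs_nonneg _)).trans (hb k x 0 j).1
    have h1 : |∑ j, pd j (plateau k) x * x j| ≤ 2 * (C₀ * shell k x) := by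
      rw [Fin.sum_univ_two]
      refine (abs_add_le _ _).trans ?_
      linarith [hj 0, hj 1]
    have h2 : |rho f x * (wt δ x)⁻¹ ^ 3 * (∑ j, pd j (plateau k) x * x j)|
        ≤ rho f x * δ⁻¹ ^ 3 * (2 * (C₀ * shell k x)) := by
      refine abs_mul_three_le (abs_of_nonneg (rho_nonneg f x)).le ?_ h1
      rw [abs_of_pos (by positivity)]
      gcongr
      exact le_wt δ x
    have := (abs_le.1 h2).1
    nlinarith
  -- The field vanishes linearly at the origin, |X| ≤ |x|/w, which cancels the 1/|x| from the
  -- derivative of the cutoff. Only |f||∇f|/|x| stays singular, and Young's inequality splits it.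
  have m4 : C₁ * shell k x * (‖x‖ * (wt δ x)⁻¹ / ‖x‖ * (kin g x + pot p f x)
      + (‖x‖ * (wt δ x)⁻¹ / ‖x‖ ^ 2 + 2 * (wt δ x)⁻¹ / ‖x‖) * (‖f x‖ * (‖g 0 x‖ + ‖g 1 x‖)))
      ≤ 4 * C₁ * δ⁻¹ * (η⁻¹ * (shell k x * kin g x) + shell k x * pot p f x
        + η * (shell k x / ‖x‖ ^ 2 * rho f x)) := by
    have hy := young_grad (F := ‖f x‖) (r := ‖x‖) (G₀ := ‖g 0 x‖) (G₁ := ‖g 1 x‖) hη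
    have hη2 : 1 ≤ η⁻¹ := (one_le_inv₀ hη).2 hη1
    have hwd : (wt δ x)⁻¹ ≤ δ⁻¹ := inv_anti₀ hδ (le_wt δ x)
    have hk := kin_nonneg g x
    have hpt := pot_nonneg p f x
    have e1 : ‖x‖ * (wt δ x)⁻¹ / ‖x‖ * (kin g x + pot p f x)
      + (‖x‖ * (wt δ x)⁻¹ / ‖x‖ ^ 2 + 2 * (wt δ x)⁻¹ / ‖x‖) * (‖f x‖ * (‖g 0 x‖ + ‖g 1 x‖))
      = (wt δ x)⁻¹ * (kin g x + pot p f x + 3 * (‖f x‖ * (‖g 0 x‖ + ‖g 1 x‖) / ‖x‖)) := by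
      field_simp
      ring
    have e2 : kin g x + pot p f x + 3 * (‖f x‖ * (‖g 0 x‖ + ‖g 1 x‖) / ‖x‖)
        ≤ 4 * (η⁻¹ * kin g x + pot p f x + η * (rho f x / ‖x‖ ^ 2)) := by
      have h1 : kin g x ≤ η⁻¹ * kin g x := le_mul_of_one_le_left hk hη2
      have h2 : 0 ≤ η * (rho f x / ‖x‖ ^ 2) := by
        have := rho_nonneg f x
        positivity
      unfold rho at h2 ⊢
      unfold kin at h1 hk ⊢
      linarith
    rw [e1]
    calc C₁ * shell k x * ((wt δ x)⁻¹ * (kin g x + pot p f x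
          + 3 * (‖f x‖ * (‖g 0 x‖ + ‖g 1 x‖) / ‖x‖)))
        ≤ C₁ * shell k x * (δ⁻¹ * (4 * (η⁻¹ * kin g x + pot p f x + η * (rho f x / ‖x‖ ^ 2)))) := by
          gcongr
      _ = _ := by ring
  have m5 : 0 ≤ C₀ * δ⁻¹ ^ 3 * (η⁻¹ * (shell k x * kin g x) + shell k x * pot p f x
        + η * (shell k x / ‖x‖ ^ 2 * rho f x)) := by
    have := kin_nonneg g x
    have := pot_nonneg p f x
    have := rho_nonneg f x
    positivity
  have m6 : 0 ≤ 4 * C₁ * δ⁻¹ * (shell k x * rho f x) := by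
    have := rho_nonneg f x
    positivity
  have eφ : 1 / 2 * (dv φ x * rho f x + ∑ j, φ j x * (2 * qd f (g j) x))
      = plateau k x * ((wt δ x)⁻¹ ^ 3 * (∑ j, x j * qd f (g j) x)
        + rho f x * (2 * (wt δ x)⁻¹ ^ 3 - 3 * ‖x‖ ^ 2 * (wt δ x)⁻¹ ^ 5) / 2)
        + rho f x * ((wt δ x)⁻¹ ^ 3 * (∑ j, pd j (plateau k) x * x j)) / 2 := by
    rw [hdφ]
    simp only [φ, Fin.sum_univ_two]
    ring
  rw [eφ, hC]
  linarith

end MorawetzFixedTime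

/-! ### Monotonicity and linearity in the weight. -/

section WeightedIntegrals

/-- The mass with weight `b`. -/
noncomputable def wMass (b : Plane → ℝ) (f : Plane → ℂ) : ℝ := ∫ x, b x * rho f x

/-- The kinetic energy with weight `b`. -/
noncomputable def wKin (b : Plane → ℝ) (g : Fin 2 → Plane → ℂ) : ℝ := ∫ x, b x * kin g x

/-- The potential energy with weight `b`. -/
noncomputable def wPot (p : ℝ) (b : Plane → ℝ) (f : Plane → ℂ) : ℝ := ∫ x, b x * pot p f x

variable {f : Plane → ℂ} {g : Fin 2 → Plane → ℂ} {b b' : Plane → ℝ}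

theorem wMass_mono (h : H1Pair f g) (hb : IsBdd b) (hb' : IsBdd b') (hle : ∀ x, b x ≤ b' x) :
    wMass b f ≤ wMass b' f :=
  (hasInt_rho hb h.memLp).self.mono_ae (hasInt_rho hb' h.memLp).self
    (ae_of_all _ fun x => mul_le_mul_of_nonneg_right (hle x) (rho_nonneg f x))

theorem wKin_mono (h : H1Pair f g) (hb : IsBdd b) (hb' : IsBdd b') (hle : ∀ x, b x ≤ b' x) :
    wKin b g ≤ wKin b' g :=
  (hasInt_kin hb h.memLp_grad).self.mono_ae (hasInt_kin hb' h.memLp_grad).self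
    (ae_of_all _ fun x => mul_le_mul_of_nonneg_right (hle x) (kin_nonneg g x))

theorem wPot_mono {p : ℝ} (hp : 1 ≤ p) (h : H1Pair f g) (hb : IsBdd b) (hb' : IsBdd b')
    (hle : ∀ x, b x ≤ b' x) : wPot p b f ≤ wPot p b' f :=
  (hasInt_pot hb hp h).self.mono_ae (hasInt_pot hb' hp h).self
    (ae_of_all _ fun x => mul_le_mul_of_nonneg_right (hle x) (pot_nonneg p f x))

theorem wMass_nonneg (hb : ∀ x, 0 ≤ b x) : 0 ≤ wMass b f :=
  integral_nonneg fun x => mul_nonneg (hb x) (rho_nonneg f x)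

theorem wKin_nonneg (hb : ∀ x, 0 ≤ b x) : 0 ≤ wKin b g :=
  integral_nonneg fun x => mul_nonneg (hb x) (kin_nonneg g x)

theorem wPot_nonneg {p : ℝ} (hb : ∀ x, 0 ≤ b x) : 0 ≤ wPot p b f :=
  integral_nonneg fun x => mul_nonneg (hb x) (pot_nonneg p f x)

theorem wMass_add (h : H1Pair f g) (hb : IsBdd b) (hb' : IsBdd b') :
    wMass (fun x => b x + b' x) f = wMass b f + wMass b' f :=
  HasInt.unique (hasInt_rho (hb.add hb') h.memLp).self
    (((hasInt_rho hb h.memLp).self.add (hasInt_rho hb' h.memLp).self).congr fun x => by ring)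

theorem wMass_const_mul (c : ℝ) : wMass (fun x => c * b x) f = c * wMass b f := by
  simp only [wMass, mul_assoc, integral_const_mul]

theorem wMass_sub (h : H1Pair f g) (hb : IsBdd b) (hb' : IsBdd b') :
    wMass (fun x => b x - b' x) f = wMass b f - wMass b' f := by
  have := wMass_add h hb (hb'.const_mul (-1))
  rw [wMass_const_mul] at this
  rw [show (fun x => b x - b' x) = fun x => b x + -1 * b' x by funext x; ring, this]
  ring

theorem wKin_sub (h : H1Pair f g) (hb : IsBdd b) (hb' : IsBdd b') :
    wKin (fun x => b x - b' x) g = wKin b g - wKin b' g := by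
  have := ((hasInt_kin hb h.memLp_grad).self.add ((hasInt_kin hb' h.memLp_grad).self.const_mul (-1)))
  have h2 := (this.congr (g := fun x => (b x - b' x) * kin g x) fun x => by ring).2
  rw [wKin, h2, wKin, wKin]
  ring

theorem wPot_sub {p : ℝ} (hp : 1 ≤ p) (h : H1Pair f g) (hb : IsBdd b) (hb' : IsBdd b') :
    wPot p (fun x => b x - b' x) f = wPot p b f - wPot p b' f := by
  have := ((hasInt_pot hb hp h).self.add ((hasInt_pot hb' hp h).self.const_mul (-1)))
  have h2 := (this.congr (g := fun x => (b x - b' x) * pot p f x) fun x => by ring).2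
  rw [wPot, h2, wPot, wPot]
  ring

end WeightedIntegrals

/-! ### Integration in time and the space-time bound for |u|²/|x|². -/

section TimeIntegrated

variable {a p c d : ℝ} {U : ℝ → L2} {G : Fin 2 → ℝ → L2}

theorem Flow.continuous_wMass (F : Flow a p c d U G) {b : Plane → ℝ} (hb : IsBdd b) :
    Continuous fun t => wMass b (U t) := by
  have : (fun t => wMass b (U t)) = fun t => (ip b (U t) (U t)).re :=
    funext fun t => (hasInt_rho hb (Lp.memLp _)).2
  rw [this]
  exact Complex.continuous_re.comp (continuous_ip hb F.cU F.cU)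

theorem Flow.continuous_wKin (F : Flow a p c d U G) {b : Plane → ℝ} (hb : IsBdd b) :
    Continuous fun t => wKin b (fun j => G j t) := by
  have : (fun t => wKin b (fun j => G j t)) = fun t => ∑ j, (ip b (G j t) (G j t)).re :=
    funext fun t => (hasInt_kin hb fun j => Lp.memLp (G j t)).2
  rw [this]
  exact continuous_finsetSum _ fun j _ =>
    Complex.continuous_re.comp (continuous_ip hb (F.cG j) (F.cG j))

theorem Flow.continuous_wPot (F : Flow a p c d U G) (hp : 1 ≤ p) {b : Plane → ℝ} (hb : IsBdd b) :
    Continuous fun t => wPot p b (U t) := by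
  obtain ⟨N, cN, hN⟩ := exists_nlL hp F.cU F.cG F.pair
  have : (fun t => wPot p b (U t)) = fun t => (ip b (U t) (N t)).re := funext fun t => by
    rw [wPot, (hasInt_pot hb hp (F.pair t)).2, ip_congr (ae_eq_refl _) (hN t)]
  rw [this]
  exact Complex.continuous_re.comp (continuous_ip hb F.cU cN)

theorem continuous_const_mul_fun {φ : ℝ → ℝ} (hφ : Continuous φ) (r : ℝ) :
    Continuous fun t => r * φ t := continuous_const.mul hφ

theorem eLpNorm_toReal (F : L2) : (eLpNorm F 2 volume).toReal = ‖F‖ := (Lp.norm_def F).symm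

theorem abs_mom_le {X : Fin 2 → Plane → ℝ} {B : ℝ} (hX : ∀ j x, |X j x| ≤ B) {u : L2} {g : Fin 2 → L2}
    {m S : ℝ} (hm : ‖u‖ ≤ m) (hS : ∀ j, ‖g j‖ ≤ S) : |mom X u (fun j => g j)| ≤ 2 * B * m * S := by
  have hB : 0 ≤ B := (abs_nonneg _).trans (hX 0 0)
  have h : ∀ j, |(ip (X j) u (g j)).im| ≤ B * (m * S) := fun j => by
    refine (Complex.abs_im_le_norm _).trans ((norm_ip_le (hX j) (Lp.memLp u) (Lp.memLp (g j))).trans ?_)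
    rw [eLpNorm_toReal, eLpNorm_toReal]
    have := (norm_nonneg u).trans hm
    gcongr
    exact hS j
  rw [mom, Fin.sum_univ_two]
  refine (abs_add_le _ _).trans ?_
  linarith [h 0, h 1]

theorem Flow.continuous_mom (F : Flow a p c d U G) {X : Fin 2 → Plane → ℝ} (hX : ∀ j, IsBdd (X j)) :
    Continuous fun t => mom X (U t) (fun j => G j t) :=
  continuous_finsetSum _ fun j _ => Complex.continuous_im.comp (continuous_ip (hX j) F.cU (F.cG j))

theorem abs_cutField_le {Y : Fin 2 → Plane → ℝ} {B : ℝ} (hY : ∀ j x, |Y j x| ≤ B) (k : ℕ) (j : Fin 2)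
    (x : Plane) : |cutField k Y j x| ≤ B := by
  rw [cutField, abs_mul, abs_of_nonneg (plateau_nonneg k x)]
  exact (mul_le_of_le_one_left (abs_nonneg _) (plateau_le_one k x)).trans (hY j x)

/-- The time-integrated Morawetz estimate with a truncated vector field. -/
theorem exists_morawetz_truncated {δ : ℝ} (hδ : 0 < δ) : ∃ C, 0 < C ∧ ∀ (a p c d : ℝ)
    (U : ℝ → L2) (G : Fin 2 → ℝ → L2), Flow a p c d U G → 1 ≤ p → c ≤ d → ∀ m S : ℝ,
    (∀ t, ‖U t‖ ≤ m) → (∀ j t, ‖G j t‖ ≤ S) → ∀ (k : ℕ) (η : ℝ), 0 < η → η ≤ 1 →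
    ∫ t in c..d, (δ ^ 2 / 2 * wKin (fun x => plateau k x * (wt δ x)⁻¹ ^ 3) (fun j => G j t)
      + (2 * a - 1 / 2) * wMass (fun x => plateau k x * ((wt δ x)⁻¹ / ‖x‖ ^ 2)) (U t)
      + p / (p + 2) * wPot p (fun x => plateau k x * (wt δ x)⁻¹) (U t))
      ≤ 4 * m * S + C * ∫ t in c..d, (η⁻¹ * wKin (shell k) (fun j => G j t)
        + wMass (shell k) (U t) + wPot p (shell k) (U t)
        + η * wMass (fun x => shell k x / ‖x‖ ^ 2) (U t)) := by
  obtain ⟨C, hC, hv⟩ := exists_virial_ge hδ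
  refine ⟨C, hC, fun a p c d U G F hp hcd m S hm hS k η hη hη1 => ?_⟩
  have hκ := (isTest_plateau k).isBdd
  have c1 : Continuous fun t => δ ^ 2 / 2 * wKin (fun x => plateau k x * (wt δ x)⁻¹ ^ 3) (fun j => G j t)
      + (2 * a - 1 / 2) * wMass (fun x => plateau k x * ((wt δ x)⁻¹ / ‖x‖ ^ 2)) (U t)
      + p / (p + 2) * wPot p (fun x => plateau k x * (wt δ x)⁻¹) (U t) :=
    ((continuous_const.mul (F.continuous_wKin (hκ.mul (isBdd_wt_inv_pow hδ 3)))).add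
      (continuous_const.mul (F.continuous_wMass (isBdd_plateau_wt hδ k)))).add
      (continuous_const.mul (F.continuous_wPot hp (hκ.mul (isBdd_wt_inv hδ))))
  have c2 : Continuous fun t => η⁻¹ * wKin (shell k) (fun j => G j t)
        + wMass (shell k) (U t) + wPot p (shell k) (U t)
        + η * wMass (fun x => shell k x / ‖x‖ ^ 2) (U t) :=
    (((continuous_const.mul (F.continuous_wKin (isBdd_shell k))).add
      (F.continuous_wMass (isBdd_shell k))).add (F.continuous_wPot hp (isBdd_shell k))).add
      (continuous_const.mul (F.continuous_wMass (isBdd_shell_div k 2)))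
  have hX := isTest_cutField k (contDiff_radial hδ)
  have key := intervalIntegral.integral_le_sub_of_hasDeriv_right_of_le hcd
    (F.continuous_mom fun j => (hX j).isBdd).continuousOn
    (fun t ht => (F.momentum _ hX (fun j => zero_notMem_tsupport_cutField k j) t ht).hasDerivWithinAt)
    ((c1.sub (continuous_const_mul_fun c2 C)).continuousOn.integrableOn_Icc)
    (fun t _ => sub_le_iff_le_add.2 (hv k a p hp (U t) (fun j => G j t) (F.pair t) η hη hη1))
  -- Each of the two endpoints contributes 2mS, since the field is bounded by one in each of its two
  -- components.
  have e : ∀ t, |mom (cutField k (radial δ)) (U t) (fun j => G j t)| ≤ 2 * 1 * m * S := fun t =>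
    abs_mom_le (abs_cutField_le (abs_radial_le_one hδ) k) (hm t) (fun j => hS j t)
  have e2 := intervalIntegral.integral_sub (c1.intervalIntegrable c d (μ := volume))
    ((continuous_const_mul_fun c2 C).intervalIntegrable c d (μ := volume))
  rw [intervalIntegral.integral_const_mul] at e2
  have e3 := key
  simp only [Pi.sub_apply] at e3
  rw [e2] at e3
  have h1 := (abs_le.1 (e d)).2
  have h2 := (abs_le.1 (e c)).1
  linarith

/-- Iterating n times multiplies the a priori bound by 4^(3n) and the recursion coefficient by
128⁻ⁿ, a net factor 2⁻ⁿ; the constants sum to less than 2K. -/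
theorem le_of_geometric_recursion {y : ℕ → ℝ} {K K₀ : ℝ} (hK : 0 ≤ K)
    (h1 : ∀ k, y k ≤ K + 1 / 128 * y (k + 3)) (h2 : ∀ k, y k ≤ K₀ * 4 ^ k) (k : ℕ) :
    y k ≤ 2 * K := by
  have h3 : ∀ n k, y k ≤ 2 * K + (1 / 128) ^ n * y (k + 3 * n) := by
    intro n
    induction n with
    | zero => intro k; simp; linarith
    | succ n ih =>
      intro k
      have h4 := h1 k
      have h5 := ih (k + 3)
      have e : k + 3 + 3 * n = k + 3 * (n + 1) := by ring
      rw [e] at h5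
      rw [pow_succ]
      linarith
  have h4 : ∀ n : ℕ, y k ≤ 2 * K + K₀ * 4 ^ k * (1 / 2) ^ n := by
    intro n
    refine (h3 n k).trans ?_
    have h5 := mul_le_mul_of_nonneg_left (h2 (k + 3 * n)) (by positivity : (0 : ℝ) ≤ (1 / 128) ^ n)
    have e : (1 / 128 : ℝ) ^ n * (K₀ * 4 ^ (k + 3 * n)) = K₀ * 4 ^ k * (1 / 2) ^ n := by
      rw [pow_add, pow_mul, show (1 / 2 : ℝ) ^ n = (1 / 128) ^ n * (4 ^ 3) ^ n by
        rw [← mul_pow]; norm_num]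
      ring
    linarith
  have h5 : Tendsto (fun n : ℕ => 2 * K + K₀ * 4 ^ k * (1 / 2 : ℝ) ^ n) atTop
      (𝓝 (2 * K + K₀ * 4 ^ k * 0)) :=
    ((tendsto_pow_atTop_nhds_zero_of_lt_one (by norm_num) (by norm_num)).const_mul _).const_add _
  rw [mul_zero, add_zero] at h5
  exact ge_of_tendsto' h5 h4

/-- For |x| ≤ 1 the weight with δ = 1 is at most 2, and for |x| ≥ 1 the left side is at most 1. -/
theorem core_div_sq_le (k : ℕ) (x : Plane) :
    core k x / ‖x‖ ^ 2 ≤ 1 + 2 * (core k x * ((wt 1 x)⁻¹ / ‖x‖ ^ 2)) := by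
  have hc := core_nonneg k x
  have hc1 := core_le_one k x
  have hw := wt_pos one_pos x
  rcases le_total ‖x‖ 1 with h | h
  · have h1 : wt 1 x ≤ 2 := (wt_le one_pos x).trans (by linarith)
    have h2 : 1 ≤ 2 * (wt 1 x)⁻¹ := by
      rw [← div_eq_mul_inv, le_div_iff₀ hw]; linarith
    have h3 : 0 ≤ core k x / ‖x‖ ^ 2 := by positivity
    have e : 2 * (core k x * ((wt 1 x)⁻¹ / ‖x‖ ^ 2)) = 2 * (wt 1 x)⁻¹ * (core k x / ‖x‖ ^ 2) := by ring
    rw [e]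
    nlinarith
  · have h3 : 0 ≤ 2 * (core k x * ((wt 1 x)⁻¹ / ‖x‖ ^ 2)) := by positivity
    have h4 : core k x / ‖x‖ ^ 2 ≤ 1 := by
      rw [div_le_one (by positivity)]
      nlinarith
    linarith

theorem Flow.integral_mono (hcd : c ≤ d) {φ ψ : ℝ → ℝ} (hφ : Continuous φ) (hψ : Continuous ψ)
    (h : ∀ t, φ t ≤ ψ t) : ∫ t in c..d, φ t ≤ ∫ t in c..d, ψ t :=
  intervalIntegral.integral_mono hcd (hφ.intervalIntegrable c d) (hψ.intervalIntegrable c d) h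

/-- H¹ does not bound |u|²/|x|² in the plane; the Morawetz inequality does, in space-time. Its error
at level k contains a small multiple of the same integral at level k+3, and the trivial bound 4ᵏ
grows slowly enough for the recursion to close. Positivity of 2a - 1/2 is essential. -/
theorem Flow.exists_wMass_le (F : Flow a p c d U G) (ha : 1 / 4 < a) (hp : 1 ≤ p) (hcd : c ≤ d)
    {m S : ℝ} (hm : ∀ t, ‖U t‖ ≤ m) (hS : ∀ j t, ‖G j t‖ ≤ S) :
    ∃ K, ∀ k, ∫ t in c..d, wMass (fun x => core k x / ‖x‖ ^ 2) (U t) ≤ K := by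
  obtain ⟨C, hC, hmor⟩ := exists_morawetz_truncated one_pos
  have one := isBdd_const 1
  set y : ℕ → ℝ := fun k => ∫ t in c..d, wMass (fun x => core k x * ((wt 1 x)⁻¹ / ‖x‖ ^ 2)) (U t) with hy
  set R := ∫ t in c..d, wMass (fun _ => 1) (U t) with hR
  set K := ∫ t in c..d, wKin (fun _ => 1) (fun j => G j t) with hK
  set P := ∫ t in c..d, wPot p (fun _ => 1) (U t) with hP
  have cy : ∀ k, Continuous fun t => wMass (fun x => core k x * ((wt 1 x)⁻¹ / ‖x‖ ^ 2)) (U t) :=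
    fun k => F.continuous_wMass (isBdd_core_wt one_pos k)
  have cR := F.continuous_wMass one
  have cK := F.continuous_wKin one
  have cP := F.continuous_wPot hp one
  have R0 : 0 ≤ R := intervalIntegral.integral_nonneg hcd fun t _ => wMass_nonneg fun _ => zero_le_one
  have K0 : 0 ≤ K := intervalIntegral.integral_nonneg hcd fun t _ => wKin_nonneg fun _ => zero_le_one
  have P0 : 0 ≤ P := intervalIntegral.integral_nonneg hcd fun t _ => wPot_nonneg fun _ => zero_le_one
  have m0 : 0 ≤ m := (norm_nonneg _).trans (hm 0)
  have S0 : 0 ≤ S := (norm_nonneg _).trans (hS 0 0)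
  have hdiv : ∀ k, ∫ t in c..d, wMass (fun x => core k x / ‖x‖ ^ 2) (U t) ≤ R + 2 * y k := by
    intro k
    have h1 := Flow.integral_mono hcd (F.continuous_wMass (isBdd_core_div k 2))
      (cR.fun_add (continuous_const_mul_fun (cy k) 2)) fun t => by
        refine (wMass_mono (F.pair t) (isBdd_core_div k 2)
          (one.add ((isBdd_core_wt one_pos k).const_mul 2)) (core_div_sq_le k)).trans_eq ?_
        rw [wMass_add (F.pair t) one ((isBdd_core_wt one_pos k).const_mul 2), wMass_const_mul]
    refine h1.trans_eq ?_
    rw [intervalIntegral.integral_add (cR.intervalIntegrable c d)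
      ((continuous_const_mul_fun (cy k) 2).intervalIntegrable c d),
      intervalIntegral.integral_const_mul]
  have ha' : 0 < 2 * a - 1 / 2 := by linarith
  -- Young's parameter is chosen so that, after division by 2a - 1/2, the integral at level k+3
  -- appears with coefficient at most 1/128.
  set η := min 1 ((2 * a - 1 / 2) / (256 * C)) with hη
  have η0 : 0 < η := lt_min one_pos (by positivity)
  have η1 : η ≤ 1 := min_le_left _ _
  have η2 : 2 * C * η ≤ (2 * a - 1 / 2) / 128 := by
    have := min_le_right 1 ((2 * a - 1 / 2) / (256 * C))
    rw [← hη, le_div_iff₀ (by positivity)] at this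
    linarith
  have hrec : ∀ k, (2 * a - 1 / 2) * y k
      ≤ 4 * m * S + C * (η⁻¹ * K + R + P + η * (R + 2 * y (k + 3))) := by
    intro k
    have h1 := hmor a p c d U G F hp hcd m S hm hS k η η0 η1
    have hκ := (isTest_plateau k).isBdd
    have i1 := isBdd_wt_inv_pow one_pos 3
    have i2 := isBdd_wt_inv one_pos
    refine le_trans (le_trans ?_ h1) ?_
    · rw [hy, ← intervalIntegral.integral_const_mul]
      refine Flow.integral_mono hcd (continuous_const.mul (cy k)) ?_ fun t => ?_
      · exact ((continuous_const.mul (F.continuous_wKin (hκ.mul i1))).add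
          (continuous_const.mul (F.continuous_wMass (isBdd_plateau_wt one_pos k)))).add
          (continuous_const.mul (F.continuous_wPot hp (hκ.mul i2)))
      · have e1 : 0 ≤ wKin (fun x => plateau k x * (wt 1 x)⁻¹ ^ 3) (fun j => G j t) :=
          wKin_nonneg fun x => mul_nonneg (plateau_nonneg k x)
            (pow_nonneg (inv_nonneg.2 (wt_pos one_pos x).le) 3)
        have e2 : 0 ≤ wPot p (fun x => plateau k x * (wt 1 x)⁻¹) (U t) :=
          wPot_nonneg fun x => mul_nonneg (plateau_nonneg k x) (inv_nonneg.2 (wt_pos one_pos x).le)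
        have e3 := wMass_mono (F.pair t) (isBdd_core_wt one_pos k) (isBdd_plateau_wt one_pos k)
          fun x => mul_le_mul_of_nonneg_right (core_le_plateau k x)
            (div_nonneg (inv_nonneg.2 (wt_pos one_pos x).le) (by positivity))
        have e4 := mul_le_mul_of_nonneg_left e3 ha'.le
        have e5 : 0 ≤ p / (p + 2) * wPot p (fun x => plateau k x * (wt 1 x)⁻¹) (U t) :=
          mul_nonneg (by positivity) e2
        have e6 : 0 ≤ (1 : ℝ) ^ 2 / 2 * wKin (fun x => plateau k x * (wt 1 x)⁻¹ ^ 3) (fun j => G j t) :=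
          mul_nonneg (by positivity) e1
        linarith
    gcongr
    have s1 := F.continuous_wKin (isBdd_shell k)
    have s2 := F.continuous_wMass (isBdd_shell k)
    have s3 := F.continuous_wPot hp (isBdd_shell k)
    have s4 := F.continuous_wMass (isBdd_shell_div k 2)
    have s1' : Continuous fun t => η⁻¹ * wKin (shell k) (fun j => G j t) := continuous_const.mul s1
    have s4' : Continuous fun t => η * wMass (fun x => shell k x / ‖x‖ ^ 2) (U t) :=
      continuous_const.mul s4
    have s12 : Continuous fun t => η⁻¹ * wKin (shell k) (fun j => G j t) + wMass (shell k) (U t) :=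
      s1'.add s2
    have s123 : Continuous fun t => η⁻¹ * wKin (shell k) (fun j => G j t) + wMass (shell k) (U t)
      + wPot p (shell k) (U t) := s12.add s3
    rw [intervalIntegral.integral_add (s123.intervalIntegrable c d) (s4'.intervalIntegrable c d),
      intervalIntegral.integral_add (s12.intervalIntegrable c d) (s3.intervalIntegrable c d),
      intervalIntegral.integral_add (s1'.intervalIntegrable c d) (s2.intervalIntegrable c d),
      intervalIntegral.integral_const_mul, intervalIntegral.integral_const_mul]
    have q1 : ∫ t in c..d, wKin (shell k) (fun j => G j t) ≤ K := Flow.integral_mono hcd s1 cK fun t =>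
      wKin_mono (F.pair t) (isBdd_shell k) one (shell_le_one k)
    have q2 : ∫ t in c..d, wMass (shell k) (U t) ≤ R := Flow.integral_mono hcd s2 cR fun t =>
      wMass_mono (F.pair t) (isBdd_shell k) one (shell_le_one k)
    have q3 : ∫ t in c..d, wPot p (shell k) (U t) ≤ P := Flow.integral_mono hcd s3 cP fun t =>
      wPot_mono hp (F.pair t) (isBdd_shell k) one (shell_le_one k)
    have q4 : ∫ t in c..d, wMass (fun x => shell k x / ‖x‖ ^ 2) (U t) ≤ R + 2 * y (k + 3) := by
      refine (Flow.integral_mono hcd s4 (F.continuous_wMass (isBdd_core_div (k + 3) 2)) fun t =>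
        wMass_mono (F.pair t) (isBdd_shell_div k 2) (isBdd_core_div (k + 3) 2) fun x => ?_).trans
        (hdiv (k + 3))
      exact div_le_div_of_nonneg_right (shell_le_core k x) (by positivity)
    gcongr
  have y0 : ∀ k, 0 ≤ y k := fun k => intervalIntegral.integral_nonneg hcd fun t _ =>
    wMass_nonneg fun x => mul_nonneg (core_nonneg k x)
      (div_nonneg (inv_nonneg.2 (wt_pos one_pos x).le) (by positivity))
  set K' := (4 * m * S + C * (η⁻¹ * K + R + P + η * R)) / (2 * a - 1 / 2) with hK'
  have K'0 : 0 ≤ K' := by positivity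
  have h1 : ∀ k, y k ≤ K' + 1 / 128 * y (k + 3) := by
    intro k
    have h := hrec k
    have e : K' + 1 / 128 * y (k + 3) = (4 * m * S + C * (η⁻¹ * K + R + P + η * R)
        + (2 * a - 1 / 2) / 128 * y (k + 3)) / (2 * a - 1 / 2) := by
      rw [hK', eq_div_iff ha'.ne', add_mul, div_mul_cancel₀ _ ha'.ne']; ring
    rw [e, le_div_iff₀ ha']
    have := mul_le_mul_of_nonneg_right η2 (y0 (k + 3))
    linarith
  have h2 : ∀ k, y k ≤ R * 4 ^ k := by
    intro k
    rw [mul_comm, hR, ← intervalIntegral.integral_const_mul]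
    refine Flow.integral_mono hcd (cy k) (continuous_const.mul cR) fun t => ?_
    rw [← wMass_const_mul]
    refine wMass_mono (F.pair t) (isBdd_core_wt one_pos k) (one.const_mul _) fun x => ?_
    have h3 := core_div_le k 2 x
    have h4 : (wt 1 x)⁻¹ ≤ 1 := inv_le_one_of_one_le₀ (le_wt 1 x)
    have e : core k x * ((wt 1 x)⁻¹ / ‖x‖ ^ 2) = core k x / ‖x‖ ^ 2 * (wt 1 x)⁻¹ := by ring
    have e2 : ((2 : ℝ) ^ k) ^ 2 = 4 ^ k := by rw [← pow_mul, mul_comm, pow_mul]; norm_num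
    rw [e, ← e2]
    have : 0 ≤ core k x / ‖x‖ ^ 2 := div_nonneg (core_nonneg k x) (by positivity)
    have := inv_nonneg.2 (wt_pos one_pos x).le
    gcongr
  exact ⟨R + 2 * (2 * K'), fun k => (hdiv k).trans (by
    linarith [le_of_geometric_recursion K'0 h1 h2 k])⟩

end TimeIntegrated

/-! ### Removing the cutoff: the Morawetz estimate and conservation of mass. -/

section Limits

variable {a p c d : ℝ} {U : ℝ → L2} {G : Fin 2 → ℝ → L2}

/-- The quantity which controls the errors made by truncation. -/
noncomputable def shellError (p c d : ℝ) (U : ℝ → L2) (G : Fin 2 → ℝ → L2) (k : ℕ) : ℝ :=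
  ∫ t in c..d, (wKin (shell k) (fun j => G j t) + wMass (shell k) (U t) + wPot p (shell k) (U t)
    + wMass (fun x => shell k x / ‖x‖ ^ 2) (U t))

theorem Flow.continuous_shellError (F : Flow a p c d U G) (hp : 1 ≤ p) (k : ℕ) :
    Continuous fun t => wKin (shell k) (fun j => G j t) + wMass (shell k) (U t)
      + wPot p (shell k) (U t) + wMass (fun x => shell k x / ‖x‖ ^ 2) (U t) :=
  (((F.continuous_wKin (isBdd_shell k)).fun_add (F.continuous_wMass (isBdd_shell k))).fun_add
    (F.continuous_wPot hp (isBdd_shell k))).fun_add (F.continuous_wMass (isBdd_shell_div k 2))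

/-- A shell is the difference of two annuli, so the error is T(k+3) - T(k) for an increasing
sequence T, which is bounded by the space-time estimate for |u|²/|x|². -/
theorem Flow.tendsto_shellError (F : Flow a p c d U G) (ha : 1 / 4 < a) (hp : 1 ≤ p) (hcd : c ≤ d)
    {m S : ℝ} (hm : ∀ t, ‖U t‖ ≤ m) (hS : ∀ j t, ‖G j t‖ ≤ S) :
    Tendsto (shellError p c d U G) atTop (𝓝 0) := by
  obtain ⟨K, hK⟩ := F.exists_wMass_le ha hp hcd hm hS
  let e : ℕ → ℝ → ℝ := fun k t => wKin (core k) (fun j => G j t) + wMass (core k) (U t)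
    + wPot p (core k) (U t)
  let e' : ℕ → ℝ → ℝ := fun k t => wMass (fun x => core k x / ‖x‖ ^ 2) (U t)
  have ce : ∀ k, Continuous (e k) := fun k =>
    ((F.continuous_wKin (isBdd_core k)).fun_add (F.continuous_wMass (isBdd_core k))).fun_add
      (F.continuous_wPot hp (isBdd_core k))
  have ce' : ∀ k, Continuous (e' k) := fun k => F.continuous_wMass (isBdd_core_div k 2)
  have one := isBdd_const 1
  let e₁ : ℝ → ℝ := fun t => wKin (fun _ => 1) (fun j => G j t) + wMass (fun _ => 1) (U t)
    + wPot p (fun _ => 1) (U t)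
  have ce₁ : Continuous e₁ := ((F.continuous_wKin one).fun_add (F.continuous_wMass one)).fun_add
      (F.continuous_wPot hp one)
  let T : ℕ → ℝ := fun k => (∫ t in c..d, e k t) + ∫ t in c..d, e' k t
  have hmono : Monotone T := by
    intro k l hkl
    refine add_le_add (Flow.integral_mono hcd (ce k) (ce l) fun t => ?_)
      (Flow.integral_mono hcd (ce' k) (ce' l) fun t => ?_)
    · exact add_le_add (add_le_add
        (wKin_mono (F.pair t) (isBdd_core k) (isBdd_core l) (core_mono hkl))
        (wMass_mono (F.pair t) (isBdd_core k) (isBdd_core l) (core_mono hkl)))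
        (wPot_mono hp (F.pair t) (isBdd_core k) (isBdd_core l) (core_mono hkl))
    · exact wMass_mono (F.pair t) (isBdd_core_div k 2) (isBdd_core_div l 2) fun x =>
        div_le_div_of_nonneg_right (core_mono hkl x) (by positivity)
  have hbdd : BddAbove (Set.range T) := by
    refine ⟨(∫ t in c..d, e₁ t) + K, ?_⟩
    rintro _ ⟨k, rfl⟩
    refine add_le_add (Flow.integral_mono hcd (ce k) ce₁ fun t => ?_) (hK k)
    exact add_le_add (add_le_add
        (wKin_mono (F.pair t) (isBdd_core k) one (core_le_one k))
        (wMass_mono (F.pair t) (isBdd_core k) one (core_le_one k)))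
        (wPot_mono hp (F.pair t) (isBdd_core k) one (core_le_one k))
  have hlim := tendsto_atTop_ciSup hmono hbdd
  have h3 := (hlim.comp (tendsto_add_atTop_nat 3)).sub hlim
  rw [sub_self] at h3
  refine h3.congr fun k => ?_
  have i : ∀ {φ : ℝ → ℝ}, Continuous φ → IntervalIntegrable φ volume c d := fun h =>
    h.intervalIntegrable c d
  simp only [T, Function.comp]
  rw [← intervalIntegral.integral_add (i (ce _)) (i (ce' _)),
    ← intervalIntegral.integral_add (i (ce _)) (i (ce' _)),
    ← intervalIntegral.integral_sub (i ((ce _).fun_add (ce' _))) (i ((ce _).fun_add (ce' _))), shellError]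
  congr 1
  funext t
  have e1 := wKin_sub (F.pair t) (isBdd_core (k + 3)) (isBdd_core k)
  have e2 := wMass_sub (F.pair t) (isBdd_core (k + 3)) (isBdd_core k)
  have e3 := wPot_sub hp (F.pair t) (isBdd_core (k + 3)) (isBdd_core k)
  have e4 := wMass_sub (F.pair t) (isBdd_core_div (k + 3) 2) (isBdd_core_div k 2)
  have e5 : (fun x => shell k x / ‖x‖ ^ 2) = fun x => core (k + 3) x / ‖x‖ ^ 2 - core k x / ‖x‖ ^ 2 := by
    funext x; rw [shell, sub_div]
  have e6 : shell k = fun x => core (k + 3) x - core k x := rfl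
  rw [e5, e4, e6, e1, e2, e3]
  simp only [e, e']
  ring

/-- The Morawetz estimate. -/
theorem Flow.morawetz (F : Flow a p c d U G) (ha : 1 / 4 < a) (hp : 1 ≤ p) (hcd : c ≤ d)
    {m S : ℝ} (hm : ∀ t, ‖U t‖ ≤ m) (hS : ∀ j t, ‖G j t‖ ≤ S) {δ : ℝ} (hδ : 0 < δ) (k : ℕ) :
    ∫ t in c..d, (δ ^ 2 / 2 * wKin (fun x => core k x * (wt δ x)⁻¹ ^ 3) (fun j => G j t)
      + (2 * a - 1 / 2) * wMass (fun x => core k x * ((wt δ x)⁻¹ / ‖x‖ ^ 2)) (U t)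
      + p / (p + 2) * wPot p (fun x => core k x * (wt δ x)⁻¹) (U t)) ≤ 4 * m * S := by
  obtain ⟨C, hC, hmor⟩ := exists_morawetz_truncated hδ
  have h := F.tendsto_shellError ha hp hcd hm hS
  have h2 : Tendsto (fun l => 4 * m * S + C * shellError p c d U G l) atTop
      (𝓝 (4 * m * S + C * 0)) := (h.const_mul C).const_add _
  rw [mul_zero, add_zero] at h2
  refine ge_of_tendsto h2 ?_
  -- The annulus k on the left stays fixed while the truncation l of the field tends to infinity.
  filter_upwards [eventually_ge_atTop k] with l hl
  have h3 := hmor a p c d U G F hp hcd m S hm hS l 1 one_pos le_rfl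
  simp only [inv_one, one_mul] at h3
  refine le_trans (Flow.integral_mono hcd ?_ ?_ fun t => ?_) h3
  · exact (((continuous_const_mul_fun (F.continuous_wKin ((isBdd_core k).mul (isBdd_wt_inv_pow hδ 3))) _)).add
      (continuous_const_mul_fun (F.continuous_wMass (isBdd_core_wt hδ k)) _)).add
      (continuous_const_mul_fun (F.continuous_wPot hp ((isBdd_core k).mul (isBdd_wt_inv hδ))) _)
  · have hκ := (isTest_plateau l).isBdd
    exact (((continuous_const_mul_fun (F.continuous_wKin (hκ.mul (isBdd_wt_inv_pow hδ 3))) _)).add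
      (continuous_const_mul_fun (F.continuous_wMass (isBdd_plateau_wt hδ l)) _)).add
      (continuous_const_mul_fun (F.continuous_wPot hp (hκ.mul (isBdd_wt_inv hδ))) _)
  · have hκ := (isTest_plateau l).isBdd
    have hle : ∀ x, core k x ≤ plateau l x := fun x => (core_mono hl x).trans (core_le_plateau l x)
    have hw : ∀ x, 0 ≤ (wt δ x)⁻¹ := fun x => inv_nonneg.2 (wt_pos hδ x).le
    have e1 := wKin_mono (F.pair t) ((isBdd_core k).mul (isBdd_wt_inv_pow hδ 3))
      (hκ.mul (isBdd_wt_inv_pow hδ 3)) fun x =>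
        mul_le_mul_of_nonneg_right (hle x) (pow_nonneg (hw x) 3)
    have e2 := wMass_mono (F.pair t) (isBdd_core_wt hδ k) (isBdd_plateau_wt hδ l) fun x =>
      mul_le_mul_of_nonneg_right (hle x) (div_nonneg (hw x) (by positivity))
    have e3 := wPot_mono hp (F.pair t) ((isBdd_core k).mul (isBdd_wt_inv hδ))
      (hκ.mul (isBdd_wt_inv hδ)) fun x => mul_le_mul_of_nonneg_right (hle x) (hw x)
    have ha' : 0 ≤ 2 * a - 1 / 2 := by linarith
    have hp' : 0 ≤ p / (p + 2) := by positivity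
    gcongr

theorem eventually_core_eq_one {x : Plane} (hx : x ≠ 0) : ∀ᶠ k in atTop, core k x = 1 := by
  have hx0 : 0 < ‖x‖ := norm_pos_iff.2 hx
  have h1 : Tendsto (fun k : ℕ => (2 : ℝ) ^ k) atTop atTop :=
    tendsto_pow_atTop_atTop_of_one_lt (by norm_num)
  filter_upwards [h1.eventually_gt_atTop ‖x‖, h1.eventually_gt_atTop ‖x‖⁻¹] with k h2 h3
  rw [core, if_pos ⟨inv_lt_of_inv_lt₀ hx0 h3, h2⟩]

theorem eventually_plateau_eq_one {x : Plane} (hx : x ≠ 0) : ∀ᶠ k in atTop, plateau k x = 1 := by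
  filter_upwards [eventually_core_eq_one hx] with k hk
  exact le_antisymm (plateau_le_one k x) (hk ▸ core_le_plateau k x)

theorem tendsto_ip_plateau {b : Plane → ℝ} (hb : IsBdd b) {f g : Plane → ℂ} (hf : MemLp f 2)
    (hg : MemLp g 2) :
    Tendsto (fun k => ip (fun x => plateau k x * b x) f g) atTop (𝓝 (ip b f g)) := by
  refine tendsto_integral_of_dominated_convergence
    (fun x => ‖b x • (starRingEnd ℂ (f x) * g x)‖) (fun k => ?_) (integrable_ip hb hf hg).norm
    (fun k => ae_of_all _ fun x => ?_) ?_
  · exact (integrable_ip ((isTest_plateau k).isBdd.mul hb) hf hg).aestronglyMeasurable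
  · rw [mul_smul, norm_smul, Real.norm_eq_abs, abs_of_nonneg (plateau_nonneg k x)]
    exact mul_le_of_le_one_left (norm_nonneg _) (plateau_le_one k x)
  · filter_upwards [ae_ne_zero] with x hx
    refine tendsto_const_nhds.congr' ?_
    filter_upwards [eventually_plateau_eq_one hx] with k hk
    rw [hk, one_mul]

/-- The local conservation of mass, for weights which need not vanish at the origin. -/
theorem Flow.mass_law (F : Flow a p c d U G) (ha : 1 / 4 < a) (hp : 1 ≤ p) (hcd : c ≤ d)
    {m S : ℝ} (hm : ∀ t, ‖U t‖ ≤ m) (hS : ∀ j t, ‖G j t‖ ≤ S) {ψ : Plane → ℝ}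
    (hψ : ContDiff ℝ ∞ ψ) (hb : IsBdd ψ) (hb' : ∀ j, IsBdd (pd j ψ)) {s t : ℝ} (hs : c ≤ s)
    (hst : s ≤ t) (ht : t ≤ d) :
    ∫ τ in s..t, 2 * ∑ j, (ip (pd j ψ) (U τ) (G j τ)).im = wMass ψ (U t) - wMass ψ (U s) := by
  obtain ⟨C, hC, hbd⟩ := exists_plateau_bound
  obtain ⟨B, hB⟩ := hb.bounded
  have B0 : 0 ≤ B := (abs_nonneg _).trans (hB 0)
  choose B' hB' using fun j => (hb' j).bounded
  let ψk : ℕ → Plane → ℝ := fun k x => plateau k x * ψ x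
  have hk : ∀ k, IsTest (ψk k) := fun k => (isTest_plateau k).mul hψ
  have hk0 : ∀ k, (0 : Plane) ∉ tsupport (ψk k) := fun k h =>
    zero_notMem_tsupport_plateau k (tsupport_mul_subset_left h)
  have cont : ∀ {b : Fin 2 → Plane → ℝ}, (∀ j, IsBdd (b j)) →
      Continuous fun τ => 2 * ∑ j, (ip (b j) (U τ) (G j τ)).im := fun hb =>
    continuous_const.mul (F.continuous_mom hb)
  have ftc : ∀ k, ∫ τ in s..t, 2 * ∑ j, (ip (pd j (ψk k)) (U τ) (G j τ)).im
      = (ip (ψk k) (U t) (U t)).re - (ip (ψk k) (U s) (U s)).re := fun k =>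
    intervalIntegral.integral_eq_sub_of_hasDerivAt_of_le hst
      (Complex.continuous_re.comp (continuous_ip (hk k).isBdd F.cU F.cU)).continuousOn
      (fun τ hτ => F.mass (ψk k) (hk k) (hk0 k) τ ⟨hs.trans_lt hτ.1, hτ.2.trans_le ht⟩)
      ((cont fun j => ((hk k).pd j).isBdd).intervalIntegrable s t)
  have hpd : ∀ k j x, pd j (ψk k) x = plateau k x * pd j ψ x + pd j (plateau k) x * ψ x :=
    fun k j x => pd_mul j (differentiable_of_contDiff (contDiff_plateau k) x)
      (differentiable_of_contDiff hψ x)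
  have bκ : ∀ k j, IsBdd (fun x => pd j (plateau k) x * ψ x) := fun k j =>
    ((isTest_plateau k).pd j).isBdd.mul hb
  have bψ : ∀ k j, IsBdd (fun x => plateau k x * pd j ψ x) := fun k j =>
    (isTest_plateau k).isBdd.mul (hb' j)
  have split : ∀ k, ∫ τ in s..t, 2 * ∑ j, (ip (pd j (ψk k)) (U τ) (G j τ)).im
      = (∫ τ in s..t, 2 * ∑ j, (ip (fun x => plateau k x * pd j ψ x) (U τ) (G j τ)).im)
        + ∫ τ in s..t, 2 * ∑ j, (ip (fun x => pd j (plateau k) x * ψ x) (U τ) (G j τ)).im := by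
    intro k
    rw [← intervalIntegral.integral_add ((cont (bψ k)).intervalIntegrable s t)
      ((cont (bκ k)).intervalIntegrable s t)]
    congr 1
    funext τ
    have e : ∀ j, ip (pd j (ψk k)) (U τ) (G j τ) = ip (fun x => plateau k x * pd j ψ x) (U τ) (G j τ)
        + ip (fun x => pd j (plateau k) x * ψ x) (U τ) (G j τ) := by
      intro j
      unfold ip
      rw [← integral_add (integrable_ip (bψ k j) (Lp.memLp _) (Lp.memLp _))
        (integrable_ip (bκ k j) (Lp.memLp _) (Lp.memLp _))]
      congr 1
      funext x
      rw [hpd, add_smul]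
    simp only [e, Complex.add_im, Fin.sum_univ_two]
    ring
  -- The derivative of the cutoff is O(1/|x|) on the shell, and |f||g|/|x| ≤ |g|² + |f|²/|x|². Hence
  -- this term is dominated by the shell error.
  have lim0 : Tendsto (fun k => ∫ τ in s..t, 2 * ∑ j,
      (ip (fun x => pd j (plateau k) x * ψ x) (U τ) (G j τ)).im) atTop (𝓝 0) := by
    have hE := (F.tendsto_shellError ha hp hcd hm hS).const_mul (4 * C * B)
    rw [mul_zero] at hE
    refine squeeze_zero_norm (fun k => ?_) hE
    have hpt : ∀ τ, ‖2 * ∑ j, (ip (fun x => pd j (plateau k) x * ψ x) (U τ) (G j τ)).im‖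
        ≤ 4 * C * B * (wKin (shell k) (fun j => G j τ) + wMass (shell k) (U τ)
          + wPot p (shell k) (U τ) + wMass (fun x => shell k x / ‖x‖ ^ 2) (U τ)) := by
      intro τ
      have hj : ∀ j, |(ip (fun x => pd j (plateau k) x * ψ x) (U τ) (G j τ)).im|
          ≤ C * B * (wKin (shell k) (fun j => G j τ) + wMass (fun x => shell k x / ‖x‖ ^ 2) (U τ)) := by
        intro j
        have h1 := hasInt_ip_im (bκ k j) (Lp.memLp (U τ)) (Lp.memLp (G j τ))
        have h2 := (((hasInt_kin (isBdd_shell k) fun j => Lp.memLp (G j τ)).self.add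
          (hasInt_rho (isBdd_shell_div k 2) (Lp.memLp (U τ))).self).const_mul (C * B))
        rw [← h1.2]
        refine (abs_integral_le_integral_abs).trans
          (HasInt.mono_ae ⟨h1.1.abs, rfl⟩ h2 ?_)
        filter_upwards [ae_ne_zero] with x hx
        have hx0 : 0 < ‖x‖ := norm_pos_iff.2 hx
        have h3 : |pd j (plateau k) x| ≤ C * shell k x / ‖x‖ := by
          rw [le_div_iff₀ hx0]; exact (hbd k x 0 j).1
        have h4 := abs_mul_three_le h3 (hB x) (abs_md_le (U τ) (G j τ) x)
        refine h4.trans ?_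
        have hkin : ‖G j τ x‖ ^ 2 ≤ kin (fun j => G j τ) x := by
          unfold kin
          fin_cases j
          · exact le_add_of_nonneg_right (sq_nonneg _)
          · exact le_add_of_nonneg_left (sq_nonneg _)
        have h5 : ‖U τ x‖ * ‖G j τ x‖ / ‖x‖ ≤ kin (fun j => G j τ) x + rho (U τ) x / ‖x‖ ^ 2 := by
          have e : ‖U τ x‖ * ‖G j τ x‖ / ‖x‖ = (‖U τ x‖ / ‖x‖) * ‖G j τ x‖ := by ring
          have e2 : rho (U τ) x / ‖x‖ ^ 2 = (‖U τ x‖ / ‖x‖) ^ 2 := by rw [rho]; ring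
          rw [e, e2]
          nlinarith [sq_nonneg (‖U τ x‖ / ‖x‖ - ‖G j τ x‖), sq_nonneg (‖U τ x‖ / ‖x‖),
            sq_nonneg ‖G j τ x‖]
        have hsh := shell_nonneg k x
        calc C * shell k x / ‖x‖ * B * (‖U τ x‖ * ‖G j τ x‖)
            = C * B * shell k x * (‖U τ x‖ * ‖G j τ x‖ / ‖x‖) := by ring
          _ ≤ C * B * shell k x * (kin (fun j => G j τ) x + rho (U τ) x / ‖x‖ ^ 2) := by gcongr
          _ = _ := by ring
      have n1 : 0 ≤ wMass (shell k) (U τ) := wMass_nonneg (shell_nonneg k)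
      have n2 : 0 ≤ wPot p (shell k) (U τ) := wPot_nonneg (shell_nonneg k)
      rw [Real.norm_eq_abs, abs_mul, abs_two, Fin.sum_univ_two]
      have h6 := (abs_add_le (ip (fun x => pd 0 (plateau k) x * ψ x) (U τ) (G 0 τ)).im
        (ip (fun x => pd 1 (plateau k) x * ψ x) (U τ) (G 1 τ)).im)
      have h7 := hj 0
      have h8 := hj 1
      have n3 : 0 ≤ C * B * (wMass (shell k) (U τ) + wPot p (shell k) (U τ)) := by positivity
      linarith
    have cE := F.continuous_shellError hp k
    calc ‖∫ τ in s..t, 2 * ∑ j, (ip (fun x => pd j (plateau k) x * ψ x) (U τ) (G j τ)).im‖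
        ≤ ∫ τ in s..t, 4 * C * B * (wKin (shell k) (fun j => G j τ) + wMass (shell k) (U τ)
          + wPot p (shell k) (U τ) + wMass (fun x => shell k x / ‖x‖ ^ 2) (U τ)) :=
          intervalIntegral.norm_integral_le_of_norm_le hst (ae_of_all _ fun τ _ => hpt τ)
            ((continuous_const_mul_fun cE _).intervalIntegrable s t)
      _ ≤ ∫ τ in c..d, 4 * C * B * (wKin (shell k) (fun j => G j τ) + wMass (shell k) (U τ)
          + wPot p (shell k) (U τ) + wMass (fun x => shell k x / ‖x‖ ^ 2) (U τ)) := by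
          refine intervalIntegral.integral_mono_interval hs hst ht (ae_of_all _ fun τ => ?_)
            ((continuous_const_mul_fun cE _).intervalIntegrable c d)
          exact (norm_nonneg _).trans (hpt τ)
      _ = _ := by rw [intervalIntegral.integral_const_mul, shellError]
  have lim1 : Tendsto (fun k => ∫ τ in s..t, 2 * ∑ j,
      (ip (fun x => plateau k x * pd j ψ x) (U τ) (G j τ)).im) atTop
      (𝓝 (∫ τ in s..t, 2 * ∑ j, (ip (pd j ψ) (U τ) (G j τ)).im)) := by
    refine intervalIntegral.tendsto_integral_filter_of_dominated_convergence
      (fun _ => 2 * ∑ j, |B' j| * (m * S)) (Eventually.of_forall fun k =>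
        (cont (bψ k)).aestronglyMeasurable) (Eventually.of_forall fun k => ae_of_all _ fun τ _ => ?_)
      intervalIntegrable_const (ae_of_all _ fun τ _ => ?_)
    · rw [norm_mul, Real.norm_eq_abs, abs_two]
      gcongr
      refine (norm_sum_le _ _).trans (Finset.sum_le_sum fun j _ => ?_)
      refine (Complex.abs_im_le_norm _).trans ((norm_ip_le (C := |B' j|) (fun x => ?_) (Lp.memLp _)
        (Lp.memLp _)).trans ?_)
      · rw [abs_mul, abs_of_nonneg (plateau_nonneg k x)]
        exact (mul_le_of_le_one_left (abs_nonneg _) (plateau_le_one k x)).trans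
          ((hB' j x).trans (le_abs_self _))
      · rw [eLpNorm_toReal, eLpNorm_toReal]
        have := (norm_nonneg _).trans (hm τ)
        gcongr
        · exact hm τ
        · exact hS j τ
    · refine (tendsto_finsetSum _ fun j _ => ?_).const_mul 2
      exact (Complex.continuous_im.tendsto _).comp
        (tendsto_ip_plateau (hb' j) (Lp.memLp _) (Lp.memLp _))
  have lim2 : ∀ τ, Tendsto (fun k => (ip (ψk k) (U τ) (U τ)).re) atTop (𝓝 (wMass ψ (U τ))) := by
    intro τ
    rw [wMass, (hasInt_rho hb (Lp.memLp (U τ))).2]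
    exact (Complex.continuous_re.tendsto _).comp (tendsto_ip_plateau hb (Lp.memLp _) (Lp.memLp _))
  have l1 := (lim1.add lim0).congr fun k => (split k).symm.trans (ftc k)
  rw [add_zero] at l1
  exact tendsto_nhds_unique l1 ((lim2 t).sub (lim2 s))

theorem wMass_one (u : L2) : wMass (fun _ => 1) u = ‖u‖ ^ 2 := by
  have h := L2.inner_def (𝕜 := ℂ) u u
  simp only [inner_self_eq_norm_sq_to_K] at h
  have h2 : ((‖u‖ ^ 2 : ℝ) : ℂ) = ((∫ x, ‖u x‖ ^ 2 : ℝ) : ℂ) := by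
    rw [← integral_complex_ofReal]
    push_cast
    exact h
  rw [Complex.ofReal_inj.1 h2]
  simp [wMass, rho]

/-- The local law is applied to the constant weight, for which the flux vanishes. -/
theorem Flow.norm_eq (F : Flow a p c d U G) (ha : 1 / 4 < a) (hp : 1 ≤ p) (hcd : c ≤ d)
    {m S : ℝ} (hm : ∀ t, ‖U t‖ ≤ m) (hS : ∀ j t, ‖G j t‖ ≤ S) {t : ℝ} (ht : t ∈ Set.Icc c d) :
    ‖U t‖ = ‖U c‖ := by
  have h0 : ∀ j : Fin 2, pd j (fun _ : Plane => (1 : ℝ)) = fun _ => 0 := fun j => by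
    funext x; simp [pd]
  have h := F.mass_law ha hp hcd hm hS (ψ := fun _ => 1) contDiff_const (isBdd_const 1)
    (fun j => by rw [h0]; exact isBdd_const 0) le_rfl ht.1 ht.2
  simp only [h0, wMass_one] at h
  have e : ∀ u v : L2, ip (fun _ => 0) u v = 0 := fun u v => by simp [ip]
  simp only [e, Complex.zero_im, Finset.sum_const_zero, mul_zero,
    intervalIntegral.integral_zero] at h
  exact (pow_left_inj₀ (norm_nonneg _) (norm_nonneg _) two_ne_zero).1 (by linarith)

end Limits

/-! ### Densities as continuous curves in L¹. -/

section Curves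

/-- Curves of integrable functions which are continuous in `L¹`. -/
structure L1Curve (e : ℝ → Plane → ℝ) : Prop where
  integrable : ∀ t, Integrable (e t)
  tendsto : ∀ t, Tendsto (fun s => ∫ x, |e s x - e t x|) (𝓝 t) (𝓝 0)

theorem L1Curve.continuous_integral_abs {e : ℝ → Plane → ℝ} (h : L1Curve e) :
    Continuous fun t => ∫ x, |e t x| := by
  refine continuous_iff_continuousAt.2 fun t => tendsto_iff_norm_sub_tendsto_zero.2 ?_
  refine squeeze_zero (fun _ => norm_nonneg _) (fun s => ?_) (h.tendsto t)
  rw [← integral_sub (h.integrable s).abs (h.integrable t).abs]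
  refine (norm_integral_le_integral_norm _).trans (integral_mono_of_nonneg
    (ae_of_all _ fun _ => norm_nonneg _) ((h.integrable s).sub (h.integrable t)).abs
    (ae_of_all _ fun x => abs_abs_sub_abs_le_abs_sub _ _))

theorem L1Curve.congr_ae {e e' : ℝ → Plane → ℝ} (h : L1Curve e) (he : ∀ t, e t =ᵐ[volume] e' t) :
    L1Curve e' where
  integrable t := (h.integrable t).congr (he t)
  tendsto t := (h.tendsto t).congr fun s => integral_congr_ae (by
    filter_upwards [he s, he t] with x h1 h2
    rw [h1, h2])

theorem tendsto_integral_conj_mul {F F' : ℝ → L2} (hF : Continuous F) (hF' : Continuous F') (t : ℝ) :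
    Tendsto (fun s => ∫ x, ‖starRingEnd ℂ (F s x) * F' s x - starRingEnd ℂ (F t x) * F' t x‖) (𝓝 t)
      (𝓝 0) := by
  have key : ∀ s, ∫ x, ‖starRingEnd ℂ (F s x) * F' s x - starRingEnd ℂ (F t x) * F' t x‖
      ≤ ‖F s‖ * ‖F' s - F' t‖ + ‖F s - F t‖ * ‖F' t‖ := by
    intro s
    have i : ∀ u v : L2, Integrable fun x => ‖u x‖ * ‖v x‖ := fun u v =>
      (Lp.memLp u).norm.integrable_mul (Lp.memLp v).norm
    have b : ∀ u v : L2, ∫ x, ‖u x‖ * ‖v x‖ ≤ ‖u‖ * ‖v‖ := fun u v => by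
      have := norm_integral_conj_mul_le (Lp.memLp u) (Lp.memLp v)
      rwa [eLpNorm_toReal, eLpNorm_toReal] at this
    refine le_trans (integral_mono_ae ?_ ((i (F s) (F' s - F' t)).add (i (F s - F t) (F' t))) ?_) ?_
    · exact ((integrable_conj_mul (Lp.memLp _) (Lp.memLp _)).sub
        (integrable_conj_mul (Lp.memLp _) (Lp.memLp _))).norm
    · filter_upwards [Lp.coeFn_sub (F' s) (F' t), Lp.coeFn_sub (F s) (F t)] with x h1 h2
      simp only [Pi.add_apply, h1, h2, Pi.sub_apply]
      have e : starRingEnd ℂ (F s x) * F' s x - starRingEnd ℂ (F t x) * F' t x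
          = starRingEnd ℂ (F s x) * (F' s x - F' t x) + starRingEnd ℂ (F s x - F t x) * F' t x := by
        rw [map_sub]; ring
      rw [e]
      refine (norm_add_le _ _).trans_eq ?_
      rw [norm_mul, norm_mul, RCLike.norm_conj, RCLike.norm_conj]
    · have := integral_add (i (F s) (F' s - F' t)) (i (F s - F t) (F' t))
      exact this.le.trans (add_le_add (b _ _) (b _ _))
  have hlim : Tendsto (fun s => ‖F s‖ * ‖F' s - F' t‖ + ‖F s - F t‖ * ‖F' t‖) (𝓝 t) (𝓝 0) := by
    have : Continuous fun s => ‖F s‖ * ‖F' s - F' t‖ + ‖F s - F t‖ * ‖F' t‖ := by fun_prop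
    have h := this.tendsto t
    simpa using h
  exact squeeze_zero (fun s => integral_nonneg fun x => norm_nonneg _) key hlim

theorem integrable_qd {f h : Plane → ℂ} (hf : MemLp f 2) (hh : MemLp h 2) : Integrable (qd f h) :=
  (integrable_conj_mul hf hh).re

theorem integrable_md {f h : Plane → ℂ} (hf : MemLp f 2) (hh : MemLp h 2) : Integrable (md f h) :=
  (integrable_conj_mul hf hh).im

theorem l1Curve_qd {F F' : ℝ → L2} (hF : Continuous F) (hF' : Continuous F') :
    L1Curve fun t => qd (F t) (F' t) where
  integrable t := integrable_qd (Lp.memLp _) (Lp.memLp _)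
  tendsto t := by
    refine squeeze_zero (fun s => integral_nonneg fun x => abs_nonneg _) (fun s => ?_)
      (tendsto_integral_conj_mul hF hF' t)
    refine integral_mono_of_nonneg (ae_of_all _ fun x => abs_nonneg _)
      ((integrable_conj_mul (Lp.memLp _) (Lp.memLp _)).sub
        (integrable_conj_mul (Lp.memLp _) (Lp.memLp _))).norm (ae_of_all _ fun x => ?_)
    simp only [qd, ← Complex.sub_re]
    exact Complex.abs_re_le_norm _

theorem l1Curve_md {F F' : ℝ → L2} (hF : Continuous F) (hF' : Continuous F') :
    L1Curve fun t => md (F t) (F' t) where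
  integrable t := integrable_md (Lp.memLp _) (Lp.memLp _)
  tendsto t := by
    refine squeeze_zero (fun s => integral_nonneg fun x => abs_nonneg _) (fun s => ?_)
      (tendsto_integral_conj_mul hF hF' t)
    refine integral_mono_of_nonneg (ae_of_all _ fun x => abs_nonneg _)
      ((integrable_conj_mul (Lp.memLp _) (Lp.memLp _)).sub
        (integrable_conj_mul (Lp.memLp _) (Lp.memLp _))).norm (ae_of_all _ fun x => ?_)
    simp only [md, ← Complex.sub_im]
    exact Complex.abs_im_le_norm _

end Curves

/-! ### Bilinear forms with a bounded kernel, and convolutions. -/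

section DoubleIntegrals

/-- The bilinear form on integrable functions with kernel `Φ`. -/
noncomputable def dbl (Φ : Plane × Plane → ℝ) (e e' : Plane → ℝ) : ℝ :=
  ∫ z : Plane × Plane, Φ z * (e' z.1 * e z.2)

variable {Φ : Plane × Plane → ℝ} {C : ℝ}

theorem integrable_dbl (hΦ : Measurable Φ) (hC : ∀ z, |Φ z| ≤ C) {e e' : Plane → ℝ}
    (he : Integrable e) (he' : Integrable e') :
    Integrable fun z : Plane × Plane => Φ z * (e' z.1 * e z.2) :=
  (he'.mul_prod he).bdd_mul (c := C) hΦ.aestronglyMeasurable (ae_of_all _ hC)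

theorem abs_dbl_le (hC : ∀ z, |Φ z| ≤ C) {e e' : Plane → ℝ}
    (he : Integrable e) (he' : Integrable e') :
    |dbl Φ e e'| ≤ C * ((∫ x, |e x|) * ∫ x, |e' x|) := by
  refine (abs_integral_le_integral_abs).trans ?_
  have h : ∫ z : Plane × Plane, C * (|e' z.1| * |e z.2|) = C * ((∫ x, |e x|) * ∫ x, |e' x|) := by
    have e0 := integral_prod_mul (μ := (volume : Measure Plane)) (ν := (volume : Measure Plane))
      (fun x => |e' x|) (fun y => |e y|)
    rw [integral_const_mul, Measure.volume_eq_prod, e0, mul_comm (∫ x, |e' x|)]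
  rw [← h]
  refine integral_mono_of_nonneg (ae_of_all _ fun _ => abs_nonneg _)
    ((he'.abs.mul_prod he.abs).const_mul C) (ae_of_all _ fun z => ?_)
  simp only [abs_mul]
  exact mul_le_mul_of_nonneg_right (hC z) (by positivity)

theorem dbl_sub_left (hΦ : Measurable Φ) (hC : ∀ z, |Φ z| ≤ C) {e₁ e₂ e' : Plane → ℝ}
    (h₁ : Integrable e₁) (h₂ : Integrable e₂) (he' : Integrable e') :
    dbl Φ (fun x => e₁ x - e₂ x) e' = dbl Φ e₁ e' - dbl Φ e₂ e' := by
  rw [dbl, dbl, dbl, ← integral_sub (integrable_dbl hΦ hC h₁ he') (integrable_dbl hΦ hC h₂ he')]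
  congr 1; funext z; ring

theorem dbl_sub_right (hΦ : Measurable Φ) (hC : ∀ z, |Φ z| ≤ C) {e e₁ e₂ : Plane → ℝ}
    (he : Integrable e) (h₁ : Integrable e₁) (h₂ : Integrable e₂) :
    dbl Φ e (fun x => e₁ x - e₂ x) = dbl Φ e e₁ - dbl Φ e e₂ := by
  rw [dbl, dbl, dbl, ← integral_sub (integrable_dbl hΦ hC he h₁) (integrable_dbl hΦ hC he h₂)]
  congr 1; funext z; ring

/-- The two densities are evaluated at independent times, because the interaction functional is
later differentiated in each time separately. -/
theorem continuous_dbl (hΦ : Measurable Φ) (hC : ∀ z, |Φ z| ≤ C) {e e' : ℝ → Plane → ℝ}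
    (he : L1Curve e) (he' : L1Curve e') : Continuous fun z : ℝ × ℝ => dbl Φ (e z.1) (e' z.2) := by
  refine continuous_iff_continuousAt.2 fun z => tendsto_iff_norm_sub_tendsto_zero.2 ?_
  have hb : ∀ w : ℝ × ℝ, ‖dbl Φ (e w.1) (e' w.2) - dbl Φ (e z.1) (e' z.2)‖
      ≤ C * ((∫ x, |e w.1 x - e z.1 x|) * ∫ x, |e' w.2 x|)
        + C * ((∫ x, |e z.1 x|) * ∫ x, |e' w.2 x - e' z.2 x|) := by
    intro w
    have e1 := dbl_sub_left hΦ hC (he.integrable w.1) (he.integrable z.1) (he'.integrable w.2)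
    have e2 := dbl_sub_right hΦ hC (he.integrable z.1) (he'.integrable w.2) (he'.integrable z.2)
    have e3 : dbl Φ (e w.1) (e' w.2) - dbl Φ (e z.1) (e' z.2)
        = dbl Φ (fun x => e w.1 x - e z.1 x) (e' w.2) + dbl Φ (e z.1) (fun x => e' w.2 x - e' z.2 x) := by
      rw [e1, e2]; ring
    rw [e3]
    exact (norm_add_le _ _).trans (add_le_add
      (abs_dbl_le hC ((he.integrable w.1).sub (he.integrable z.1)) (he'.integrable w.2))
      (abs_dbl_le hC (he.integrable z.1) ((he'.integrable w.2).sub (he'.integrable z.2))))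
  have t1 : Tendsto (fun w : ℝ × ℝ => ∫ x, |e w.1 x - e z.1 x|) (𝓝 z) (𝓝 0) :=
    (he.tendsto z.1).comp (continuous_fst.tendsto z)
  have t2 : Tendsto (fun w : ℝ × ℝ => ∫ x, |e' w.2 x - e' z.2 x|) (𝓝 z) (𝓝 0) :=
    (he'.tendsto z.2).comp (continuous_snd.tendsto z)
  have t3 : Tendsto (fun w : ℝ × ℝ => ∫ x, |e' w.2 x|) (𝓝 z) (𝓝 (∫ x, |e' z.2 x|)) :=
    (he'.continuous_integral_abs.tendsto z.2).comp (continuous_snd.tendsto z)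
  have t4 := ((t1.mul t3).const_mul C).add ((t2.const_mul (∫ x, |e z.1 x|)).const_mul C)
  simp only [zero_mul, mul_zero, add_zero] at t4
  exact squeeze_zero (fun _ => norm_nonneg _) hb t4

theorem tendsto_dbl {Φk : ℕ → Plane × Plane → ℝ} (hm : ∀ k, Measurable (Φk k))
    (hC : ∀ k z, |Φk k z| ≤ C) (hlim : ∀ᵐ z, Tendsto (fun k => Φk k z) atTop (𝓝 (Φ z)))
    {e e' : Plane → ℝ} (he : Integrable e) (he' : Integrable e') :
    Tendsto (fun k => dbl (Φk k) e e') atTop (𝓝 (dbl Φ e e')) := by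
  refine tendsto_integral_of_dominated_convergence (fun z => C * (|e' z.1| * |e z.2|)) (fun k => ?_)
    ((he'.abs.mul_prod he.abs).const_mul C) (fun k => ae_of_all _ fun z => ?_) ?_
  · exact (integrable_dbl (hm k) (hC k) he he').aestronglyMeasurable
  · rw [Real.norm_eq_abs, abs_mul, abs_mul]
    exact mul_le_mul_of_nonneg_right (hC k z) (by positivity)
  · filter_upwards [hlim] with z hz
    exact hz.mul_const _

/-- The convolution of an integrable function with a kernel. -/
noncomputable def cv (φ : Plane → ℝ) (e : Plane → ℝ) (x : Plane) : ℝ := ∫ y, e y * φ (x - y)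

theorem cv_eq_convolution (φ e : Plane → ℝ) :
    cv φ e = MeasureTheory.convolution e φ (ContinuousLinearMap.mul ℝ ℝ) volume := rfl

variable {φ : Plane → ℝ} {e e' : Plane → ℝ}

theorem contDiff_cv (hφ : IsTest φ) (he : Integrable e) : ContDiff ℝ ∞ (cv φ e) := by
  rw [cv_eq_convolution]
  exact hφ.compact.contDiff_convolution_right _ he.locallyIntegrable hφ.contDiff

theorem integrable_cv {φ : Plane → ℝ} {C : ℝ} (hm : Measurable φ) (hC : ∀ x, |φ x| ≤ C) (he : Integrable e)
    (x : Plane) : Integrable fun y => e y * φ (x - y) :=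
  he.mul_bdd (c := C) (hm.comp (measurable_const.sub measurable_id)).aestronglyMeasurable
    (ae_of_all _ fun y => hC (x - y))

theorem pd_cv (hφ : IsTest φ) (he : Integrable e) (j : Fin 2) (x : Plane) :
    pd j (cv φ e) x = cv (pd j φ) e x := by
  have h := hφ.compact.hasFDerivAt_convolution_right (ContinuousLinearMap.mul ℝ ℝ)
    he.locallyIntegrable (hφ.contDiff.of_le (by simp)) x (μ := volume)
  rw [← cv_eq_convolution] at h
  rw [pd, h.fderiv, MeasureTheory.convolution, ContinuousLinearMap.integral_apply]
  · rfl
  · have hi := (hφ.compact.fderiv ℝ).convolutionExists_right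
      ((ContinuousLinearMap.mul ℝ ℝ).precompR Plane) he.locallyIntegrable
      (hφ.contDiff.continuous_fderiv (by simp)) x (μ := volume)
    exact hi

theorem abs_cv_le {C : ℝ} (hC : ∀ x, |φ x| ≤ C) (he : Integrable e) (x : Plane) :
    |cv φ e x| ≤ C * ∫ y, |e y| := by
  refine (abs_integral_le_integral_abs).trans ?_
  rw [← integral_const_mul]
  refine integral_mono_of_nonneg (ae_of_all _ fun _ => abs_nonneg _) (he.abs.const_mul C)
    (ae_of_all _ fun y => ?_)
  simp only [abs_mul]
  rw [mul_comm]
  exact mul_le_mul_of_nonneg_right (hC _) (abs_nonneg _)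

theorem measurable_kernel {θ : Plane → ℝ} (hθ : Measurable θ) (hφ : Measurable φ) :
    Measurable fun z : Plane × Plane => θ z.1 * φ (z.1 - z.2) :=
  (hθ.comp measurable_fst).mul (hφ.comp (measurable_fst.sub measurable_snd))

/-- Fubini read in the variable x exhibits a convolution field acting on the second density. Read in
y, as in `dbl_eq_right`, the same form is an integral of the first density against a smooth weight.
The momentum law uses the one reading, the mass law the other. -/
theorem dbl_eq_left {θ : Plane → ℝ} (hθ : IsBdd θ) (hφ : IsBdd φ) (he : Integrable e)
    (he' : Integrable e') :
    HasInt (fun x => θ x * (cv φ e x * e' x)) (dbl (fun z => θ z.1 * φ (z.1 - z.2)) e e') := by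
  obtain ⟨C, hC⟩ := hθ.bounded
  obtain ⟨C', hC'⟩ := hφ.bounded
  have hi := integrable_dbl (measurable_kernel hθ.measurable hφ.measurable) (C := C * C') (fun z => by
    rw [abs_mul]
    exact mul_le_mul (hC _) (hC' _) (abs_nonneg _) ((abs_nonneg _).trans (hC z.1))) he he'
  rw [Measure.volume_eq_prod] at hi
  have e1 : ∀ x, ∫ y, θ x * φ (x - y) * (e' x * e y) = θ x * (cv φ e x * e' x) := by
    intro x
    rw [cv, ← integral_mul_const, ← integral_const_mul]
    congr 1; funext y; ring
  refine HasInt.congr ⟨hi.integral_prod_left, ?_⟩ e1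
  rw [dbl, Measure.volume_eq_prod, integral_prod _ hi]

theorem dbl_eq_right {θ : Plane → ℝ} (hθ : IsBdd θ) (hφ : IsBdd φ) (he : Integrable e)
    (he' : Integrable e') :
    HasInt (fun y => cv (fun x => φ (-x)) (fun x => θ x * e' x) y * e y)
      (dbl (fun z => θ z.1 * φ (z.1 - z.2)) e e') := by
  obtain ⟨C, hC⟩ := hθ.bounded
  obtain ⟨C', hC'⟩ := hφ.bounded
  have hi := integrable_dbl (measurable_kernel hθ.measurable hφ.measurable) (C := C * C') (fun z => by
    rw [abs_mul]
    exact mul_le_mul (hC _) (hC' _) (abs_nonneg _) ((abs_nonneg _).trans (hC z.1))) he he'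
  rw [Measure.volume_eq_prod] at hi
  have e1 : ∀ y, ∫ x, θ x * φ (x - y) * (e' x * e y)
      = cv (fun x => φ (-x)) (fun x => θ x * e' x) y * e y := by
    intro y
    rw [cv, ← integral_mul_const]
    congr 1; funext x
    rw [neg_sub]; ring
  refine HasInt.congr ⟨hi.integral_prod_right, ?_⟩ e1
  rw [dbl, Measure.volume_eq_prod, integral_prod_symm _ hi]

end DoubleIntegrals

/-! ### The interaction kernel, truncated at infinity. -/

section Kernel

variable {σ : ℝ}

/-- The regularized radial unit field, cut off near infinity. -/
noncomputable def ker (σ : ℝ) (k : ℕ) (j : Fin 2) (x : Plane) : ℝ :=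
  (1 - cut ((2 ^ k)⁻¹) x) * radial σ j x

theorem isTest_ker (hσ : 0 < σ) (k : ℕ) (j : Fin 2) : IsTest (ker σ k j) :=
  (isTest_one_sub_cut (by positivity)).mul (contDiff_radial hσ j)

theorem abs_ker_le (hσ : 0 < σ) (k : ℕ) (j : Fin 2) (x : Plane) : |ker σ k j x| ≤ 1 := by
  have h1 := cut_nonneg ((2 ^ k)⁻¹) x
  have h2 := cut_le_one ((2 ^ k)⁻¹) x
  rw [ker, abs_mul, abs_of_nonneg (by linarith)]
  exact mul_le_one₀ (by linarith) (abs_nonneg _) (abs_radial_le_one hσ j x)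

/-- The bound depends on σ but not on k: the weight is at least σ, and the cutoff scale 2⁻ᵏ is at
most one. -/
theorem exists_pd_ker_le (hσ : 0 < σ) :
    ∃ C, 0 < C ∧ ∀ (k : ℕ) (l j : Fin 2) (x : Plane), |pd l (ker σ k j) x| ≤ C := by
  obtain ⟨C, hC, hb⟩ := exists_cut_bound
  refine ⟨2 * σ⁻¹ + C, by positivity, fun k l j x => ?_⟩
  have hs : |((2 : ℝ) ^ k)⁻¹| ≤ 1 := by
    rw [abs_of_pos (by positivity)]
    exact inv_le_one_of_one_le₀ (one_le_pow₀ (by norm_num))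
  have d1 := differentiable_of_contDiff (contDiff_cut ((2 : ℝ) ^ k)⁻¹)
  have e : pd l (ker σ k j) x = (1 - cut ((2 ^ k)⁻¹) x) * pd l (radial σ j) x
      + (-pd l (cut ((2 ^ k)⁻¹)) x) * radial σ j x := by
    have := pd_mul l ((d1 x).const_sub 1) (differentiable_of_contDiff (contDiff_radial hσ j) x)
    have h2 : pd l (fun x => 1 - cut ((2 ^ k)⁻¹) x) x = -pd l (cut ((2 ^ k)⁻¹)) x := by
      simp [pd, fderiv_const_sub]
    rw [h2] at this
    exact this
  have h1 := cut_nonneg ((2 ^ k)⁻¹) x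
  have h2 := cut_le_one ((2 ^ k)⁻¹) x
  rw [e]
  refine (abs_add_le _ _).trans (add_le_add ?_ ?_)
  · rw [abs_mul, abs_of_nonneg (by linarith)]
    refine (mul_le_of_le_one_left (abs_nonneg _) (by linarith)).trans
      ((abs_pd_radial_le hσ l j x).trans ?_)
    gcongr
    exact le_wt σ x
  · rw [abs_mul, abs_neg]
    refine (mul_le_of_le_one_right (abs_nonneg _) (abs_radial_le_one hσ j x)).trans
      ((hb _ x 0 l).1.trans ?_)
    exact mul_le_of_le_one_right hC.le hs

theorem eventually_pd_ker_eq (l j : Fin 2) (x : Plane) :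
    ∀ᶠ k in atTop, pd l (ker σ k j) x = pd l (radial σ j) x := by
  have h1 : Tendsto (fun k : ℕ => (2 : ℝ) ^ k) atTop atTop :=
    tendsto_pow_atTop_atTop_of_one_lt (by norm_num)
  filter_upwards [h1.eventually_gt_atTop ‖x‖] with k hk
  have : ker σ k j =ᶠ[𝓝 x] radial σ j := by
    filter_upwards [continuous_norm.continuousAt.eventually_lt continuousAt_const hk] with y hy
    rw [ker, cut_eq_zero, sub_zero, one_mul]
    rw [abs_of_pos (by positivity), inv_mul_le_iff₀ (by positivity), mul_one]
    exact hy.le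
  rw [pd, pd, this.fderiv_eq]

end Kernel

/-! ### Differentiation along the diagonal. -/

section DiagonalDerivative

/-- By continuity at the point (t, t) alone, L τ s is uniformly close to L t t for all τ between t
and s. -/
theorem hasDerivAt_integral_diag {L : ℝ → ℝ → ℝ} (hL : Continuous fun z : ℝ × ℝ => L z.1 z.2)
    (t : ℝ) : HasDerivAt (fun s => ∫ τ in t..s, L τ s) (L t t) t := by
  rw [hasDerivAt_iff_isLittleO, Asymptotics.isLittleO_iff]
  intro ε hε
  obtain ⟨r, hr, hball⟩ := Metric.continuousAt_iff.1 (hL.continuousAt (x := (t, t))) ε hε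
  filter_upwards [Metric.ball_mem_nhds t hr] with s hs
  have hc : Continuous fun τ => L τ s := hL.comp (continuous_id.prodMk continuous_const)
  have e : (∫ τ in t..s, L τ s) - (∫ τ in t..t, L τ t) - (s - t) • L t t
      = ∫ τ in t..s, (L τ s - L t t) := by
    rw [intervalIntegral.integral_sub (hc.intervalIntegrable t s) intervalIntegrable_const,
      intervalIntegral.integral_const, intervalIntegral.integral_same, sub_zero]
  rw [e]
  refine intervalIntegral.norm_integral_le_of_norm_le_const fun τ hτ => ?_
  have h1 : dist τ t < r := by
    have : |τ - t| ≤ |s - t| := Set.abs_sub_left_of_mem_uIcc (Set.uIoc_subset_uIcc hτ)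
    exact lt_of_le_of_lt this hs
  have h2 := @hball (τ, s) (by rw [Prod.dist_eq]; exact max_lt h1 hs)
  exact h2.le

/-- The first argument is the time of the mass density, whose law is known in integrated form. The
second is the time of the momentum, where a pointwise derivative is available with the field frozen.
-/
theorem hasDerivAt_diag {B L : ℝ → ℝ → ℝ} {c d t v : ℝ} (ht : t ∈ Set.Ioo c d)
    (hL : Continuous fun z : ℝ × ℝ => L z.1 z.2)
    (hB : ∀ τ s s', c ≤ s → s ≤ s' → s' ≤ d → ∫ r in s..s', L r τ = B s' τ - B s τ)
    (hv : HasDerivAt (B t) v t) : HasDerivAt (fun s => B s s) (v + L t t) t := by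
  refine (hv.fun_add (hasDerivAt_integral_diag hL t)).congr_of_eventuallyEq ?_
  filter_upwards [Icc_mem_nhds ht.1 ht.2] with s hs
  rcases le_total t s with h | h
  · rw [hB s t s ht.1.le h hs.2]; ring
  · rw [intervalIntegral.integral_symm, hB s s t hs.1 h ht.2.le]; ring

end DiagonalDerivative

/-! ### The interaction functional and its time derivative. -/

section Interaction

variable {a p c d σ : ℝ} {U : ℝ → L2} {G : Fin 2 → ℝ → L2}

/-- The vector field generated by the mass density `rho f`. -/
noncomputable def massField (σ : ℝ) (k : ℕ) (f : Plane → ℂ) (j : Fin 2) : Plane → ℝ :=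
  cv (ker σ k j) (rho f)

theorem integrable_rho {f : Plane → ℂ} (hf : MemLp f 2) : Integrable (rho f) :=
  (integrable_qd hf hf).congr (ae_of_all _ (qd_self f))

theorem contDiff_massField (hσ : 0 < σ) (k : ℕ) {f : Plane → ℂ} (hf : MemLp f 2) (j : Fin 2) :
    ContDiff ℝ ∞ (massField σ k f j) := contDiff_cv (isTest_ker hσ k j) (integrable_rho hf)

theorem mom_eq_dbl (hσ : 0 < σ) (k : ℕ) {f f' : Plane → ℂ} (hf : MemLp f 2) (hf' : MemLp f' 2)
    {g : Fin 2 → Plane → ℂ} (hg : ∀ j, MemLp (g j) 2) :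
    mom (cutField k (massField σ k f)) f' g
      = ∑ j, dbl (fun z => plateau k z.1 * ker σ k j (z.1 - z.2)) (rho f) (md f' (g j)) := by
  refine Finset.sum_congr rfl fun j _ => ?_
  have h1 := hasInt_ip_im (isTest_cutField k (contDiff_massField hσ k hf) j).isBdd hf' (hg j)
  have h2 := dbl_eq_left (isTest_plateau k).isBdd (isTest_ker hσ k j).isBdd (integrable_rho hf)
    (integrable_md hf' (hg j))
  exact h1.unique (h2.congr fun x => by rw [cutField, massField]; ring)

/-- The derivative of the interaction functional with respect to the mass density. -/
noncomputable def fluxForm (σ : ℝ) (k : ℕ) (f f' : Plane → ℂ) (g g' : Fin 2 → Plane → ℂ) : ℝ :=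
  -(2 * ∑ l, ∑ j, dbl (fun z => plateau k z.1 * pd l (ker σ k j) (z.1 - z.2))
    (md f (g l)) (md f' (g' j)))

theorem isTest_comp_neg {φ : Plane → ℝ} (hφ : IsTest φ) : IsTest (fun x => φ (-x)) :=
  ⟨hφ.contDiff.comp contDiff_neg, hφ.compact.comp_homeomorph (Homeomorph.neg Plane)⟩

theorem pd_comp_neg {φ : Plane → ℝ} (hφ : IsTest φ) (l : Fin 2) (x : Plane) :
    pd l (fun x => φ (-x)) x = -pd l φ (-x) := by
  have := pd_comp_smul (differentiable_of_contDiff hφ.contDiff) (-1) l x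
  simpa using this

theorem isBdd_cv {φ e : Plane → ℝ} (hφ : IsTest φ) (he : Integrable e) : IsBdd (cv φ e) := by
  obtain ⟨C, hC⟩ := hφ.exists_bound
  exact ⟨(contDiff_cv hφ he).continuous.measurable, _, abs_cv_le hC he⟩

theorem cv_neg (φ e : Plane → ℝ) (x : Plane) : cv (fun x => -φ x) e x = -cv φ e x := by
  simp only [cv, mul_neg, integral_neg]

/-- With the momentum density frozen, the functional is the mass with a smooth weight obtained by
convolution. This weight need not vanish at the origin, so the extended mass law is needed. -/
theorem Flow.integral_fluxForm (F : Flow a p c d U G) (ha : 1 / 4 < a) (hp : 1 ≤ p) (hcd : c ≤ d)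
    {m S : ℝ} (hm : ∀ t, ‖U t‖ ≤ m) (hS : ∀ j t, ‖G j t‖ ≤ S) (hσ : 0 < σ) (k : ℕ)
    {f' : Plane → ℂ} (hf' : MemLp f' 2) {g' : Fin 2 → Plane → ℂ} (hg' : ∀ j, MemLp (g' j) 2)
    {s t : ℝ} (hs : c ≤ s) (hst : s ≤ t) (ht : t ≤ d) :
    ∫ r in s..t, fluxForm σ k (U r) f' (fun l => G l r) g'
      = mom (cutField k (massField σ k (U t))) f' g' - mom (cutField k (massField σ k (U s))) f' g' := by
  have hκ := (isTest_plateau k).isBdd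
  let e : Fin 2 → Plane → ℝ := fun j x => plateau k x * md f' (g' j) x
  have he : ∀ j, Integrable (e j) := fun j => (hasInt_ip_im hκ hf' (hg' j)).1
  let φ : Fin 2 → Plane → ℝ := fun j x => ker σ k j (-x)
  have hφ : ∀ j, IsTest (φ j) := fun j => isTest_comp_neg (isTest_ker hσ k j)
  -- The weight seen by the mass density: the reflected kernel convolved with the truncated momentum
  -- density.
  let Z : Plane → ℝ := fun x => ∑ j, cv (φ j) (e j) x
  have cZ : ∀ j, ContDiff ℝ ∞ (cv (φ j) (e j)) := fun j => contDiff_cv (hφ j) (he j)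
  have hZ : ContDiff ℝ ∞ Z := by
    simp only [Z, Fin.sum_univ_two]
    exact (cZ 0).add (cZ 1)
  have bZ : IsBdd Z := by
    simp only [Z, Fin.sum_univ_two]
    exact (isBdd_cv (hφ 0) (he 0)).add (isBdd_cv (hφ 1) (he 1))
  have pZ : ∀ l, pd l Z = fun x => ∑ j, -cv (fun x => pd l (ker σ k j) (-x)) (e j) x := by
    intro l
    funext x
    rw [pd_sum l fun j => differentiable_of_contDiff (cZ j) x]
    refine Finset.sum_congr rfl fun j _ => ?_
    rw [pd_cv (hφ j) (he j), show pd l (φ j) = fun x => -pd l (ker σ k j) (-x) from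
      funext fun x => pd_comp_neg (isTest_ker hσ k j) l x, cv_neg]
  have bpZ : ∀ l, IsBdd (pd l Z) := by
    intro l
    rw [pZ]
    simp only [Fin.sum_univ_two, neg_eq_neg_one_mul (cv _ _ _)]
    exact ((isBdd_cv (isTest_comp_neg ((isTest_ker hσ k 0).pd l)) (he 0)).const_mul (-1)).add
      ((isBdd_cv (isTest_comp_neg ((isTest_ker hσ k 1).pd l)) (he 1)).const_mul (-1))
  have law := F.mass_law ha hp hcd hm hS hZ bZ bpZ hs hst ht
  have e1 : ∀ r, wMass Z (U r) = mom (cutField k (massField σ k (U r))) f' g' := by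
    intro r
    rw [mom_eq_dbl hσ k (Lp.memLp _) hf' hg']
    have h := HasInt.sum fun j => dbl_eq_right hκ (isTest_ker hσ k j).isBdd
      (integrable_rho (Lp.memLp (U r))) (integrable_md hf' (hg' j))
    refine (hasInt_rho bZ (Lp.memLp (U r))).self.unique (h.congr fun x => ?_)
    simp only [Z, Finset.sum_mul]
    rfl
  have e2 : ∀ r, 2 * ∑ l, (ip (pd l Z) (U r) (G l r)).im
      = fluxForm σ k (U r) f' (fun l => G l r) g' := by
    intro r
    rw [fluxForm, ← mul_neg, ← Finset.sum_neg_distrib]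
    congr 1
    refine Finset.sum_congr rfl fun l _ => ?_
    have h := (HasInt.sum fun j => dbl_eq_right hκ ((isTest_ker hσ k j).pd l).isBdd
      (integrable_md (Lp.memLp (U r)) (Lp.memLp (G l r))) (integrable_md hf' (hg' j))).const_mul (-1)
    rw [neg_eq_neg_one_mul]
    refine (hasInt_ip_im (bpZ l) (Lp.memLp (U r)) (Lp.memLp (G l r))).unique (h.congr fun x => ?_)
    rw [pZ]
    simp only [Fin.sum_univ_two, e]
    ring
  simp only [e2, e1] at law
  exact law

theorem exists_kernel_bound {φ : Plane → ℝ} (hφ : IsTest φ) (k : ℕ) :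
    ∃ C, ∀ z : Plane × Plane, |plateau k z.1 * φ (z.1 - z.2)| ≤ C := by
  obtain ⟨C, hC⟩ := hφ.exists_bound
  refine ⟨C, fun z => ?_⟩
  rw [abs_mul, abs_of_nonneg (plateau_nonneg k _)]
  exact (mul_le_of_le_one_left (abs_nonneg _) (plateau_le_one k _)).trans (hC _)

theorem continuous_dbl_kernel {φ : Plane → ℝ} (hφ : IsTest φ) (k : ℕ) {e e' : ℝ → Plane → ℝ}
    (he : L1Curve e) (he' : L1Curve e') : Continuous fun z : ℝ × ℝ =>
      dbl (fun z => plateau k z.1 * φ (z.1 - z.2)) (e z.1) (e' z.2) := by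
  obtain ⟨C, hC⟩ := exists_kernel_bound hφ k
  exact continuous_dbl (measurable_kernel (isTest_plateau k).continuous.measurable
    hφ.continuous.measurable) hC he he'

theorem Flow.l1Curve_rho (F : Flow a p c d U G) : L1Curve fun t => rho (U t) :=
  (l1Curve_qd F.cU F.cU).congr_ae fun _ => ae_of_all _ (qd_self _)

theorem Flow.continuous_fluxForm (F : Flow a p c d U G) (hσ : 0 < σ) (k : ℕ) :
    Continuous fun z : ℝ × ℝ =>
      fluxForm σ k (U z.1) (U z.2) (fun l => G l z.1) (fun l => G l z.2) :=
  (continuous_const.mul (continuous_finsetSum _ fun l _ => continuous_finsetSum _ fun j _ =>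
    continuous_dbl_kernel ((isTest_ker hσ k j).pd l) k (l1Curve_md F.cU (F.cG l))
      (l1Curve_md F.cU (F.cG j)))).neg

theorem Flow.hasDerivAt_interaction (F : Flow a p c d U G) (ha : 1 / 4 < a) (hp : 1 ≤ p)
    {m S : ℝ} (hm : ∀ t, ‖U t‖ ≤ m) (hS : ∀ j t, ‖G j t‖ ≤ S) (hσ : 0 < σ) (k : ℕ) {t : ℝ}
    (ht : t ∈ Set.Ioo c d) :
    HasDerivAt (fun t => mom (cutField k (massField σ k (U t))) (U t) (fun j => G j t))
      (virial a p (cutField k (massField σ k (U t))) (U t) (fun j => G j t)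
        + fluxForm σ k (U t) (U t) (fun l => G l t) (fun l => G l t)) t :=
  hasDerivAt_diag (B := fun s τ => mom (cutField k (massField σ k (U s))) (U τ) (fun j => G j τ))
    (L := fun s τ => fluxForm σ k (U s) (U τ) (fun l => G l s) (fun l => G l τ)) ht
    (F.continuous_fluxForm hσ k)
    (fun _ _ _ hs hss hs' => F.integral_fluxForm ha hp (ht.1.trans ht.2).le hm hS hσ k (Lp.memLp _)
      (fun _ => Lp.memLp _) hs hss hs')
    (F.momentum _ (isTest_cutField k (contDiff_massField hσ k (Lp.memLp _)))
      (fun j => zero_notMem_tsupport_cutField k j) t ht)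

theorem Flow.continuous_interaction (F : Flow a p c d U G) (hσ : 0 < σ) (k : ℕ) :
    Continuous fun t => mom (cutField k (massField σ k (U t))) (U t) (fun j => G j t) := by
  simp only [fun t => mom_eq_dbl hσ k (Lp.memLp (U t)) (Lp.memLp (U t)) (fun j => Lp.memLp (G j t))]
  exact continuous_finsetSum _ fun j _ => (continuous_dbl_kernel (isTest_ker hσ k j) k F.l1Curve_rho
    (l1Curve_md F.cU (F.cG j))).comp (continuous_id.prodMk continuous_id)

end Interaction

/-! ### Cutoff errors of the interaction functional. -/

section InteractionLowerBound

/-- The part of the derivative of the interaction functional which survives in the limit. -/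
noncomputable def interForm (Φ : Fin 2 → Fin 2 → Plane × Plane → ℝ) (p : ℝ) (f : Plane → ℂ)
    (g : Fin 2 → Plane → ℂ) : ℝ :=
  (∑ j, ∑ l, 2 * dbl (Φ l j) (rho f) (qd (g j) (g l)))
    + (∑ l, ∑ j, dbl (Φ j j) (fun x => 2 * qd f (g l) x) (qd f (g l)))
    + p / (p + 2) * (∑ j, dbl (Φ j j) (rho f) (pot p f))
    - 2 * ∑ l, ∑ j, dbl (Φ l j) (md f (g l)) (md f (g j))

/-- The truncated Hessian kernel. -/
noncomputable def cutKer (σ : ℝ) (k : ℕ) (l j : Fin 2) (z : Plane × Plane) : ℝ :=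
  plateau k z.1 * pd l (ker σ k j) (z.1 - z.2)

/-- The Hessian kernel. -/
noncomputable def hessKer (σ : ℝ) (l j : Fin 2) (z : Plane × Plane) : ℝ :=
  pd l (radial σ j) (z.1 - z.2)

theorem integrable_pot {p : ℝ} (hp : 1 ≤ p) {f : Plane → ℂ} {g : Fin 2 → Plane → ℂ}
    (h : H1Pair f g) : Integrable (pot p f) :=
  (integrable_qd h.memLp (h.memLp_nl hp)).congr (ae_of_all _ (qd_nl p f))

theorem pd_comp_sub {φ : Plane → ℝ} (hφ : IsTest φ) (l : Fin 2) (x y : Plane) :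
    pd l (fun y => φ (x - y)) y = -pd l φ (x - y) := by
  have hd := (differentiable_of_contDiff hφ.contDiff (x - y)).hasFDerivAt
  have := hd.comp y ((hasFDerivAt_id y).const_sub x)
  rw [pd, show (fun y => φ (x - y)) = φ ∘ fun y => x - y from rfl]
  erw [this.fderiv]
  simp [pd]

theorem isTest_comp_sub {φ : Plane → ℝ} (hφ : IsTest φ) (x : Plane) : IsTest (fun y => φ (x - y)) :=
  ⟨hφ.contDiff.comp (contDiff_const.sub contDiff_id),
    hφ.compact.comp_homeomorph (Homeomorph.subLeft x)⟩

/-- Integration by parts moves the derivative from the kernel onto ρ, using ∂ₗρ = 2 Re(f̄∂ₗf). -/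
theorem cv_pd_rho {φ : Plane → ℝ} (hφ : IsTest φ) {f : Plane → ℂ} {g : Fin 2 → Plane → ℂ}
    (h : H1Pair f g) (l : Fin 2) (x : Plane) :
    cv (pd l φ) (rho f) x = cv φ (fun y => 2 * qd f (g l) y) x := by
  have hψ := isTest_comp_sub hφ x
  have e := congrArg Complex.re (ip_pd_eq h h hψ.contDiff hψ.isBdd l (hψ.pd l).isBdd)
  have h1 := hasInt_rho (hψ.pd l).isBdd h.memLp
  have h2 := hasInt_ip_re hψ.isBdd h.memLp (h.memLp_grad l)
  have h3 := (hasInt_ip_re hψ.isBdd (h.memLp_grad l) h.memLp).congr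
    (g := fun y => φ (x - y) * qd f (g l) y) fun y => by rw [qd_eq, qd_eq]; ring
  rw [Complex.neg_re, Complex.add_re, ← h3.unique h2] at e
  have h4 := (h1.const_mul (-1)).congr (g := fun y => rho f y * pd l φ (x - y)) fun y => by
    rw [pd_comp_sub hφ]; ring
  have h5 := (h3.const_mul 2).congr (g := fun y => 2 * qd f (g l) y * φ (x - y)) fun y => by ring
  rw [cv, cv, h4.2, h5.2, e]
  ring

theorem cv_sum {φ : Fin 2 → Plane → ℝ} (hφ : ∀ j, IsBdd (φ j)) {e : Plane → ℝ} (he : Integrable e)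
    (x : Plane) : cv (fun y => ∑ j, φ j y) e x = ∑ j, cv (φ j) e x := by
  have hi : ∀ j, Integrable fun y => e y * φ j (x - y) := fun j => by
    obtain ⟨C, hC⟩ := (hφ j).bounded
    exact integrable_cv (hφ j).measurable hC he x
  simp only [cv, Finset.mul_sum]
  exact integral_finsetSum _ fun j _ => hi j

variable {σ : ℝ}

theorem dv_massField (hσ : 0 < σ) (k : ℕ) {f : Plane → ℂ} (hf : MemLp f 2) (x : Plane) :
    dv (massField σ k f) x = cv (dv (ker σ k)) (rho f) x := by
  have := cv_sum (fun j => ((isTest_ker hσ k j).pd j).isBdd) (integrable_rho hf) x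
  simp only [dv, massField, fun j => pd_cv (isTest_ker hσ k j) (integrable_rho hf) j x]
  exact this.symm

/-- The third derivatives of the weight are traded for a derivative of the density, so only the
Hessian kernel enters, and the term becomes a form in ∇ρ on both sides. -/
theorem pd_dv_massField (hσ : 0 < σ) (k : ℕ) {f : Plane → ℂ} {g : Fin 2 → Plane → ℂ}
    (h : H1Pair f g) (l : Fin 2) (x : Plane) :
    pd l (dv (massField σ k f)) x = ∑ j, cv (pd j (ker σ k j)) (fun y => 2 * qd f (g l) y) x := by
  have ht := isTest_dv (isTest_ker hσ k)
  rw [show dv (massField σ k f) = cv (dv (ker σ k)) (rho f) from funext (dv_massField hσ k h.memLp),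
    pd_cv ht (integrable_rho h.memLp), cv_pd_rho ht h]
  exact cv_sum (fun j => ((isTest_ker hσ k j).pd j).isBdd)
    ((integrable_qd h.memLp (h.memLp_grad l)).const_mul 2) x

theorem hasInt_interForm (hσ : 0 < σ) (k : ℕ) {p : ℝ} (hp : 1 ≤ p) {f : Plane → ℂ}
    {g : Fin 2 → Plane → ℂ} (h : H1Pair f g) :
    HasInt (fun x => plateau k x * ((∑ j, ∑ l, 2 * (pd l (massField σ k f j) x * qd (g j) (g l) x))
        + (∑ l, pd l (dv (massField σ k f)) x * qd f (g l) x)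
        + p / (p + 2) * (dv (massField σ k f) x * pot p f x)))
      (interForm (cutKer σ k) p f g - fluxForm σ k f f g g) := by
  have hκ := (isTest_plateau k).isBdd
  have hK : ∀ l j, IsBdd (pd l (ker σ k j)) := fun l j => ((isTest_ker hσ k j).pd l).isBdd
  have hρ := integrable_rho h.memLp
  have t1 := HasInt.sum fun j => HasInt.sum fun l => (dbl_eq_left hκ (hK l j) hρ
    (integrable_qd (h.memLp_grad j) (h.memLp_grad l))).const_mul 2
  have t2 := HasInt.sum fun l => HasInt.sum fun j => dbl_eq_left hκ (hK j j)
    ((integrable_qd h.memLp (h.memLp_grad l)).const_mul 2) (integrable_qd h.memLp (h.memLp_grad l))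
  have t3 := (HasInt.sum fun j => dbl_eq_left hκ (hK j j) hρ (integrable_pot hp h)).const_mul
    (p / (p + 2))
  refine (show interForm (cutKer σ k) p f g - fluxForm σ k f f g g = _ from ?_) ▸
    ((t1.add t2).add t3).congr fun x => ?_
  · have e : ∀ l j, cutKer σ k l j = fun z => plateau k z.1 * pd l (ker σ k j) (z.1 - z.2) :=
      fun _ _ => rfl
    simp only [interForm, fluxForm, e]
    ring
  · have e : ∀ l, pd l (dv (massField σ k f)) x
        = ∑ j, cv (pd j (ker σ k j)) (fun y => 2 * qd f (g l) y) x :=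
      fun l => pd_dv_massField hσ k h l x
    rw [show dv (massField σ k f) x = ∑ j, pd j (massField σ k f j) x from rfl]
    simp only [e, massField, fun l j => pd_cv (isTest_ker hσ k j) hρ l x, Fin.sum_univ_two]
    ring

/-- On this annulus 2⁻ᵏ < 8|x|, so the weight with δ = 2⁻ᵏ is at most 9|x|. -/
theorem core_div_cube_le (k : ℕ) {x : Plane} (hx : x ≠ 0) :
    core (k + 3) x / ‖x‖ ≤ 9 * (core (k + 3) x * (wt (2 ^ k)⁻¹ x)⁻¹) := by
  have hx0 : 0 < ‖x‖ := norm_pos_iff.2 hx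
  have hδ : (0 : ℝ) < (2 ^ k)⁻¹ := by positivity
  have hw := wt_pos hδ x
  unfold core
  split_ifs with h
  · have h1 := h.1
    rw [pow_add, mul_inv] at h1
    have h2 := wt_le hδ x
    rw [one_mul, ← div_eq_mul_inv, one_div, le_div_iff₀ hw, inv_mul_le_iff₀ hx0]
    norm_num at h1
    linarith
  · simp

/-- On the inner half of the shell |x| is comparable to δ = 2⁻ᵏ, so w ≤ 2δ and 1/|x| ≤ 8/δ = 64
δ²(2δ)⁻³, which is what the kinetic term of the Morawetz estimate at scale δ provides. On the outer
half |x| ≥ 1. -/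
theorem shell_div_le (k : ℕ) {x : Plane} (hx : x ≠ 0) :
    shell k x / ‖x‖ ≤ 64 * (((2 : ℝ) ^ k)⁻¹ ^ 2 * (core (k + 3) x * (wt (2 ^ k)⁻¹ x)⁻¹ ^ 3))
      + shell k x := by
  have hx0 : 0 < ‖x‖ := norm_pos_iff.2 hx
  have hδ : (0 : ℝ) < (2 ^ k)⁻¹ := by positivity
  set δ := ((2 : ℝ) ^ k)⁻¹ with hδd
  have hw := wt_pos hδ x
  have hs0 := shell_nonneg k x
  have hc0 := core_nonneg (k + 3) x
  rcases le_or_gt 1 ‖x‖ with h1 | h1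
  · have := div_le_self hs0 h1
    have : 0 ≤ 64 * (δ ^ 2 * (core (k + 3) x * (wt δ x)⁻¹ ^ 3)) := by positivity
    linarith
  · have h2 : ‖x‖ < 2 ^ k := h1.trans_le (one_le_pow₀ (by norm_num))
    have h2' : ‖x‖ < 2 ^ (k + 3) := h1.trans_le (one_le_pow₀ (by norm_num))
    rcases lt_or_ge δ ‖x‖ with h3 | h3
    · have e1 : core k x = 1 := by rw [core, if_pos ⟨h3, h2⟩]
      have e2 : shell k x = 0 := le_antisymm (by
        rw [shell, e1]; linarith [core_le_one (k + 3) x]) hs0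
      rw [e2] at *
      simp only [zero_div, add_zero]
      positivity
    · by_cases h4 : ((2 : ℝ) ^ (k + 3))⁻¹ < ‖x‖
      · have e1 : core (k + 3) x = 1 := by rw [core, if_pos ⟨h4, h2'⟩]
        rw [pow_add, mul_inv, ← hδd] at h4
        norm_num at h4
        have hw2 : wt δ x ≤ 2 * δ := by linarith [wt_le hδ x]
        have h5 : ‖x‖⁻¹ ≤ 8 * δ⁻¹ := by
          rw [show 8 * δ⁻¹ = (δ / 8)⁻¹ by field_simp]
          exact inv_anti₀ (by positivity) (by linarith)
        have h6 : (2 * δ)⁻¹ ^ 3 ≤ (wt δ x)⁻¹ ^ 3 := by gcongr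
        have h7 : 64 * (δ ^ 2 * (1 * (2 * δ)⁻¹ ^ 3)) = 8 * δ⁻¹ := by field_simp; norm_num
        rw [e1]
        calc shell k x / ‖x‖ ≤ 1 / ‖x‖ := by gcongr; exact shell_le_one k x
          _ = ‖x‖⁻¹ := one_div _
          _ ≤ 64 * (δ ^ 2 * (1 * (2 * δ)⁻¹ ^ 3)) := by rw [h7]; exact h5
          _ ≤ 64 * (δ ^ 2 * (1 * (wt δ x)⁻¹ ^ 3)) := by gcongr
          _ ≤ _ := by linarith
      · have e1 : core (k + 3) x = 0 := by rw [core, if_neg fun h => h4 h.1]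
        have e2 : shell k x = 0 := le_antisymm (e1 ▸ shell_le_core k x) hs0
        rw [e2, e1]
        simp

/-- The density of the Morawetz estimate. -/
noncomputable def morDens (a p δ : ℝ) (k : ℕ) (f : Plane → ℂ) (g : Fin 2 → Plane → ℂ) : ℝ :=
  δ ^ 2 / 2 * wKin (fun x => core k x * (wt δ x)⁻¹ ^ 3) g
      + (2 * a - 1 / 2) * wMass (fun x => core k x * ((wt δ x)⁻¹ / ‖x‖ ^ 2)) f
      + p / (p + 2) * wPot p (fun x => core k x * (wt δ x)⁻¹) f

/-- The density of the error caused by the truncation. -/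
noncomputable def shellDens (p : ℝ) (k : ℕ) (f : Plane → ℂ) (g : Fin 2 → Plane → ℂ) : ℝ :=
  wKin (shell k) g + wMass (shell k) f + wPot p (shell k) f + wMass (fun x => shell k x / ‖x‖ ^ 2) f

set_option maxHeartbeats 800000 in
-- The field generated by ρ is bounded by M uniformly in σ, and only its derivatives cost a constant
-- depending on σ. Errors with the undifferentiated field are O(1/|x|) worse near the origin than
-- for the radial field; they go to the Morawetz density at scale 2⁻ᵏ, with A independent of σ.
-- Errors with the differentiated field go to the shell density, which disappears as k → ∞ for fixed
-- σ.
theorem exists_interForm_le {a : ℝ} (ha : 1 / 4 < a) : ∃ A, 0 < A ∧ ∀ σ, 0 < σ → ∃ B, 0 < B ∧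
    ∀ (k : ℕ) (p : ℝ) (_ : 2 ≤ p) (f : Plane → ℂ) (g : Fin 2 → Plane → ℂ) (_ : H1Pair f g) (M : ℝ)
      (_ : ∫ x, |rho f x| ≤ M),
      interForm (cutKer σ k) p f g ≤ virial a p (cutField k (massField σ k f)) f g
        + fluxForm σ k f f g g + A * M * morDens a p (2 ^ k)⁻¹ (k + 3) f g
        + B * M * shellDens p k f g := by
  obtain ⟨C, hC, hv⟩ := exists_vdens_cutField_ge
  have ha' : 0 < 2 * a - 1 / 2 := by linarith
  -- The three parts pay for the kinetic, mass and potential terms of the Morawetz density, whose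
  -- coefficients δ²/2, 2a - 1/2 and p/(p+2) are divided out.
  refine ⟨256 * C + (36 * a + 9 * C) * (2 * a - 1 / 2)⁻¹ + 18 * C,
    by have := inv_pos.2 ha'; have : 0 < 36 * a + 9 * C := by linarith
       positivity, fun σ hσ => ?_⟩
  obtain ⟨C', hC', hker⟩ := exists_pd_ker_le hσ
  refine ⟨2 * C + C * C', by positivity, fun k p hp f g h M hM => ?_⟩
  have hp1 : 1 ≤ p := by linarith
  have hδ : (0 : ℝ) < (2 ^ k)⁻¹ := by positivity
  have hρ := integrable_rho h.memLp
  have hM0 : 0 ≤ M := (integral_nonneg fun _ => abs_nonneg _).trans hM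
  set δ := ((2 : ℝ) ^ k)⁻¹ with hδd
  have hg := h.memLp_grad
  set Y := massField σ k f with hYd
  have hY := contDiff_massField hσ k h.memLp
  have V := hasInt_virial (a := a) hp1 k hY h
  have hc := isBdd_core (k + 3)
  have L1 := ((hasInt_kin (hc.mul (isBdd_wt_inv_pow hδ 3)) hg).self).const_mul (δ ^ 2 / 2)
  have L2 := ((hasInt_rho (isBdd_core_wt hδ (k + 3)) h.memLp).self).const_mul (2 * a - 1 / 2)
  have L3 := ((hasInt_pot (hc.mul (isBdd_wt_inv hδ)) hp1 h).self).const_mul (p / (p + 2))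
  have R1 := (hasInt_kin (isBdd_shell k) hg).self
  have R2 := (hasInt_rho (isBdd_shell k) h.memLp).self
  have R3 := (hasInt_pot (isBdd_shell k) hp1 h).self
  have R4 := (hasInt_rho (isBdd_shell_div k 2) h.memLp).self
  set A := 256 * C + (36 * a + 9 * C) * (2 * a - 1 / 2)⁻¹ + 18 * C with hA
  have key := (hasInt_interForm hσ k hp1 h).mono_ae ((V.add (((L1.add L2).add L3).const_mul
    (A * M))).add ((((R1.add R2).add R3).add R4).const_mul ((2 * C + C * C') * M))) ?_
  · unfold morDens shellDens wKin wMass wPot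
    linarith
  filter_upwards [ae_ne_zero] with x hx
  have hx0 : 0 < ‖x‖ := norm_pos_iff.2 hx
  have hyb : ∀ j, |Y j x| ≤ M := fun j => (abs_cv_le (abs_ker_le hσ k j) hρ x).trans (by
    rw [one_mul]; exact hM)
  have hyb' : ∀ l j, |pd l (Y j) x| ≤ C' * M := fun l j => by
    rw [hYd, massField, pd_cv (isTest_ker hσ k j) hρ]
    exact (abs_cv_le (hker k l j) hρ x).trans (by gcongr)
  have m1 := hv k Y hY a p (by linarith) f g x hx M (C' * M) hyb hyb'
  have hκ0 := plateau_nonneg k x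
  have hκ1 := plateau_le_core k x
  have hs := shell_nonneg k x
  have hc0 := core_nonneg (k + 3) x
  have hw := wt_pos hδ x
  have hr := rho_nonneg f x
  have hk := kin_nonneg g x
  have hpt := pot_nonneg p f x
  have b1 := core_div_cube_le k hx
  have b2 := shell_div_le k hx
  rw [← hδd] at b1 b2
  set c := core (k + 3) x
  set s := shell k x
  set w := (wt δ x)⁻¹ with hwd
  have hw0 : 0 < w := inv_pos.2 hw
  set r := ‖x‖
  have b3 : s / r ≤ 9 * (c * w) := le_trans (by gcongr; exact shell_le_core k x) b1
  have hdiv : |(∑ j, Y j x * x j) / r ^ 4| ≤ 2 * M / r ^ 3 := by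
    rw [abs_div, abs_of_pos (by positivity : 0 < r ^ 4), div_le_div_iff₀ (by positivity) (by positivity)]
    have h1 : |∑ j, Y j x * x j| ≤ 2 * (M * r) := by
      rw [Fin.sum_univ_two]
      refine (abs_add_le _ _).trans ?_
      rw [abs_mul, abs_mul]
      have := mul_le_mul (hyb 0) (abs_coord_le x 0) (abs_nonneg _) hM0
      have := mul_le_mul (hyb 1) (abs_coord_le x 1) (abs_nonneg _) hM0
      linarith
    calc _ ≤ 2 * (M * r) * r ^ 3 := by gcongr
      _ = _ := by ring
  -- The interaction field is not directed away from the origin, so the potential term has no sign.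
  -- It is bounded by |u|²/|x|³, and 1/|x| is replaced by 9/w.
  have m2 : -(36 * a * M * (c * (w / r ^ 2) * rho f x))
      ≤ plateau k x * (2 * a * ((∑ j, Y j x * x j) / r ^ 4 * rho f x)) := by
    have h1 := (abs_le.1 hdiv).1
    have h2 : plateau k x * (2 * a) * rho f x * (2 * M / r ^ 3)
        ≤ 36 * a * M * (c * (w / r ^ 2) * rho f x) := by
      calc plateau k x * (2 * a) * rho f x * (2 * M / r ^ 3)
          ≤ c * (2 * a) * rho f x * (2 * M / r ^ 3) := by gcongr
        _ = 4 * a * M * rho f x / r ^ 2 * (c / r) := by field_simp; ring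
        _ ≤ 4 * a * M * rho f x / r ^ 2 * (9 * (c * w)) := by gcongr
        _ = _ := by ring
    have h3 : 0 ≤ plateau k x * (2 * a) * rho f x := by positivity
    have h4 := mul_le_mul_of_nonneg_left h1 h3
    calc _ ≤ -(plateau k x * (2 * a) * rho f x * (2 * M / r ^ 3)) := neg_le_neg h2
      _ = plateau k x * (2 * a) * rho f x * (-(2 * M / r ^ 3)) := by ring
      _ ≤ _ := h4
      _ = _ := by ring
  set T := ‖f x‖ * (‖g 0 x‖ + ‖g 1 x‖) with hT
  have hT0 : 0 ≤ T := by positivity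
  have hy : T / r ≤ rho f x / r ^ 2 + kin g x := by
    have := young_grad (F := ‖f x‖) (r := r) (G₀ := ‖g 0 x‖) (G₁ := ‖g 1 x‖) one_pos
    simpa [rho, kin] using this
  have m3 : s * (M / r * (kin g x + pot p f x) + (M / r ^ 2 + C' * M / r) * T)
      ≤ M * (2 * ((64 * (δ ^ 2 * (c * w ^ 3)) + s) * kin g x) + 9 * (c * w * pot p f x)
        + 9 * (c * (w / r ^ 2) * rho f x) + C' * (s / r ^ 2 * rho f x + s * kin g x)) := by
    calc s * (M / r * (kin g x + pot p f x) + (M / r ^ 2 + C' * M / r) * T)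
        = M * (s / r * kin g x + s / r * pot p f x + s / r * (T / r) + C' * (s * (T / r))) := by
          field_simp
          ring
      _ ≤ M * (s / r * kin g x + s / r * pot p f x + s / r * (rho f x / r ^ 2 + kin g x)
          + C' * (s * (rho f x / r ^ 2 + kin g x))) := by gcongr
      _ = M * (2 * (s / r * kin g x) + s / r * pot p f x + s / r * (rho f x / r ^ 2)
          + C' * (s / r ^ 2 * rho f x + s * kin g x)) := by ring
      _ ≤ M * (2 * ((64 * (δ ^ 2 * (c * w ^ 3)) + s) * kin g x) + 9 * (c * w) * pot p f x
          + 9 * (c * w) * (rho f x / r ^ 2) + C' * (s / r ^ 2 * rho f x + s * kin g x)) := by gcongr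
      _ = _ := by ring
  have m4 := mul_le_mul_of_nonneg_left m3 hC.le
  -- This is where p ≥ 2 makes the constant independent of p.
  have hq : 1 / 2 ≤ p / (p + 2) := by
    rw [div_le_div_iff₀ (by norm_num) (by linarith)]; linarith
  have z1 : 0 ≤ c * w ^ 3 * kin g x := by positivity
  have z2 : 0 ≤ c * (w / r ^ 2) * rho f x := by positivity
  have z3 : 0 ≤ c * w * pot p f x := by positivity
  have z4 : 0 ≤ s * kin g x := by positivity
  have z5 : 0 ≤ s / r ^ 2 * rho f x := by positivity
  have z6 : 0 ≤ s * rho f x := by positivity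
  have z7 : 0 ≤ s * pot p f x := by positivity
  have hi : 0 < (2 * a - 1 / 2)⁻¹ := inv_pos.2 ha'
  have n1 : 128 * C * (δ ^ 2 * (c * w ^ 3 * kin g x)) ≤ A * (δ ^ 2 / 2 * (c * w ^ 3 * kin g x)) := by
    have : 256 * C ≤ A := by
      have : 0 < (36 * a + 9 * C) * (2 * a - 1 / 2)⁻¹ := mul_pos (by linarith) hi
      linarith
    calc _ = 256 * C * (δ ^ 2 / 2 * (c * w ^ 3 * kin g x)) := by ring
      _ ≤ _ := by gcongr
  have n2 : (36 * a + 9 * C) * (c * (w / r ^ 2) * rho f x)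
      ≤ A * ((2 * a - 1 / 2) * (c * (w / r ^ 2) * rho f x)) := by
    have : (36 * a + 9 * C) * (2 * a - 1 / 2)⁻¹ ≤ A := by linarith
    calc _ = (36 * a + 9 * C) * (2 * a - 1 / 2)⁻¹ * ((2 * a - 1 / 2) * (c * (w / r ^ 2) * rho f x)) := by
          rw [mul_assoc _ (2 * a - 1 / 2)⁻¹, inv_mul_cancel_left₀ ha'.ne']
      _ ≤ _ := by gcongr
  have n3 : 9 * C * (c * w * pot p f x) ≤ A * (p / (p + 2) * (c * w * pot p f x)) := by
    have : 18 * C ≤ A := by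
      have : 0 < (36 * a + 9 * C) * (2 * a - 1 / 2)⁻¹ := mul_pos (by linarith) hi
      linarith
    calc _ = 18 * C * (1 / 2 * (c * w * pot p f x)) := by ring
      _ ≤ _ := by gcongr
  have n4 : C * (2 * (s * kin g x) + C' * (s / r ^ 2 * rho f x + s * kin g x))
      ≤ (2 * C + C * C') * (s * kin g x + s * rho f x + s * pot p f x + s / r ^ 2 * rho f x) := by
    have : 0 ≤ C * C' := by positivity
    linarith [mul_nonneg hC.le z5, mul_nonneg hC.le z6, mul_nonneg hC.le z7, mul_nonneg this z6,
      mul_nonneg this z7]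
  have n5 := mul_le_mul_of_nonneg_left (add_le_add (add_le_add (add_le_add n1 n2) n3) n4) hM0
  have e : plateau k x * vdens a p Y f g x
      = plateau k x * ((∑ j, ∑ l, 2 * (pd l (Y j) x * qd (g j) (g l) x))
        + (∑ l, pd l (dv Y) x * qd f (g l) x) + p / (p + 2) * (dv Y x * pot p f x))
        + plateau k x * (2 * a * ((∑ j, Y j x * x j) / r ^ 4 * rho f x)) := by
    rw [vdens]; ring
  rw [e] at m1
  linarith

end InteractionLowerBound

/-! ### Passing to the limit in the cutoff. -/

section InteractionLimit

/-- Continuous functions whose integrals over `[c, d]` converge. -/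
structure LimInt (c d : ℝ) (Fk : ℕ → ℝ → ℝ) (F : ℝ → ℝ) : Prop where
  continuous_seq : ∀ k, Continuous (Fk k)
  continuous_lim : Continuous F
  tendsto : Tendsto (fun k => ∫ t in c..d, Fk k t) atTop (𝓝 (∫ t in c..d, F t))

variable {c d : ℝ}

theorem LimInt.add {Fk Fk' : ℕ → ℝ → ℝ} {F F' : ℝ → ℝ} (h : LimInt c d Fk F)
    (h' : LimInt c d Fk' F') : LimInt c d (fun k t => Fk k t + Fk' k t) (fun t => F t + F' t) where
  continuous_seq k := (h.continuous_seq k).add (h'.continuous_seq k)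
  continuous_lim := h.continuous_lim.add h'.continuous_lim
  tendsto := by
    have e : ∀ {u v : ℝ → ℝ}, Continuous u → Continuous v →
        ∫ t in c..d, (u t + v t) = (∫ t in c..d, u t) + ∫ t in c..d, v t := fun hu hv =>
      intervalIntegral.integral_add (hu.intervalIntegrable c d) (hv.intervalIntegrable c d)
    rw [e h.continuous_lim h'.continuous_lim]
    exact (h.tendsto.add h'.tendsto).congr fun k => (e (h.continuous_seq k) (h'.continuous_seq k)).symm

theorem LimInt.const_mul {Fk : ℕ → ℝ → ℝ} {F : ℝ → ℝ} (h : LimInt c d Fk F) (v : ℝ) :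
    LimInt c d (fun k t => v * Fk k t) (fun t => v * F t) where
  continuous_seq k := continuous_const.mul (h.continuous_seq k)
  continuous_lim := continuous_const.mul h.continuous_lim
  tendsto := by
    simp only [intervalIntegral.integral_const_mul]
    exact h.tendsto.const_mul v

theorem LimInt.sum {Fk : Fin 2 → ℕ → ℝ → ℝ} {F : Fin 2 → ℝ → ℝ}
    (h : ∀ j, LimInt c d (Fk j) (F j)) :
    LimInt c d (fun k t => ∑ j, Fk j k t) (fun t => ∑ j, F j t) := by
  simpa only [Fin.sum_univ_two] using (h 0).add (h 1)

theorem L1Curve.const_mul {e : ℝ → Plane → ℝ} (h : L1Curve e) (v : ℝ) :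
    L1Curve fun t x => v * e t x where
  integrable t := (h.integrable t).const_mul v
  tendsto t := by
    have : ∀ s, ∫ x, |v * e s x - v * e t x| = |v| * ∫ x, |e s x - e t x| := fun s => by
      simp only [← mul_sub, abs_mul, integral_const_mul]
    simp only [this]
    simpa using (h.tendsto t).const_mul |v|

theorem limInt_dbl {Φk : ℕ → Plane × Plane → ℝ} {Φ : Plane × Plane → ℝ} {C : ℝ}
    (hm : ∀ k, Measurable (Φk k)) (hC : ∀ k z, |Φk k z| ≤ C) (hm' : Measurable Φ)
    (hC' : ∀ z, |Φ z| ≤ C) (hlim : ∀ᵐ z, Tendsto (fun k => Φk k z) atTop (𝓝 (Φ z)))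
    {e e' : ℝ → Plane → ℝ} (he : L1Curve e) (he' : L1Curve e') :
    LimInt c d (fun k t => dbl (Φk k) (e t) (e' t)) (fun t => dbl Φ (e t) (e' t)) where
  continuous_seq k := (continuous_dbl (hm k) (hC k) he he').comp (continuous_id.prodMk continuous_id)
  continuous_lim := (continuous_dbl hm' hC' he he').comp (continuous_id.prodMk continuous_id)
  tendsto := by
    refine intervalIntegral.tendsto_integral_filter_of_dominated_convergence
      (fun t => C * ((∫ x, |e t x|) * ∫ x, |e' t x|)) (Eventually.of_forall fun k => ?_)
      (Eventually.of_forall fun k => ae_of_all _ fun t _ =>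
        abs_dbl_le (hC k) (he.integrable t) (he'.integrable t)) ?_
      (ae_of_all _ fun t _ => tendsto_dbl hm hC hlim (he.integrable t) (he'.integrable t))
    · exact ((continuous_dbl (hm k) (hC k) he he').comp
        (continuous_id.prodMk continuous_id)).aestronglyMeasurable
    · exact (continuous_const.mul (he.continuous_integral_abs.mul
        he'.continuous_integral_abs)).intervalIntegrable c d

variable {σ : ℝ}

theorem measurable_cutKer (hσ : 0 < σ) (k : ℕ) (l j : Fin 2) : Measurable (cutKer σ k l j) :=
  measurable_kernel (isTest_plateau k).isBdd.measurable ((isTest_ker hσ k j).pd l).isBdd.measurable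

theorem continuous_pd_radial (hσ : 0 < σ) (l j : Fin 2) : Continuous (pd l (radial σ j)) := by
  rw [funext fun x => pd_radial_field hσ j l x]
  have h1 := (contDiff_wt hσ).continuous
  have h0 : ∀ x, wt σ x ≠ 0 := fun x => (wt_pos hσ x).ne'
  have h3 : ∀ i, Continuous fun x : Plane => x i := fun i => (contDiff_coord i).continuous
  refine (continuous_const.mul (h1.inv₀ h0)).sub (((h3 j).mul (h3 l)).mul
    ((h1.pow 3).inv₀ fun x => pow_ne_zero 3 (h0 x)))

theorem measurable_hessKer (hσ : 0 < σ) (l j : Fin 2) : Measurable (hessKer σ l j) :=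
  ((continuous_pd_radial hσ l j).comp (continuous_fst.sub continuous_snd)).measurable

theorem abs_hessKer_le (hσ : 0 < σ) (l j : Fin 2) (z : Plane × Plane) :
    |hessKer σ l j z| ≤ 2 * σ⁻¹ :=
  (abs_pd_radial_le hσ l j _).trans (by
    have := inv_anti₀ hσ (le_wt σ (z.1 - z.2))
    linarith)

theorem ae_tendsto_cutKer (l j : Fin 2) :
    ∀ᵐ z : Plane × Plane, Tendsto (fun k => cutKer σ k l j z) atTop (𝓝 (hessKer σ l j z)) := by
  have h : ∀ᵐ z : Plane × Plane, z.1 ≠ 0 := by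
    rw [Measure.volume_eq_prod]
    exact Measure.quasiMeasurePreserving_fst.ae ae_ne_zero
  filter_upwards [h] with z hz
  refine tendsto_const_nhds.congr' ?_
  filter_upwards [eventually_plateau_eq_one hz, eventually_pd_ker_eq (σ := σ) l j (z.1 - z.2)]
    with k h1 h2
  rw [cutKer, h1, h2, one_mul, hessKer]

variable {a p : ℝ} {U : ℝ → L2} {G : Fin 2 → ℝ → L2}

theorem Flow.l1Curve_pot (F : Flow a p c d U G) (hp : 1 ≤ p) : L1Curve fun t => pot p (U t) := by
  obtain ⟨N, cN, hN⟩ := exists_nlL hp F.cU F.cG F.pair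
  refine (l1Curve_qd F.cU cN).congr_ae fun t => ?_
  filter_upwards [hN t] with x hx
  rw [← qd_nl, qd, qd, hx]

theorem Flow.limInt_interForm (F : Flow a p c d U G) (hp : 1 ≤ p) (hσ : 0 < σ) :
    LimInt c d (fun k t => interForm (cutKer σ k) p (U t) (fun j => G j t))
      (fun t => interForm (hessKer σ) p (U t) (fun j => G j t)) := by
  obtain ⟨C, hC, hker⟩ := exists_pd_ker_le hσ
  have hb : ∀ l j k z, |cutKer σ k l j z| ≤ C + 2 * σ⁻¹ := fun l j k z => by
    have : 0 < σ⁻¹ := inv_pos.2 hσ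
    rw [cutKer, abs_mul, abs_of_nonneg (plateau_nonneg k _)]
    refine (mul_le_of_le_one_left (abs_nonneg _) (plateau_le_one k _)).trans ((hker k l j _).trans ?_)
    linarith
  have hD : ∀ {e e' : ℝ → Plane → ℝ}, L1Curve e → L1Curve e' → ∀ l j : Fin 2,
      LimInt c d (fun k t => dbl (cutKer σ k l j) (e t) (e' t))
        (fun t => dbl (hessKer σ l j) (e t) (e' t)) := fun he he' l j =>
    limInt_dbl (fun k => measurable_cutKer hσ k l j) (hb l j) (measurable_hessKer hσ l j)
      (fun z => (abs_hessKer_le hσ l j z).trans (by linarith)) (ae_tendsto_cutKer l j) he he'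
  have hρ := F.l1Curve_rho
  have q0 := fun l => l1Curve_qd F.cU (F.cG l)
  have t1 := LimInt.sum fun j => LimInt.sum fun l =>
    (hD hρ (l1Curve_qd (F.cG j) (F.cG l)) l j).const_mul 2
  have t2 := LimInt.sum fun l => LimInt.sum fun j => hD ((q0 l).const_mul 2) (q0 l) j j
  have t3 := (LimInt.sum fun j => hD hρ (F.l1Curve_pot hp) j j).const_mul (p / (p + 2))
  have t4 := (LimInt.sum fun l => LimInt.sum fun j =>
    hD (l1Curve_md F.cU (F.cG l)) (l1Curve_md F.cU (F.cG j)) l j).const_mul (-2)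
  have e : ∀ (Φ : Fin 2 → Fin 2 → Plane × Plane → ℝ) (t : ℝ), interForm Φ p (U t) (fun j => G j t)
      = (∑ j, ∑ l, 2 * dbl (Φ l j) (rho (U t)) (qd (G j t) (G l t)))
        + (∑ l, ∑ j, dbl (Φ j j) (fun x => 2 * qd (U t) (G l t) x) (qd (U t) (G l t)))
        + p / (p + 2) * (∑ j, dbl (Φ j j) (rho (U t)) (pot p (U t)))
        + -2 * ∑ l, ∑ j, dbl (Φ l j) (md (U t) (G l t)) (md (U t) (G j t)) := fun Φ t => by
    rw [interForm]; ring
  simp only [e]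
  exact ((t1.add t2).add t3).add t4

theorem integral_abs_rho (u : L2) : ∫ x, |rho u x| = ‖u‖ ^ 2 := by
  rw [← wMass_one, wMass]
  simp only [abs_of_nonneg (rho_nonneg _ _), one_mul]

/-- The derivative of the interaction functional is integrated over [c, d]. The endpoints give 4m³S
because the field is bounded by m², the Morawetz density gives Am²·4mS, and the shell error tends to
zero as k → ∞. -/
theorem exists_integral_interForm_le {a : ℝ} (ha : 1 / 4 < a) : ∃ A, 0 < A ∧
    ∀ {p c d : ℝ} {U : ℝ → L2} {G : Fin 2 → ℝ → L2} (_ : Flow a p c d U G) (_ : 2 ≤ p) (_ : c ≤ d)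
    {m S : ℝ} (_ : ∀ t, ‖U t‖ ≤ m) (_ : ∀ j t, ‖G j t‖ ≤ S) {σ : ℝ} (_ : 0 < σ),
    ∫ t in c..d, interForm (hessKer σ) p (U t) (fun j => G j t) ≤ A * (m ^ 3 * S) := by
  obtain ⟨A, hA, hmain⟩ := exists_interForm_le ha
  refine ⟨4 + 4 * A, by positivity, fun {p c d U G} F hp hcd {m S} hm hS {σ} hσ => ?_⟩
  have hp1 : 1 ≤ p := by linarith
  obtain ⟨B, hB, hle⟩ := hmain σ hσ
  have hm0 : 0 ≤ m := (norm_nonneg _).trans (hm c)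
  have hL := F.limInt_interForm hp1 hσ
  have hlim : Tendsto (fun k => (4 + 4 * A) * (m ^ 3 * S) + B * m ^ 2 * shellError p c d U G k) atTop
      (𝓝 ((4 + 4 * A) * (m ^ 3 * S))) := by
    simpa using ((F.tendsto_shellError ha hp1 hcd hm hS).const_mul (B * m ^ 2)).const_add
      ((4 + 4 * A) * (m ^ 3 * S))
  refine le_of_tendsto_of_tendsto' hL.tendsto hlim fun k => ?_
  have hδ : (0 : ℝ) < (2 ^ k)⁻¹ := by positivity
  have hc := isBdd_core (k + 3)
  have cM : Continuous fun t => morDens a p (2 ^ k)⁻¹ (k + 3) (U t) (fun j => G j t) :=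
    ((continuous_const_mul_fun (F.continuous_wKin (hc.mul (isBdd_wt_inv_pow hδ 3))) _).fun_add
      (continuous_const_mul_fun (F.continuous_wMass (isBdd_core_wt hδ (k + 3))) _)).fun_add
      (continuous_const_mul_fun (F.continuous_wPot hp1 (hc.mul (isBdd_wt_inv hδ))) _)
  have cS : Continuous fun t => shellDens p k (U t) (fun j => G j t) := F.continuous_shellError hp1 k
  have cI := hL.continuous_seq k
  have cE := (continuous_const_mul_fun cM (A * m ^ 2)).fun_add (continuous_const_mul_fun cS (B * m ^ 2))
  have key := intervalIntegral.integral_le_sub_of_hasDeriv_right_of_le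
    (φ := fun t => interForm (cutKer σ k) p (U t) (fun j => G j t)
      - (A * m ^ 2 * morDens a p (2 ^ k)⁻¹ (k + 3) (U t) (fun j => G j t)
        + B * m ^ 2 * shellDens p k (U t) (fun j => G j t))) hcd
    (F.continuous_interaction hσ k).continuousOn
    (fun t ht => (F.hasDerivAt_interaction ha hp1 hm hS hσ k ht).hasDerivWithinAt)
    (cI.sub cE).continuousOn.integrableOn_Icc (fun t ht => by
      have := hle k p hp (U t) (fun j => G j t) (F.pair t) (m ^ 2) (by
        rw [integral_abs_rho]; exact pow_le_pow_left₀ (norm_nonneg _) (hm t) 2)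
      linarith)
  rw [intervalIntegral.integral_sub (cI.intervalIntegrable c d) (cE.intervalIntegrable c d),
    intervalIntegral.integral_add ((continuous_const_mul_fun cM _).intervalIntegrable c d)
      ((continuous_const_mul_fun cS _).intervalIntegrable c d),
    intervalIntegral.integral_const_mul, intervalIntegral.integral_const_mul] at key
  have hmor : ∫ t in c..d, morDens a p (2 ^ k)⁻¹ (k + 3) (U t) (fun j => G j t) ≤ 4 * m * S :=
    F.morawetz ha hp1 hcd hm hS hδ (k + 3)
  have hmom : ∀ t, |mom (cutField k (massField σ k (U t))) (U t) (fun j => G j t)|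
      ≤ 2 * m ^ 2 * m * S := fun t => by
    refine abs_mom_le (fun j x => ?_) (hm t) (fun j => hS j t)
    rw [cutField, abs_mul, abs_of_nonneg (plateau_nonneg k x)]
    refine (mul_le_of_le_one_left (abs_nonneg _) (plateau_le_one k _)).trans
      ((abs_cv_le (abs_ker_le hσ k j) (integrable_rho (Lp.memLp _)) x).trans ?_)
    rw [integral_abs_rho, one_mul]
    exact pow_le_pow_left₀ (norm_nonneg _) (hm t) 2
  have h1 := (abs_le.1 (hmom d)).2
  have h2 := (abs_le.1 (hmom c)).1
  have h3 := mul_le_mul_of_nonneg_left hmor (by positivity : 0 ≤ A * m ^ 2)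
  have h4 : ∫ t in c..d, shellDens p k (U t) (fun j => G j t) = shellError p c d U G k := rfl
  rw [h4] at key
  linarith

end InteractionLimit

/-! ### Positivity of the Hessian terms. -/

section Positivity

variable {σ : ℝ}

theorem dbl_comm {Φ : Plane × Plane → ℝ} (hΦ : ∀ z, Φ z.swap = Φ z) (e e' : Plane → ℝ) :
    dbl Φ e e' = dbl Φ e' e := by
  have := integral_prod_swap (μ := (volume : Measure Plane)) (ν := (volume : Measure Plane))
    (fun z => Φ z * (e' z.1 * e z.2))
  rw [dbl, dbl, Measure.volume_eq_prod, ← this]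
  refine integral_congr_ae (ae_of_all _ fun z => ?_)
  simp only [hΦ, Prod.fst_swap, Prod.snd_swap]
  ring

theorem hessKer_eq (hσ : 0 < σ) (l j : Fin 2) (z : Plane × Plane) :
    hessKer σ l j z = (if j = l then 1 else 0) * (wt σ (z.1 - z.2))⁻¹
      - (z.1 - z.2) j * (z.1 - z.2) l * (wt σ (z.1 - z.2) ^ 3)⁻¹ :=
  pd_radial_field hσ j l _

theorem hessKer_swap (hσ : 0 < σ) (l j : Fin 2) (z : Plane × Plane) :
    hessKer σ l j z.swap = hessKer σ l j z := by
  have : wt σ (z.2 - z.1) = wt σ (z.1 - z.2) := by rw [wt, wt, norm_sub_rev]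
  rw [hessKer_eq hσ, hessKer_eq hσ, Prod.fst_swap, Prod.snd_swap, this]
  simp only [PiLp.sub_apply]
  ring

theorem hessKer_symm (hσ : 0 < σ) (l j : Fin 2) (z : Plane × Plane) :
    hessKer σ l j z = hessKer σ j l z := by
  rw [hessKer_eq hσ, hessKer_eq hσ]
  simp only [eq_comm (a := j) (b := l)]
  ring

/-- Convexity of √(|x|²+σ²), by the Cauchy–Schwarz inequality. -/
theorem hessKer_quadratic_nonneg (hσ : 0 < σ) (z : Plane × Plane) (v w : ℝ) :
    0 ≤ hessKer σ 0 0 z * v ^ 2 + 2 * hessKer σ 0 1 z * (v * w) + hessKer σ 1 1 z * w ^ 2 := by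
  have hw := wt_pos hσ (z.1 - z.2)
  have h1 := wt_sq σ (z.1 - z.2)
  have h2 := norm_sq_eq (z.1 - z.2)
  simp only [hessKer_eq hσ, if_true, if_neg (show ¬((1 : Fin 2) = 0) by decide)]
  set x := (z.1 - z.2) 0
  set y := (z.1 - z.2) 1
  set r := wt σ (z.1 - z.2)
  have e : (1 * r⁻¹ - x * x * (r ^ 3)⁻¹) * v ^ 2 + 2 * (0 * r⁻¹ - y * x * (r ^ 3)⁻¹) * (v * w)
      + (1 * r⁻¹ - y * y * (r ^ 3)⁻¹) * w ^ 2
      = (r ^ 3)⁻¹ * (r ^ 2 * (v ^ 2 + w ^ 2) - (x * v + y * w) ^ 2) := by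
    field_simp
    ring
  rw [e]
  refine mul_nonneg (by positivity) ?_
  rw [h1, h2]
  nlinarith [sq_nonneg (x * w - y * v), mul_nonneg (sq_nonneg σ) (sq_nonneg v),
    mul_nonneg (sq_nonneg σ) (sq_nonneg w)]

/-- The kernel `Δ √(|x|² + σ²)`. -/
noncomputable def traceKer (σ : ℝ) (z : Plane × Plane) : ℝ :=
  (wt σ (z.1 - z.2))⁻¹ + σ ^ 2 * (wt σ (z.1 - z.2) ^ 3)⁻¹

theorem sum_hessKer (hσ : 0 < σ) (z : Plane × Plane) : ∑ j, hessKer σ j j z = traceKer σ z := by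
  have := congrFun (dv_radial hσ) (z.1 - z.2)
  simp only [pow_one] at this
  exact this

/-- Read α = f(y), β = f(x), with (a, A) and (b, B) the gradients of f at x and at y. The expression
is half the sum of the quadratic form over the real and imaginary parts of the vectors α∇f(x) -
β∇f(y) and ᾱ∇f(x) + β∇f̄(y). The conjugation in the second pair makes the cross terms combine into
products of momenta. -/
theorem hessian_identity (P Q R α₁ α₂ β₁ β₂ a₁ a₂ A₁ A₂ b₁ b₂ B₁ B₂ : ℝ)
    (h : ∀ v w : ℝ, 0 ≤ P * v ^ 2 + 2 * Q * (v * w) + R * w ^ 2) :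
    0 ≤ P * ((α₁ * α₁ + α₂ * α₂) * (a₁ * a₁ + a₂ * a₂) + (β₁ * β₁ + β₂ * β₂) * (b₁ * b₁ + b₂ * b₂)
        - 2 * ((α₁ * b₂ - α₂ * b₁) * (β₁ * a₂ - β₂ * a₁)))
      + Q * (2 * ((α₁ * α₁ + α₂ * α₂) * (a₁ * A₁ + a₂ * A₂)
          + (β₁ * β₁ + β₂ * β₂) * (b₁ * B₁ + b₂ * B₂))
        - 2 * ((α₁ * b₂ - α₂ * b₁) * (β₁ * A₂ - β₂ * A₁))
        - 2 * ((α₁ * B₂ - α₂ * B₁) * (β₁ * a₂ - β₂ * a₁)))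
      + R * ((α₁ * α₁ + α₂ * α₂) * (A₁ * A₁ + A₂ * A₂) + (β₁ * β₁ + β₂ * β₂) * (B₁ * B₁ + B₂ * B₂)
        - 2 * ((α₁ * B₂ - α₂ * B₁) * (β₁ * A₂ - β₂ * A₁))) := by
  have h1 := h (α₁ * a₁ - α₂ * a₂ - (β₁ * b₁ - β₂ * b₂)) (α₁ * A₁ - α₂ * A₂ - (β₁ * B₁ - β₂ * B₂))
  have h2 := h (α₁ * a₂ + α₂ * a₁ - (β₁ * b₂ + β₂ * b₁)) (α₁ * A₂ + α₂ * A₁ - (β₁ * B₂ + β₂ * B₁))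
  have h3 := h (α₁ * a₁ + α₂ * a₂ + (β₁ * b₁ + β₂ * b₂)) (α₁ * A₁ + α₂ * A₂ + (β₁ * B₁ + β₂ * B₂))
  have h4 := h (α₁ * a₂ - α₂ * a₁ + (β₂ * b₁ - β₁ * b₂)) (α₁ * A₂ - α₂ * A₁ + (β₂ * B₁ - β₁ * B₂))
  linarith

theorem dbl_const_mul_left (Φ : Plane × Plane → ℝ) (v : ℝ) (e e' : Plane → ℝ) :
    dbl Φ (fun x => v * e x) e' = v * dbl Φ e e' := by
  rw [dbl, dbl, ← integral_const_mul]
  congr 1; funext z; ring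

theorem measurable_traceKer (hσ : 0 < σ) : Measurable (traceKer σ) := by
  rw [← funext (sum_hessKer hσ)]
  exact Finset.measurable_fun_sum _ fun j _ => measurable_hessKer hσ j j

theorem abs_traceKer_le (hσ : 0 < σ) (z : Plane × Plane) : |traceKer σ z| ≤ 4 * σ⁻¹ := by
  rw [← sum_hessKer hσ, Fin.sum_univ_two]
  refine (abs_add_le _ _).trans ?_
  linarith [abs_hessKer_le hσ 0 0 z, abs_hessKer_le hσ 1 1 z]

theorem sum_dbl_hessKer (hσ : 0 < σ) {e e' : Plane → ℝ} (he : Integrable e) (he' : Integrable e') :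
    ∑ j, dbl (hessKer σ j j) e e' = dbl (traceKer σ) e e' := by
  simp only [dbl, ← sum_hessKer hσ, Finset.sum_mul]
  exact (integral_finsetSum _ fun j _ => integrable_dbl (measurable_hessKer hσ j j)
    (abs_hessKer_le hσ j j) he he').symm

/-- The nonlinear term is nonnegative because the kernel is, and the gradient terms minus the flux
are nonnegative by `hessian_identity`. The form in ∇ρ is kept. -/
theorem interForm_ge (hσ : 0 < σ) {p : ℝ} (hp : 1 ≤ p) {f : Plane → ℂ} {g : Fin 2 → Plane → ℂ}
    (h : H1Pair f g) :
    2 * ∑ l, dbl (traceKer σ) (qd f (g l)) (qd f (g l)) ≤ interForm (hessKer σ) p f g := by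
  have hρ := integrable_rho h.memLp
  have hq := fun l => integrable_qd h.memLp (h.memLp_grad l)
  have hqq := fun j l => integrable_qd (h.memLp_grad j) (h.memLp_grad l)
  have hmd := fun l => integrable_md h.memLp (h.memLp_grad l)
  have hpot := integrable_pot hp h
  have t3 : 0 ≤ p / (p + 2) * (∑ j, dbl (hessKer σ j j) (rho f) (pot p f)) := by
    rw [sum_dbl_hessKer hσ hρ hpot]
    refine mul_nonneg (by positivity) (integral_nonneg fun z => mul_nonneg ?_
      (mul_nonneg (pot_nonneg p f _) (rho_nonneg f _)))
    have := wt_pos hσ (z.1 - z.2)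
    unfold traceKer
    positivity
  have t2 : ∀ l, ∑ j, dbl (hessKer σ j j) (fun x => 2 * qd f (g l) x) (qd f (g l))
      = 2 * dbl (traceKer σ) (qd f (g l)) (qd f (g l)) := fun l => by
    rw [sum_dbl_hessKer hσ ((hq l).const_mul 2) (hq l), dbl_const_mul_left]
  have t1 : 0 ≤ (∑ j, ∑ l, 2 * dbl (hessKer σ l j) (rho f) (qd (g j) (g l)))
      - 2 * ∑ l, ∑ j, dbl (hessKer σ l j) (md f (g l)) (md f (g j)) := by
    have i1 := fun l j => integrable_dbl (measurable_hessKer hσ l j) (abs_hessKer_le hσ l j)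
      hρ (hqq j l)
    have i2 := fun l j => integrable_dbl (measurable_hessKer hσ l j) (abs_hessKer_le hσ l j)
      (hqq j l) hρ
    have i3 := fun l j => integrable_dbl (measurable_hessKer hσ l j) (abs_hessKer_le hσ l j)
      (hmd l) (hmd j)
    -- Symmetrization in x and y, needed because the algebraic identity involves |f(y)|²|∇f(x)|² and
    -- |f(x)|²|∇f(y)|² together.
    have e1 : ∀ l j, 2 * dbl (hessKer σ l j) (rho f) (qd (g j) (g l))
        = dbl (hessKer σ l j) (rho f) (qd (g j) (g l))
          + dbl (hessKer σ l j) (qd (g j) (g l)) (rho f) := fun l j => by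
      rw [dbl_comm (hessKer_swap hσ l j) (qd (g j) (g l)) (rho f)]; ring
    let D : Fin 2 → Fin 2 → Plane × Plane → ℝ := fun l j z =>
      hessKer σ l j z * (qd (g j) (g l) z.1 * rho f z.2)
        + hessKer σ l j z * (rho f z.1 * qd (g j) (g l) z.2)
        - 2 * (hessKer σ l j z * (md f (g j) z.1 * md f (g l) z.2))
    have i4 : ∀ l j, Integrable (D l j) := fun l j =>
      ((i1 l j).add (i2 l j)).sub ((i3 l j).const_mul 2)
    have e3 : ∀ l j, ∫ z, D l j z = dbl (hessKer σ l j) (rho f) (qd (g j) (g l))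
        + dbl (hessKer σ l j) (qd (g j) (g l)) (rho f)
        - 2 * dbl (hessKer σ l j) (md f (g l)) (md f (g j)) := fun l j => by
      have h1 := integral_sub ((i1 l j).add (i2 l j)) ((i3 l j).const_mul 2)
      have h2 := integral_add (i1 l j) (i2 l j)
      have h3 := integral_const_mul (μ := volume) (2 : ℝ) fun z : Plane × Plane =>
        hessKer σ l j z * (md f (g j) z.1 * md f (g l) z.2)
      exact h1.trans (congrArg₂ (· - ·) h2 h3)
    have e2 : (∑ j, ∑ l, 2 * dbl (hessKer σ l j) (rho f) (qd (g j) (g l)))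
        - 2 * ∑ l, ∑ j, dbl (hessKer σ l j) (md f (g l)) (md f (g j)) = ∑ l, ∑ j, ∫ z, D l j z := by
      simp only [e3, e1, Fin.sum_univ_two]
      ring
    have e4 : ∑ l, ∑ j, ∫ z, D l j z = ∫ z, ∑ l, ∑ j, D l j z := by
      rw [integral_finsetSum _ fun l _ => integrable_finsetSum _ fun j _ => i4 l j]
      exact Finset.sum_congr rfl fun l _ => (integral_finsetSum _ fun j _ => i4 l j).symm
    rw [e2, e4]
    refine integral_nonneg fun z => ?_
    have := hessian_identity (hessKer σ 0 0 z) (hessKer σ 0 1 z) (hessKer σ 1 1 z)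
      (f z.2).re (f z.2).im (f z.1).re (f z.1).im (g 0 z.1).re (g 0 z.1).im (g 1 z.1).re (g 1 z.1).im
      (g 0 z.2).re (g 0 z.2).im (g 1 z.2).re (g 1 z.2).im (hessKer_quadratic_nonneg hσ z)
    simp only [D, Pi.zero_apply, Fin.sum_univ_two, hessKer_symm hσ 1 0 z, qd_eq, md_eq, rho,
      norm_sq_complex]
    linarith
  rw [interForm]
  simp only [t2]
  rw [Finset.mul_sum]
  linarith

/-- The interaction Morawetz estimate. -/
theorem exists_interaction_le {a : ℝ} (ha : 1 / 4 < a) : ∃ A, 0 < A ∧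
    ∀ {p c d : ℝ} {U : ℝ → L2} {G : Fin 2 → ℝ → L2} (_ : Flow a p c d U G) (_ : 2 ≤ p) (_ : c ≤ d)
    {m S : ℝ} (_ : ∀ t, ‖U t‖ ≤ m) (_ : ∀ j t, ‖G j t‖ ≤ S) {σ : ℝ} (_ : 0 < σ),
    ∫ t in c..d, ∑ l, dbl (traceKer σ) (qd (U t) (G l t)) (qd (U t) (G l t)) ≤ A * (m ^ 3 * S) := by
  obtain ⟨A, hA, h⟩ := exists_integral_interForm_le ha
  refine ⟨A, hA, fun {p c d U G} F hp hcd {m S} hm hS {σ} hσ => ?_⟩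
  have hp1 : 1 ≤ p := by linarith
  have c1 : Continuous fun t => ∑ l, dbl (traceKer σ) (qd (U t) (G l t)) (qd (U t) (G l t)) :=
    continuous_finsetSum _ fun l _ => (continuous_dbl (measurable_traceKer hσ) (abs_traceKer_le hσ)
      (l1Curve_qd F.cU (F.cG l)) (l1Curve_qd F.cU (F.cG l))).comp (continuous_id.prodMk continuous_id)
  have h1 := Flow.integral_mono hcd (continuous_const_mul_fun c1 2)
    (F.limInt_interForm hp1 hσ).continuous_lim (fun t => interForm_ge hσ hp1 (F.pair t))
  have h2 := h F hp hcd hm hS hσ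
  rw [intervalIntegral.integral_const_mul] at h1
  have h3 : 0 ≤ A * (m ^ 3 * S) := by
    have := (norm_nonneg _).trans (hm c)
    have := (norm_nonneg _).trans (hS 0 c)
    positivity
  linarith

end Positivity

/-! ### Fourier representation of the remaining form. -/

section FourierLowerBound

open Real

/-- The cosine transform. -/
noncomputable def cosT (e : Plane → ℝ) (ξ : Plane) : ℝ := ∫ x, cos (2 * π * inner ℝ x ξ) * e x

/-- The sine transform. -/
noncomputable def sinT (e : Plane → ℝ) (ξ : Plane) : ℝ := ∫ x, sin (2 * π * inner ℝ x ξ) * e x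

/-- The power spectrum. -/
noncomputable def powSpec (e : Plane → ℝ) (ξ : Plane) : ℝ := cosT e ξ ^ 2 + sinT e ξ ^ 2

theorem powSpec_nonneg (e : Plane → ℝ) (ξ : Plane) : 0 ≤ powSpec e ξ := by
  unfold powSpec; positivity

variable {e : Plane → ℝ}

theorem continuous_phase (ξ : Plane) : Continuous fun x : Plane => 2 * π * inner ℝ x ξ := by
  fun_prop

theorem integrable_cos_mul (he : Integrable e) (ξ : Plane) :
    Integrable fun x => cos (2 * π * inner ℝ x ξ) * e x :=
  he.bdd_mul (c := 1) (continuous_cos.comp (continuous_phase ξ)).aestronglyMeasurable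
    (ae_of_all _ fun _ => abs_cos_le_one _)

theorem integrable_sin_mul (he : Integrable e) (ξ : Plane) :
    Integrable fun x => sin (2 * π * inner ℝ x ξ) * e x :=
  he.bdd_mul (c := 1) (continuous_sin.comp (continuous_phase ξ)).aestronglyMeasurable
    (ae_of_all _ fun _ => abs_sin_le_one _)

theorem continuous_powSpec (he : Integrable e) : Continuous (powSpec e) := by
  refine (Continuous.pow ?_ 2).add (Continuous.pow ?_ 2)
  · refine continuous_of_dominated (fun ξ => (integrable_cos_mul he ξ).aestronglyMeasurable)
      (bound := fun x => |e x|) (fun ξ => ae_of_all _ fun x => ?_) he.abs (ae_of_all _ fun x => ?_)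
    · rw [Real.norm_eq_abs, abs_mul]
      exact mul_le_of_le_one_left (abs_nonneg _) (abs_cos_le_one _)
    · fun_prop
  · refine continuous_of_dominated (fun ξ => (integrable_sin_mul he ξ).aestronglyMeasurable)
      (bound := fun x => |e x|) (fun ξ => ae_of_all _ fun x => ?_) he.abs (ae_of_all _ fun x => ?_)
    · rw [Real.norm_eq_abs, abs_mul]
      exact mul_le_of_le_one_left (abs_nonneg _) (abs_sin_le_one _)
    · fun_prop

theorem norm_fourier_sq (he : Integrable e) (ξ : Plane) :
    ‖𝓕 (fun x => (e x : ℂ)) ξ‖ ^ 2 = powSpec e ξ := by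
  have h : 𝓕 (fun x => (e x : ℂ)) ξ = (cosT e ξ : ℂ) - (sinT e ξ : ℂ) * Complex.I := by
    rw [Real.fourier_eq', cosT, sinT, ← integral_complex_ofReal, ← integral_complex_ofReal,
      ← integral_mul_const, ← integral_sub (integrable_cos_mul he ξ).ofReal
        ((integrable_sin_mul he ξ).ofReal.mul_const _)]
    refine integral_congr_ae (ae_of_all _ fun x => ?_)
    simp only [smul_eq_mul]
    rw [Complex.exp_mul_I]
    push_cast
    rw [show -2 * (π : ℂ) * (inner ℝ x ξ : ℝ) = -(2 * π * (inner ℝ x ξ : ℝ)) by ring, Complex.cos_neg,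
      Complex.sin_neg]
    ring
  rw [h, norm_sq_complex, powSpec]
  simp
  ring

/-- The real part of the Fourier transform of a Gaussian; in dimension two the prefactor has
exponent one. -/
theorem integral_gauss_cos {b : ℝ} (hb : 0 < b) (x : Plane) :
    ∫ ξ : Plane, exp (-(π ^ 2 / b * ‖ξ‖ ^ 2)) * cos (2 * π * inner ℝ x ξ)
      = b / π * exp (-(b * ‖x‖ ^ 2)) := by
  have hb' : 0 < (((π ^ 2 / b : ℝ) : ℂ)).re := by
    rw [Complex.ofReal_re]; positivity
  have h := GaussianFourier.integral_cexp_neg_mul_sq_norm_add hb' (2 * π * Complex.I) x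
  have hi := GaussianFourier.integrable_cexp_neg_mul_sq_norm_add hb' (2 * π * Complex.I) x
  have h1 := congrArg Complex.re h
  have h2 : (∫ v : Plane, Complex.exp (-((π ^ 2 / b : ℝ) : ℂ) * ‖v‖ ^ 2
      + 2 * π * Complex.I * (inner ℝ x v : ℝ))).re
      = ∫ v : Plane, (Complex.exp (-((π ^ 2 / b : ℝ) : ℂ) * ‖v‖ ^ 2
      + 2 * π * Complex.I * (inner ℝ x v : ℝ))).re := (integral_re hi).symm
  have hπ : (π : ℂ) ≠ 0 := by exact_mod_cast pi_ne_zero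
  have hbc : (b : ℂ) ≠ 0 := by exact_mod_cast hb.ne'
  have e1 : ((π : ℂ) / ((π ^ 2 / b : ℝ) : ℂ)) ^ ((Module.finrank ℝ Plane : ℂ) / 2)
      * Complex.exp ((2 * π * Complex.I) ^ 2 * ‖x‖ ^ 2 / (4 * ((π ^ 2 / b : ℝ) : ℂ)))
      = ((b / π * exp (-(b * ‖x‖ ^ 2)) : ℝ) : ℂ) := by
    rw [finrank_euclideanSpace_fin]
    push_cast
    rw [show (2 : ℂ) / 2 = 1 by norm_num, Complex.cpow_one]
    congr 1
    · field_simp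
    · congr 1
      rw [mul_pow, Complex.I_sq]
      field_simp
      ring
  rw [e1, h2, Complex.ofReal_re] at h1
  rw [← h1]
  refine integral_congr_ae (ae_of_all _ fun v => ?_)
  simp only
  rw [show -((π ^ 2 / b : ℝ) : ℂ) * ‖v‖ ^ 2 + 2 * π * Complex.I * (inner ℝ x v : ℝ)
      = ((-(π ^ 2 / b * ‖v‖ ^ 2) : ℝ) : ℂ) + ((2 * π * inner ℝ x v : ℝ) : ℂ) * Complex.I by
    push_cast; ring, Complex.exp_add, ← Complex.ofReal_exp, Complex.re_ofReal_mul,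
    Complex.exp_ofReal_mul_I_re]

theorem integrable_gauss {b : ℝ} (hb : 0 < b) :
    Integrable fun ξ : Plane => exp (-(π ^ 2 / b * ‖ξ‖ ^ 2)) := by
  have hb' : 0 < (((π ^ 2 / b : ℝ) : ℂ)).re := by
    rw [Complex.ofReal_re]; positivity
  have hi := (GaussianFourier.integrable_cexp_neg_mul_sq_norm_add hb' 0 (0 : Plane)).re
  refine hi.congr (ae_of_all _ fun v => ?_)
  simp only [RCLike.re_to_complex]
  rw [show -((π ^ 2 / b : ℝ) : ℂ) * ‖v‖ ^ 2 + 0 * (inner ℝ (0 : Plane) v : ℝ)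
      = ((-(π ^ 2 / b * ‖v‖ ^ 2) : ℝ) : ℂ) by push_cast; ring, ← Complex.ofReal_exp,
    Complex.ofReal_re]

/-- The addition formula for the cosine separates x from y and produces the squares of the cosine
and sine transforms. -/
theorem dbl_gauss {b : ℝ} (hb : 0 < b) (he : Integrable e) :
    dbl (fun z => exp (-(b * ‖z.1 - z.2‖ ^ 2))) e e
      = π / b * ∫ ξ, exp (-(π ^ 2 / b * ‖ξ‖ ^ 2)) * powSpec e ξ := by
  have hi : Integrable (Function.uncurry fun (z : Plane × Plane) (ξ : Plane) =>
      cos (2 * π * inner ℝ (z.1 - z.2) ξ) * ((e z.1 * e z.2) * exp (-(π ^ 2 / b * ‖ξ‖ ^ 2))))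
      ((volume : Measure (Plane × Plane)).prod volume) := by
    refine ((he.mul_prod he).mul_prod (integrable_gauss hb)).bdd_mul (c := 1)
      (Continuous.aestronglyMeasurable ?_) (ae_of_all _ fun w => abs_cos_le_one _)
    fun_prop
  have e1 : dbl (fun z => exp (-(b * ‖z.1 - z.2‖ ^ 2))) e e
      = ∫ z : Plane × Plane, π / b * ∫ ξ, cos (2 * π * inner ℝ (z.1 - z.2) ξ)
        * ((e z.1 * e z.2) * exp (-(π ^ 2 / b * ‖ξ‖ ^ 2))) := by
    refine integral_congr_ae (ae_of_all _ fun z => ?_)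
    simp only
    have h := integral_gauss_cos hb (z.1 - z.2)
    have h2 : ∫ ξ, cos (2 * π * inner ℝ (z.1 - z.2) ξ)
        * ((e z.1 * e z.2) * exp (-(π ^ 2 / b * ‖ξ‖ ^ 2)))
        = (e z.1 * e z.2) * ∫ ξ : Plane, exp (-(π ^ 2 / b * ‖ξ‖ ^ 2))
          * cos (2 * π * inner ℝ (z.1 - z.2) ξ) := by
      rw [← integral_const_mul]
      congr 1; funext ξ; ring
    rw [h2, h]
    have := pi_ne_zero
    field_simp
  rw [e1, integral_const_mul, integral_integral_swap hi]
  congr 1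
  refine integral_congr_ae (ae_of_all _ fun ξ => ?_)
  simp only
  have c1 := (integrable_cos_mul he ξ).mul_prod (integrable_cos_mul he ξ)
  have c2 := (integrable_sin_mul he ξ).mul_prod (integrable_sin_mul he ξ)
  have e2 : ∀ z : Plane × Plane, cos (2 * π * inner ℝ (z.1 - z.2) ξ)
      * ((e z.1 * e z.2) * exp (-(π ^ 2 / b * ‖ξ‖ ^ 2)))
      = exp (-(π ^ 2 / b * ‖ξ‖ ^ 2)) * ((cos (2 * π * inner ℝ z.1 ξ) * e z.1)
          * (cos (2 * π * inner ℝ z.2 ξ) * e z.2)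
        + (sin (2 * π * inner ℝ z.1 ξ) * e z.1) * (sin (2 * π * inner ℝ z.2 ξ) * e z.2)) := by
    intro z
    rw [inner_sub_left, mul_sub, cos_sub]
    ring
  simp only [e2]
  rw [integral_const_mul, Measure.volume_eq_prod, integral_add c1 c2, integral_prod_mul
    (fun x => cos (2 * π * inner ℝ x ξ) * e x) (fun x => cos (2 * π * inner ℝ x ξ) * e x),
    integral_prod_mul (fun x => sin (2 * π * inner ℝ x ξ) * e x)
    (fun x => sin (2 * π * inner ℝ x ξ) * e x), powSpec, cosT, sinT]
  ring

/-- The density of the representation of `traceKer` as a superposition of Gaussians. -/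
noncomputable def gaussDens (σ b : ℝ) : ℝ :=
  (√π)⁻¹ * (b ^ ((1 / 2 : ℝ) - 1) * exp (-(σ ^ 2 * b)))
    + 2 * σ ^ 2 * (√π)⁻¹ * (b ^ ((3 / 2 : ℝ) - 1) * exp (-(σ ^ 2 * b)))

theorem integrableOn_rpow_exp {s r : ℝ} (hs : 0 < s) (hr : 0 < r) :
    IntegrableOn (fun b : ℝ => b ^ (s - 1) * exp (-(r * b))) (Set.Ioi 0) := by
  have := integrableOn_rpow_mul_exp_neg_mul_rpow (s := s - 1) (p := 1) (b := r) (by linarith)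
    one_pos hr
  simpa using this

theorem integrableOn_gaussDens {σ : ℝ} (hσ : 0 < σ) : IntegrableOn (gaussDens σ) (Set.Ioi 0) :=
  ((integrableOn_rpow_exp (by norm_num) (by positivity)).const_mul _).add
    ((integrableOn_rpow_exp (by norm_num) (by positivity)).const_mul _)

/-- The powers w⁻¹ and w⁻³ are Gamma integrals of exp(-w²b) with exponents 1/2 and 3/2, and
exp(-w²b) is a Gaussian in x-y times exp(-σ²b). -/
theorem traceKer_eq {σ : ℝ} (hσ : 0 < σ) (z : Plane × Plane) :
    traceKer σ z = ∫ b in Set.Ioi 0, gaussDens σ b * exp (-(b * ‖z.1 - z.2‖ ^ 2)) := by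
  have hw := wt_pos hσ (z.1 - z.2)
  have hsq := wt_sq σ (z.1 - z.2)
  set w := wt σ (z.1 - z.2)
  have hw2 : 0 < w ^ 2 := by positivity
  have e : ∀ b, gaussDens σ b * exp (-(b * ‖z.1 - z.2‖ ^ 2))
      = (√π)⁻¹ * (b ^ ((1 / 2 : ℝ) - 1) * exp (-(w ^ 2 * b)))
        + 2 * σ ^ 2 * (√π)⁻¹ * (b ^ ((3 / 2 : ℝ) - 1) * exp (-(w ^ 2 * b))) := fun b => by
    have : exp (-(w ^ 2 * b)) = exp (-(σ ^ 2 * b)) * exp (-(b * ‖z.1 - z.2‖ ^ 2)) := by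
      rw [← exp_add, hsq]; congr 1; ring
    rw [gaussDens, this]
    ring
  have h0 : √π ≠ 0 := (sqrt_pos.2 pi_pos).ne'
  have g3 : Gamma (3 / 2) = 1 / 2 * √π := by
    rw [show (3 / 2 : ℝ) = 1 / 2 + 1 by norm_num, Gamma_add_one (by norm_num), Gamma_one_half_eq]
  have r1 : (1 / w ^ 2) ^ (1 / 2 : ℝ) = w⁻¹ := by
    rw [← sqrt_eq_rpow, one_div, ← inv_pow, sqrt_sq (by positivity)]
  have r3 : (1 / w ^ 2) ^ (3 / 2 : ℝ) = (w ^ 3)⁻¹ := by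
    rw [show (3 / 2 : ℝ) = (1 / 2 : ℝ) * (3 : ℕ) by norm_num, rpow_mul (by positivity), r1,
      rpow_natCast, inv_pow]
  simp only [e]
  rw [integral_add ((integrableOn_rpow_exp (by norm_num) hw2).const_mul _)
      ((integrableOn_rpow_exp (by norm_num) hw2).const_mul _), integral_const_mul,
    integral_const_mul, integral_rpow_mul_exp_neg_mul_Ioi (by norm_num) hw2,
    integral_rpow_mul_exp_neg_mul_Ioi (by norm_num) hw2, g3, Gamma_one_half_eq, r1, r3]
  change w⁻¹ + σ ^ 2 * (w ^ 3)⁻¹ = _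
  field_simp

theorem dbl_traceKer {σ : ℝ} (hσ : 0 < σ) (he : Integrable e) :
    Integrable (fun b => gaussDens σ b * dbl (fun z => exp (-(b * ‖z.1 - z.2‖ ^ 2))) e e)
      (volume.restrict (Set.Ioi 0)) ∧
    dbl (traceKer σ) e e = ∫ b in Set.Ioi 0,
      gaussDens σ b * dbl (fun z => exp (-(b * ‖z.1 - z.2‖ ^ 2))) e e := by
  have hi : Integrable (Function.uncurry fun (b : ℝ) (z : Plane × Plane) =>
      exp (-(b * ‖z.1 - z.2‖ ^ 2)) * (gaussDens σ b * (e z.1 * e z.2)))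
      ((volume.restrict (Set.Ioi 0)).prod (volume : Measure (Plane × Plane))) := by
    refine ((integrableOn_gaussDens hσ).mul_prod (he.mul_prod he)).bdd_mul (c := 1)
      (Continuous.aestronglyMeasurable ?_) ?_
    · fun_prop
    · have h : ∀ᵐ w : ℝ × (Plane × Plane) ∂((volume.restrict (Set.Ioi 0)).prod
          (volume : Measure (Plane × Plane))), w.1 ∈ Set.Ioi (0 : ℝ) :=
        Measure.quasiMeasurePreserving_fst.ae (ae_restrict_mem measurableSet_Ioi)
      filter_upwards [h] with w hw
      rw [Real.norm_eq_abs, abs_exp, exp_le_one_iff, neg_nonpos]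
      have : (0 : ℝ) < w.1 := hw
      positivity
  have e1 : ∀ b, gaussDens σ b * dbl (fun z => exp (-(b * ‖z.1 - z.2‖ ^ 2))) e e
      = ∫ z : Plane × Plane, exp (-(b * ‖z.1 - z.2‖ ^ 2)) * (gaussDens σ b * (e z.1 * e z.2)) := by
    intro b
    rw [dbl, ← integral_const_mul]
    congr 1; funext z; ring
  simp only [e1]
  refine ⟨hi.integral_prod_left, ?_⟩
  rw [integral_integral_swap hi]
  refine integral_congr_ae (ae_of_all _ fun z => ?_)
  simp only
  rw [traceKer_eq hσ, ← integral_mul_const]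
  congr 1; funext b; ring

theorem pd_phase {φ φ' : ℝ → ℝ} (hφ : ∀ s, HasDerivAt φ (φ' s) s) (ξ : Plane) (l : Fin 2)
    (x : Plane) : pd l (fun x => φ (2 * π * inner ℝ x ξ)) x
      = 2 * π * ξ l * φ' (2 * π * inner ℝ x ξ) := by
  have h1 : HasFDerivAt (fun x : Plane => 2 * π * inner ℝ x ξ) ((2 * π) • innerSL ℝ ξ) x := by
    have := ((innerSL ℝ ξ).hasFDerivAt (x := x)).const_mul (2 * π)
    refine this.congr_of_eventuallyEq (Eventually.of_forall fun y => ?_)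
    simp [real_inner_comm]
  have h2 := (hφ (2 * π * inner ℝ x ξ)).comp_hasFDerivAt x h1
  rw [pd]
  erw [h2.fderiv]
  simp [EuclideanSpace.inner_single_right]
  ring

/-- The density is half of ∂ₗρ, so its transform is that of ρ times πξₗ in modulus. The test
functions are plane waves, which are bounded but not compactly supported. -/
theorem powSpec_qd {f : Plane → ℂ} {g : Fin 2 → Plane → ℂ} (h : H1Pair f g) (l : Fin 2)
    (ξ : Plane) : powSpec (qd f (g l)) ξ = π ^ 2 * ξ l ^ 2 * powSpec (rho f) ξ := by
  have key : ∀ {φ φ' : ℝ → ℝ}, ContDiff ℝ ∞ φ → Continuous φ' → (∀ s, |φ s| ≤ 1) →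
      (∀ s, |φ' s| ≤ 1) → (∀ s, HasDerivAt φ (φ' s) s) →
      2 * π * ξ l * ∫ x, φ' (2 * π * inner ℝ x ξ) * rho f x
        = -(2 * ∫ x, φ (2 * π * inner ℝ x ξ) * qd f (g l) x) := by
    intro φ φ' c1 c2 b1 b2 hd
    have ep : pd l (fun x => φ (2 * π * inner ℝ x ξ))
        = fun x => 2 * π * ξ l * φ' (2 * π * inner ℝ x ξ) := funext (pd_phase hd ξ l)
    have k1 : IsBdd fun x : Plane => φ (2 * π * inner ℝ x ξ) :=
      ⟨(c1.continuous.comp (continuous_phase ξ)).measurable, 1, fun x => b1 _⟩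
    have k2 : IsBdd fun x : Plane => φ' (2 * π * inner ℝ x ξ) :=
      ⟨(c2.comp (continuous_phase ξ)).measurable, 1, fun x => b2 _⟩
    have k3 : IsBdd (pd l fun x => φ (2 * π * inner ℝ x ξ)) := by
      rw [ep]; exact k2.const_mul _
    have hc : ContDiff ℝ ∞ fun x : Plane => φ (2 * π * inner ℝ x ξ) :=
      c1.comp (contDiff_const.mul (contDiff_id.inner ℝ contDiff_const))
    have e := congrArg Complex.re (ip_pd_eq h h hc k1 l k3)
    have h2 := hasInt_ip_re k1 h.memLp (h.memLp_grad l)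
    have h3 := (hasInt_ip_re k1 (h.memLp_grad l) h.memLp).congr
      (g := fun x => φ (2 * π * inner ℝ x ξ) * qd f (g l) x) fun y => by rw [qd_eq, qd_eq]; ring
    rw [Complex.neg_re, Complex.add_re, h3.unique h2, ← (hasInt_rho k3 h.memLp).2, ← h2.2, ep] at e
    simp only [mul_assoc (2 * π * ξ l), integral_const_mul] at e
    linarith
  have hs := key contDiff_sin continuous_cos abs_sin_le_one abs_cos_le_one hasDerivAt_sin
  have hc := key contDiff_cos continuous_sin.neg abs_cos_le_one
    (fun s => by rw [Pi.neg_apply, abs_neg]; exact abs_sin_le_one s) hasDerivAt_cos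
  simp only [Pi.neg_apply, neg_mul, integral_neg] at hc
  have es : sinT (qd f (g l)) ξ = -(π * ξ l * cosT (rho f) ξ) := by
    rw [sinT, cosT]; linarith
  have ec : cosT (qd f (g l)) ξ = π * ξ l * sinT (rho f) ξ := by
    rw [sinT, cosT]; linarith
  rw [powSpec, powSpec, es, ec]
  ring

theorem powSpec_le (he : Integrable e) (ξ : Plane) : powSpec e ξ ≤ 2 * (∫ x, |e x|) ^ 2 := by
  have h1 : |cosT e ξ| ≤ ∫ x, |e x| := abs_integral_le_integral_abs.trans (integral_mono_of_nonneg
    (ae_of_all _ fun _ => abs_nonneg _) he.abs (ae_of_all _ fun x => by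
      simp only [abs_mul]
      exact mul_le_of_le_one_left (abs_nonneg _) (abs_cos_le_one _)))
  have h2 : |sinT e ξ| ≤ ∫ x, |e x| := abs_integral_le_integral_abs.trans (integral_mono_of_nonneg
    (ae_of_all _ fun _ => abs_nonneg _) he.abs (ae_of_all _ fun x => by
      simp only [abs_mul]
      exact mul_le_of_le_one_left (abs_nonneg _) (abs_sin_le_one _)))
  have := sq_le_sq' (abs_le.1 h1).1 (abs_le.1 h1).2
  have := sq_le_sq' (abs_le.1 h2).1 (abs_le.1 h2).2
  rw [powSpec]
  linarith

theorem gaussDens_nonneg (σ : ℝ) {b : ℝ} (hb : 0 < b) : 0 ≤ gaussDens σ b := by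
  unfold gaussDens; positivity

/-- Every Gaussian contributes a nonnegative amount, so the form can be written with nonnegative
integrals, which may be exchanged freely and for which no finiteness is needed. -/
theorem ofReal_dbl_traceKer {σ : ℝ} (hσ : 0 < σ) (he : Integrable e) :
    0 ≤ dbl (traceKer σ) e e ∧ ENNReal.ofReal (dbl (traceKer σ) e e)
      = ∫⁻ b in Set.Ioi 0, ∫⁻ ξ,
        ENNReal.ofReal (gaussDens σ b * (π / b) * exp (-(π ^ 2 / b * ‖ξ‖ ^ 2)) * powSpec e ξ) := by
  obtain ⟨h1, h2⟩ := dbl_traceKer hσ he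
  have hd : ∀ b, 0 < b → gaussDens σ b * dbl (fun z => exp (-(b * ‖z.1 - z.2‖ ^ 2))) e e
      = ∫ ξ, gaussDens σ b * (π / b) * exp (-(π ^ 2 / b * ‖ξ‖ ^ 2)) * powSpec e ξ := fun b hb => by
    rw [dbl_gauss hb he, ← mul_assoc, ← integral_const_mul]
    congr 1; funext ξ; ring
  have hn : ∀ b, 0 < b → ∀ ξ,
      0 ≤ gaussDens σ b * (π / b) * exp (-(π ^ 2 / b * ‖ξ‖ ^ 2)) * powSpec e ξ := fun b hb ξ => by
    have := gaussDens_nonneg σ hb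
    have := powSpec_nonneg e ξ
    positivity
  have hae : ∀ᵐ b ∂(volume.restrict (Set.Ioi (0 : ℝ))),
      0 ≤ gaussDens σ b * dbl (fun z => exp (-(b * ‖z.1 - z.2‖ ^ 2))) e e := by
    filter_upwards [ae_restrict_mem measurableSet_Ioi] with b hb
    rw [hd b hb]
    exact integral_nonneg (hn b hb)
  rw [h2]
  refine ⟨integral_nonneg_of_ae hae, ?_⟩
  rw [ofReal_integral_eq_lintegral_ofReal h1 hae]
  refine setLIntegral_congr_fun measurableSet_Ioi fun b hb => ?_
  rw [hd b hb, ofReal_integral_eq_lintegral_ofReal _ (ae_of_all _ (hn b hb))]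
  have hg := ((integrable_gauss (b := b) hb).const_mul (gaussDens σ b * (π / b))).bdd_mul
    (c := 2 * (∫ x, |e x|) ^ 2) (continuous_powSpec he).aestronglyMeasurable
    (ae_of_all _ fun ξ => by
      rw [Real.norm_eq_abs, abs_of_nonneg (powSpec_nonneg e ξ)]
      exact powSpec_le he ξ)
  exact hg.congr (ae_of_all _ fun ξ => by ring)

theorem measurable_gaussDens (σ : ℝ) : Measurable (gaussDens σ) := by
  unfold gaussDens
  fun_prop

/-- A lower bound for the constant in the spectral estimate. -/
noncomputable def spectralConst : ℝ := exp (-π ^ 2) * ((√π)⁻¹ * (√2)⁻¹ * π ^ 3 / 2)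

theorem spectralConst_pos : 0 < spectralConst := by unfold spectralConst; positivity

/-- Only r² < b ≤ 2r² is kept, an interval of length r² where π²r²/b ≤ π² and the first term of the
density is at least of order r⁻¹exp(-2σ²r²). A lower bound of the right order is all that is needed
of the transform of the kernel. -/
theorem lintegral_gaussDens_ge (σ : ℝ) {r : ℝ} (hr : 0 < r) :
    ENNReal.ofReal (spectralConst * r * exp (-(2 * σ ^ 2 * r ^ 2)))
      ≤ ∫⁻ b in Set.Ioi 0,
        ENNReal.ofReal (gaussDens σ b * (π / b) * exp (-(π ^ 2 / b * r ^ 2)) * (π ^ 2 * r ^ 2)) := by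
  have hv : ∀ b ∈ Set.Ioc (r ^ 2) (2 * r ^ 2), spectralConst * r⁻¹ * exp (-(2 * σ ^ 2 * r ^ 2))
      ≤ gaussDens σ b * (π / b) * exp (-(π ^ 2 / b * r ^ 2)) * (π ^ 2 * r ^ 2) := by
    intro b hb
    have hb0 : 0 < b := lt_trans (by positivity) hb.1
    have h1 : (√π)⁻¹ * ((√2)⁻¹ * r⁻¹ * exp (-(2 * σ ^ 2 * r ^ 2))) ≤ gaussDens σ b := by
      have e1 : (√2)⁻¹ * r⁻¹ ≤ b ^ ((1 / 2 : ℝ) - 1) := by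
        rw [show (1 / 2 : ℝ) - 1 = -(1 / 2) by norm_num, rpow_neg hb0.le, ← sqrt_eq_rpow, ← mul_inv]
        refine inv_anti₀ (sqrt_pos.2 hb0) ?_
        rw [sqrt_le_left (by positivity), mul_pow, sq_sqrt (by norm_num)]
        exact hb.2
      have e2 : exp (-(2 * σ ^ 2 * r ^ 2)) ≤ exp (-(σ ^ 2 * b)) := by
        rw [exp_le_exp, neg_le_neg_iff]
        nlinarith [mul_le_mul_of_nonneg_left hb.2 (sq_nonneg σ)]
      have e3 : 0 ≤ 2 * σ ^ 2 * (√π)⁻¹ * (b ^ ((3 / 2 : ℝ) - 1) * exp (-(σ ^ 2 * b))) := by positivity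
      have e4 : (√2)⁻¹ * r⁻¹ * exp (-(2 * σ ^ 2 * r ^ 2))
          ≤ b ^ ((1 / 2 : ℝ) - 1) * exp (-(σ ^ 2 * b)) := by gcongr
      have e5 := mul_le_mul_of_nonneg_left e4 (by positivity : 0 ≤ (√π)⁻¹)
      rw [gaussDens]
      linarith
    have h2 : π / (2 * r ^ 2) ≤ π / b := div_le_div_of_nonneg_left pi_pos.le hb0 hb.2
    have h3 : exp (-π ^ 2) ≤ exp (-(π ^ 2 / b * r ^ 2)) := by
      rw [exp_le_exp, neg_le_neg_iff, div_mul_eq_mul_div, div_le_iff₀ hb0]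
      exact mul_le_mul_of_nonneg_left hb.1.le (by positivity)
    have h4 := gaussDens_nonneg σ hb0
    calc spectralConst * r⁻¹ * exp (-(2 * σ ^ 2 * r ^ 2))
        = (√π)⁻¹ * ((√2)⁻¹ * r⁻¹ * exp (-(2 * σ ^ 2 * r ^ 2))) * (π / (2 * r ^ 2)) * exp (-π ^ 2)
          * (π ^ 2 * r ^ 2) := by
          unfold spectralConst
          field_simp
      _ ≤ _ := by gcongr
  calc ENNReal.ofReal (spectralConst * r * exp (-(2 * σ ^ 2 * r ^ 2)))
      = ENNReal.ofReal (spectralConst * r⁻¹ * exp (-(2 * σ ^ 2 * r ^ 2)))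
          * volume (Set.Ioc (r ^ 2) (2 * r ^ 2)) := by
        rw [Real.volume_Ioc, ← ENNReal.ofReal_mul (by have := spectralConst_pos; positivity)]
        congr 1
        field_simp
        ring
    _ = ∫⁻ _ in Set.Ioc (r ^ 2) (2 * r ^ 2),
          ENNReal.ofReal (spectralConst * r⁻¹ * exp (-(2 * σ ^ 2 * r ^ 2))) := by
        rw [setLIntegral_const]
    _ ≤ ∫⁻ b in Set.Ioc (r ^ 2) (2 * r ^ 2),
        ENNReal.ofReal (gaussDens σ b * (π / b) * exp (-(π ^ 2 / b * r ^ 2)) * (π ^ 2 * r ^ 2)) :=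
        setLIntegral_mono' measurableSet_Ioc fun b hb => ENNReal.ofReal_le_ofReal (hv b hb)
    _ ≤ _ := lintegral_mono_set fun b hb => lt_trans (by positivity) hb.1

theorem ofReal_add_coord (B P : ℝ) (hB : 0 ≤ B) (hP : 0 ≤ P) (ξ : Plane) :
    ENNReal.ofReal (B * (π ^ 2 * ‖ξ‖ ^ 2)) * ENNReal.ofReal P
      = ENNReal.ofReal (B * (π ^ 2 * ξ 0 ^ 2 * P)) + ENNReal.ofReal (B * (π ^ 2 * ξ 1 ^ 2 * P)) := by
  rw [← ENNReal.ofReal_mul (by positivity), ← ENNReal.ofReal_add (by positivity) (by positivity),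
    norm_sq_eq]
  congr 1
  ring

theorem lintegral_add_swap (μ : Measure ℝ) [SFinite μ] {F F' : ℝ → Plane → ℝ≥0∞}
    (hF : Measurable (Function.uncurry F)) (hF' : Measurable (Function.uncurry F')) :
    (∫⁻ b, (∫⁻ ξ, F b ξ) ∂μ) + (∫⁻ b, (∫⁻ ξ, F' b ξ) ∂μ) = ∫⁻ ξ, ∫⁻ b, (F b ξ + F' b ξ) ∂μ := by
  rw [lintegral_lintegral_swap hF.aemeasurable, lintegral_lintegral_swap hF'.aemeasurable]
  refine (lintegral_add_left hF.lintegral_prod_left' _).symm.trans ?_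
  refine lintegral_congr fun ξ => ?_
  exact (lintegral_add_left (hF.comp measurable_prodMk_right) _).symm

/-- The integrand of the spectral representation. -/
noncomputable def spectralDens (σ : ℝ) (P : Plane → ℝ) (l : Fin 2) (b : ℝ) (ξ : Plane) : ℝ≥0∞ :=
  ENNReal.ofReal (gaussDens σ b * (π / b) * exp (-(π ^ 2 / b * ‖ξ‖ ^ 2)) * (π ^ 2 * ξ l ^ 2 * P ξ))

theorem measurable_spectralDens (σ : ℝ) {P : Plane → ℝ} (hP : Continuous P) (l : Fin 2) :
    Measurable (Function.uncurry (spectralDens σ P l)) := by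
  have h1 : Measurable fun z : ℝ × Plane => gaussDens σ z.1 :=
    (measurable_gaussDens σ).comp measurable_fst
  have h2 : Measurable fun z : ℝ × Plane => P z.2 := hP.measurable.comp measurable_snd
  have h3 : Measurable fun z : ℝ × Plane => z.2 l :=
    ((contDiff_coord l).continuous.measurable).comp measurable_snd
  have h4 : Measurable fun z : ℝ × Plane => ‖z.2‖ := measurable_snd.norm
  refine Measurable.ennreal_ofReal (((h1.mul (measurable_fst.const_div π)).mul
    (measurable_exp.comp (Measurable.neg ((measurable_fst.const_div (π ^ 2)).mul (h4.pow_const 2))))).mul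
    (((h3.pow_const 2).const_mul (π ^ 2)).mul h2))

theorem ofReal_sum_dbl_ge {σ : ℝ} (hσ : 0 < σ) {f : Plane → ℂ} {g : Fin 2 → Plane → ℂ}
    (h : H1Pair f g) :
    ∫⁻ ξ, ENNReal.ofReal (spectralConst * ‖ξ‖ * exp (-(2 * σ ^ 2 * ‖ξ‖ ^ 2)) * powSpec (rho f) ξ)
      ≤ ENNReal.ofReal (∑ l, dbl (traceKer σ) (qd f (g l)) (qd f (g l))) := by
  have hq := fun l => ofReal_dbl_traceKer hσ (integrable_qd h.memLp (h.memLp_grad l))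
  have hP := continuous_powSpec (integrable_rho h.memLp)
  have hq' : ∀ l, ENNReal.ofReal (dbl (traceKer σ) (qd f (g l)) (qd f (g l)))
      = ∫⁻ b in Set.Ioi 0, ∫⁻ ξ, spectralDens σ (powSpec (rho f)) l b ξ := fun l => by
    rw [(hq l).2]
    simp only [powSpec_qd h, spectralDens]
  rw [Fin.sum_univ_two, ENNReal.ofReal_add (hq 0).1 (hq 1).1, hq' 0, hq' 1,
    lintegral_add_swap _ (measurable_spectralDens σ hP 0) (measurable_spectralDens σ hP 1)]
  refine lintegral_mono_ae ?_
  filter_upwards [ae_ne_zero] with ξ hξ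
  have hr : 0 < ‖ξ‖ := norm_pos_iff.2 hξ
  have hp := powSpec_nonneg (rho f) ξ
  have hsc := spectralConst_pos
  calc ENNReal.ofReal (spectralConst * ‖ξ‖ * exp (-(2 * σ ^ 2 * ‖ξ‖ ^ 2)) * powSpec (rho f) ξ)
      = ENNReal.ofReal (spectralConst * ‖ξ‖ * exp (-(2 * σ ^ 2 * ‖ξ‖ ^ 2)))
        * ENNReal.ofReal (powSpec (rho f) ξ) := ENNReal.ofReal_mul (by positivity)
    _ ≤ (∫⁻ b in Set.Ioi 0, ENNReal.ofReal (gaussDens σ b * (π / b) * exp (-(π ^ 2 / b * ‖ξ‖ ^ 2))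
        * (π ^ 2 * ‖ξ‖ ^ 2))) * ENNReal.ofReal (powSpec (rho f) ξ) := by
        gcongr
        exact lintegral_gaussDens_ge σ hr
    _ = ∫⁻ b in Set.Ioi 0, ENNReal.ofReal (gaussDens σ b * (π / b) * exp (-(π ^ 2 / b * ‖ξ‖ ^ 2))
        * (π ^ 2 * ‖ξ‖ ^ 2)) * ENNReal.ofReal (powSpec (rho f) ξ) := by
        rw [lintegral_mul_const']
        exact ENNReal.ofReal_ne_top
    _ = _ := by
        refine setLIntegral_congr_fun measurableSet_Ioi fun b hb => ?_
        have hb0 : 0 < b := hb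
        have := gaussDens_nonneg σ hb0
        exact ofReal_add_coord _ _ (by positivity) hp ξ

end FourierLowerBound

/-! ### Plancherel's theorem for functions in L¹ ∩ L². -/

section Plancherel

open scoped SchwartzMap

theorem ae_eq_of_test {f g : Plane → ℂ} (hf : LocallyIntegrable f) (hg : LocallyIntegrable g)
    (h : ∀ φ : 𝓢(Plane, ℂ), ∫ x, φ x • f x = ∫ x, φ x • g x) : f =ᵐ[volume] g := by
  refine ae_eq_of_integral_contDiff_smul_eq hf hg fun φ hφ hc => ?_
  have h₁ : HasCompactSupport (Complex.ofRealCLM ∘ φ) := hc.comp_left rfl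
  have h₂ : ContDiff ℝ ∞ (Complex.ofRealCLM ∘ φ) := by fun_prop
  simpa using! h (h₁.toSchwartzMap h₂)

theorem integral_schwartz_fourier {f : Plane → ℂ} (hf : Integrable f) (φ : 𝓢(Plane, ℂ)) :
    ∫ x, (𝓕 φ) x • f x = ∫ x, φ x • 𝓕 f x := by
  have := VectorFourier.integral_fourierIntegral_smul_eq_flip (L := innerₗ Plane) (f := φ)
    (g := f) (μ := volume) (ν := volume) Real.continuous_fourierChar continuous_inner φ.integrable hf
  rw [flip_innerₗ] at this
  exact this

theorem integral_schwartz_fourierInv {f : Plane → ℂ} (hf : Integrable f) (φ : 𝓢(Plane, ℂ)) :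
    ∫ x, (𝓕⁻ φ) x • f x = ∫ x, φ x • 𝓕⁻ f x := by
  have := VectorFourier.integral_fourierIntegral_smul_eq_flip (L := -innerₗ Plane) (f := φ)
    (g := f) (μ := volume) (ν := volume) Real.continuous_fourierChar (by
      have := (continuous_inner (𝕜 := ℝ) (E := Plane)).fun_neg
      exact this) φ.integrable hf
  have e : (-innerₗ Plane).flip = -innerₗ Plane := by
    ext x y; simp [real_inner_comm]
  rw [e] at this
  simp only [SchwartzMap.fourierInv_coe]
  exact this

theorem locallyIntegrable_fourier {f : Plane → ℂ} (hf : Integrable f) :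
    LocallyIntegrable (𝓕 f) :=
  (VectorFourier.fourierIntegral_continuous Real.continuous_fourierChar continuous_inner
    hf).locallyIntegrable

/-- The L² transform and the integral transform agree as tempered distributions: both move onto the
Schwartz function under the pairing. -/
theorem fourier_toLp_ae {f : Plane → ℂ} (hf : Integrable f) (h2 : MemLp f 2) :
    (𝓕 (h2.toLp f) : L2) =ᵐ[volume] 𝓕 f := by
  refine ae_eq_of_test ((Lp.memLp _).locallyIntegrable (by norm_num)) (locallyIntegrable_fourier hf)
    fun φ => ?_
  have h := congrArg (fun T => T φ) (Lp.fourier_toTemperedDistribution_eq (h2.toLp f))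
  simp only [TemperedDistribution.fourier_apply, Lp.toTemperedDistribution_apply] at h
  rw [← h, ← integral_schwartz_fourier hf]
  refine integral_congr_ae ?_
  filter_upwards [h2.coeFn_toLp] with x hx
  rw [hx]

theorem fourierInv_toLp_ae {f : Plane → ℂ} (hf : Integrable f) (h2 : MemLp f 2) :
    (𝓕⁻ (h2.toLp f) : L2) =ᵐ[volume] 𝓕⁻ f := by
  have hl : LocallyIntegrable (𝓕⁻ f) := by
    rw [Real.fourierInv_eq_fourier_comp_neg]
    exact locallyIntegrable_fourier hf.comp_neg
  refine ae_eq_of_test ((Lp.memLp _).locallyIntegrable (by norm_num)) hl fun φ => ?_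
  have h := congrArg (fun T => T φ) (Lp.fourierInv_toTemperedDistribution_eq (h2.toLp f))
  simp only [TemperedDistribution.fourierInv_apply, Lp.toTemperedDistribution_apply] at h
  rw [← h, ← integral_schwartz_fourierInv hf]
  refine integral_congr_ae ?_
  filter_upwards [h2.coeFn_toLp] with x hx
  rw [hx]

theorem memLp_fourier {f : Plane → ℂ} (hf : Integrable f) (h2 : MemLp f 2) : MemLp (𝓕 f) 2 :=
  (Lp.memLp (𝓕 (h2.toLp f) : L2)).ae_eq (fourier_toLp_ae hf h2)

/-- The `L²` norm of what is left of `f` after removing the part with frequencies in `s`. -/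
theorem eLpNorm_sub_fourierInv_indicator {f : Plane → ℂ} (hf : Integrable f) (h2 : MemLp f 2)
    {s : Set Plane} (hs : MeasurableSet s) (hi : IntegrableOn (𝓕 f) s) :
    AEStronglyMeasurable (𝓕⁻ (s.indicator (𝓕 f))) ∧
    eLpNorm (fun x => f x - 𝓕⁻ (s.indicator (𝓕 f)) x) 2 volume = eLpNorm (sᶜ.indicator (𝓕 f)) 2 := by
  have hg2 : MemLp (s.indicator (𝓕 f)) 2 := (memLp_fourier hf h2).indicator hs
  have hg : Integrable (s.indicator (𝓕 f)) := (integrable_indicator_iff hs).2 hi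
  have hI := fourierInv_toLp_ae hg hg2
  have h1 : ‖(h2.toLp f - 𝓕⁻ (hg2.toLp _) : L2)‖ₑ = ‖(𝓕 (h2.toLp f) - hg2.toLp _ : L2)‖ₑ := by
    have e : (𝓕 (h2.toLp f - 𝓕⁻ (hg2.toLp _)) : L2) = 𝓕 (h2.toLp f) - hg2.toLp _ := by
      rw [sub_eq_add_neg, ← neg_one_smul ℂ (𝓕⁻ (hg2.toLp _) : L2), FourierTransform.fourier_add,
        FourierTransform.fourier_smul, FourierTransform.fourier_fourierInv_eq, neg_one_smul,
        ← sub_eq_add_neg]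
    have := Lp.norm_fourier_eq (h2.toLp f - 𝓕⁻ (hg2.toLp _) : L2)
    rw [e] at this
    rw [← ofReal_norm, ← ofReal_norm, this]
  rw [Lp.enorm_def, Lp.enorm_def] at h1
  refine ⟨(Lp.memLp _).aestronglyMeasurable.congr hI, ?_⟩
  have e1 : (fun x => f x - 𝓕⁻ (s.indicator (𝓕 f)) x)
      =ᵐ[volume] (h2.toLp f - 𝓕⁻ (hg2.toLp _) : L2) := by
    filter_upwards [Lp.coeFn_sub (h2.toLp f) (𝓕⁻ (hg2.toLp _) : L2), h2.coeFn_toLp, hI] with x a b c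
    rw [a, Pi.sub_apply, b, c]
  have e2 : sᶜ.indicator (𝓕 f) =ᵐ[volume] (𝓕 (h2.toLp f) - hg2.toLp _ : L2) := by
    filter_upwards [Lp.coeFn_sub (𝓕 (h2.toLp f) : L2) (hg2.toLp _), fourier_toLp_ae hf h2,
      hg2.coeFn_toLp] with x a b c
    rw [a, Pi.sub_apply, b, c, Set.indicator_compl, Pi.sub_apply]
  rw [eLpNorm_congr_ae e1, eLpNorm_congr_ae e2, h1]

end Plancherel

/-! ### The embedding of Ḣ^(1/2) into L⁴, by splitting frequencies at each level. -/

section Sobolev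

theorem lintegral_ball_inv_norm {s : ℝ} (hs : 0 < s) :
    ∫⁻ ξ in Metric.ball (0 : Plane) s, ENNReal.ofReal ‖ξ‖⁻¹ = ENNReal.ofReal (2 * Real.pi * s) := by
  have h0 : ∀ y ∈ Set.Ioi (0 : ℝ), y ^ (Module.finrank ℝ Plane - 1)
      • (Set.Iio s).indicator (fun y : ℝ => y⁻¹) y = (Set.Iio s).indicator (fun _ => 1) y := by
    intro y hy
    have : y ≠ 0 := (Set.mem_Ioi.1 hy).ne'
    by_cases h : y ∈ Set.Iio s
    · simp [h, this]
    · simp [h]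
  have hI : IntegrableOn (fun y : ℝ => y ^ (Module.finrank ℝ Plane - 1)
      • (Set.Iio s).indicator (fun y : ℝ => y⁻¹) y) (Set.Ioi 0) := by
    refine IntegrableOn.congr_fun ?_ (fun y hy => (h0 y hy).symm) measurableSet_Ioi
    rw [integrableOn_indicator_iff measurableSet_Iio]
    rw [integrableOn_const_iff, Set.inter_comm, Set.Ioi_inter_Iio, Real.volume_Ioo]
    exact Or.inr ENNReal.ofReal_lt_top
  have hintg := (integrable_fun_norm_addHaar (volume : Measure Plane)
    (f := (Set.Iio s).indicator fun y : ℝ => y⁻¹)).2 hI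
  have hval := integral_fun_norm_addHaar (volume : Measure Plane)
    ((Set.Iio s).indicator fun y : ℝ => y⁻¹)
  rw [setIntegral_congr_fun measurableSet_Ioi h0, setIntegral_indicator measurableSet_Iio] at hval
  have hb : volume.real (Metric.ball (0 : Plane) 1) = Real.pi := by
    rw [Measure.real, EuclideanSpace.volume_ball_fin_two]
    simp [Real.pi_pos.le]
  rw [hb] at hval
  have he : ∀ ξ : Plane, ENNReal.ofReal ((Set.Iio s).indicator (fun y : ℝ => y⁻¹) ‖ξ‖)
      = (Metric.ball (0 : Plane) s).indicator (fun ξ => ENNReal.ofReal ‖ξ‖⁻¹) ξ := fun ξ => by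
    by_cases h : ‖ξ‖ < s <;> simp [Set.indicator, h]
  rw [← lintegral_indicator Metric.isOpen_ball.measurableSet]
  simp only [← he]
  rw [← ofReal_integral_eq_lintegral_ofReal hintg (ae_of_all _ fun ξ => ?_), hval]
  · congr 1
    simp [Set.Ioi_inter_Iio, hs.le]
    ring
  · by_cases h : ‖ξ‖ < s <;> simp [Set.indicator, h]

variable {e : Plane → ℝ}

theorem enorm_fourier_sq (he : Integrable e) (ξ : Plane) :
    ‖𝓕 (fun x => (e x : ℂ)) ξ‖ₑ ^ 2 = ENNReal.ofReal (powSpec e ξ) := by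
  rw [← norm_fourier_sq he, ENNReal.ofReal_pow (norm_nonneg _), ofReal_norm]

theorem enorm_fourierInv_le (g : Plane → ℂ) (x : Plane) : ‖𝓕⁻ g x‖ₑ ≤ ∫⁻ ξ, ‖g ξ‖ₑ := by
  rw [Real.fourierInv_eq]
  refine (enorm_integral_le_lintegral_enorm _).trans_eq (lintegral_congr fun ξ => ?_)
  rw [← ofReal_norm, ← ofReal_norm, Circle.norm_smul]

/-- The sup norm is at most the L¹ norm of the transform over the ball, and Cauchy–Schwarz with the
weights |ξ|^(1/2) and |ξ|^(-1/2) gives the bound, the integral of 1/|ξ| over the ball being 2πs. -/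
theorem enorm_low_frequency_le (he : Integrable e) {B s : ℝ} (hB : 0 ≤ B) (hs : 0 < s)
    (h : ∫⁻ ξ, ENNReal.ofReal (‖ξ‖ * powSpec e ξ) ≤ ENNReal.ofReal B) (x : Plane) :
    ‖𝓕⁻ ((Metric.ball 0 s).indicator (𝓕 fun x => (e x : ℂ))) x‖ₑ
      ≤ ENNReal.ofReal √(B * (2 * Real.pi * s)) := by
  have hP := (continuous_powSpec he).measurable
  have hm : MeasurableSet (Metric.ball (0 : Plane) s) := Metric.isOpen_ball.measurableSet
  have h1 : ∫⁻ ξ, ‖(Metric.ball 0 s).indicator (𝓕 fun x => (e x : ℂ)) ξ‖ₑ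
      = ∫⁻ ξ in Metric.ball 0 s, ENNReal.ofReal √(‖ξ‖ * powSpec e ξ) * ENNReal.ofReal √‖ξ‖⁻¹ := by
    rw [← lintegral_indicator hm]
    refine lintegral_congr_ae ?_
    filter_upwards [ae_ne_zero] with ξ hξ
    have hξ0 : 0 < ‖ξ‖ := norm_pos_iff.2 hξ
    by_cases hb : ξ ∈ Metric.ball (0 : Plane) s
    · rw [Set.indicator_of_mem hb, Set.indicator_of_mem hb, ← ENNReal.ofReal_mul (Real.sqrt_nonneg _),
        ← Real.sqrt_mul (mul_nonneg hξ0.le (powSpec_nonneg e ξ)), mul_comm, ← mul_assoc,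
        inv_mul_cancel₀ hξ0.ne', one_mul, ← norm_fourier_sq he, Real.sqrt_sq (norm_nonneg _),
        ofReal_norm]
    · rw [Set.indicator_of_notMem hb, Set.indicator_of_notMem hb, enorm_zero]
  have hsq : ∀ {r : ℝ}, 0 ≤ r → ENNReal.ofReal √r ^ (2 : ℝ) = ENNReal.ofReal r := fun {r} hr => by
    rw [ENNReal.ofReal_rpow_of_nonneg (Real.sqrt_nonneg r) (by norm_num), Real.rpow_two,
      Real.sq_sqrt hr]
  refine (enorm_fourierInv_le _ x).trans ?_
  rw [h1]
  refine (ENNReal.lintegral_mul_le_Lp_mul_Lq _ (p := 2) (q := 2) (by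
    constructor <;> norm_num) (by fun_prop) (by fun_prop)).trans ?_
  simp only [fun ξ : Plane => hsq (mul_nonneg (norm_nonneg ξ) (powSpec_nonneg e ξ)),
    fun ξ : Plane => hsq (inv_nonneg.2 (norm_nonneg ξ))]
  rw [lintegral_ball_inv_norm hs, ← ENNReal.mul_rpow_of_nonneg _ _ (by norm_num), Real.sqrt_eq_rpow,
    ← ENNReal.ofReal_rpow_of_nonneg (by positivity) (by norm_num), ENNReal.ofReal_mul hB]
  gcongr
  exact (setLIntegral_le_lintegral _ _).trans h

/-- If the low frequencies contribute at most t/2, then on {e > t} the high frequencies contribute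
at least t/2; Chebyshev and Plancherel apply to the latter. -/
theorem volume_superlevel_le (he : Integrable e) (he2 : MemLp e 2) {B t : ℝ} (hB : 0 < B) (ht : 0 < t)
    (h : ∫⁻ ξ, ENNReal.ofReal (‖ξ‖ * powSpec e ξ) ≤ ENNReal.ofReal B) :
    ENNReal.ofReal ((t / 2) ^ 2) * volume {x | t < e x}
      ≤ ∫⁻ ξ, {ξ : Plane | t ^ 2 ≤ 8 * Real.pi * B * ‖ξ‖}.indicator
          (fun ξ => ENNReal.ofReal (powSpec e ξ)) ξ := by
  have hπ := Real.pi_pos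
  -- The threshold makes the low-frequency bound √(2πBs) equal to t/2.
  set s := t ^ 2 / (8 * Real.pi * B) with hsd
  have hs : 0 < s := by positivity
  set f : Plane → ℂ := fun x => (e x : ℂ) with hf
  have hf1 : Integrable f := he.ofReal
  have hm : MeasurableSet (Metric.ball (0 : Plane) s) := Metric.isOpen_ball.measurableSet
  have hc : Continuous (𝓕 f) := VectorFourier.fourierIntegral_continuous Real.continuous_fourierChar
    continuous_inner hf1
  have hi : IntegrableOn (𝓕 f) (Metric.ball 0 s) :=
    (hc.continuousOn.integrableOn_compact (isCompact_closedBall 0 s)).mono_set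
      Metric.ball_subset_closedBall
  obtain ⟨hm2, hn⟩ := eLpNorm_sub_fourierInv_indicator hf1 he2.ofReal hm hi
  set l := 𝓕⁻ ((Metric.ball 0 s).indicator (𝓕 f)) with hl
  have hlow : ∀ x, ‖l x‖ ≤ t / 2 := fun x => by
    have h1 := enorm_low_frequency_le he hB.le hs h x
    have e1 : B * (2 * Real.pi * s) = (t / 2) ^ 2 := by
      rw [hsd]; field_simp; ring
    rw [e1, Real.sqrt_sq (by positivity), ← ofReal_norm] at h1
    exact (ENNReal.ofReal_le_ofReal_iff (by positivity)).1 h1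
  have hsub : {x | t < e x} ⊆ {x | ENNReal.ofReal ((t / 2) ^ 2) ≤ ‖f x - l x‖ₑ ^ 2} := by
    intro x hx
    have hx' : t < e x := hx
    have h1 : ‖f x‖ = e x := by
      rw [hf, Complex.norm_real, Real.norm_eq_abs, abs_of_pos (ht.trans hx')]
    have h2 : t / 2 ≤ ‖f x - l x‖ := by
      have := norm_sub_norm_le (f x) (l x)
      have := hlow x
      linarith
    change ENNReal.ofReal ((t / 2) ^ 2) ≤ ‖f x - l x‖ₑ ^ 2
    rw [← ofReal_norm, ← ENNReal.ofReal_pow (norm_nonneg _)]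
    exact ENNReal.ofReal_le_ofReal (by gcongr)
  have hfm : AEMeasurable (fun x => ‖f x - l x‖ₑ ^ 2) :=
    ((hf1.aestronglyMeasurable.sub hm2).enorm).pow_const 2
  have hmk := mul_meas_ge_le_lintegral₀ hfm (ENNReal.ofReal ((t / 2) ^ 2))
  calc ENNReal.ofReal ((t / 2) ^ 2) * volume {x | t < e x}
      ≤ ENNReal.ofReal ((t / 2) ^ 2)
        * volume {x | ENNReal.ofReal ((t / 2) ^ 2) ≤ ‖f x - l x‖ₑ ^ 2} := by gcongr
    _ ≤ ∫⁻ x, ‖f x - l x‖ₑ ^ 2 := hmk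
    _ = ∫⁻ ξ, ‖(Metric.ball 0 s)ᶜ.indicator (𝓕 f) ξ‖ₑ ^ 2 := by
        rw [← eLpNorm_two_sq, ← eLpNorm_two_sq, hn]
    _ = _ := by
        refine lintegral_congr fun ξ => ?_
        have hiff : ξ ∈ (Metric.ball (0 : Plane) s)ᶜ ↔ ξ ∈ {ξ : Plane | t ^ 2 ≤ 8 * Real.pi * B * ‖ξ‖} := by
          change _ ↔ t ^ 2 ≤ 8 * Real.pi * B * ‖ξ‖
          rw [Set.mem_compl_iff, mem_ball_zero_iff, not_lt, hsd, div_le_iff₀ (by positivity), mul_comm]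
        by_cases hb : ξ ∈ (Metric.ball (0 : Plane) s)ᶜ
        · rw [Set.indicator_of_mem hb, Set.indicator_of_mem (hiff.1 hb), hf, enorm_fourier_sq he]
        · rw [Set.indicator_of_notMem hb, Set.indicator_of_notMem fun h => hb (hiff.2 h), enorm_zero]
          norm_num

/-- The Sobolev embedding of `Ḣ^{1/2}` into `L⁴` of the plane. -/
theorem lintegral_pow_four_le (he : Integrable e) (he2 : MemLp e 2) (hpos : ∀ x, 0 ≤ e x) {B : ℝ}
    (hB : 0 < B) (h : ∫⁻ ξ, ENNReal.ofReal (‖ξ‖ * powSpec e ξ) ≤ ENNReal.ofReal B) :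
    ∫⁻ x, ENNReal.ofReal (e x ^ 4) ≤ ENNReal.ofReal (128 * Real.pi * B ^ 2) := by
  have hπ := Real.pi_pos
  have hP := (continuous_powSpec he).measurable
  let S : Set (ℝ × Plane) := {z | z.1 ^ 2 ≤ 8 * Real.pi * B * ‖z.2‖}
  have hS : MeasurableSet S := by
    refine measurableSet_le ?_ ?_ <;> fun_prop
  have hlc := lintegral_rpow_eq_lintegral_meas_lt_mul volume (ae_of_all _ hpos)
    he.aestronglyMeasurable.aemeasurable (p := 4) (by norm_num)
  have e4 : ∀ x, e x ^ (4 : ℝ) = e x ^ 4 := fun x => by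
    rw [show (4 : ℝ) = (4 : ℕ) by norm_num, Real.rpow_natCast]
  simp only [e4] at hlc
  rw [hlc]
  have hF : Measurable fun z : ℝ × Plane =>
      S.indicator (fun z => ENNReal.ofReal (4 * z.1) * ENNReal.ofReal (powSpec e z.2)) z :=
    Measurable.indicator (by fun_prop) hS
  -- The layer-cake weight t³ is written as 4t(t/2)², whose last factor is the one in the superlevel
  -- estimate.
  have h1 : ∫⁻ t in Set.Ioi (0 : ℝ), volume {x | t < e x} * ENNReal.ofReal (t ^ ((4 : ℝ) - 1))
      ≤ ∫⁻ t in Set.Ioi (0 : ℝ), ∫⁻ ξ,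
        S.indicator (fun z => ENNReal.ofReal (4 * z.1) * ENNReal.ofReal (powSpec e z.2)) (t, ξ) := by
    refine setLIntegral_mono' measurableSet_Ioi fun t ht => ?_
    have ht0 : 0 < t := ht
    have e1 : t ^ ((4 : ℝ) - 1) = 4 * t * (t / 2) ^ 2 := by
      rw [show (4 : ℝ) - 1 = (3 : ℕ) by norm_num, Real.rpow_natCast]; ring
    rw [e1, ENNReal.ofReal_mul (by positivity), mul_comm, mul_assoc]
    refine (mul_le_mul_right (volume_superlevel_le he he2 hB ht0 h) _).trans_eq ?_
    rw [← lintegral_const_mul' _ _ ENNReal.ofReal_ne_top]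
    refine lintegral_congr fun ξ => ?_
    by_cases hb : t ^ 2 ≤ 8 * Real.pi * B * ‖ξ‖
    · rw [Set.indicator_of_mem (show ξ ∈ {ξ : Plane | t ^ 2 ≤ 8 * Real.pi * B * ‖ξ‖} from hb),
        Set.indicator_of_mem (show (t, ξ) ∈ S from hb)]
    · rw [Set.indicator_of_notMem (show ξ ∉ {ξ : Plane | t ^ 2 ≤ 8 * Real.pi * B * ‖ξ‖} from hb),
        Set.indicator_of_notMem (show (t, ξ) ∉ S from hb), mul_zero]
  -- For fixed ξ the levels run up to c = √(8πB|ξ|). Bounding t by c gives 4c² = 32πB|ξ|, which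
  -- restores the weight |ξ|.
  have h2 : ∀ ξ : Plane, ∫⁻ t in Set.Ioi (0 : ℝ),
      S.indicator (fun z => ENNReal.ofReal (4 * z.1) * ENNReal.ofReal (powSpec e z.2)) (t, ξ)
      ≤ ENNReal.ofReal (32 * Real.pi * B) * ENNReal.ofReal (‖ξ‖ * powSpec e ξ) := by
    intro ξ
    set c := √(8 * Real.pi * B * ‖ξ‖) with hc
    have hc2 : c ^ 2 = 8 * Real.pi * B * ‖ξ‖ := Real.sq_sqrt (by positivity)
    have hc0 : 0 ≤ c := Real.sqrt_nonneg _
    calc ∫⁻ t in Set.Ioi (0 : ℝ),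
          S.indicator (fun z => ENNReal.ofReal (4 * z.1) * ENNReal.ofReal (powSpec e z.2)) (t, ξ)
        ≤ ∫⁻ t in Set.Ioi (0 : ℝ), (Set.Iic c).indicator
          (fun _ => ENNReal.ofReal (4 * c) * ENNReal.ofReal (powSpec e ξ)) t := by
          refine setLIntegral_mono' measurableSet_Ioi fun t ht => ?_
          by_cases hb : (t, ξ) ∈ S
          · have htc : t ≤ c := Real.le_sqrt_of_sq_le hb
            rw [Set.indicator_of_mem hb, Set.indicator_of_mem (show t ∈ Set.Iic c from htc)]
            gcongr
          · rw [Set.indicator_of_notMem hb]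
            exact zero_le
      _ = ENNReal.ofReal (4 * c) * ENNReal.ofReal (powSpec e ξ) * ENNReal.ofReal c := by
          rw [setLIntegral_indicator measurableSet_Iic, setLIntegral_const, Set.Iic_inter_Ioi,
            Real.volume_Ioc, sub_zero]
      _ = _ := by
          rw [← ENNReal.ofReal_mul (by positivity), ← ENNReal.ofReal_mul
            (mul_nonneg (by positivity) (powSpec_nonneg e ξ)), ← ENNReal.ofReal_mul (by positivity)]
          congr 1
          linear_combination (4 * powSpec e ξ) * hc2
  calc ENNReal.ofReal 4 * ∫⁻ t in Set.Ioi (0 : ℝ), volume {x | t < e x}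
        * ENNReal.ofReal (t ^ ((4 : ℝ) - 1))
      ≤ ENNReal.ofReal 4 * ∫⁻ ξ, ∫⁻ t in Set.Ioi (0 : ℝ),
        S.indicator (fun z => ENNReal.ofReal (4 * z.1) * ENNReal.ofReal (powSpec e z.2)) (t, ξ) := by
        refine mul_le_mul_right (h1.trans_eq ?_) _
        exact lintegral_lintegral_swap hF.aemeasurable
    _ ≤ ENNReal.ofReal 4 * ∫⁻ ξ, ENNReal.ofReal (32 * Real.pi * B)
        * ENNReal.ofReal (‖ξ‖ * powSpec e ξ) := mul_le_mul_right (lintegral_mono h2) _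
    _ ≤ ENNReal.ofReal 4 * (ENNReal.ofReal (32 * Real.pi * B) * ENNReal.ofReal B) := by
        rw [lintegral_const_mul' _ _ ENNReal.ofReal_ne_top]
        gcongr
    _ = _ := by
        rw [← ENNReal.ofReal_mul (by positivity), ← ENNReal.ofReal_mul (by positivity)]
        congr 1
        ring

end Sobolev

/-! ### Space-time estimates and the removal of the remaining parameters. -/

section SpaceTime

/-- The square of the norm of `|f|²` in `Ḣ^{1/2}`, up to a constant. -/
noncomputable def halfEnergy (f : Plane → ℂ) : ℝ≥0∞ :=
  ∫⁻ ξ, ENNReal.ofReal (‖ξ‖ * powSpec (rho f) ξ)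

theorem halfEnergy_congr {f f' : Plane → ℂ} (h : f =ᵐ[volume] f') : halfEnergy f = halfEnergy f' := by
  have e : ∀ φ : Plane → ℝ, ∫ x, φ x * rho f x = ∫ x, φ x * rho f' x := fun φ =>
    integral_congr_ae (by filter_upwards [h] with x hx; rw [rho, rho, hx])
  simp only [halfEnergy, powSpec, cosT, sinT, e]

theorem absGradPowL2Norm_half_sq {f : Plane → ℂ} (hf : MemLp f 2) :
    absGradPowL2Norm (1 / 2) (fun x => ((‖f x‖ ^ 2 : ℝ) : ℂ)) ^ 2
      = ENNReal.ofReal (2 * Real.pi) * halfEnergy f := by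
  have hπ := Real.pi_pos
  rw [absGradPowL2Norm, eLpNorm_two_sq, halfEnergy, ← lintegral_const_mul' _ _ ENNReal.ofReal_ne_top]
  refine lintegral_congr fun ξ => ?_
  have hF : ‖𝓕 (fun x => ((‖f x‖ ^ 2 : ℝ) : ℂ)) ξ‖ₑ ^ 2 = ENNReal.ofReal (powSpec (rho f) ξ) :=
    enorm_fourier_sq (e := rho f) (integrable_rho hf) ξ
  rw [enorm_smul, mul_pow, hF, ← ofReal_norm,
    ← ENNReal.ofReal_pow (norm_nonneg _), Real.norm_eq_abs, sq_abs, ← Real.sqrt_eq_rpow,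
    Real.sq_sqrt (by positivity), ← ENNReal.ofReal_mul (by positivity),
    ← ENNReal.ofReal_mul (by positivity)]
  congr 1
  ring

theorem memLp_rho {f : Plane → ℂ} {g : Fin 2 → Plane → ℂ} (h : H1Pair f g) : MemLp (rho f) 2 := by
  refine ⟨h.memLp.aestronglyMeasurable.norm.pow 2, ?_⟩
  have e : eLpNorm (rho f) 2 volume = eLpNorm (fun x => f x ^ (1 + 1)) 2 volume :=
    eLpNorm_congr_norm_ae (ae_of_all _ fun x => by simp [rho])
  rw [e]
  exact (h.eLpNorm_pow_ne_top 1).lt_top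

theorem eLpNorm_eight_pow {f : Plane → ℂ} :
    eLpNorm f 8 volume ^ 4 = (∫⁻ x, ENNReal.ofReal (rho f x ^ 4)) ^ (1 / 2 : ℝ) := by
  have h := eLpNorm_nnreal_pow_eq_lintegral (f := f) (μ := (volume : Measure Plane)) (p := 8)
    (by norm_num)
  have e : ∀ x, ‖f x‖ₑ ^ ((8 : ℝ≥0) : ℝ) = ENNReal.ofReal (rho f x ^ 4) := fun x => by
    rw [show ((8 : ℝ≥0) : ℝ) = ((8 : ℕ) : ℝ) by norm_num, ENNReal.rpow_natCast, rho, ← pow_mul,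
      ENNReal.ofReal_pow (norm_nonneg _), ofReal_norm]
  simp only [e] at h
  rw [← h, ← ENNReal.rpow_mul, show ((8 : ℝ≥0) : ℝ) * (1 / 2) = ((4 : ℕ) : ℝ) by norm_num,
    ENNReal.rpow_natCast]
  rfl

/-- The Sobolev bound requires a positive B, so it is used with the half energy plus 1/(n+1), and n
→ ∞. This covers functions whose half energy is zero. -/
theorem eLpNorm_eight_pow_le {f : Plane → ℂ} {g : Fin 2 → Plane → ℂ} (h : H1Pair f g) :
    eLpNorm f 8 volume ^ 4 ≤ ENNReal.ofReal √(128 * Real.pi) * halfEnergy f := by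
  have hπ := Real.pi_pos
  rcases eq_or_ne (halfEnergy f) ⊤ with hQ | hQ
  · rw [hQ, ENNReal.mul_top (by simpa using hπ)]
    exact le_top
  rw [eLpNorm_eight_pow]
  have hlim : Tendsto (fun n : ℕ => ENNReal.ofReal (√(128 * Real.pi)
      * ((halfEnergy f).toReal + 1 / ((n : ℝ) + 1)))) atTop
      (𝓝 (ENNReal.ofReal (√(128 * Real.pi) * ((halfEnergy f).toReal + 0)))) :=
    (ENNReal.continuous_ofReal.tendsto _).comp
      ((tendsto_one_div_add_atTop_nhds_zero_nat.const_add _).const_mul _)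
  rw [add_zero, ENNReal.ofReal_mul (Real.sqrt_nonneg _), ENNReal.ofReal_toReal hQ] at hlim
  refine ge_of_tendsto' hlim fun n => ?_
  have hB : 0 < (halfEnergy f).toReal + 1 / ((n : ℝ) + 1) := by positivity
  have hle : halfEnergy f ≤ ENNReal.ofReal ((halfEnergy f).toReal + 1 / ((n : ℝ) + 1)) := by
    rw [← ENNReal.ofReal_toReal hQ, ENNReal.toReal_ofReal ENNReal.toReal_nonneg]
    exact ENNReal.ofReal_le_ofReal (by have : 0 < 1 / ((n : ℝ) + 1) := by positivity
                                       linarith)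
  have := lintegral_pow_four_le (integrable_rho h.memLp) (memLp_rho h) (rho_nonneg f) hB hle
  calc _ ≤ (ENNReal.ofReal (128 * Real.pi * ((halfEnergy f).toReal + 1 / ((n : ℝ) + 1)) ^ 2))
        ^ (1 / 2 : ℝ) := by gcongr
    _ = _ := by
        rw [ENNReal.ofReal_rpow_of_nonneg (by positivity) (by norm_num), ← Real.sqrt_eq_rpow,
          Real.sqrt_mul (by positivity), Real.sqrt_sq hB.le]

/-- Fatou's lemma in frequency, with σ = 1/(n+1) → 0. -/
theorem halfEnergy_le_liminf {f : Plane → ℂ} {g : Fin 2 → Plane → ℂ} (h : H1Pair f g) :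
    ENNReal.ofReal spectralConst * halfEnergy f
      ≤ liminf (fun n : ℕ => ENNReal.ofReal (∑ l, dbl (traceKer (1 / ((n : ℝ) + 1))) (qd f (g l))
        (qd f (g l)))) atTop := by
  have hsc := spectralConst_pos
  have hP := (continuous_powSpec (integrable_rho h.memLp)).measurable
  have hl : ∀ ξ : Plane, Tendsto (fun n : ℕ => ENNReal.ofReal (spectralConst * ‖ξ‖
      * Real.exp (-(2 * (1 / ((n : ℝ) + 1)) ^ 2 * ‖ξ‖ ^ 2)) * powSpec (rho f) ξ)) atTop
      (𝓝 (ENNReal.ofReal (spectralConst * ‖ξ‖ * powSpec (rho f) ξ))) := fun ξ => by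
    have h0 : Tendsto (fun n : ℕ => 1 / ((n : ℝ) + 1)) atTop (𝓝 0) :=
      tendsto_one_div_add_atTop_nhds_zero_nat
    have hc : Continuous fun s : ℝ => ENNReal.ofReal (spectralConst * ‖ξ‖
        * Real.exp (-(2 * s ^ 2 * ‖ξ‖ ^ 2)) * powSpec (rho f) ξ) :=
      ENNReal.continuous_ofReal.comp (by fun_prop)
    have := (hc.tendsto 0).comp h0
    simpa [Function.comp_def] using this
  calc ENNReal.ofReal spectralConst * halfEnergy f
      = ∫⁻ ξ, ENNReal.ofReal (spectralConst * ‖ξ‖ * powSpec (rho f) ξ) := by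
        rw [halfEnergy, ← lintegral_const_mul' _ _ ENNReal.ofReal_ne_top]
        refine lintegral_congr fun ξ => ?_
        rw [← ENNReal.ofReal_mul hsc.le, mul_assoc]
    _ = ∫⁻ ξ, liminf (fun n : ℕ => ENNReal.ofReal (spectralConst * ‖ξ‖
        * Real.exp (-(2 * (1 / ((n : ℝ) + 1)) ^ 2 * ‖ξ‖ ^ 2)) * powSpec (rho f) ξ)) atTop :=
        lintegral_congr fun ξ => (hl ξ).liminf_eq.symm
    _ ≤ liminf (fun n : ℕ => ∫⁻ ξ, ENNReal.ofReal (spectralConst * ‖ξ‖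
        * Real.exp (-(2 * (1 / ((n : ℝ) + 1)) ^ 2 * ‖ξ‖ ^ 2)) * powSpec (rho f) ξ)) atTop :=
        lintegral_liminf_le fun n => by fun_prop
    _ ≤ _ := liminf_le_liminf (Eventually.of_forall fun n => ofReal_sum_dbl_ge (by positivity) h)

/-- Fatou's lemma again, now in time; the bound on the approximations does not depend on σ. -/
theorem exists_lintegral_halfEnergy_le {a : ℝ} (ha : 1 / 4 < a) : ∃ D, 0 < D ∧
    ∀ {p c d : ℝ} {U : ℝ → L2} {G : Fin 2 → ℝ → L2} (_ : Flow a p c d U G) (_ : 2 ≤ p) (_ : c ≤ d)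
    {m S : ℝ} (_ : ∀ t, ‖U t‖ ≤ m) (_ : ∀ j t, ‖G j t‖ ≤ S),
    ∫⁻ t in Set.Icc c d, halfEnergy (U t) ≤ ENNReal.ofReal (D * (m ^ 3 * S)) := by
  obtain ⟨A, hA, h⟩ := exists_interaction_le ha
  have hsc := spectralConst_pos
  refine ⟨spectralConst⁻¹ * A, by positivity, fun {p c d U G} F hp hcd {m S} hm hS => ?_⟩
  have hσ : ∀ n : ℕ, (0 : ℝ) < 1 / ((n : ℝ) + 1) := fun n => by positivity
  have hc : ∀ n : ℕ, Continuous fun t => ∑ l, dbl (traceKer (1 / ((n : ℝ) + 1)))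
      (qd (U t) (G l t)) (qd (U t) (G l t)) := fun n =>
    continuous_finsetSum _ fun l _ => (continuous_dbl (measurable_traceKer (hσ n))
      (abs_traceKer_le (hσ n)) (l1Curve_qd F.cU (F.cG l)) (l1Curve_qd F.cU (F.cG l))).comp
      (continuous_id.prodMk continuous_id)
  have hn : ∀ (n : ℕ) t, 0 ≤ ∑ l, dbl (traceKer (1 / ((n : ℝ) + 1))) (qd (U t) (G l t))
      (qd (U t) (G l t)) := fun n t => Finset.sum_nonneg fun l _ =>
    (ofReal_dbl_traceKer (hσ n) (integrable_qd (Lp.memLp _) (Lp.memLp _))).1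
  have key : ENNReal.ofReal spectralConst * ∫⁻ t in Set.Icc c d, halfEnergy (U t)
      ≤ ENNReal.ofReal (A * (m ^ 3 * S)) := by
    rw [← lintegral_const_mul' _ _ ENNReal.ofReal_ne_top]
    calc _ ≤ ∫⁻ t in Set.Icc c d, liminf (fun n : ℕ => ENNReal.ofReal
          (∑ l, dbl (traceKer (1 / ((n : ℝ) + 1))) (qd (U t) (G l t)) (qd (U t) (G l t)))) atTop :=
          lintegral_mono fun t => halfEnergy_le_liminf (F.pair t)
      _ ≤ liminf (fun n : ℕ => ∫⁻ t in Set.Icc c d, ENNReal.ofReal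
          (∑ l, dbl (traceKer (1 / ((n : ℝ) + 1))) (qd (U t) (G l t)) (qd (U t) (G l t)))) atTop :=
          lintegral_liminf_le fun n => (hc n).measurable.ennreal_ofReal
      _ ≤ liminf (fun _ : ℕ => ENNReal.ofReal (A * (m ^ 3 * S))) atTop := by
          refine liminf_le_liminf (Eventually.of_forall fun n => ?_)
          rw [setLIntegral_congr Ioc_ae_eq_Icc.symm, ← ofReal_integral_eq_lintegral_ofReal
            ((hc n).continuousOn.integrableOn_Icc.mono_set Set.Ioc_subset_Icc_self)
            (ae_of_all _ (hn n)), ← intervalIntegral.integral_of_le hcd]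
          exact ENNReal.ofReal_le_ofReal (h F hp hcd hm hS (hσ n))
      _ = _ := liminf_const _
  have e : ENNReal.ofReal (spectralConst⁻¹ * A * (m ^ 3 * S))
      = ENNReal.ofReal spectralConst⁻¹ * ENNReal.ofReal (A * (m ^ 3 * S)) := by
    rw [mul_assoc, ENNReal.ofReal_mul (by positivity)]
  rw [e, ENNReal.ofReal_inv_of_pos hsc]
  exact (ENNReal.mul_le_iff_le_inv (by simpa using hsc) ENNReal.ofReal_ne_top).1 key

/-- An integral over an interval is controlled by the integrals over compact subintervals. -/
theorem setLIntegral_le_of_forall_Icc {I : Set ℝ} (hI : I.OrdConnected) {φ : ℝ → ℝ≥0∞} {K : ℝ≥0∞}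
    (h : ∀ c d, c ≤ d → Set.Icc c d ⊆ I → ∫⁻ t in Set.Icc c d, φ t ≤ K) : ∫⁻ t in I, φ t ≤ K := by
  -- Rational endpoints give a countable family, directed under inclusion, along which the integral
  -- converges.
  let ι := {q : ℚ × ℚ // (q.1 : ℝ) ≤ q.2 ∧ Set.Icc (q.1 : ℝ) q.2 ⊆ I}
  let s : ι → Set ℝ := fun q => Set.Icc (q.1.1 : ℝ) q.1.2
  have hd : Directed (· ⊆ ·) s := by
    rintro ⟨⟨q, r⟩, hqr, hs⟩ ⟨⟨q', r'⟩, hqr', hs'⟩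
    have hmin : ((min q q' : ℚ) : ℝ) ∈ I := by
      rcases min_choice q q' with e | e <;> rw [e]
      · exact hs ⟨le_rfl, hqr⟩
      · exact hs' ⟨le_rfl, hqr'⟩
    have hmax : ((max r r' : ℚ) : ℝ) ∈ I := by
      rcases max_choice r r' with e | e <;> rw [e]
      · exact hs ⟨hqr, le_rfl⟩
      · exact hs' ⟨hqr', le_rfl⟩
    have h1 : ((min q q' : ℚ) : ℝ) ≤ q := by exact_mod_cast min_le_left q q'
    have h2 : ((min q q' : ℚ) : ℝ) ≤ q' := by exact_mod_cast min_le_right q q'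
    have h3 : (r : ℝ) ≤ ((max r r' : ℚ) : ℝ) := by exact_mod_cast le_max_left r r'
    have h4 : (r' : ℝ) ≤ ((max r r' : ℚ) : ℝ) := by exact_mod_cast le_max_right r r'
    exact ⟨⟨(min q q', max r r'), h1.trans (hqr.trans h3), hI.out hmin hmax⟩,
      Set.Icc_subset_Icc h1 h3, Set.Icc_subset_Icc h2 h4⟩
  -- A point that is neither the least nor the greatest element of I lies inside some rational
  -- interval; the two exceptional points form a null set.
  have hsub : I ⊆ (⋃ q, s q) ∪ ({x | IsLeast I x} ∪ {x | IsGreatest I x}) := by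
    intro x hx
    by_cases h1 : IsLeast I x
    · exact Or.inr (Or.inl h1)
    by_cases h2 : IsGreatest I x
    · exact Or.inr (Or.inr h2)
    have h1' : ∃ y ∈ I, y < x := by
      by_contra! hc
      exact h1 ⟨hx, hc⟩
    have h2' : ∃ z ∈ I, x < z := by
      by_contra! hc
      exact h2 ⟨hx, hc⟩
    obtain ⟨y, hy, hyx⟩ := h1'
    obtain ⟨z, hz, hxz⟩ := h2'
    obtain ⟨q, hq1, hq2⟩ := exists_rat_btwn hyx
    obtain ⟨r, hr1, hr2⟩ := exists_rat_btwn hxz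
    exact Or.inl (Set.mem_iUnion.2 ⟨⟨(q, r), (hq2.trans hr1).le,
      (Set.Icc_subset_Icc hq1.le hr2.le).trans (hI.out hy hz)⟩, hq2.le, hr1.le⟩)
  have hnull : volume ({x | IsLeast I x} ∪ {x | IsGreatest I x}) = 0 := by
    have a1 : ({x | IsLeast I x} : Set ℝ).Subsingleton := fun x hx y hy => hx.unique hy
    have a2 : ({x | IsGreatest I x} : Set ℝ).Subsingleton := fun x hx y hy => hx.unique hy
    exact measure_union_null (a1.measure_zero _) (a2.measure_zero _)
  have hae : I ≤ᵐ[volume] ⋃ q, s q := by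
    have hz : ∀ᵐ x, x ∉ {x | IsLeast I x} ∪ {x | IsGreatest I x} := measure_eq_zero_iff_ae_notMem.1 hnull
    filter_upwards [hz] with x hx hxI
    exact (hsub hxI).resolve_right hx
  refine (lintegral_mono_set' hae).trans ?_
  rw [setLIntegral_iUnion_of_directed φ hd]
  exact iSup_le fun q => h _ _ q.2.1 q.2.2

theorem eLpNorm_eq_of_mem {a p : ℝ} (ha : 1 / 4 < a) (hp : 1 ≤ p) {I : Set ℝ} {u : ℝ → Plane → ℂ}
    (hu : IsH1Solution a p I u) {c d : ℝ} (hcd : c ≤ d) (hI : Set.Icc c d ⊆ I) :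
    eLpNorm (u c) 2 volume = eLpNorm (u d) 2 volume := by
  obtain ⟨U, G, F, ⟨B, hBU, hBG⟩, -, hU⟩ := exists_flow hp hu hcd hI
  have h := F.norm_eq ha hp hcd hBU hBG (t := d) ⟨hcd, le_rfl⟩
  rw [← eLpNorm_congr_ae (hU c ⟨le_rfl, hcd⟩), ← eLpNorm_congr_ae (hU d ⟨hcd, le_rfl⟩),
    ← Lp.enorm_def, ← Lp.enorm_def, ← ofReal_norm, ← ofReal_norm, h]

theorem eLpNorm_eq {a p : ℝ} (ha : 1 / 4 < a) (hp : 1 ≤ p) {I : Set ℝ} (hI : I.OrdConnected)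
    {u : ℝ → Plane → ℂ} (hu : IsH1Solution a p I u) {s t : ℝ} (hs : s ∈ I) (ht : t ∈ I) :
    eLpNorm (u s) 2 volume = eLpNorm (u t) 2 volume := by
  rcases le_total s t with h | h
  · exact eLpNorm_eq_of_mem ha hp hu h (hI.out hs ht)
  · exact (eLpNorm_eq_of_mem ha hp hu h (hI.out ht hs)).symm

theorem halfEnergy_eq_zero {f : Plane → ℂ} (hf : f =ᵐ[volume] 0) : halfEnergy f = 0 := by
  rw [halfEnergy_congr hf]
  simp [halfEnergy, powSpec, cosT, sinT, rho]

/-- The interaction Morawetz estimate for solutions, in terms of the power spectrum of the mass. -/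
theorem exists_setLIntegral_halfEnergy_le {a : ℝ} (ha : 1 / 4 < a) : ∃ D, 0 < D ∧
    ∀ p : ℝ, 2 < p → ∀ I : Set ℝ, I.OrdConnected → ∀ u : ℝ → Plane → ℂ, IsH1Solution a p I u →
      ∀ t₀ ∈ I, ∫⁻ t in I, halfEnergy (u t) ≤ ENNReal.ofReal D * (eLpNorm (u t₀) 2 volume ^ 3
        * ⨆ t ∈ I, hDotOneNorm (u t)) := by
  obtain ⟨D, hD, hmain⟩ := exists_lintegral_halfEnergy_le ha
  refine ⟨D, hD, fun p hp I hI u hu t₀ ht₀ => ?_⟩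
  have hp1 : 1 ≤ p := by linarith
  set M := eLpNorm (u t₀) 2 volume with hM
  set V := ⨆ t ∈ I, hDotOneNorm (u t) with hV
  have hMt : M ≠ ⊤ := (hu.continuousInH1On.1 t₀ ht₀).1.2.ne
  have hmass : ∀ t ∈ I, eLpNorm (u t) 2 volume = M := fun t ht => eLpNorm_eq ha hp1 hI hu ht ht₀
  refine setLIntegral_le_of_forall_Icc hI fun c d hcd hsub => ?_
  -- Zero mass is treated apart, since the right side could otherwise be the product of zero and an
  -- infinite supremum.
  rcases eq_or_ne M 0 with hM0 | hM0
  · have : ∫⁻ t in Set.Icc c d, halfEnergy (u t) = 0 := by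
      rw [setLIntegral_congr_fun measurableSet_Icc (g := fun _ => 0) fun t ht => ?_, lintegral_zero]
      have h1 := hmass t (hsub ht)
      rw [hM0, eLpNorm_eq_zero_iff (hu.continuousInH1On.1 t (hsub ht)).1.1 (by norm_num)] at h1
      exact halfEnergy_eq_zero h1
    rw [this]
    exact zero_le
  rcases eq_or_ne V ⊤ with hVt | hVt
  · rw [hVt, ENNReal.mul_top (pow_ne_zero 3 hM0), ENNReal.mul_top (by simpa using hD)]
    exact le_top
  obtain ⟨U, G, F, -, hUG, hU⟩ := exists_flow hp1 hu hcd hsub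
  have h1 : ∀ t, ‖U t‖ ≤ M.toReal := fun t => by
    obtain ⟨s, hs, hUs, -⟩ := hUG t
    rw [← eLpNorm_toReal, eLpNorm_congr_ae hUs, hmass s (hsub hs)]
  have h2 : ∀ j t, ‖G j t‖ ≤ V.toReal := fun j t => by
    obtain ⟨s, hs, -, hG⟩ := hUG t
    have hle : ENNReal.ofReal (‖G j t‖ ^ 2) ≤ V ^ 2 := by
      refine (ENNReal.ofReal_le_ofReal (Finset.single_le_sum (f := fun j => ‖G j t‖ ^ 2)
        (fun _ _ => by positivity) (Finset.mem_univ j))).trans ?_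
      rw [hG]
      gcongr
      exact le_iSup₂ (f := fun t (_ : t ∈ I) => hDotOneNorm (u t)) s (hsub hs)
    rw [← ENNReal.ofReal_toReal hVt, ← ENNReal.ofReal_pow ENNReal.toReal_nonneg,
      ENNReal.ofReal_le_ofReal_iff (by positivity)] at hle
    exact (pow_le_pow_iff_left₀ (norm_nonneg _) ENNReal.toReal_nonneg (by norm_num)).1 hle
  have h3 := hmain F hp.le hcd h1 h2
  rw [ENNReal.ofReal_mul hD.le, ENNReal.ofReal_mul (by positivity), ENNReal.ofReal_toReal hVt,
    ENNReal.ofReal_pow ENNReal.toReal_nonneg, ENNReal.ofReal_toReal hMt] at h3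
  refine le_of_eq_of_le (setLIntegral_congr_fun measurableSet_Icc fun t ht => ?_) h3
  exact (halfEnergy_congr (hU t ht)).symm

/-- For E ≥ 1 and r ≤ 1 the power of the constant is bounded by E itself, so one constant serves
both estimates. -/
theorem rpow_mul_three {E M V : ℝ≥0∞} {r : ℝ} (hr : 0 ≤ r) (hr1 : r ≤ 1) (hE : 1 ≤ E) :
    (E * (M ^ 3 * V)) ^ r ≤ E * M ^ (3 * r) * V ^ r := by
  rw [ENNReal.mul_rpow_of_nonneg _ _ hr, ENNReal.mul_rpow_of_nonneg _ _ hr, ← ENNReal.rpow_natCast,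
    ← ENNReal.rpow_mul, Nat.cast_ofNat, mul_assoc]
  exact mul_le_mul_left ((ENNReal.rpow_le_rpow_of_exponent_le hE hr1).trans_eq (ENNReal.rpow_one E)) _

end SpaceTime

end InteractionMorawetz

open InteractionMorawetz in
theorem propositionA1 (a : ℝ) (ha : 1 / 4 < a) :
    ∃ C : ℝ≥0, ∀ p : ℝ, 2 < p → ∀ I : Set ℝ, I.OrdConnected → ∀ u : ℝ → Plane → ℂ,
      IsH1Solution a p I u → ∀ t₀ ∈ I,
        (∫⁻ t in I, absGradPowL2Norm (1 / 2) (fun x => ((‖u t x‖ ^ 2 : ℝ) : ℂ)) ^ 2) ^ (1 / 2 : ℝ)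
            ≤ C * eLpNorm (u t₀) 2 volume ^ (3 / 2 : ℝ)
                * (⨆ t ∈ I, hDotOneNorm (u t)) ^ (1 / 2 : ℝ) ∧
        (∫⁻ t in I, eLpNorm (u t) 8 volume ^ 4) ^ (1 / 4 : ℝ)
            ≤ C * eLpNorm (u t₀) 2 volume ^ (3 / 4 : ℝ)
                * (⨆ t ∈ I, hDotOneNorm (u t)) ^ (1 / 4 : ℝ) := by
  obtain ⟨D, hD, h⟩ := exists_setLIntegral_halfEnergy_le ha
  have hπ := Real.pi_pos
  have hsq : 0 ≤ √(128 * Real.pi) := Real.sqrt_nonneg _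
  -- The two summands cover the Fourier normalization 2π and the Sobolev constant √(128π); the added
  -- one ensures E ≥ 1.
  set E : ℝ := (2 * Real.pi + √(128 * Real.pi)) * D + 1 with hE
  have hE1 : (1 : ℝ≥0∞) ≤ (E.toNNReal : ℝ≥0∞) := by
    change ENNReal.ofNNReal 1 ≤ _
    rw [ENNReal.coe_le_coe, ← Real.toNNReal_one]
    exact Real.toNNReal_le_toNNReal (by rw [hE]; nlinarith)
  refine ⟨E.toNNReal, fun p hp I hI u hu t₀ ht₀ => ?_⟩
  have hmain := h p hp I hI u hu t₀ ht₀
  have hconst : ∀ c : ℝ, 0 ≤ c → c ≤ 2 * Real.pi + √(128 * Real.pi) →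
      ENNReal.ofReal c * ∫⁻ t in I, halfEnergy (u t)
        ≤ (E.toNNReal : ℝ≥0∞) * (eLpNorm (u t₀) 2 volume ^ 3 * ⨆ t ∈ I, hDotOneNorm (u t)) := by
    intro c hc hle
    refine (mul_le_mul_right hmain _).trans ?_
    rw [← mul_assoc, ← ENNReal.ofReal_mul hc]
    refine mul_le_mul_left (ENNReal.ofReal_le_ofReal ?_) _
    rw [hE]
    nlinarith
  have hmem : MeasurableSet I := hI.measurableSet
  constructor
  · have e : ∫⁻ t in I, absGradPowL2Norm (1 / 2) (fun x => ((‖u t x‖ ^ 2 : ℝ) : ℂ)) ^ 2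
        = ENNReal.ofReal (2 * Real.pi) * ∫⁻ t in I, halfEnergy (u t) := by
      rw [← lintegral_const_mul' _ _ ENNReal.ofReal_ne_top]
      exact setLIntegral_congr_fun hmem fun t ht =>
        absGradPowL2Norm_half_sq (hu.continuousInH1On.1 t ht).1
    rw [e]
    refine (ENNReal.rpow_le_rpow (hconst _ (by positivity) (by linarith)) (by norm_num)).trans ?_
    refine (rpow_mul_three (by norm_num) (by norm_num) hE1).trans_eq ?_
    norm_num
  · have e : ∫⁻ t in I, eLpNorm (u t) 8 volume ^ 4
        ≤ ENNReal.ofReal √(128 * Real.pi) * ∫⁻ t in I, halfEnergy (u t) := by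
      rw [← lintegral_const_mul' _ _ ENNReal.ofReal_ne_top]
      refine setLIntegral_mono' hmem fun t ht => ?_
      obtain ⟨g, hg, hg2⟩ := exists_isWeakGradient (hu.continuousInH1On.1 t ht)
      exact eLpNorm_eight_pow_le (isWeakGradient_h1Pair hg (hu.continuousInH1On.1 t ht).1 hg2)
    refine (ENNReal.rpow_le_rpow (e.trans (hconst _ hsq (by linarith))) (by norm_num)).trans ?_
    refine (rpow_mul_three (by norm_num) (by norm_num) hE1).trans_eq ?_
    norm_num
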